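/- **Conventions.** A 2-category is strict. $\mathbf{Gray}$ denotes the category of (small) 2-categories and 2-functors with the Gray tensor product (pseudo version), enriched in itself by pseudonatural transformations and modifications. A Gray-category $\mathcal K$ is a category enriched in $\mathbf{Gray}$; its 2-cells and 3-cells are the 1-cells and 2-cells of the hom-2-categories $\mathcal K(A,B)$, "$\circ$" is composition in a hom-2-category, and juxtaposition is composition (whiskering) of 1-cells $A\to B$ with cells of any dimension. For $f\colon F\Rightarrow F'$ in $\mathcal K(A,B)$ and $g\colon G\Rightarrow G'$ in $\mathcal K(B,C)$ there is an invertible interchange 3-cell $g_f\colon G'f\circ gF\Rrightarrow gF'\circ Gf$. A *pseudomonad* $\mathbb T=(T,\eta,\mu,\lambda,\rho,\alpha)$ on an object $B$ consists of $T\colon B\to B$, 2-cells $\eta\colon 1\Rightarrow T$, $\mu\colon TT\Rightarrow T$ and invertible 3-cells $\lambda\colon\mu\circ\eta T\Rrightarrow 1$, $\rho\colon 1\Rrightarrow\mu\circ T\eta$, $\alpha\colon\mu\circ T\mu\Rrightarrow\mu\circ\mu T$ satisfying the usual pentagon axiom and the (middle) unit axiom. A *pseudocomonad* is the same notion with all 2-cells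 reversed. A *pseudoadjunction* $\Sigma,\Upsilon,\iota,\sigma\colon T\dashv_p G$ consists of a unit $\iota\colon1\Rightarrow GT$, a counit $\sigma\colon TG\Rightarrow1$ and invertible 3-cells $\Sigma\colon1_G\Rrightarrow G\sigma\circ\iota G$, $\Upsilon\colon\sigma T\circ T\iota\Rrightarrow1_T$ satisfying the two swallowtail equations. The *pseudo-mate* of $\zeta\colon F'\Rightarrow F$ with respect to $F\dashv_pU$ and $F'\dashv_pU'$ (with units $i,i'$ and counits $e,e'$) is $\Phi(\zeta)=U'e\circ U'\zeta U\circ i'U\colon U\Rightarrow U'$, and similarly for 3-cells; there are canonical invertible 3-cells, built from interchange cells and the cell $e'F'\circ F'i'\Rrightarrow 1_{F'}$ of $F'\dashv_p U'$, comparing mates of composites with composites of mates. For a pseudomonad $\mathbb T$ on $B$, $\mathbb T\text{-}\mathrm{Alg}\colon\mathcal K^{\mathrm{op}}\to\mathbf{Gray}$ is the Gray-functor sending $A$ to the 2-category of pseudoalgebras with domain $A$: a pseudoalgebra is $s\colon A\to B$ with $\nu\colon Ts\Rightarrow s$ and coherent invertible $\psi\colon\nu\circ\eta s\Rrightarrow1$,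 $\chi\colon\nu\circ T\nu\Rrightarrow\nu\circ\mu s$; a morphism is $h\colon s\Rightarrow s'$ with a coherent invertible $\varrho\colon\nu'\circ Th\Rrightarrow h\circ\nu$; a 2-cell is a 3-cell $\xi\colon h\Rrightarrow h'$ compatible with the $\varrho$'s. Dually, a pseudocomonad $\mathbb G$ on $B$ has a Gray-functor $\mathbb G\text{-}\mathrm{CoAlg}\colon\mathcal K^{\mathrm{op}}\to\mathbf{Gray}$ of pseudocoalgebras. Forgetting the structure defines Gray-natural transformations $U^{\mathbb T}\colon\mathbb T\text{-}\mathrm{Alg}\to\mathcal K(-,B)$ and $U^{\mathbb G}\colon\mathbb G\text{-}\mathrm{CoAlg}\to\mathcal K(-,B)$. **Theorem (the categorified adjoint monad theorem).** Let $\mathbb T=(T,\eta,\mu,\lambda,\rho,\alpha)$ be a pseudomonad on an object $B$ of a Gray-category $\mathcal K$ and let $\Sigma,\Upsilon,\iota,\sigma\colon T\dashv_pG$ be a pseudoadjunction in $\mathcal K$. Then $G$ with the counit $\Phi(\eta)\colon G\Rightarrow1$, the comultiplication $\Phi(\mu)\colon G\Rightarrow GG$ and the invertible 3-cells obtained from the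 mates $\Phi(\lambda),\Phi(\rho),\Phi(\alpha)$ by composing with the canonical comparison 3-cells is a pseudocomonad $\mathbb G$, and the Gray-functors $\mathbb T\text{-}\mathrm{Alg}$ and $\mathbb G\text{-}\mathrm{CoAlg}$ are Gray-equivalent in the Gray-category $[\mathcal K^{\mathrm{op}},\mathbf{Gray}]$: there are Gray-natural transformations $\mathcal M\colon\mathbb T\text{-}\mathrm{Alg}\to\mathbb G\text{-}\mathrm{CoAlg}$ and $\overline{\mathcal M}\colon\mathbb G\text{-}\mathrm{CoAlg}\to\mathbb T\text{-}\mathrm{Alg}$ and invertible Gray-modifications $\Gamma\colon1\Rrightarrow\overline{\mathcal M}\mathcal M$ and $\overline\Gamma\colon\mathcal M\overline{\mathcal M}\Rrightarrow1$. Moreover, this equivalence commutes with the forgetful Gray-natural transformations: $U^{\mathbb G}\mathcal M=U^{\mathbb T}$, $U^{\mathbb T}\overline{\mathcal M}=U^{\mathbb G}$, and $U^{\mathbb T}\Gamma$ and $U^{\mathbb G}\overline\Gamma$ are identities. -/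

import Mathlib

set_option linter.unusedSimpArgs false
set_option linter.checkUnivs false

universe u v w

/-! ### Strict 2-categories, 2-functors, pseudonatural transformations, modifications -/

/-- A (small, strict) 2-category, presented by its sets of objects, 1-cells and 2-cells with
source and target maps.  The operations are written as total functions; they are meaningful, and
subject to the axioms, exactly on composable arguments.  `comp g f` is the composite `g ∘ f`,
`vcomp y x` is the vertical composite "`x`, then `y`", and `wl g x`, `wr x f` are the two
whiskerings `g ∘ x`, `x ∘ f` of a 2-cell by a 1-cell. -/
structure TwoCat : Type (w + 1) where
  Ob : Type w
  One : Type w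
  Two : Type w
  src : One → Ob
  tgt : One → Ob
  src₂ : Two → One
  tgt₂ : Two → One
  id : Ob → One
  comp : One → One → One
  id₂ : One → Two
  vcomp : Two → Two → Two
  wl : One → Two → Two
  wr : Two → One → Two
  src_src₂ : ∀ x, src (src₂ x) = src (tgt₂ x)
  tgt_src₂ : ∀ x, tgt (src₂ x) = tgt (tgt₂ x)
  src_id : ∀ a, src (id a) = a
  tgt_id : ∀ a, tgt (id a) = a
  src_comp : ∀ g f, tgt f = src g → src (comp g f) = src f
  tgt_comp : ∀ g f, tgt f = src g → tgt (comp g f) = tgt g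
  comp_id : ∀ f, comp f (id (src f)) = f
  id_comp : ∀ f, comp (id (tgt f)) f = f
  comp_assoc : ∀ h g f, tgt f = src g → tgt g = src h → comp (comp h g) f = comp h (comp g f)
  src_id₂ : ∀ f, src₂ (id₂ f) = f
  tgt_id₂ : ∀ f, tgt₂ (id₂ f) = f
  src_vcomp : ∀ y x, tgt₂ x = src₂ y → src₂ (vcomp y x) = src₂ x
  tgt_vcomp : ∀ y x, tgt₂ x = src₂ y → tgt₂ (vcomp y x) = tgt₂ y
  vcomp_id : ∀ x, vcomp x (id₂ (src₂ x)) = x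
  id_vcomp : ∀ x, vcomp (id₂ (tgt₂ x)) x = x
  vcomp_assoc : ∀ z y x, tgt₂ x = src₂ y → tgt₂ y = src₂ z →
    vcomp (vcomp z y) x = vcomp z (vcomp y x)
  src_wl : ∀ g x, tgt (tgt₂ x) = src g → src₂ (wl g x) = comp g (src₂ x)
  tgt_wl : ∀ g x, tgt (tgt₂ x) = src g → tgt₂ (wl g x) = comp g (tgt₂ x)
  wl_id₂ : ∀ g f, tgt f = src g → wl g (id₂ f) = id₂ (comp g f)
  wl_vcomp : ∀ g y x, tgt₂ x = src₂ y → tgt (tgt₂ y) = src g →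
    wl g (vcomp y x) = vcomp (wl g y) (wl g x)
  id_wl : ∀ x, wl (id (tgt (tgt₂ x))) x = x
  comp_wl : ∀ h g x, tgt (tgt₂ x) = src g → tgt g = src h → wl (comp h g) x = wl h (wl g x)
  src_wr : ∀ x f, tgt f = src (tgt₂ x) → src₂ (wr x f) = comp (src₂ x) f
  tgt_wr : ∀ x f, tgt f = src (tgt₂ x) → tgt₂ (wr x f) = comp (tgt₂ x) f
  id₂_wr : ∀ g f, tgt f = src g → wr (id₂ g) f = id₂ (comp g f)
  vcomp_wr : ∀ y x f, tgt₂ x = src₂ y → tgt f = src (tgt₂ y) →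
    wr (vcomp y x) f = vcomp (wr y f) (wr x f)
  wr_id : ∀ x, wr x (id (src (tgt₂ x))) = x
  wr_comp : ∀ x g f, tgt f = src g → tgt g = src (tgt₂ x) → wr x (comp g f) = wr (wr x g) f
  wl_wr : ∀ h x f, tgt f = src (tgt₂ x) → tgt (tgt₂ x) = src h →
    wr (wl h x) f = wl h (wr x f)
  interchange : ∀ y x, tgt (tgt₂ x) = src (tgt₂ y) →
    vcomp (wl (tgt₂ y) x) (wr y (src₂ x)) = vcomp (wr y (tgt₂ x)) (wl (src₂ y) x)

attribute [simp] TwoCat.src_src₂ TwoCat.tgt_src₂ TwoCat.src_id TwoCat.tgt_id TwoCat.src_comp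
  TwoCat.tgt_comp TwoCat.comp_id TwoCat.id_comp TwoCat.comp_assoc TwoCat.src_id₂ TwoCat.tgt_id₂
  TwoCat.src_vcomp TwoCat.tgt_vcomp TwoCat.vcomp_id TwoCat.id_vcomp TwoCat.vcomp_assoc
  TwoCat.src_wl TwoCat.tgt_wl TwoCat.wl_id₂ TwoCat.wl_vcomp TwoCat.id_wl TwoCat.comp_wl
  TwoCat.src_wr TwoCat.tgt_wr TwoCat.id₂_wr TwoCat.vcomp_wr TwoCat.wr_id TwoCat.wr_comp
  TwoCat.wl_wr

notation:75 g:76 " ∘₁ " f:75 => TwoCat.comp _ g f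
notation:70 y:71 " ∘₂ " x:70 => TwoCat.vcomp _ y x
notation:75 g:76 " ◁ " x:75 => TwoCat.wl _ g x
notation:75 x:76 " ▷ " f:75 => TwoCat.wr _ x f

namespace TwoCat

variable {X : TwoCat.{w}}

/-- `y` is a vertical inverse of the 2-cell `x`. -/
def IsInv (x y : X.Two) : Prop :=
  X.src₂ y = X.tgt₂ x ∧ X.tgt₂ y = X.src₂ x ∧
    y ∘₂ x = X.id₂ (X.src₂ x) ∧ x ∘₂ y = X.id₂ (X.tgt₂ x)

/-- The 2-cell `x` is invertible for vertical composition. -/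
def IsIso (x : X.Two) : Prop := ∃ y, IsInv x y

open Classical in
/-- The (unique) vertical inverse of an invertible 2-cell. -/
noncomputable def inv (x : X.Two) : X.Two := if h : IsIso x then h.choose else x

@[simp] theorem comp_id' (f : X.One) (a : X.Ob) (h : X.src f = a) : f ∘₁ X.id a = f := by
  subst h; simp

@[simp] theorem id_comp' (f : X.One) (a : X.Ob) (h : X.tgt f = a) : X.id a ∘₁ f = f := by
  subst h; simp

@[simp] theorem vcomp_id' (x : X.Two) (f : X.One) (h : X.src₂ x = f) : x ∘₂ X.id₂ f = x := by
  subst h; simp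

@[simp] theorem id_vcomp' (x : X.Two) (f : X.One) (h : X.tgt₂ x = f) : X.id₂ f ∘₂ x = x := by
  subst h; simp

@[simp] theorem id_wl' (x : X.Two) (a : X.Ob) (h : X.tgt (X.tgt₂ x) = a) : X.id a ◁ x = x := by
  subst h; simp

@[simp] theorem wr_id' (x : X.Two) (a : X.Ob) (h : X.src (X.tgt₂ x) = a) : x ▷ X.id a = x := by
  subst h; simp

theorem IsIso.isInv {x : X.Two} (h : IsIso x) : IsInv x (inv x) := by
  rw [inv, dif_pos h]; exact h.choose_spec

theorem IsInv.inv_eq {x y : X.Two} (h : IsInv x y) : inv x = y := by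
  obtain ⟨a, b, c, d⟩ := h
  obtain ⟨a', b', c', d'⟩ := IsIso.isInv ⟨y, a, b, c, d⟩
  have := X.vcomp_assoc (inv x) x y b a'.symm
  rwa [c', d, ← b, X.id_vcomp, ← a', X.vcomp_id, eq_comm] at this

theorem IsInv.symm {x y : X.Two} (h : IsInv x y) : IsInv y x :=
  ⟨h.2.1.symm, h.1.symm, by rw [h.2.2.2, h.1], by rw [h.2.2.1, h.2.1]⟩

@[simp] theorem src_inv {x : X.Two} (h : IsIso x) : X.src₂ (inv x) = X.tgt₂ x := h.isInv.1
@[simp] theorem tgt_inv {x : X.Two} (h : IsIso x) : X.tgt₂ (inv x) = X.src₂ x := h.isInv.2.1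
@[simp] theorem inv_vcomp {x : X.Two} (h : IsIso x) : inv x ∘₂ x = X.id₂ (X.src₂ x) :=
  h.isInv.2.2.1
@[simp] theorem vcomp_inv {x : X.Two} (h : IsIso x) : x ∘₂ inv x = X.id₂ (X.tgt₂ x) :=
  h.isInv.2.2.2
@[simp] theorem isIso_inv {x : X.Two} (h : IsIso x) : IsIso (inv x) := ⟨x, h.isInv.symm⟩
@[simp] theorem inv_inv {x : X.Two} (h : IsIso x) : inv (inv x) = x := h.isInv.symm.inv_eq

theorem isInv_id₂ (f : X.One) : IsInv (X.id₂ f) (X.id₂ f) := by simp [IsInv]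
@[simp] theorem isIso_id₂ (f : X.One) : IsIso (X.id₂ f) := ⟨_, isInv_id₂ f⟩
@[simp] theorem inv_id₂ (f : X.One) : inv (X.id₂ f) = X.id₂ f := (isInv_id₂ f).inv_eq

theorem IsInv.vcomp {x x' y y' : X.Two} (h : IsInv x x') (k : IsInv y y')
    (e : X.tgt₂ x = X.src₂ y) : IsInv (y ∘₂ x) (x' ∘₂ y') := by
  obtain ⟨a, b, c, d⟩ := h
  obtain ⟨a', b', c', d'⟩ := k
  refine ⟨by simp [*], by simp [*], ?_, ?_⟩
  · rw [X.vcomp_assoc _ _ _ (by simp [*]) (by simp [*]), ← X.vcomp_assoc y' _ _ (by simp [*])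
      (by simp [*]), c']
    simp [*]
  · rw [X.vcomp_assoc _ _ _ (by simp [*]) (by simp [*]), ← X.vcomp_assoc x _ _ (by simp [*])
      (by simp [*]), d]
    simp [*]

theorem IsInv.wl {x y : X.Two} (h : IsInv x y) (g : X.One) (e : X.tgt (X.tgt₂ x) = X.src g) :
    IsInv (g ◁ x) (g ◁ y) := by
  obtain ⟨a, b, c, d⟩ := h
  have e' : X.tgt (X.tgt₂ y) = X.src g := by rw [b, X.tgt_src₂, e]
  refine ⟨by simp [*], by simp [*], ?_, ?_⟩
  · rw [← X.wl_vcomp _ _ _ a.symm e', c, X.wl_id₂ _ _ (by simp [*]), X.src_wl _ _ e]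
  · rw [← X.wl_vcomp _ _ _ b e, d, X.wl_id₂ _ _ (by simp [*]), X.tgt_wl _ _ e]

theorem IsInv.wr {x y : X.Two} (h : IsInv x y) (f : X.One) (e : X.tgt f = X.src (X.tgt₂ x)) :
    IsInv (x ▷ f) (y ▷ f) := by
  obtain ⟨a, b, c, d⟩ := h
  have e' : X.tgt f = X.src (X.tgt₂ y) := by rw [b, X.src_src₂, e]
  refine ⟨by simp [*], by simp [*], ?_, ?_⟩
  · rw [← X.vcomp_wr _ _ _ a.symm e', c, X.id₂_wr _ _ (by simp [*]), X.src_wr _ _ e]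
  · rw [← X.vcomp_wr _ _ _ b e, d, X.id₂_wr _ _ (by simp [*]), X.tgt_wr _ _ e]

@[simp] theorem isIso_vcomp {x y : X.Two} (h : IsIso x) (k : IsIso y)
    (e : X.tgt₂ x = X.src₂ y) : IsIso (y ∘₂ x) := ⟨_, h.isInv.vcomp k.isInv e⟩

@[simp] theorem isIso_wl {x : X.Two} (h : IsIso x) (g : X.One)
    (e : X.tgt (X.tgt₂ x) = X.src g) : IsIso (g ◁ x) := ⟨_, h.isInv.wl g e⟩

@[simp] theorem isIso_wr {x : X.Two} (h : IsIso x) (f : X.One)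
    (e : X.tgt f = X.src (X.tgt₂ x)) : IsIso (x ▷ f) := ⟨_, h.isInv.wr f e⟩

@[simp] theorem inv_vcomp' {x y : X.Two} (h : IsIso x) (k : IsIso y)
    (e : X.tgt₂ x = X.src₂ y) : inv (y ∘₂ x) = inv x ∘₂ inv y := (h.isInv.vcomp k.isInv e).inv_eq

@[simp] theorem inv_wl {x : X.Two} (h : IsIso x) (g : X.One)
    (e : X.tgt (X.tgt₂ x) = X.src g) : inv (g ◁ x) = g ◁ inv x := (h.isInv.wl g e).inv_eq

@[simp] theorem inv_wr {x : X.Two} (h : IsIso x) (f : X.One)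
    (e : X.tgt f = X.src (X.tgt₂ x)) : inv (x ▷ f) = inv x ▷ f := (h.isInv.wr f e).inv_eq

theorem reassoc {a b c d : X.Two} (h : b ∘₂ a = d ∘₂ c) (hab : X.tgt₂ a = X.src₂ b)
    (hcd : X.tgt₂ c = X.src₂ d) (z : X.Two) (hz : X.tgt₂ z = X.src₂ a) :
    b ∘₂ a ∘₂ z = d ∘₂ c ∘₂ z := by
  have h2 : X.src₂ a = X.src₂ c := by
    have := congrArg X.src₂ h; simpa [hab, hcd] using this
  rw [← X.vcomp_assoc _ _ _ hz hab, h, X.vcomp_assoc _ _ _ (hz.trans h2) hcd]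

theorem reassoc3 {a b c a' b' c' : X.Two} (h : c ∘₂ b ∘₂ a = c' ∘₂ b' ∘₂ a')
    (hab : X.tgt₂ a = X.src₂ b) (hbc : X.tgt₂ b = X.src₂ c)
    (hab' : X.tgt₂ a' = X.src₂ b') (hbc' : X.tgt₂ b' = X.src₂ c') (z : X.Two)
    (hz : X.tgt₂ z = X.src₂ a) : c ∘₂ b ∘₂ a ∘₂ z = c' ∘₂ b' ∘₂ a' ∘₂ z := by
  have h2 : X.src₂ a = X.src₂ a' := by
    have := congrArg X.src₂ h; simpa [hab, hbc, hab', hbc'] using this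
  have h3 := reassoc h (by simp [hab, hbc]) (by simp [hab', hbc']) z (by simp [hab, hz])
  rwa [X.vcomp_assoc _ _ _ hz hab, X.vcomp_assoc _ _ _ (hz.trans h2) hab'] at h3

/-- Moving invertible 2-cells to the other side of a commutative square. -/
theorem inv_square {a b c d : X.Two} (ha : IsIso a) (hd : IsIso d)
    (hab : X.tgt₂ a = X.src₂ b) (hcd : X.tgt₂ c = X.src₂ d)
    (h : b ∘₂ a = d ∘₂ c) : inv d ∘₂ b = c ∘₂ inv a := by
  have h1 : X.tgt₂ b = X.tgt₂ d := by
    have := congrArg X.tgt₂ h; simpa [hab, hcd] using this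
  have h2 : X.src₂ a = X.src₂ c := by
    have := congrArg X.src₂ h; simpa [hab, hcd] using this
  have h3 : inv d ∘₂ (b ∘₂ a) ∘₂ inv a = inv d ∘₂ (d ∘₂ c) ∘₂ inv a := by rw [h]
  rw [X.vcomp_assoc b a _ (by simp [*]) hab, vcomp_inv ha, hab, X.vcomp_id,
    X.vcomp_assoc d c _ (by simp [*]) hcd, ← X.vcomp_assoc (inv d) d _ (by simp [*]) (by simp [*]),
    inv_vcomp hd, ← hcd] at h3
  exact h3.trans (id_vcomp' _ _ (by simp [*]))

end TwoCat

/-- A (strict) 2-functor. -/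
@[ext] structure TwoFunctor (X Y : TwoCat.{w}) : Type w where
  ob : X.Ob → Y.Ob
  one : X.One → Y.One
  two : X.Two → Y.Two
  src_one : ∀ f, Y.src (one f) = ob (X.src f)
  tgt_one : ∀ f, Y.tgt (one f) = ob (X.tgt f)
  src_two : ∀ x, Y.src₂ (two x) = one (X.src₂ x)
  tgt_two : ∀ x, Y.tgt₂ (two x) = one (X.tgt₂ x)
  map_id : ∀ a, one (X.id a) = Y.id (ob a)
  map_comp : ∀ g f, X.tgt f = X.src g → one (g ∘₁ f) = one g ∘₁ one f
  map_id₂ : ∀ f, two (X.id₂ f) = Y.id₂ (one f)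
  map_vcomp : ∀ y x, X.tgt₂ x = X.src₂ y → two (y ∘₂ x) = two y ∘₂ two x
  map_wl : ∀ g x, X.tgt (X.tgt₂ x) = X.src g → two (g ◁ x) = one g ◁ two x
  map_wr : ∀ x f, X.tgt f = X.src (X.tgt₂ x) → two (x ▷ f) = two x ▷ one f

attribute [simp] TwoFunctor.src_one TwoFunctor.tgt_one TwoFunctor.src_two TwoFunctor.tgt_two
  TwoFunctor.map_id TwoFunctor.map_comp TwoFunctor.map_id₂ TwoFunctor.map_vcomp
  TwoFunctor.map_wl TwoFunctor.map_wr

namespace TwoFunctor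

variable {X Y Z W : TwoCat.{w}}

/-- The identity 2-functor. -/
def id (X : TwoCat.{w}) : TwoFunctor X X where
  ob a := a
  one f := f
  two x := x
  src_one := by simp
  tgt_one := by simp
  src_two := by simp
  tgt_two := by simp
  map_id := by simp
  map_comp := by simp
  map_id₂ := by simp
  map_vcomp := by simp
  map_wl := by simp
  map_wr := by simp

/-- The composite 2-functor `G ∘ F`. -/
def comp (G : TwoFunctor Y Z) (F : TwoFunctor X Y) : TwoFunctor X Z where
  ob a := G.ob (F.ob a)
  one f := G.one (F.one f)
  two x := G.two (F.two x)
  src_one := by simp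
  tgt_one := by simp
  src_two := by simp
  tgt_two := by simp
  map_id := by simp
  map_comp := by intros; simp [*]
  map_id₂ := by simp
  map_vcomp := by intros; simp [*]
  map_wl := by intros; simp [*]
  map_wr := by intros; simp [*]

@[simp] theorem id_ob (a : X.Ob) : (id X).ob a = a := rfl
@[simp] theorem id_one (a : X.One) : (id X).one a = a := rfl
@[simp] theorem id_two (a : X.Two) : (id X).two a = a := rfl
@[simp] theorem comp_ob (G : TwoFunctor Y Z) (F : TwoFunctor X Y) (a : X.Ob) :
    (G.comp F).ob a = G.ob (F.ob a) := rfl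
@[simp] theorem comp_one (G : TwoFunctor Y Z) (F : TwoFunctor X Y) (a : X.One) :
    (G.comp F).one a = G.one (F.one a) := rfl
@[simp] theorem comp_two (G : TwoFunctor Y Z) (F : TwoFunctor X Y) (a : X.Two) :
    (G.comp F).two a = G.two (F.two a) := rfl

@[simp] theorem comp_assoc (H : TwoFunctor Z W) (G : TwoFunctor Y Z) (F : TwoFunctor X Y) :
    (H.comp G).comp F = H.comp (G.comp F) := rfl

theorem map_isInv (F : TwoFunctor X Y) {x y : X.Two} (h : TwoCat.IsInv x y) :
    TwoCat.IsInv (F.two x) (F.two y) := by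
  obtain ⟨a, b, c, d⟩ := h
  refine ⟨by simp [*], by simp [*], ?_, ?_⟩
  · rw [← F.map_vcomp _ _ a.symm, c]; simp
  · rw [← F.map_vcomp _ _ b, d]; simp

@[simp] theorem map_isIso (F : TwoFunctor X Y) {x : X.Two} (h : TwoCat.IsIso x) :
    TwoCat.IsIso (F.two x) := ⟨_, F.map_isInv h.isInv⟩

@[simp] theorem map_inv (F : TwoFunctor X Y) {x : X.Two} (h : TwoCat.IsIso x) :
    F.two (TwoCat.inv x) = TwoCat.inv (F.two x) := (F.map_isInv h.isInv).inv_eq.symm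

end TwoFunctor

/-- A pseudonatural transformation `α : F ⇒ G` between 2-functors `F = src`, `G = tgt`, with
components `α_a : F a → G a` and invertible structure cells `α_f : G f ∘ α_a ⇒ α_b ∘ F f`. -/
@[ext] structure PsNat (X Y : TwoCat.{w}) : Type w where
  src : TwoFunctor X Y
  tgt : TwoFunctor X Y
  app : X.Ob → Y.One
  nat : X.One → Y.Two
  src_app : ∀ a, Y.src (app a) = src.ob a
  tgt_app : ∀ a, Y.tgt (app a) = tgt.ob a
  src_nat : ∀ f, Y.src₂ (nat f) = tgt.one f ∘₁ app (X.src f)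
  tgt_nat : ∀ f, Y.tgt₂ (nat f) = app (X.tgt f) ∘₁ src.one f
  nat_iso : ∀ f, TwoCat.IsIso (nat f)
  nat_id : ∀ a, nat (X.id a) = Y.id₂ (app a)
  nat_comp : ∀ g f, X.tgt f = X.src g →
    nat (g ∘₁ f) = (nat g ▷ src.one f) ∘₂ (tgt.one g ◁ nat f)
  nat_two : ∀ x, nat (X.tgt₂ x) ∘₂ (tgt.two x ▷ app (X.src (X.tgt₂ x))) =
    (app (X.tgt (X.tgt₂ x)) ◁ src.two x) ∘₂ nat (X.src₂ x)

attribute [simp] PsNat.src_app PsNat.tgt_app PsNat.src_nat PsNat.tgt_nat PsNat.nat_iso PsNat.nat_id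
  PsNat.nat_comp

/-- A modification `m : α ⇛ β` between parallel pseudonatural transformations `α = src`,
`β = tgt`. -/
@[ext] structure Modif (X Y : TwoCat.{w}) : Type w where
  src : PsNat X Y
  tgt : PsNat X Y
  src_eq : src.src = tgt.src
  tgt_eq : src.tgt = tgt.tgt
  app : X.Ob → Y.Two
  src_app : ∀ a, Y.src₂ (app a) = src.app a
  tgt_app : ∀ a, Y.tgt₂ (app a) = tgt.app a
  naturality : ∀ f, tgt.nat f ∘₂ (tgt.tgt.one f ◁ app (X.src f)) =
    (app (X.tgt f) ▷ tgt.src.one f) ∘₂ src.nat f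

attribute [simp] Modif.src_app Modif.tgt_app Modif.src_eq Modif.tgt_eq

namespace PsNat

variable {X Y Z : TwoCat.{w}}

/-- The identity pseudonatural transformation. -/
@[simps] def id (F : TwoFunctor X Y) : PsNat X Y where
  src := F
  tgt := F
  app a := Y.id (F.ob a)
  nat f := Y.id₂ (F.one f)
  src_app := by simp (maxDischargeDepth := 9)
  tgt_app := by simp (maxDischargeDepth := 9)
  src_nat := by simp (maxDischargeDepth := 9)
  tgt_nat := by simp (maxDischargeDepth := 9)
  nat_iso := by simp (maxDischargeDepth := 9)
  nat_id := by simp (maxDischargeDepth := 9)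
  nat_comp := by intros; simp (maxDischargeDepth := 9) [*]
  nat_two := by simp (maxDischargeDepth := 9)

/-- The vertical composite of composable pseudonatural transformations. -/
def vcomp (β α : PsNat X Y) (h : α.tgt = β.src) : PsNat X Y where
  src := α.src
  tgt := β.tgt
  app a := β.app a ∘₁ α.app a
  nat f := (β.app (X.tgt f) ◁ α.nat f) ∘₂ (β.nat f ▷ α.app (X.src f))
  src_app := by simp (maxDischargeDepth := 9) [h]
  tgt_app := by simp (maxDischargeDepth := 9) [h]
  src_nat := by simp (maxDischargeDepth := 9) [h]
  tgt_nat := by simp (maxDischargeDepth := 9) [h]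
  nat_iso := by intro; simp (maxDischargeDepth := 9) [h]
  nat_id := by simp (maxDischargeDepth := 9) [h]
  nat_comp g f e := by
    have I := Y.interchange (β.nat g) (α.nat f) (by simp (maxDischargeDepth := 9) [h, e])
    simp (maxDischargeDepth := 9) [h, e] at I
    have J := TwoCat.reassoc I (by simp (maxDischargeDepth := 9) [h, e])
      (by simp (maxDischargeDepth := 9) [h, e])
      (β.tgt.one g ◁ β.nat f ▷ α.app (X.src f)) (by simp (maxDischargeDepth := 9) [h, e])
    simp (maxDischargeDepth := 9) [h, e, J]
  nat_two x := by
    have h1 := congrArg (Y.wl (β.app (X.tgt (X.tgt₂ x)))) (α.nat_two x)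
    have h2 := congrArg (fun y => Y.wr y (α.app (X.src (X.tgt₂ x)))) (β.nat_two x)
    simp (maxDischargeDepth := 9) [h] at h1 h2
    have h3 := TwoCat.reassoc h1 (by simp (maxDischargeDepth := 9) [h])
      (by simp (maxDischargeDepth := 9) [h])
    simp (maxDischargeDepth := 9) [h, h2, h3]

open Classical in
/-- Vertical composition of pseudonatural transformations. -/
noncomputable def comp (β α : PsNat X Y) : PsNat X Y :=
  if h : α.tgt = β.src then vcomp β α h else α

theorem comp_eq {β α : PsNat X Y} (h : α.tgt = β.src) : comp β α = vcomp β α h := dif_pos h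

@[simp] theorem src_comp {β α : PsNat X Y} (h : α.tgt = β.src) : (comp β α).src = α.src := by
  rw [comp_eq h]; rfl
@[simp] theorem tgt_comp {β α : PsNat X Y} (h : α.tgt = β.src) : (comp β α).tgt = β.tgt := by
  rw [comp_eq h]; rfl
@[simp] theorem comp_app {β α : PsNat X Y} (h : α.tgt = β.src) (a : X.Ob) :
    (comp β α).app a = β.app a ∘₁ α.app a := by
  rw [comp_eq h]; rfl
@[simp] theorem comp_nat {β α : PsNat X Y} (h : α.tgt = β.src) (f : X.One) :
    (comp β α).nat f = (β.app (X.tgt f) ◁ α.nat f) ∘₂ (β.nat f ▷ α.app (X.src f)) := by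
  rw [comp_eq h]; rfl

/-- The whiskering `G α` of a pseudonatural transformation by a 2-functor. -/
@[simps] def post (G : TwoFunctor Y Z) (α : PsNat X Y) : PsNat X Z where
  src := G.comp α.src
  tgt := G.comp α.tgt
  app a := G.one (α.app a)
  nat f := G.two (α.nat f)
  src_app := by simp (maxDischargeDepth := 9)
  tgt_app := by simp (maxDischargeDepth := 9)
  src_nat := by simp (maxDischargeDepth := 9)
  tgt_nat := by simp (maxDischargeDepth := 9)
  nat_iso := by intro; simp (maxDischargeDepth := 9)
  nat_id := by simp (maxDischargeDepth := 9)
  nat_comp := by intros; simp (maxDischargeDepth := 9) [*]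
  nat_two x := by
    have := congrArg G.two (α.nat_two x)
    simpa using this

/-- The whiskering `α F` of a pseudonatural transformation by a 2-functor. -/
@[simps] def pre (F : TwoFunctor X Y) (α : PsNat Y Z) : PsNat X Z where
  src := α.src.comp F
  tgt := α.tgt.comp F
  app a := α.app (F.ob a)
  nat f := α.nat (F.one f)
  src_app := by simp (maxDischargeDepth := 9)
  tgt_app := by simp (maxDischargeDepth := 9)
  src_nat := by simp (maxDischargeDepth := 9)
  tgt_nat := by simp (maxDischargeDepth := 9)
  nat_iso := by intro; simp (maxDischargeDepth := 9)
  nat_id := by simp (maxDischargeDepth := 9)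
  nat_comp := by intros; simp (maxDischargeDepth := 9) [*]
  nat_two x := by
    have := α.nat_two (F.two x)
    simpa using this

end PsNat

namespace Modif

variable {X Y Z : TwoCat.{w}}

/-- The identity modification. -/
@[simps] def id (α : PsNat X Y) : Modif X Y where
  src := α
  tgt := α
  src_eq := rfl
  tgt_eq := rfl
  app a := Y.id₂ (α.app a)
  src_app := by simp (maxDischargeDepth := 9)
  tgt_app := by simp (maxDischargeDepth := 9)
  naturality := by simp (maxDischargeDepth := 9)

/-- Vertical composition of modifications (if they are composable). -/
def vcomp' (n m : Modif X Y) (h : m.tgt = n.src) : Modif X Y where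
  src := m.src
  tgt := n.tgt
  src_eq := by simp (maxDischargeDepth := 9) [h]
  tgt_eq := by simp (maxDischargeDepth := 9) [h]
  app a := n.app a ∘₂ m.app a
  src_app := by simp (maxDischargeDepth := 9) [h]
  tgt_app := by simp (maxDischargeDepth := 9) [h]
  naturality f := by
    have h1 := n.naturality f
    have h2 := congrArg (Y.vcomp (n.app (X.tgt f) ▷ n.tgt.src.one f)) (m.naturality f)
    have h3 := TwoCat.reassoc h1 (by simp (maxDischargeDepth := 9))
      (by simp (maxDischargeDepth := 9)) (m.tgt.tgt.one f ◁ m.app (X.src f))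
      (by simp (maxDischargeDepth := 9) [h])
    simp (maxDischargeDepth := 9) [h] at h1 h2 h3
    simp (maxDischargeDepth := 9) [h, h3, h2]

open Classical in
/-- Vertical composition of modifications. -/
noncomputable def vcomp (n m : Modif X Y) : Modif X Y :=
  if h : m.tgt = n.src then vcomp' n m h else m

/-- Whiskering of a modification by a pseudonatural transformation (if composable). -/
noncomputable def wl' (β : PsNat X Y) (m : Modif X Y) (h : m.tgt.tgt = β.src) : Modif X Y where
  src := β.comp m.src
  tgt := β.comp m.tgt
  src_eq := by simp (maxDischargeDepth := 9) [h]
  tgt_eq := by simp (maxDischargeDepth := 9) [h]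
  app a := β.app a ◁ m.app a
  src_app := by simp (maxDischargeDepth := 9) [h]
  tgt_app := by simp (maxDischargeDepth := 9) [h]
  naturality f := by
    have h1 := congrArg (Y.wl (β.app (X.tgt f))) (m.naturality f)
    have I := Y.interchange (β.nat f) (m.app (X.src f)) (by simp (maxDischargeDepth := 9) [h])
    simp (maxDischargeDepth := 9) [h] at h1 I
    have h3 := TwoCat.reassoc h1 (by simp (maxDischargeDepth := 9) [h])
      (by simp (maxDischargeDepth := 9) [h])
    simp (maxDischargeDepth := 9) [h, h3, ← I]

open Classical in
/-- Whiskering of a modification by a pseudonatural transformation. -/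
noncomputable def wl (β : PsNat X Y) (m : Modif X Y) : Modif X Y :=
  if h : m.tgt.tgt = β.src then wl' β m h else m

/-- Whiskering of a modification by a pseudonatural transformation (if composable). -/
noncomputable def wr' (m : Modif X Y) (α : PsNat X Y) (h : α.tgt = m.tgt.src) : Modif X Y where
  src := m.src.comp α
  tgt := m.tgt.comp α
  src_eq := by simp (maxDischargeDepth := 9) [h]
  tgt_eq := by simp (maxDischargeDepth := 9) [h]
  app a := m.app a ▷ α.app a
  src_app := by simp (maxDischargeDepth := 9) [h]
  tgt_app := by simp (maxDischargeDepth := 9) [h]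
  naturality f := by
    have h1 := congrArg (fun y => Y.wr y (α.app (X.src f))) (m.naturality f)
    have I := Y.interchange (m.app (X.tgt f)) (α.nat f) (by simp (maxDischargeDepth := 9) [h])
    simp (maxDischargeDepth := 9) [h] at h1 I
    have h3 := TwoCat.reassoc I (by simp (maxDischargeDepth := 9) [h])
      (by simp (maxDischargeDepth := 9) [h])
    simp (maxDischargeDepth := 9) [h, h1, ← h3]

open Classical in
/-- Whiskering of a modification by a pseudonatural transformation. -/
noncomputable def wr (m : Modif X Y) (α : PsNat X Y) : Modif X Y :=
  if h : α.tgt = m.tgt.src then wr' m α h else m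

@[simp] theorem src_vcomp {n m : Modif X Y} (h : m.tgt = n.src) : (vcomp n m).src = m.src := by
  rw [vcomp, dif_pos h]; rfl
@[simp] theorem tgt_vcomp {n m : Modif X Y} (h : m.tgt = n.src) : (vcomp n m).tgt = n.tgt := by
  rw [vcomp, dif_pos h]; rfl
@[simp] theorem vcomp_app {n m : Modif X Y} (h : m.tgt = n.src) (a : X.Ob) :
    (vcomp n m).app a = n.app a ∘₂ m.app a := by
  rw [vcomp, dif_pos h]; rfl
@[simp] theorem src_wl {β : PsNat X Y} {m : Modif X Y} (h : m.tgt.tgt = β.src) :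
    (wl β m).src = β.comp m.src := by
  rw [wl, dif_pos h]; rfl
@[simp] theorem tgt_wl {β : PsNat X Y} {m : Modif X Y} (h : m.tgt.tgt = β.src) :
    (wl β m).tgt = β.comp m.tgt := by
  rw [wl, dif_pos h]; rfl
@[simp] theorem wl_app {β : PsNat X Y} {m : Modif X Y} (h : m.tgt.tgt = β.src) (a : X.Ob) :
    (wl β m).app a = β.app a ◁ m.app a := by
  rw [wl, dif_pos h]; rfl
@[simp] theorem src_wr {m : Modif X Y} {α : PsNat X Y} (h : α.tgt = m.tgt.src) :
    (wr m α).src = m.src.comp α := by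
  rw [wr, dif_pos h]; rfl
@[simp] theorem tgt_wr {m : Modif X Y} {α : PsNat X Y} (h : α.tgt = m.tgt.src) :
    (wr m α).tgt = m.tgt.comp α := by
  rw [wr, dif_pos h]; rfl
@[simp] theorem wr_app {m : Modif X Y} {α : PsNat X Y} (h : α.tgt = m.tgt.src) (a : X.Ob) :
    (wr m α).app a = m.app a ▷ α.app a := by
  rw [wr, dif_pos h]; rfl

end Modif
 
/-- The 2-category of 2-functors, pseudonatural transformations and modifications. -/
noncomputable def homTwoCat (X Y : TwoCat.{w}) : TwoCat.{w} where
  Ob := TwoFunctor X Y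
  One := PsNat X Y
  Two := Modif X Y
  src := PsNat.src
  tgt := PsNat.tgt
  src₂ := Modif.src
  tgt₂ := Modif.tgt
  id := PsNat.id
  comp := PsNat.comp
  id₂ := Modif.id
  vcomp := Modif.vcomp
  wl := Modif.wl
  wr := Modif.wr
  src_src₂ x := by simp
  tgt_src₂ x := by simp
  src_id _ := rfl
  tgt_id _ := rfl
  src_comp g f e := by simp (maxDischargeDepth := 9) [e]
  tgt_comp g f e := by simp (maxDischargeDepth := 9) [e]
  comp_id f := by ext <;> simp (maxDischargeDepth := 9)
  id_comp f := by ext <;> simp (maxDischargeDepth := 9)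
  comp_assoc h g f e k := by ext <;> simp (maxDischargeDepth := 9) [e, k]
  src_id₂ _ := rfl
  tgt_id₂ _ := rfl
  src_vcomp y x e := by simp (maxDischargeDepth := 9) [e]
  tgt_vcomp y x e := by simp (maxDischargeDepth := 9) [e]
  vcomp_id x := by ext <;> simp (maxDischargeDepth := 9)
  id_vcomp x := by ext <;> simp (maxDischargeDepth := 9)
  vcomp_assoc z y x e k := by ext <;> simp (maxDischargeDepth := 9) [e, k]
  src_wl g x e := by simp (maxDischargeDepth := 9) [e]
  tgt_wl g x e := by simp (maxDischargeDepth := 9) [e]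
  wl_id₂ g f e := by ext <;> simp (maxDischargeDepth := 9) [e]
  wl_vcomp g y x e k := by ext <;> simp (maxDischargeDepth := 9) [e, k]
  id_wl x := by ext <;> simp (maxDischargeDepth := 9)
  comp_wl h g x e k := by ext <;> simp (maxDischargeDepth := 9) [e, k]
  src_wr x f e := by simp (maxDischargeDepth := 9) [e]
  tgt_wr x f e := by simp (maxDischargeDepth := 9) [e]
  id₂_wr g f e := by ext <;> simp (maxDischargeDepth := 9) [e]
  vcomp_wr y x f e k := by ext <;> simp (maxDischargeDepth := 9) [e, k]
  wr_id x := by ext <;> simp (maxDischargeDepth := 9)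
  wr_comp x g f e k := by ext <;> simp (maxDischargeDepth := 9) [e, k]
  wl_wr h x f e k := by ext <;> simp (maxDischargeDepth := 9) [e, k]
  interchange y x e := by
    ext a
    all_goals try simp (maxDischargeDepth := 9) [e]
    simpa using Y.interchange (y.app a) (x.app a) (by simp [e])

/-! ### Gray-categories -/

/-- A Gray-category `K`, i.e. a category enriched in 2-categories with the Gray tensor product:
hom-2-categories `K.hom A B`, identities, and a composition that is a cubical functor.  The latter
is given by the 2-functors `post G = G ∘ -` and `pre F = - ∘ F`, which agree on objects, together
with the invertible interchange 3-cells `ix g f = g_f : G'f · gF ⇛ gF' · Gf` for `f : F ⇒ F'` in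
`hom A B` and `g : G ⇒ G'` in `hom B C`. -/
structure GrayCat : Type (max (u + 1) (w + 1)) where
  Obj : Type u
  hom : Obj → Obj → TwoCat.{w}
  one (A : Obj) : (hom A A).Ob
  post {A B C : Obj} (G : (hom B C).Ob) : TwoFunctor (hom A B) (hom A C)
  pre {A B C : Obj} (F : (hom A B).Ob) : TwoFunctor (hom B C) (hom A C)
  ix {A B C : Obj} (g : (hom B C).One) (f : (hom A B).One) : (hom A C).Two
  pre_ob : ∀ {A B C : Obj} (F : (hom A B).Ob) (G : (hom B C).Ob), (pre F).ob G = (post G).ob F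
  post_id : ∀ A B : Obj, post (A := A) (one B) = TwoFunctor.id (hom A B)
  pre_id : ∀ A B : Obj, pre (C := B) (one A) = TwoFunctor.id (hom A B)
  post_comp : ∀ {A B C D : Obj} (H : (hom C D).Ob) (G : (hom B C).Ob),
    post (A := A) ((post H).ob G) = (post H).comp (post G)
  pre_comp : ∀ {A B C D : Obj} (G : (hom B C).Ob) (F : (hom A B).Ob),
    pre (C := D) ((post G).ob F) = (pre F).comp (pre G)
  pre_post : ∀ {A B C D : Obj} (H : (hom C D).Ob) (F : (hom A B).Ob),
    (pre F).comp (post (A := B) H) = (post H).comp (pre F)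
  src_ix : ∀ {A B C : Obj} (g : (hom B C).One) (f : (hom A B).One), (hom A C).src₂ (ix g f) =
    (post ((hom B C).tgt g)).one f ∘₁ (pre ((hom A B).src f)).one g
  tgt_ix : ∀ {A B C : Obj} (g : (hom B C).One) (f : (hom A B).One), (hom A C).tgt₂ (ix g f) =
    (pre ((hom A B).tgt f)).one g ∘₁ (post ((hom B C).src g)).one f
  ix_iso : ∀ {A B C : Obj} (g : (hom B C).One) (f : (hom A B).One), TwoCat.IsIso (ix g f)
  ix_id_left : ∀ {A B C : Obj} (G : (hom B C).Ob) (f : (hom A B).One),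
    ix ((hom B C).id G) f = (hom A C).id₂ ((post G).one f)
  ix_id_right : ∀ {A B C : Obj} (g : (hom B C).One) (F : (hom A B).Ob),
    ix g ((hom A B).id F) = (hom A C).id₂ ((pre F).one g)
  ix_comp_left : ∀ {A B C : Obj} (g' g : (hom B C).One) (f : (hom A B).One),
    (hom B C).tgt g = (hom B C).src g' → ix (g' ∘₁ g) f =
      ((pre ((hom A B).tgt f)).one g' ◁ ix g f) ∘₂ (ix g' f ▷ (pre ((hom A B).src f)).one g)
  ix_comp_right : ∀ {A B C : Obj} (g : (hom B C).One) (f' f : (hom A B).One),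
    (hom A B).tgt f = (hom A B).src f' → ix g (f' ∘₁ f) =
      (ix g f' ▷ (post ((hom B C).src g)).one f) ∘₂ ((post ((hom B C).tgt g)).one f' ◁ ix g f)
  ix_two_left : ∀ {A B C : Obj} (y : (hom B C).Two) (f : (hom A B).One),
    ix ((hom B C).tgt₂ y) f ∘₂
        ((post ((hom B C).tgt ((hom B C).tgt₂ y))).one f ◁ (pre ((hom A B).src f)).two y) =
      ((pre ((hom A B).tgt f)).two y ▷ (post ((hom B C).src ((hom B C).tgt₂ y))).one f) ∘₂
        ix ((hom B C).src₂ y) f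
  ix_two_right : ∀ {A B C : Obj} (g : (hom B C).One) (x : (hom A B).Two),
    ix g ((hom A B).tgt₂ x) ∘₂
        ((post ((hom B C).tgt g)).two x ▷ (pre ((hom A B).src ((hom A B).tgt₂ x))).one g) =
      ((pre ((hom A B).tgt ((hom A B).tgt₂ x))).one g ◁ (post ((hom B C).src g)).two x) ∘₂
        ix g ((hom A B).src₂ x)
  post_ix : ∀ {A B C D : Obj} (H : (hom C D).Ob) (g : (hom B C).One) (f : (hom A B).One),
    ix ((post H).one g) f = (post H).two (ix g f)
  ix_post : ∀ {A B C D : Obj} (h : (hom C D).One) (G : (hom B C).Ob) (f : (hom A B).One),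
    ix h ((post G).one f) = ix ((pre G).one h) f
  pre_ix : ∀ {A B C D : Obj} (h : (hom C D).One) (g : (hom B C).One) (F : (hom A B).Ob),
    ix h ((pre F).one g) = (pre F).two (ix h g)

notation:80 G:81 " ⋆ " F:80 => TwoFunctor.ob (GrayCat.post _ G) F
notation:80 G:81 " ⋆ₗ " f:80 => TwoFunctor.one (GrayCat.post _ G) f
notation:80 G:81 " ⋆ₗₗ " x:80 => TwoFunctor.two (GrayCat.post _ G) x
notation:80 g:80 " ⋆ᵣ " F:81 => TwoFunctor.one (GrayCat.pre _ F) g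
notation:80 y:80 " ⋆ᵣᵣ " F:81 => TwoFunctor.two (GrayCat.pre _ F) y

namespace GrayCat

attribute [simp] pre_ob src_ix tgt_ix ix_iso ix_id_left ix_id_right ix_comp_left ix_comp_right
  post_ix ix_post pre_ix

section lemmas

variable {K : GrayCat.{u, w}} {A B C D : K.Obj}

@[simp] theorem one_ob (F : (K.hom A B).Ob) : K.one B ⋆ F = F := by rw [post_id]; rfl
@[simp] theorem one_one (f : (K.hom A B).One) : K.one B ⋆ₗ f = f := by rw [post_id]; rfl
@[simp] theorem one_two (x : (K.hom A B).Two) : K.one B ⋆ₗₗ x = x := by rw [post_id]; rfl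
@[simp] theorem ob_one (F : (K.hom A B).Ob) : F ⋆ K.one A = F := by rw [← pre_ob, pre_id]; rfl
@[simp] theorem one_one' (f : (K.hom A B).One) : f ⋆ᵣ K.one A = f := by rw [pre_id]; rfl
@[simp] theorem two_one (x : (K.hom A B).Two) : x ⋆ᵣᵣ K.one A = x := by rw [pre_id]; rfl

@[simp] theorem comp_ob (H : (K.hom C D).Ob) (G : (K.hom B C).Ob) (F : (K.hom A B).Ob) :
    (H ⋆ G) ⋆ F = H ⋆ G ⋆ F := by rw [post_comp]; rfl
@[simp] theorem comp_one (H : (K.hom C D).Ob) (G : (K.hom B C).Ob) (f : (K.hom A B).One) :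
    (H ⋆ G) ⋆ₗ f = H ⋆ₗ G ⋆ₗ f := by rw [post_comp]; rfl
@[simp] theorem comp_two (H : (K.hom C D).Ob) (G : (K.hom B C).Ob) (x : (K.hom A B).Two) :
    (H ⋆ G) ⋆ₗₗ x = H ⋆ₗₗ G ⋆ₗₗ x := by rw [post_comp]; rfl
@[simp] theorem one_comp (h : (K.hom C D).One) (G : (K.hom B C).Ob) (F : (K.hom A B).Ob) :
    h ⋆ᵣ (G ⋆ F) = h ⋆ᵣ G ⋆ᵣ F := by rw [pre_comp]; rfl
@[simp] theorem two_comp (y : (K.hom C D).Two) (G : (K.hom B C).Ob) (F : (K.hom A B).Ob) :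
    y ⋆ᵣᵣ (G ⋆ F) = y ⋆ᵣᵣ G ⋆ᵣᵣ F := by rw [pre_comp]; rfl
@[simp] theorem one_mid (H : (K.hom C D).Ob) (g : (K.hom B C).One) (F : (K.hom A B).Ob) :
    (H ⋆ₗ g) ⋆ᵣ F = H ⋆ₗ (g ⋆ᵣ F) := congrFun (congrArg TwoFunctor.one (pre_post K H F)) g
@[simp] theorem two_mid (H : (K.hom C D).Ob) (y : (K.hom B C).Two) (F : (K.hom A B).Ob) :
    (H ⋆ₗₗ y) ⋆ᵣᵣ F = H ⋆ₗₗ (y ⋆ᵣᵣ F) := congrFun (congrArg TwoFunctor.two (pre_post K H F)) y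

end lemmas

/-- The opposite Gray-category, with 1-cells reversed. -/
noncomputable def op (K : GrayCat.{u, w}) : GrayCat.{u, w} where
  Obj := K.Obj
  hom A B := K.hom B A
  one A := K.one A
  post G := K.pre G
  pre F := K.post F
  ix g f := TwoCat.inv (K.ix f g)
  pre_ob F G := by simp
  post_id A B := K.pre_id _ _
  pre_id A B := K.post_id _ _
  post_comp H G := by simp [K.pre_comp]
  pre_comp G F := by simp [K.post_comp]
  pre_post H F := (K.pre_post _ _).symm
  src_ix g f := by simp
  tgt_ix g f := by simp
  ix_iso g f := by simp
  ix_id_left G f := by simp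
  ix_id_right g F := by simp
  ix_comp_left g' g f h := by
    simp (maxDischargeDepth := 9) [h]
  ix_comp_right g f' f h := by
    simp (maxDischargeDepth := 9) [h]
  ix_two_left y f := TwoCat.inv_square (by simp) (by simp) (by simp) (by simp)
    (K.ix_two_right f y).symm
  ix_two_right g x := TwoCat.inv_square (by simp) (by simp) (by simp) (by simp)
    (K.ix_two_left x g).symm
  post_ix H g f := by simp
  ix_post h G f := by simp
  pre_ix h g F := by simp

end GrayCat

namespace Modif

variable {X Y Z : TwoCat.{w}}

/-- The whiskering of a modification by a 2-functor `G` on the left. -/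
@[simps] def post (G : TwoFunctor Y Z) (x : Modif X Y) : Modif X Z where
  src := PsNat.post G x.src
  tgt := PsNat.post G x.tgt
  src_eq := by simp
  tgt_eq := by simp
  app a := G.two (x.app a)
  src_app := by simp
  tgt_app := by simp
  naturality f := by
    have := congrArg G.two (x.naturality f)
    simp (maxDischargeDepth := 9) at this
    simpa (maxDischargeDepth := 9) using this

/-- The whiskering of a modification by a 2-functor `F` on the right. -/
@[simps] def pre (F : TwoFunctor X Y) (x : Modif Y Z) : Modif X Z where
  src := PsNat.pre F x.src
  tgt := PsNat.pre F x.tgt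
  src_eq := by simp
  tgt_eq := by simp
  app a := x.app (F.ob a)
  src_app := by simp
  tgt_app := by simp
  naturality f := by simpa using x.naturality (F.one f)

/-- The interchange `g_f` of pseudonatural transformations `f : F ⇒ F'` and `g : G ⇒ G'`: the
modification whose components are the structure cells of `g` at the components of `f`. -/
@[simps] noncomputable def ix (g : PsNat Y Z) (f : PsNat X Y) : Modif X Z where
  src := (PsNat.post g.tgt f).comp (PsNat.pre f.src g)
  tgt := (PsNat.pre f.tgt g).comp (PsNat.post g.src f)
  src_eq := by simp
  tgt_eq := by simp
  app a := g.nat (f.app a)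
  src_app := by simp
  tgt_app := by simp
  naturality k := by
    have := g.nat_two (f.nat k)
    simp (maxDischargeDepth := 9) at this
    simpa (maxDischargeDepth := 9) using this.symm

/-- A modification with invertible components is invertible. -/
theorem isIso {m : Modif X Y} (h : ∀ a, TwoCat.IsIso (m.app a)) :
    TwoCat.IsIso (X := homTwoCat X Y) m := by
  refine ⟨(⟨m.tgt, m.src, m.src_eq.symm, m.tgt_eq.symm, fun a => TwoCat.inv (m.app a),
    by simp [h], by simp [h], fun f => ?_⟩ : Modif X Y), rfl, rfl, ?_, ?_⟩
  · have := TwoCat.inv_square (by simp (maxDischargeDepth := 9) [h])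
      (by simp (maxDischargeDepth := 9) [h]) (by simp (maxDischargeDepth := 9) [h])
      (by simp (maxDischargeDepth := 9) [h]) (m.naturality f)
    simpa (maxDischargeDepth := 9) [h] using this.symm
  · exact Modif.ext (by simp [homTwoCat]) (by simp [homTwoCat]) (by funext a; simp [homTwoCat, h])
  · exact Modif.ext (by simp [homTwoCat]) (by simp [homTwoCat]) (by funext a; simp [homTwoCat, h])

end Modif

/-- The 2-functor `G ∘ -` between 2-categories of 2-functors. -/
noncomputable def grayPost {X Y Z : TwoCat.{w}} (G : TwoFunctor Y Z) :
    TwoFunctor (homTwoCat X Y) (homTwoCat X Z) where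
  ob F := G.comp F
  one (f : PsNat X Y) := PsNat.post G f
  two (x : Modif X Y) := Modif.post G x
  src_one _ := rfl
  tgt_one _ := rfl
  src_two _ := rfl
  tgt_two _ := rfl
  map_id (a : TwoFunctor X Y) := by
    change PsNat.post G (PsNat.id a) = PsNat.id (G.comp a)
    apply PsNat.ext <;> (try funext a) <;> simp
  map_comp (g f : PsNat X Y) (h : f.tgt = g.src) := by
    change PsNat.post G (g.comp f) = (PsNat.post G g).comp (PsNat.post G f)
    apply PsNat.ext <;> (try funext a) <;> simp (maxDischargeDepth := 9) [h]
  map_id₂ (f : PsNat X Y) := by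
    change Modif.post G (Modif.id f) = Modif.id (PsNat.post G f)
    apply Modif.ext <;> (try funext a) <;> simp
  map_vcomp (y x : Modif X Y) (h : x.tgt = y.src) := by
    change Modif.post G (Modif.vcomp y x) = (Modif.post G y).vcomp (Modif.post G x)
    apply Modif.ext <;> (try apply PsNat.ext) <;> (try funext a) <;> simp (maxDischargeDepth := 9) [h]
  map_wl (g : PsNat X Y) (x : Modif X Y) (h : x.tgt.tgt = g.src) := by
    change Modif.post G (Modif.wl g x) = Modif.wl (PsNat.post G g) (Modif.post G x)
    apply Modif.ext <;> (try apply PsNat.ext) <;> (try funext a) <;> simp (maxDischargeDepth := 9) [h]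
  map_wr (x : Modif X Y) (f : PsNat X Y) (h : f.tgt = x.tgt.src) := by
    change Modif.post G (Modif.wr x f) = Modif.wr (Modif.post G x) (PsNat.post G f)
    apply Modif.ext <;> (try apply PsNat.ext) <;> (try funext a) <;> simp (maxDischargeDepth := 9) [h]

/-- The 2-functor `- ∘ F` between 2-categories of 2-functors. -/
noncomputable def grayPre {X Y Z : TwoCat.{w}} (F : TwoFunctor X Y) :
    TwoFunctor (homTwoCat Y Z) (homTwoCat X Z) where
  ob G := G.comp F
  one (f : PsNat Y Z) := PsNat.pre F f
  two (x : Modif Y Z) := Modif.pre F x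
  src_one _ := rfl
  tgt_one _ := rfl
  src_two _ := rfl
  tgt_two _ := rfl
  map_id (a : TwoFunctor Y Z) := by
    change PsNat.pre F (PsNat.id a) = PsNat.id (a.comp F)
    apply PsNat.ext <;> (try funext a) <;> simp
  map_comp (g f : PsNat Y Z) (h : f.tgt = g.src) := by
    change PsNat.pre F (g.comp f) = (PsNat.pre F g).comp (PsNat.pre F f)
    apply PsNat.ext <;> (try funext a) <;> simp (maxDischargeDepth := 9) [h]
  map_id₂ (f : PsNat Y Z) := by
    change Modif.pre F (Modif.id f) = Modif.id (PsNat.pre F f)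
    apply Modif.ext <;> (try funext a) <;> simp
  map_vcomp (y x : Modif Y Z) (h : x.tgt = y.src) := by
    change Modif.pre F (Modif.vcomp y x) = (Modif.pre F y).vcomp (Modif.pre F x)
    apply Modif.ext <;> (try apply PsNat.ext) <;> (try funext a) <;> simp (maxDischargeDepth := 9) [h]
  map_wl (g : PsNat Y Z) (x : Modif Y Z) (h : x.tgt.tgt = g.src) := by
    change Modif.pre F (Modif.wl g x) = Modif.wl (PsNat.pre F g) (Modif.pre F x)
    apply Modif.ext <;> (try apply PsNat.ext) <;> (try funext a) <;> simp (maxDischargeDepth := 9) [h]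
  map_wr (x : Modif Y Z) (f : PsNat Y Z) (h : f.tgt = x.tgt.src) := by
    change Modif.pre F (Modif.wr x f) = Modif.wr (Modif.pre F x) (PsNat.pre F f)
    apply Modif.ext <;> (try apply PsNat.ext) <;> (try funext a) <;> simp (maxDischargeDepth := 9) [h]

/-- The Gray-category `Gray` of (small) 2-categories, 2-functors, pseudonatural transformations
and modifications. -/
noncomputable def Gray : GrayCat.{w + 1, w} where
  Obj := TwoCat.{w}
  hom := homTwoCat
  one := TwoFunctor.id
  post := grayPost
  pre := grayPre
  ix := Modif.ix
  pre_ob _ _ := rfl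
  post_id _ _ := rfl
  pre_id _ _ := rfl
  post_comp _ _ := rfl
  pre_comp _ _ := rfl
  pre_post _ _ := rfl
  src_ix _ _ := rfl
  tgt_ix _ _ := rfl
  ix_iso (g : PsNat _ _) (f : PsNat _ _) := Modif.isIso (fun a => g.nat_iso (f.app a))
  ix_id_left (G : TwoFunctor _ _) (f : PsNat _ _) := by
    change (Modif.ix (PsNat.id G) f : Modif _ _) = Modif.id (PsNat.post G f)
    apply Modif.ext <;> (try apply PsNat.ext) <;> (try funext a) <;> simp (maxDischargeDepth := 9)
  ix_id_right (g : PsNat _ _) (F : TwoFunctor _ _) := by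
    change (Modif.ix g (PsNat.id F) : Modif _ _) = Modif.id (PsNat.pre F g)
    apply Modif.ext <;> (try apply PsNat.ext) <;> (try funext a) <;> simp (maxDischargeDepth := 9)
  ix_comp_left (g' g : PsNat _ _) (f : PsNat _ _) (h : g.tgt = g'.src) := by
    change (Modif.ix (g'.comp g) f : Modif _ _) = (Modif.wl (PsNat.pre f.tgt g') (Modif.ix g f)).vcomp
      ((Modif.ix g' f).wr (PsNat.pre f.src g))
    have e : ((Modif.ix g' f).wr (PsNat.pre f.src g)).tgt =
        (Modif.wl (PsNat.pre f.tgt g') (Modif.ix g f)).src := by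
      apply PsNat.ext <;> (try funext a) <;> simp (maxDischargeDepth := 9) [h]
    apply Modif.ext <;> (try apply PsNat.ext) <;> (try funext a) <;> simp (maxDischargeDepth := 9) [h, Modif.src_vcomp e, Modif.tgt_vcomp e,
        Modif.vcomp_app e]
  ix_comp_right (g : PsNat _ _) (f' f : PsNat _ _) (h : f.tgt = f'.src) := by
    change (Modif.ix g (f'.comp f) : Modif _ _) = ((Modif.ix g f').wr (PsNat.post g.src f)).vcomp
      (Modif.wl (PsNat.post g.tgt f') (Modif.ix g f))
    have e : (Modif.wl (PsNat.post g.tgt f') (Modif.ix g f)).tgt =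
        ((Modif.ix g f').wr (PsNat.post g.src f)).src := by
      apply PsNat.ext <;> (try funext a) <;> simp (maxDischargeDepth := 9) [h]
    apply Modif.ext <;> (try apply PsNat.ext) <;> (try funext a) <;> simp (maxDischargeDepth := 9) [h, Modif.src_vcomp e, Modif.tgt_vcomp e,
        Modif.vcomp_app e]
  ix_two_left (y : Modif _ _) (f : PsNat _ _) := by
    change Modif.vcomp (Modif.ix y.tgt f) (Modif.wl (PsNat.post y.tgt.tgt f) (Modif.pre f.src y)) =
      Modif.vcomp (Modif.wr (Modif.pre f.tgt y) (PsNat.post y.tgt.src f)) (Modif.ix y.src f)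
    apply Modif.ext <;> (try apply PsNat.ext) <;> (try funext a) <;> simp (maxDischargeDepth := 9)
    simpa using y.naturality (f.app a)
  ix_two_right (g : PsNat _ _) (x : Modif _ _) := by
    change Modif.vcomp (Modif.ix g x.tgt) (Modif.wr (Modif.post g.tgt x) (PsNat.pre x.tgt.src g)) =
      Modif.vcomp (Modif.wl (PsNat.pre x.tgt.tgt g) (Modif.post g.src x)) (Modif.ix g x.src)
    apply Modif.ext <;> (try apply PsNat.ext) <;> (try funext a) <;> simp (maxDischargeDepth := 9)
    simpa using g.nat_two (x.app a)
  post_ix (H : TwoFunctor _ _) (g : PsNat _ _) (f : PsNat _ _) := by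
    change Modif.ix (PsNat.post H g) f = Modif.post H (Modif.ix g f)
    apply Modif.ext <;> (try apply PsNat.ext) <;> (try funext a) <;> simp (maxDischargeDepth := 9)
  ix_post (h : PsNat _ _) (G : TwoFunctor _ _) (f : PsNat _ _) := by
    change Modif.ix h (PsNat.post G f) = Modif.ix (PsNat.pre G h) f
    apply Modif.ext <;> (try apply PsNat.ext) <;> (try funext a) <;> simp (maxDischargeDepth := 9)
  pre_ix (h : PsNat _ _) (g : PsNat _ _) (F : TwoFunctor _ _) := by
    change Modif.ix h (PsNat.pre F g) = Modif.pre F (Modif.ix h g)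
    apply Modif.ext <;> (try apply PsNat.ext) <;> (try funext a) <;> simp (maxDischargeDepth := 9)

/-- A Gray-functor. -/
structure GrayFunctor (K : GrayCat.{u, w}) (L : GrayCat.{v, w}) where
  obj : K.Obj → L.Obj
  map (A B : K.Obj) : TwoFunctor (K.hom A B) (L.hom (obj A) (obj B))
  map_one : ∀ A, (map A A).ob (K.one A) = L.one (obj A)
  map_post : ∀ {A B C : K.Obj} (G : (K.hom B C).Ob),
    (map A C).comp (K.post G) = (L.post ((map B C).ob G)).comp (map A B)
  map_pre : ∀ {A B C : K.Obj} (F : (K.hom A B).Ob),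
    (map A C).comp (K.pre F) = (L.pre ((map A B).ob F)).comp (map B C)
  map_ix : ∀ {A B C : K.Obj} (g : (K.hom B C).One) (f : (K.hom A B).One),
    (map A C).two (K.ix g f) = L.ix ((map B C).one g) ((map A B).one f)

/-- A Gray-natural transformation. -/
@[ext] structure GrayNat {K : GrayCat.{u, w}} {L : GrayCat.{v, w}} (F G : GrayFunctor K L) where
  app (A : K.Obj) : (L.hom (F.obj A) (G.obj A)).Ob
  naturality : ∀ A B : K.Obj,
    (L.post (app B)).comp (F.map A B) = (L.pre (app A)).comp (G.map A B)

namespace GrayNat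

variable {K : GrayCat.{u, w}} {L : GrayCat.{v, w}} {F G H : GrayFunctor K L}

/-- The identity Gray-natural transformation. -/
def id (F : GrayFunctor K L) : GrayNat F F where
  app A := L.one (F.obj A)
  naturality A B := by rw [L.post_id, L.pre_id]

/-- The composite Gray-natural transformation `β ∘ α`. -/
def comp (β : GrayNat G H) (α : GrayNat F G) : GrayNat F H where
  app A := β.app A ⋆ α.app A
  naturality A B := by
    rw [L.post_comp, L.pre_comp]
    have h1 := congrArg ((L.post (β.app B)).comp) (α.naturality A B)
    have h2 := congrArg ((L.pre (α.app A)).comp) (β.naturality A B)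
    have h3 := congrArg (fun M => M.comp (G.map A B)) (L.pre_post (β.app B) (α.app A))
    exact h1.trans (h3.symm.trans h2)

end GrayNat

/-- A Gray-modification `θ : α ⇛ β`: components `θ_A : α_A ⇒ β_A`, compatible with the 1-cells
and with the 2-cells of `K` (for a 2-cell `k`, the two interchange cells filling the square on
`θ` and `k` coincide). -/
structure GrayMod {K : GrayCat.{u, w}} {L : GrayCat.{v, w}} {F G : GrayFunctor K L}
    (α β : GrayNat F G) where
  app (A : K.Obj) : (L.hom (F.obj A) (G.obj A)).One
  src_app : ∀ A, (L.hom _ _).src (app A) = α.app A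
  tgt_app : ∀ A, (L.hom _ _).tgt (app A) = β.app A
  nat_one : ∀ {A B : K.Obj} (k : (K.hom A B).Ob),
    app B ⋆ᵣ (F.map A B).ob k = (G.map A B).ob k ⋆ₗ app A
  nat_two : ∀ {A B : K.Obj} (k : (K.hom A B).One),
    L.ix (app B) ((F.map A B).one k) = TwoCat.inv (L.ix ((G.map A B).one k) (app A))

/-- A Gray-modification is invertible if it has a two-sided inverse Gray-modification. -/
def GrayMod.IsInvertible {K : GrayCat.{u, w}} {L : GrayCat.{v, w}} {F G : GrayFunctor K L}
    {α β : GrayNat F G} (θ : GrayMod α β) : Prop :=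
  ∃ θ' : GrayMod β α, ∀ A,
    θ'.app A ∘₁ θ.app A = (L.hom _ _).id (α.app A) ∧ θ.app A ∘₁ θ'.app A = (L.hom _ _).id (β.app A)

/-! ### Gray-functors `Kᵒᵖ → Gray` -/

/-- The data and the laws of a Gray-functor `Kᵒᵖ → Gray` written out in terms of `K`: a 2-category
`obj A` for every object, a 2-functor `ob k : obj A → obj A'` for every `k : A' → A`,
a pseudonatural transformation `one k` for every 2-cell `k` and a modification `two x` for every
3-cell `x`. -/
structure GrayPresheaf (K : GrayCat.{u, w}) where
  obj : K.Obj → TwoCat.{w}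
  ob {A A' : K.Obj} : (K.hom A' A).Ob → TwoFunctor (obj A) (obj A')
  one {A A' : K.Obj} : (K.hom A' A).One → PsNat (obj A) (obj A')
  two {A A' : K.Obj} : (K.hom A' A).Two → Modif (obj A) (obj A')
  src_one : ∀ {A A' : K.Obj} (k : (K.hom A' A).One), (one k).src = ob ((K.hom A' A).src k)
  tgt_one : ∀ {A A' : K.Obj} (k : (K.hom A' A).One), (one k).tgt = ob ((K.hom A' A).tgt k)
  src_two : ∀ {A A' : K.Obj} (x : (K.hom A' A).Two), (two x).src = one ((K.hom A' A).src₂ x)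
  tgt_two : ∀ {A A' : K.Obj} (x : (K.hom A' A).Two), (two x).tgt = one ((K.hom A' A).tgt₂ x)
  map_id : ∀ {A A' : K.Obj} (F : (K.hom A' A).Ob), one ((K.hom A' A).id F) = PsNat.id (ob F)
  map_comp : ∀ {A A' : K.Obj} (g f : (K.hom A' A).One), (K.hom A' A).tgt f = (K.hom A' A).src g →
    one (g ∘₁ f) = (one g).comp (one f)
  map_id₂ : ∀ {A A' : K.Obj} (f : (K.hom A' A).One), two ((K.hom A' A).id₂ f) = Modif.id (one f)
  map_vcomp : ∀ {A A' : K.Obj} (y x : (K.hom A' A).Two),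
    (K.hom A' A).tgt₂ x = (K.hom A' A).src₂ y → two (y ∘₂ x) = (two y).vcomp (two x)
  map_wl : ∀ {A A' : K.Obj} (g : (K.hom A' A).One) (x : (K.hom A' A).Two),
    (K.hom A' A).tgt ((K.hom A' A).tgt₂ x) = (K.hom A' A).src g →
    two (g ◁ x) = Modif.wl (one g) (two x)
  map_wr : ∀ {A A' : K.Obj} (x : (K.hom A' A).Two) (f : (K.hom A' A).One),
    (K.hom A' A).tgt f = (K.hom A' A).src ((K.hom A' A).tgt₂ x) →
    two (x ▷ f) = (two x).wr (one f)
  ob_one : ∀ A : K.Obj, ob (K.one A) = TwoFunctor.id (obj A)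
  ob_comp : ∀ {A A' A'' : K.Obj} (F : (K.hom A' A).Ob) (G : (K.hom A'' A').Ob),
    ob (F ⋆ G) = (ob G).comp (ob F)
  one_pre : ∀ {A A' A'' : K.Obj} (f : (K.hom A' A).One) (G : (K.hom A'' A').Ob),
    one (f ⋆ᵣ G) = PsNat.post (ob G) (one f)
  one_post : ∀ {A A' A'' : K.Obj} (F : (K.hom A' A).Ob) (g : (K.hom A'' A').One),
    one (F ⋆ₗ g) = PsNat.pre (ob F) (one g)
  two_pre : ∀ {A A' A'' : K.Obj} (x : (K.hom A' A).Two) (G : (K.hom A'' A').Ob),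
    two (x ⋆ᵣᵣ G) = Modif.post (ob G) (two x)
  two_post : ∀ {A A' A'' : K.Obj} (F : (K.hom A' A).Ob) (y : (K.hom A'' A').Two),
    two (F ⋆ₗₗ y) = Modif.pre (ob F) (two y)
  two_ix : ∀ {A A' A'' : K.Obj} (f : (K.hom A' A).One) (g : (K.hom A'' A').One),
    two (TwoCat.inv (K.ix f g)) = Modif.ix (one g) (one f)

/-- The Gray-functor `Kᵒᵖ → Gray` given by such data. -/
noncomputable def GrayPresheaf.toGrayFunctor {K : GrayCat.{u, w}} (P : GrayPresheaf K) :
    GrayFunctor K.op Gray.{w} where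
  obj := P.obj
  map A A' :=
    { ob := P.ob
      one := P.one
      two := P.two
      src_one := P.src_one
      tgt_one := P.tgt_one
      src_two := P.src_two
      tgt_two := P.tgt_two
      map_id := P.map_id
      map_comp := P.map_comp
      map_id₂ := P.map_id₂
      map_vcomp := P.map_vcomp
      map_wl := P.map_wl
      map_wr := P.map_wr }
  map_one := P.ob_one
  map_post {A A' A''} (G : (K.hom A'' A').Ob) := by
    refine TwoFunctor.ext (funext fun F => ?_) (funext fun f => P.one_pre f G)
      (funext fun x => P.two_pre x G)
    exact (congrArg P.ob (K.pre_ob G F)).trans (P.ob_comp F G)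
  map_pre {A A' A''} (F : (K.hom A' A).Ob) :=
    TwoFunctor.ext (funext fun G => P.ob_comp F G) (funext fun g => P.one_post F g)
      (funext fun y => P.two_post F y)
  map_ix g f := P.two_ix f g

/-- The pseudonatural transformation `K(k, B) : K(F, B) ⇒ K(F', B)` for `k : F ⇒ F'`. -/
@[simps] noncomputable def repPs {K : GrayCat.{u, w}} {A A' : K.Obj} (B : K.Obj)
    (k : (K.hom A' A).One) : PsNat (K.hom A B) (K.hom A' B) where
  src := K.pre ((K.hom A' A).src k)
  tgt := K.pre ((K.hom A' A).tgt k)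
  app s := s ⋆ₗ k
  nat h := TwoCat.inv (K.ix h k)
  src_app := by simp
  tgt_app := by simp
  src_nat := by simp
  tgt_nat := by simp
  nat_iso := by simp
  nat_id := by simp
  nat_comp g f h := by simp (maxDischargeDepth := 9) [h]
  nat_two x := by
    simpa using (TwoCat.inv_square (by simp) (by simp) (by simp) (by simp)
      (K.ix_two_left x k).symm)

/-- The modification `K(x, B) : K(k, B) ⇛ K(k', B)` for `x : k ⇛ k'`. -/
@[simps] noncomputable def repModif {K : GrayCat.{u, w}} {A A' : K.Obj} (B : K.Obj)
    (x : (K.hom A' A).Two) : Modif (K.hom A B) (K.hom A' B) where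
  src := repPs B ((K.hom A' A).src₂ x)
  tgt := repPs B ((K.hom A' A).tgt₂ x)
  src_eq := by simp
  tgt_eq := by simp
  app s := s ⋆ₗₗ x
  src_app := by simp
  tgt_app := by simp
  naturality h := by
    simpa using (TwoCat.inv_square (by simp) (by simp) (by simp) (by simp)
      (K.ix_two_right h x).symm)

/-- The representable Gray-functor `K(-, B) : Kᵒᵖ → Gray`. -/
noncomputable def repGray (K : GrayCat.{u, w}) (B : K.Obj) : GrayFunctor K.op Gray.{w} :=
  GrayPresheaf.toGrayFunctor
  { obj := fun A => K.hom A B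
    ob := fun F => K.pre F
    one := fun k => repPs B k
    two := fun x => repModif B x
    src_one := fun _ => rfl
    tgt_one := fun _ => rfl
    src_two := fun _ => rfl
    tgt_two := fun _ => rfl
    map_id := fun F => by
      apply PsNat.ext <;> (try funext a) <;> simp
    map_comp := fun g f h => by
      have e : (repPs B f).tgt = (repPs B g).src := by simp [h]
      apply PsNat.ext <;> (try funext a) <;> simp (maxDischargeDepth := 9) [e, h]
    map_id₂ := fun f => by
      apply Modif.ext <;> (try funext a) <;> simp
    map_vcomp := fun y x h => by
      have e : (repModif B x).tgt = (repModif B y).src := by simp [h]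
      apply Modif.ext <;> (try apply PsNat.ext) <;> (try funext a) <;>
        simp (maxDischargeDepth := 9) [e, h]
    map_wl := fun g x h => by
      have e : (repModif B x).tgt.tgt = (repPs B g).src := by simp [h]
      apply Modif.ext <;> (try apply PsNat.ext) <;> (try funext a) <;>
        simp (maxDischargeDepth := 9) [e, h]
    map_wr := fun x f h => by
      have e : (repPs B f).tgt = (repModif B x).tgt.src := by simp [h]
      apply Modif.ext <;> (try apply PsNat.ext) <;> (try funext a) <;>
        simp (maxDischargeDepth := 9) [e, h]
    ob_one := fun A => K.pre_id A B
    ob_comp := fun F G => K.pre_comp F G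
    one_pre := fun f G => by
      apply PsNat.ext <;> (try apply TwoFunctor.ext) <;> (try funext a) <;> simp [K.pre_comp]
    one_post := fun F g => by
      apply PsNat.ext <;> (try apply TwoFunctor.ext) <;> (try funext a) <;> simp [K.pre_comp]
    two_pre := fun x G => by
      apply Modif.ext <;> (try apply PsNat.ext) <;> (try apply TwoFunctor.ext) <;>
        (try funext a) <;> simp [K.pre_comp]
    two_post := fun F y => by
      apply Modif.ext <;> (try apply PsNat.ext) <;> (try apply TwoFunctor.ext) <;>
        (try funext a) <;> simp [K.pre_comp]
    two_ix := fun f g => by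
      apply Modif.ext <;> (try apply PsNat.ext) <;> (try funext a) <;>
        simp (maxDischargeDepth := 9) [K.pre_comp] }

/-! ### Pseudomonads, their pseudoalgebras, and the Gray-functor `T-Alg` -/

/-- A pseudomonad on an object `B` of a Gray-category. -/
structure Pseudomonad (K : GrayCat.{u, w}) (B : K.Obj) where
  T : (K.hom B B).Ob
  η : (K.hom B B).One
  μ : (K.hom B B).One
  lam : (K.hom B B).Two
  rho : (K.hom B B).Two
  alpha : (K.hom B B).Two
  src_η : (K.hom B B).src η = K.one B
  tgt_η : (K.hom B B).tgt η = T
  src_μ : (K.hom B B).src μ = T ⋆ T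
  tgt_μ : (K.hom B B).tgt μ = T
  src_lam : (K.hom B B).src₂ lam = μ ∘₁ η ⋆ᵣ T
  tgt_lam : (K.hom B B).tgt₂ lam = (K.hom B B).id T
  src_rho : (K.hom B B).src₂ rho = (K.hom B B).id T
  tgt_rho : (K.hom B B).tgt₂ rho = μ ∘₁ T ⋆ₗ η
  src_alpha : (K.hom B B).src₂ alpha = μ ∘₁ T ⋆ₗ μ
  tgt_alpha : (K.hom B B).tgt₂ alpha = μ ∘₁ μ ⋆ᵣ T
  lam_iso : TwoCat.IsIso lam
  rho_iso : TwoCat.IsIso rho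
  alpha_iso : TwoCat.IsIso alpha
  assoc : (μ ◁ (alpha ⋆ᵣᵣ T)) ∘₂ (alpha ▷ (T ⋆ₗ μ ⋆ᵣ T)) ∘₂ (μ ◁ (T ⋆ₗₗ alpha)) =
    (alpha ▷ (μ ⋆ᵣ T ⋆ᵣ T)) ∘₂ (μ ◁ TwoCat.inv (K.ix μ μ)) ∘₂ (alpha ▷ (T ⋆ₗ T ⋆ₗ μ))
  unit : alpha ▷ (T ⋆ₗ η ⋆ᵣ T) = (μ ◁ (rho ⋆ᵣᵣ T)) ∘₂ (μ ◁ (T ⋆ₗₗ lam))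

attribute [simp] Pseudomonad.src_η Pseudomonad.tgt_η Pseudomonad.src_μ Pseudomonad.tgt_μ
  Pseudomonad.src_lam Pseudomonad.tgt_lam Pseudomonad.src_rho Pseudomonad.tgt_rho
  Pseudomonad.src_alpha Pseudomonad.tgt_alpha Pseudomonad.lam_iso Pseudomonad.rho_iso
  Pseudomonad.alpha_iso

/-- A pseudoalgebra with domain `A` for a pseudomonad. -/
@[ext] structure Pseudoalgebra {K : GrayCat.{u, w}} {B : K.Obj} (T : Pseudomonad K B)
    (A : K.Obj) where
  s : (K.hom A B).Ob
  ν : (K.hom A B).One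
  ψ : (K.hom A B).Two
  χ : (K.hom A B).Two
  src_ν : (K.hom A B).src ν = T.T ⋆ s
  tgt_ν : (K.hom A B).tgt ν = s
  src_ψ : (K.hom A B).src₂ ψ = ν ∘₁ T.η ⋆ᵣ s
  tgt_ψ : (K.hom A B).tgt₂ ψ = (K.hom A B).id s
  src_χ : (K.hom A B).src₂ χ = ν ∘₁ T.T ⋆ₗ ν
  tgt_χ : (K.hom A B).tgt₂ χ = ν ∘₁ T.μ ⋆ᵣ s
  ψ_iso : TwoCat.IsIso ψ
  χ_iso : TwoCat.IsIso χ
  assoc : (ν ◁ (T.alpha ⋆ᵣᵣ s)) ∘₂ (χ ▷ (T.T ⋆ₗ T.μ ⋆ᵣ s)) ∘₂ (ν ◁ (T.T ⋆ₗₗ χ)) =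
    (χ ▷ (T.μ ⋆ᵣ T.T ⋆ᵣ s)) ∘₂ (ν ◁ TwoCat.inv (K.ix T.μ ν)) ∘₂ (χ ▷ (T.T ⋆ₗ T.T ⋆ₗ ν))
  unit : χ ▷ (T.T ⋆ₗ T.η ⋆ᵣ s) = (ν ◁ (T.rho ⋆ᵣᵣ s)) ∘₂ (ν ◁ (T.T ⋆ₗₗ ψ))

attribute [simp] Pseudoalgebra.src_ν Pseudoalgebra.tgt_ν Pseudoalgebra.src_ψ Pseudoalgebra.tgt_ψ
  Pseudoalgebra.src_χ Pseudoalgebra.tgt_χ Pseudoalgebra.ψ_iso Pseudoalgebra.χ_iso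

/-- A (pseudo-)morphism of pseudoalgebras with domain `A`. -/
@[ext] structure PseudoalgHom {K : GrayCat.{u, w}} {B : K.Obj} (T : Pseudomonad K B) (A : K.Obj) where
  src : Pseudoalgebra T A
  tgt : Pseudoalgebra T A
  h : (K.hom A B).One
  ϱ : (K.hom A B).Two
  src_h : (K.hom A B).src h = src.s
  tgt_h : (K.hom A B).tgt h = tgt.s
  src_ϱ : (K.hom A B).src₂ ϱ = tgt.ν ∘₁ T.T ⋆ₗ h
  tgt_ϱ : (K.hom A B).tgt₂ ϱ = h ∘₁ src.ν
  ϱ_iso : TwoCat.IsIso ϱ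
  unit : (h ◁ src.ψ) ∘₂ (ϱ ▷ (T.η ⋆ᵣ src.s)) = (tgt.ψ ▷ h) ∘₂ (tgt.ν ◁ K.ix T.η h)
  mult : (h ◁ src.χ) ∘₂ (ϱ ▷ (T.T ⋆ₗ src.ν)) ∘₂ (tgt.ν ◁ (T.T ⋆ₗₗ ϱ)) =
    (ϱ ▷ (T.μ ⋆ᵣ src.s)) ∘₂ (tgt.ν ◁ TwoCat.inv (K.ix T.μ h)) ∘₂ (tgt.χ ▷ (T.T ⋆ₗ T.T ⋆ₗ h))

attribute [simp] PseudoalgHom.src_h PseudoalgHom.tgt_h PseudoalgHom.src_ϱ PseudoalgHom.tgt_ϱ PseudoalgHom.ϱ_iso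

/-- A 2-cell of pseudoalgebras with domain `A`. -/
@[ext] structure PseudoalgTwo {K : GrayCat.{u, w}} {B : K.Obj} (T : Pseudomonad K B) (A : K.Obj) where
  src : PseudoalgHom T A
  tgt : PseudoalgHom T A
  src_eq : src.src = tgt.src
  tgt_eq : src.tgt = tgt.tgt
  ξ : (K.hom A B).Two
  src_ξ : (K.hom A B).src₂ ξ = src.h
  tgt_ξ : (K.hom A B).tgt₂ ξ = tgt.h
  comm : tgt.ϱ ∘₂ (tgt.tgt.ν ◁ (T.T ⋆ₗₗ ξ)) = (ξ ▷ tgt.src.ν) ∘₂ src.ϱ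

attribute [simp] PseudoalgTwo.src_eq PseudoalgTwo.tgt_eq PseudoalgTwo.src_ξ PseudoalgTwo.tgt_ξ

namespace PseudoalgHom

variable {K : GrayCat.{u, w}} {B : K.Obj} {T : Pseudomonad K B} {A : K.Obj}

/-- The identity morphism of a pseudoalgebra. -/
@[simps] def id (s : Pseudoalgebra T A) : PseudoalgHom T A where
  src := s
  tgt := s
  h := (K.hom A B).id s.s
  ϱ := (K.hom A B).id₂ s.ν
  src_h := by simp
  tgt_h := by simp
  src_ϱ := by simp
  tgt_ϱ := by simp
  ϱ_iso := by simp
  unit := by simp (maxDischargeDepth := 9)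
  mult := by simp (maxDischargeDepth := 9)

/-- The composite of composable morphisms of pseudoalgebras. -/
def comp' (g f : PseudoalgHom T A) (e : f.tgt = g.src) : PseudoalgHom T A where
  src := f.src
  tgt := g.tgt
  h := g.h ∘₁ f.h
  ϱ := (g.h ◁ f.ϱ) ∘₂ (g.ϱ ▷ (T.T ⋆ₗ f.h))
  src_h := by simp (maxDischargeDepth := 9) [e]
  tgt_h := by simp (maxDischargeDepth := 9) [e]
  src_ϱ := by simp (maxDischargeDepth := 9) [e]
  tgt_ϱ := by simp (maxDischargeDepth := 9) [e]
  ϱ_iso := by simp (maxDischargeDepth := 9) [e]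
  unit := by
    have h1 := congrArg ((K.hom A B).wl g.h) f.unit
    have h2 := congrArg (fun y => (K.hom A B).wr y f.h) g.unit
    have I := (K.hom A B).interchange g.ϱ (K.ix T.η f.h) (by simp (maxDischargeDepth := 9) [e])
    simp (maxDischargeDepth := 9) [e] at h1 h2 I
    have h1' := TwoCat.reassoc h1 (by simp (maxDischargeDepth := 9) [e])
      (by simp (maxDischargeDepth := 9) [e]) ((g.ϱ ▷ T.T ⋆ₗ f.h) ▷ T.η ⋆ᵣ f.src.s)
      (by simp (maxDischargeDepth := 9) [e])
    have h2' := TwoCat.reassoc h2 (by simp (maxDischargeDepth := 9) [e])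
      (by simp (maxDischargeDepth := 9) [e]) (g.tgt.ν ◁ T.T ⋆ₗ g.h ◁ K.ix T.η f.h)
      (by simp (maxDischargeDepth := 9) [e])
    simp (maxDischargeDepth := 9) [e, h1', h2', I]
  mult := by
    have h1 := congrArg ((K.hom A B).wl g.h) f.mult
    have h2 := congrArg (fun y => (K.hom A B).wr y (T.T ⋆ₗ T.T ⋆ₗ f.h)) g.mult
    have I := (K.hom A B).interchange g.ϱ (T.T ⋆ₗₗ f.ϱ) (by simp (maxDischargeDepth := 9) [e])
    have J := (K.hom A B).interchange g.ϱ (TwoCat.inv (K.ix T.μ f.h))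
      (by simp (maxDischargeDepth := 9) [e])
    simp (maxDischargeDepth := 9) [e] at h1 h2 I J
    have I' := TwoCat.reassoc I.symm (by simp (maxDischargeDepth := 9) [e])
      (by simp (maxDischargeDepth := 9) [e])
      (g.tgt.ν ◁ (T.T ⋆ₗₗ g.ϱ) ▷ (T.T ⋆ₗ T.T ⋆ₗ f.h)) (by simp (maxDischargeDepth := 9) [e])
    have h1' := TwoCat.reassoc3 h1 (by simp (maxDischargeDepth := 9) [e])
      (by simp (maxDischargeDepth := 9) [e]) (by simp (maxDischargeDepth := 9) [e])
      (by simp (maxDischargeDepth := 9) [e]) 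
      (((g.ϱ ▷ (T.T ⋆ₗ g.src.ν)) ▷ (T.T ⋆ₗ T.T ⋆ₗ f.h)) ∘₂
        (g.tgt.ν ◁ (T.T ⋆ₗₗ g.ϱ) ▷ (T.T ⋆ₗ T.T ⋆ₗ f.h)))
      (by simp (maxDischargeDepth := 9) [e])
    have J' := TwoCat.reassoc J (by simp (maxDischargeDepth := 9) [e])
      (by simp (maxDischargeDepth := 9) [e])
      ((g.tgt.ν ◁ TwoCat.inv (K.ix T.μ g.h) ▷ (T.T ⋆ₗ T.T ⋆ₗ f.h)) ∘₂
        ((g.tgt.χ ▷ (T.T ⋆ₗ T.T ⋆ₗ g.h)) ▷ (T.T ⋆ₗ T.T ⋆ₗ f.h)))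
      (by simp (maxDischargeDepth := 9) [e])
    simp (maxDischargeDepth := 9) [e]
    rw [I', h1', h2, J']

open Classical in
/-- Composition of morphisms of pseudoalgebras. -/
noncomputable def comp (g f : PseudoalgHom T A) : PseudoalgHom T A :=
  if e : f.tgt = g.src then comp' g f e else f

@[simp] theorem src_comp {g f : PseudoalgHom T A} (e : f.tgt = g.src) :
    (comp g f).src = f.src := by rw [comp, dif_pos e]; rfl
@[simp] theorem tgt_comp {g f : PseudoalgHom T A} (e : f.tgt = g.src) :
    (comp g f).tgt = g.tgt := by rw [comp, dif_pos e]; rfl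
@[simp] theorem comp_h {g f : PseudoalgHom T A} (e : f.tgt = g.src) :
    (comp g f).h = g.h ∘₁ f.h := by rw [comp, dif_pos e]; rfl
@[simp] theorem comp_ϱ {g f : PseudoalgHom T A} (e : f.tgt = g.src) :
    (comp g f).ϱ = (g.h ◁ f.ϱ) ∘₂ (g.ϱ ▷ (T.T ⋆ₗ f.h)) := by rw [comp, dif_pos e]; rfl

end PseudoalgHom

namespace PseudoalgTwo

variable {K : GrayCat.{u, w}} {B : K.Obj} {T : Pseudomonad K B} {A : K.Obj}

/-- The identity 2-cell of a morphism of pseudoalgebras. -/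
@[simps] def id (f : PseudoalgHom T A) : PseudoalgTwo T A where
  src := f
  tgt := f
  src_eq := rfl
  tgt_eq := rfl
  ξ := (K.hom A B).id₂ f.h
  src_ξ := by simp
  tgt_ξ := by simp
  comm := by simp (maxDischargeDepth := 9)

/-- The vertical composite of composable 2-cells of pseudoalgebras. -/
def vcomp' (y x : PseudoalgTwo T A) (e : x.tgt = y.src) : PseudoalgTwo T A where
  src := x.src
  tgt := y.tgt
  src_eq := by simp (maxDischargeDepth := 9) [e]
  tgt_eq := by simp (maxDischargeDepth := 9) [e]
  ξ := y.ξ ∘₂ x.ξ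
  src_ξ := by simp (maxDischargeDepth := 9) [e]
  tgt_ξ := by simp (maxDischargeDepth := 9) [e]
  comm := by
    have h1 := y.comm
    have h2 := x.comm
    simp (maxDischargeDepth := 9) [e] at h1 h2
    have h1' := TwoCat.reassoc h1 (by simp (maxDischargeDepth := 9) [e])
      (by simp (maxDischargeDepth := 9) [e]) (y.tgt.tgt.ν ◁ (T.T ⋆ₗₗ x.ξ))
      (by simp (maxDischargeDepth := 9) [e])
    simp (maxDischargeDepth := 9) [e, h1', h2]

open Classical in
/-- Vertical composition of 2-cells of pseudoalgebras. -/
noncomputable def vcomp (y x : PseudoalgTwo T A) : PseudoalgTwo T A :=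
  if e : x.tgt = y.src then vcomp' y x e else x

/-- Whiskering of a 2-cell by a morphism of pseudoalgebras (if composable). -/
noncomputable def wl' (g : PseudoalgHom T A) (x : PseudoalgTwo T A) (e : x.tgt.tgt = g.src) :
    PseudoalgTwo T A where
  src := g.comp x.src
  tgt := g.comp x.tgt
  src_eq := by simp (maxDischargeDepth := 9) [e]
  tgt_eq := by simp (maxDischargeDepth := 9) [e]
  ξ := g.h ◁ x.ξ
  src_ξ := by simp (maxDischargeDepth := 9) [e]
  tgt_ξ := by simp (maxDischargeDepth := 9) [e]
  comm := by
    have h1 := congrArg ((K.hom A B).wl g.h) x.comm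
    have I := (K.hom A B).interchange g.ϱ (T.T ⋆ₗₗ x.ξ) (by simp (maxDischargeDepth := 9) [e])
    simp (maxDischargeDepth := 9) [e] at h1 I
    have h1' := TwoCat.reassoc h1 (by simp (maxDischargeDepth := 9) [e])
      (by simp (maxDischargeDepth := 9) [e]) (g.ϱ ▷ (T.T ⋆ₗ x.src.h))
      (by simp (maxDischargeDepth := 9) [e])
    simp (maxDischargeDepth := 9) [e, ← I, h1']

open Classical in
/-- Whiskering of a 2-cell by a morphism of pseudoalgebras. -/
noncomputable def wl (g : PseudoalgHom T A) (x : PseudoalgTwo T A) : PseudoalgTwo T A :=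
  if e : x.tgt.tgt = g.src then wl' g x e else x

/-- Whiskering of a 2-cell by a morphism of pseudoalgebras (if composable). -/
noncomputable def wr' (x : PseudoalgTwo T A) (f : PseudoalgHom T A) (e : f.tgt = x.tgt.src) :
    PseudoalgTwo T A where
  src := x.src.comp f
  tgt := x.tgt.comp f
  src_eq := by simp (maxDischargeDepth := 9) [e]
  tgt_eq := by simp (maxDischargeDepth := 9) [e]
  ξ := x.ξ ▷ f.h
  src_ξ := by simp (maxDischargeDepth := 9) [e]
  tgt_ξ := by simp (maxDischargeDepth := 9) [e]
  comm := by
    have h1 := congrArg (fun y => (K.hom A B).wr y (T.T ⋆ₗ f.h)) x.comm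
    have I := (K.hom A B).interchange x.ξ f.ϱ (by simp (maxDischargeDepth := 9) [e])
    simp (maxDischargeDepth := 9) [e] at h1 I
    have I' := TwoCat.reassoc I (by simp (maxDischargeDepth := 9) [e])
      (by simp (maxDischargeDepth := 9) [e]) (x.src.ϱ ▷ (T.T ⋆ₗ f.h))
      (by simp (maxDischargeDepth := 9) [e])
    simp (maxDischargeDepth := 9) [e, h1, I']

open Classical in
/-- Whiskering of a 2-cell by a morphism of pseudoalgebras. -/
noncomputable def wr (x : PseudoalgTwo T A) (f : PseudoalgHom T A) : PseudoalgTwo T A :=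
  if e : f.tgt = x.tgt.src then wr' x f e else x

@[simp] theorem src_vcomp {y x : PseudoalgTwo T A} (e : x.tgt = y.src) :
    (vcomp y x).src = x.src := by rw [vcomp, dif_pos e]; rfl
@[simp] theorem tgt_vcomp {y x : PseudoalgTwo T A} (e : x.tgt = y.src) :
    (vcomp y x).tgt = y.tgt := by rw [vcomp, dif_pos e]; rfl
@[simp] theorem vcomp_ξ {y x : PseudoalgTwo T A} (e : x.tgt = y.src) :
    (vcomp y x).ξ = y.ξ ∘₂ x.ξ := by rw [vcomp, dif_pos e]; rfl
@[simp] theorem src_wl {g : PseudoalgHom T A} {x : PseudoalgTwo T A} (e : x.tgt.tgt = g.src) :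
    (wl g x).src = g.comp x.src := by rw [wl, dif_pos e]; rfl
@[simp] theorem tgt_wl {g : PseudoalgHom T A} {x : PseudoalgTwo T A} (e : x.tgt.tgt = g.src) :
    (wl g x).tgt = g.comp x.tgt := by rw [wl, dif_pos e]; rfl
@[simp] theorem wl_ξ {g : PseudoalgHom T A} {x : PseudoalgTwo T A} (e : x.tgt.tgt = g.src) :
    (wl g x).ξ = g.h ◁ x.ξ := by rw [wl, dif_pos e]; rfl
@[simp] theorem src_wr {x : PseudoalgTwo T A} {f : PseudoalgHom T A} (e : f.tgt = x.tgt.src) :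
    (wr x f).src = x.src.comp f := by rw [wr, dif_pos e]; rfl
@[simp] theorem tgt_wr {x : PseudoalgTwo T A} {f : PseudoalgHom T A} (e : f.tgt = x.tgt.src) :
    (wr x f).tgt = x.tgt.comp f := by rw [wr, dif_pos e]; rfl
@[simp] theorem wr_ξ {x : PseudoalgTwo T A} {f : PseudoalgHom T A} (e : f.tgt = x.tgt.src) :
    (wr x f).ξ = x.ξ ▷ f.h := by rw [wr, dif_pos e]; rfl

end PseudoalgTwo

/-- The 2-category of pseudoalgebras with domain `A` for a pseudomonad. -/
noncomputable def algTwoCat {K : GrayCat.{u, w}} {B : K.Obj} (T : Pseudomonad K B) (A : K.Obj) :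
    TwoCat.{w} where
  Ob := Pseudoalgebra T A
  One := PseudoalgHom T A
  Two := PseudoalgTwo T A
  src := PseudoalgHom.src
  tgt := PseudoalgHom.tgt
  src₂ := PseudoalgTwo.src
  tgt₂ := PseudoalgTwo.tgt
  id := PseudoalgHom.id
  comp := PseudoalgHom.comp
  id₂ := PseudoalgTwo.id
  vcomp := PseudoalgTwo.vcomp
  wl := PseudoalgTwo.wl
  wr := PseudoalgTwo.wr
  src_src₂ x := by simp
  tgt_src₂ x := by simp
  src_id _ := rfl
  tgt_id _ := rfl
  src_comp g f e := by simp (maxDischargeDepth := 9) [e]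
  tgt_comp g f e := by simp (maxDischargeDepth := 9) [e]
  comp_id f := by ext <;> simp (maxDischargeDepth := 9)
  id_comp f := by ext <;> simp (maxDischargeDepth := 9)
  comp_assoc h g f e k := by ext <;> simp (maxDischargeDepth := 9) [e, k]
  src_id₂ _ := rfl
  tgt_id₂ _ := rfl
  src_vcomp y x e := by simp (maxDischargeDepth := 9) [e]
  tgt_vcomp y x e := by simp (maxDischargeDepth := 9) [e]
  vcomp_id x := by ext <;> simp (maxDischargeDepth := 9)
  id_vcomp x := by ext <;> simp (maxDischargeDepth := 9)
  vcomp_assoc z y x e k := by ext <;> simp (maxDischargeDepth := 9) [e, k]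
  src_wl g x e := by simp (maxDischargeDepth := 9) [e]
  tgt_wl g x e := by simp (maxDischargeDepth := 9) [e]
  wl_id₂ g f e := by ext <;> simp (maxDischargeDepth := 9) [e]
  wl_vcomp g y x e k := by ext <;> simp (maxDischargeDepth := 9) [e, k]
  id_wl x := by ext <;> simp (maxDischargeDepth := 9)
  comp_wl h g x e k := by ext <;> simp (maxDischargeDepth := 9) [e, k]
  src_wr x f e := by simp (maxDischargeDepth := 9) [e]
  tgt_wr x f e := by simp (maxDischargeDepth := 9) [e]
  id₂_wr g f e := by ext <;> simp (maxDischargeDepth := 9) [e]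
  vcomp_wr y x f e k := by ext <;> simp (maxDischargeDepth := 9) [e, k]
  wr_id x := by ext <;> simp (maxDischargeDepth := 9)
  wr_comp x g f e k := by ext <;> simp (maxDischargeDepth := 9) [e, k]
  wl_wr h x f e k := by ext <;> simp (maxDischargeDepth := 9) [e, k]
  interchange y x e := by
    ext
    all_goals try simp (maxDischargeDepth := 9) [e]
    simpa using (K.hom A B).interchange y.ξ x.ξ (by simp [e])

section AlgBase

variable {K : GrayCat.{u, w}} {B : K.Obj} {T : Pseudomonad K B} {A A' A'' : K.Obj}

/-- Change of domain of a pseudoalgebra along `k : A' → A`. -/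
@[simps] def Pseudoalgebra.base (k : (K.hom A' A).Ob) (s : Pseudoalgebra T A) :
    Pseudoalgebra T A' where
  s := s.s ⋆ k
  ν := s.ν ⋆ᵣ k
  ψ := s.ψ ⋆ᵣᵣ k
  χ := s.χ ⋆ᵣᵣ k
  src_ν := by simp
  tgt_ν := by simp
  src_ψ := by simp
  tgt_ψ := by simp
  src_χ := by simp
  tgt_χ := by simp
  ψ_iso := by simp
  χ_iso := by simp
  assoc := by
    have := congrArg (K.pre k).two s.assoc
    simpa (maxDischargeDepth := 9) using this
  unit := by
    have := congrArg (K.pre k).two s.unit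
    simpa (maxDischargeDepth := 9) using this

/-- Change of domain of a morphism of pseudoalgebras. -/
@[simps] def PseudoalgHom.base (k : (K.hom A' A).Ob) (f : PseudoalgHom T A) :
    PseudoalgHom T A' where
  src := f.src.base k
  tgt := f.tgt.base k
  h := f.h ⋆ᵣ k
  ϱ := f.ϱ ⋆ᵣᵣ k
  src_h := by simp
  tgt_h := by simp
  src_ϱ := by simp
  tgt_ϱ := by simp
  ϱ_iso := by simp
  unit := by
    have := congrArg (K.pre k).two f.unit
    simpa (maxDischargeDepth := 9) using this
  mult := by
    have := congrArg (K.pre k).two f.mult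
    simpa (maxDischargeDepth := 9) using this

/-- Change of domain of a 2-cell of pseudoalgebras. -/
@[simps] def PseudoalgTwo.base (k : (K.hom A' A).Ob) (x : PseudoalgTwo T A) :
    PseudoalgTwo T A' where
  src := x.src.base k
  tgt := x.tgt.base k
  src_eq := by simp
  tgt_eq := by simp
  ξ := x.ξ ⋆ᵣᵣ k
  src_ξ := by simp
  tgt_ξ := by simp
  comm := by
    have := congrArg (K.pre k).two x.comm
    simpa (maxDischargeDepth := 9) using this

/-- Change of domain along `k : A' → A`, as a 2-functor. -/
@[simps] noncomputable def algBase (T : Pseudomonad K B) (k : (K.hom A' A).Ob) :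
    TwoFunctor (algTwoCat T A) (algTwoCat T A') where
  ob s := s.base k
  one f := f.base k
  two x := x.base k
  src_one _ := rfl
  tgt_one _ := rfl
  src_two _ := rfl
  tgt_two _ := rfl
  map_id (s : Pseudoalgebra T A) := by
    change (PseudoalgHom.id s).base k = PseudoalgHom.id (s.base k)
    apply PseudoalgHom.ext <;> simp
  map_comp (g f : PseudoalgHom T A) (h : f.tgt = g.src) := by
    change (g.comp f).base k = (g.base k).comp (f.base k)
    apply PseudoalgHom.ext <;> simp (maxDischargeDepth := 9) [h]
  map_id₂ (f : PseudoalgHom T A) := by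
    change (PseudoalgTwo.id f).base k = PseudoalgTwo.id (f.base k)
    apply PseudoalgTwo.ext <;> simp
  map_vcomp (y x : PseudoalgTwo T A) (h : x.tgt = y.src) := by
    change (y.vcomp x).base k = (y.base k).vcomp (x.base k)
    apply PseudoalgTwo.ext <;> simp (maxDischargeDepth := 9) [h]
  map_wl (g : PseudoalgHom T A) (x : PseudoalgTwo T A) (h : x.tgt.tgt = g.src) := by
    change (PseudoalgTwo.wl g x).base k = PseudoalgTwo.wl (g.base k) (x.base k)
    apply PseudoalgTwo.ext <;> (try apply PseudoalgHom.ext) <;>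
      simp (maxDischargeDepth := 9) [h]
  map_wr (x : PseudoalgTwo T A) (f : PseudoalgHom T A) (h : f.tgt = x.tgt.src) := by
    change (x.wr f).base k = (x.base k).wr (f.base k)
    apply PseudoalgTwo.ext <;> (try apply PseudoalgHom.ext) <;>
      simp (maxDischargeDepth := 9) [h]

/-- The component at a pseudoalgebra of the pseudonatural transformation induced by a 2-cell
`k : F ⇒ F'` between domains. -/
@[simps] noncomputable def Pseudoalgebra.whisk (s : Pseudoalgebra T A) (k : (K.hom A' A).One) :
    PseudoalgHom T A' where
  src := s.base ((K.hom A' A).src k)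
  tgt := s.base ((K.hom A' A).tgt k)
  h := s.s ⋆ₗ k
  ϱ := TwoCat.inv (K.ix s.ν k)
  src_h := by simp
  tgt_h := by simp
  src_ϱ := by simp
  tgt_ϱ := by simp
  ϱ_iso := by simp
  unit := by
    have h1 := K.ix_two_left s.ψ k
    simp (maxDischargeDepth := 9) at h1
    have h2 := TwoCat.vcomp_inv (TwoCat.isIso_wr (K.ix_iso s.ν k) (T.η ⋆ᵣ s.s ⋆ᵣ (K.hom A' A).src k)
      (by simp (maxDischargeDepth := 9)))
    simp (maxDischargeDepth := 9) at h2
    simp (maxDischargeDepth := 9) [h1, h2]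
  mult := by
    have h1 := K.ix_two_left s.χ k
    have h2 := TwoCat.inv_square (by simp (maxDischargeDepth := 9))
      (by simp (maxDischargeDepth := 9)) (by simp (maxDischargeDepth := 9))
      (by simp (maxDischargeDepth := 9)) h1.symm
    simp (maxDischargeDepth := 9) at h2
    simp (maxDischargeDepth := 9) [h2]

/-- The structure cell at a morphism of pseudoalgebras of the pseudonatural transformation induced
by a 2-cell `k : F ⇒ F'` between domains. -/
noncomputable def PseudoalgHom.whisk (f : PseudoalgHom T A) (k : (K.hom A' A).One) :
    PseudoalgTwo T A' where
  src := (f.base ((K.hom A' A).tgt k)).comp (f.src.whisk k)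
  tgt := (f.tgt.whisk k).comp (f.base ((K.hom A' A).src k))
  src_eq := by simp
  tgt_eq := by simp
  ξ := TwoCat.inv (K.ix f.h k)
  src_ξ := by simp
  tgt_ξ := by simp
  comm := by
    have h1 := K.ix_two_left f.ϱ k
    have h2 := TwoCat.inv_square (by simp (maxDischargeDepth := 9))
      (by simp (maxDischargeDepth := 9)) (by simp (maxDischargeDepth := 9))
      (by simp (maxDischargeDepth := 9)) h1.symm
    simp (maxDischargeDepth := 9) at h2
    simp (maxDischargeDepth := 9) [h2]

@[simp] theorem PseudoalgHom.src_whisk (f : PseudoalgHom T A) (k : (K.hom A' A).One) :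
    (f.whisk k).src = (f.base ((K.hom A' A).tgt k)).comp (f.src.whisk k) := rfl
@[simp] theorem PseudoalgHom.tgt_whisk (f : PseudoalgHom T A) (k : (K.hom A' A).One) :
    (f.whisk k).tgt = (f.tgt.whisk k).comp (f.base ((K.hom A' A).src k)) := rfl
@[simp] theorem PseudoalgHom.whisk_ξ (f : PseudoalgHom T A) (k : (K.hom A' A).One) :
    (f.whisk k).ξ = TwoCat.inv (K.ix f.h k) := rfl

/-- The component at a pseudoalgebra of the modification induced by a 3-cell between domains. -/
@[simps] noncomputable def Pseudoalgebra.whisk₂ (s : Pseudoalgebra T A) (x : (K.hom A' A).Two) :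
    PseudoalgTwo T A' where
  src := s.whisk ((K.hom A' A).src₂ x)
  tgt := s.whisk ((K.hom A' A).tgt₂ x)
  src_eq := by simp
  tgt_eq := by simp
  ξ := s.s ⋆ₗₗ x
  src_ξ := by simp
  tgt_ξ := by simp
  comm := by
    have h := TwoCat.inv_square (by simp) (by simp) (by simp) (by simp)
      (K.ix_two_right s.ν x).symm
    simp at h
    simp [h]

/-- A 2-cell of pseudoalgebras is invertible if its underlying 2-cell is. -/
theorem PseudoalgTwo.isIso {x : PseudoalgTwo T A} (h : TwoCat.IsIso x.ξ) :
    TwoCat.IsIso (X := algTwoCat T A) x := by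
  refine ⟨(⟨x.tgt, x.src, x.src_eq.symm, x.tgt_eq.symm, TwoCat.inv x.ξ, by simp [h], by simp [h],
    ?_⟩ : PseudoalgTwo T A), rfl, rfl, ?_, ?_⟩
  · have := TwoCat.inv_square (by simp (maxDischargeDepth := 9) [h])
      (by simp (maxDischargeDepth := 9) [h]) (by simp (maxDischargeDepth := 9) [h])
      (by simp (maxDischargeDepth := 9) [h]) x.comm
    simpa (maxDischargeDepth := 9) [h] using this.symm
  · exact PseudoalgTwo.ext (by simp [algTwoCat]) (by simp [algTwoCat]) (by simp [algTwoCat, h])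
  · exact PseudoalgTwo.ext (by simp [algTwoCat]) (by simp [algTwoCat]) (by simp [algTwoCat, h])

/-- The pseudonatural transformation induced by a 2-cell between domains. -/
@[simps] noncomputable def algPs (T : Pseudomonad K B) (k : (K.hom A' A).One) :
    PsNat (algTwoCat T A) (algTwoCat T A') where
  src := algBase T ((K.hom A' A).src k)
  tgt := algBase T ((K.hom A' A).tgt k)
  app s := s.whisk k
  nat f := f.whisk k
  src_app _ := rfl
  tgt_app _ := rfl
  src_nat _ := rfl
  tgt_nat _ := rfl
  nat_iso (f : PseudoalgHom T A) := PseudoalgTwo.isIso (by simp)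
  nat_id (s : Pseudoalgebra T A) := by
    change (PseudoalgHom.id s).whisk k = PseudoalgTwo.id (s.whisk k)
    apply PseudoalgTwo.ext <;> (try apply PseudoalgHom.ext) <;> simp (maxDischargeDepth := 9)
  nat_comp (g f : PseudoalgHom T A) (h : f.tgt = g.src) := by
    change (g.comp f).whisk k =
      ((g.whisk k).wr (f.base ((K.hom A' A).src k))).vcomp
        (PseudoalgTwo.wl (g.base ((K.hom A' A).tgt k)) (f.whisk k))
    have e : (PseudoalgTwo.wl (g.base ((K.hom A' A).tgt k)) (f.whisk k)).tgt =
        ((g.whisk k).wr (f.base ((K.hom A' A).src k))).src := by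
      apply PseudoalgHom.ext <;> simp (maxDischargeDepth := 9) [h]
    apply PseudoalgTwo.ext <;> (try apply PseudoalgHom.ext) <;>
      simp (maxDischargeDepth := 9) [h, PseudoalgTwo.src_vcomp e, PseudoalgTwo.tgt_vcomp e,
        PseudoalgTwo.vcomp_ξ e]
  nat_two (x : PseudoalgTwo T A) := by
    change (x.tgt.whisk k).vcomp ((x.base ((K.hom A' A).tgt k)).wr (x.tgt.src.whisk k)) =
      (PseudoalgTwo.wl (x.tgt.tgt.whisk k) (x.base ((K.hom A' A).src k))).vcomp (x.src.whisk k)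
    have h := TwoCat.inv_square (by simp) (by simp) (by simp) (by simp) (K.ix_two_left x.ξ k).symm
    simp at h
    have e₁ : ((x.base ((K.hom A' A).tgt k)).wr (x.tgt.src.whisk k)).tgt =
        (x.tgt.whisk k).src := by simp
    have e₂ : (x.src.whisk k).tgt =
        (PseudoalgTwo.wl (x.tgt.tgt.whisk k) (x.base ((K.hom A' A).src k))).src := by simp
    apply PseudoalgTwo.ext <;> (try apply PseudoalgHom.ext) <;>
      simp (maxDischargeDepth := 9) [h, PseudoalgTwo.src_vcomp e₁, PseudoalgTwo.tgt_vcomp e₁,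
        PseudoalgTwo.vcomp_ξ e₁, PseudoalgTwo.src_vcomp e₂, PseudoalgTwo.tgt_vcomp e₂,
        PseudoalgTwo.vcomp_ξ e₂]

/-- The modification induced by a 3-cell between domains. -/
@[simps] noncomputable def algModif (T : Pseudomonad K B) (x : (K.hom A' A).Two) :
    Modif (algTwoCat T A) (algTwoCat T A') where
  src := algPs T ((K.hom A' A).src₂ x)
  tgt := algPs T ((K.hom A' A).tgt₂ x)
  src_eq := by simp
  tgt_eq := by simp
  app s := s.whisk₂ x
  src_app _ := rfl
  tgt_app _ := rfl
  naturality (f : PseudoalgHom T A) := by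
    change (f.whisk ((K.hom A' A).tgt₂ x)).vcomp
        (PseudoalgTwo.wl (f.base ((K.hom A' A).tgt ((K.hom A' A).tgt₂ x))) (f.src.whisk₂ x)) =
      ((f.tgt.whisk₂ x).wr (f.base ((K.hom A' A).src ((K.hom A' A).tgt₂ x)))).vcomp
        (f.whisk ((K.hom A' A).src₂ x))
    have h := TwoCat.inv_square (by simp) (by simp) (by simp) (by simp)
      (K.ix_two_right f.h x).symm
    simp at h
    have e₁ : (PseudoalgTwo.wl (f.base ((K.hom A' A).tgt ((K.hom A' A).tgt₂ x)))
        (f.src.whisk₂ x)).tgt = (f.whisk ((K.hom A' A).tgt₂ x)).src := by simp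
    have e₂ : (f.whisk ((K.hom A' A).src₂ x)).tgt =
        ((f.tgt.whisk₂ x).wr (f.base ((K.hom A' A).src ((K.hom A' A).tgt₂ x)))).src := by simp
    apply PseudoalgTwo.ext <;> (try apply PseudoalgHom.ext) <;>
      simp (maxDischargeDepth := 9) [h, PseudoalgTwo.src_vcomp e₁, PseudoalgTwo.tgt_vcomp e₁,
        PseudoalgTwo.vcomp_ξ e₁, PseudoalgTwo.src_vcomp e₂, PseudoalgTwo.tgt_vcomp e₂,
        PseudoalgTwo.vcomp_ξ e₂]

end AlgBase

theorem algPs_id {K : GrayCat.{u, w}} {A A' B : K.Obj} (T : Pseudomonad K B)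
    (F : (K.hom A' A).Ob) : algPs T ((K.hom A' A).id F) = PsNat.id (algBase T F) := by
  refine PsNat.ext (by simp) (by simp) (funext fun (s : Pseudoalgebra T _) => ?_)
    (funext fun (f : PseudoalgHom T _) => ?_)
  · change s.whisk _ = PseudoalgHom.id (s.base F)
    apply PseudoalgHom.ext <;> simp
  · change f.whisk _ = PseudoalgTwo.id (f.base F)
    apply PseudoalgTwo.ext <;> (try apply PseudoalgHom.ext) <;> simp (maxDischargeDepth := 9)

theorem algPs_comp {K : GrayCat.{u, w}} {A A' B : K.Obj} (T : Pseudomonad K B)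
    (g f : (K.hom A' A).One) (h : (K.hom A' A).tgt f = (K.hom A' A).src g) :
    algPs T (g ∘₁ f) = (algPs T g).comp (algPs T f) := by
  have e : (algPs T f).tgt = (algPs T g).src := by simp [h]
  refine PsNat.ext (by simp [e, h]) (by simp [e, h])
    ((funext fun (s : Pseudoalgebra T _) => ?_).trans (funext (PsNat.comp_app e)).symm)
    ((funext fun (k : PseudoalgHom T _) => ?_).trans (funext (PsNat.comp_nat e)).symm)
  · change s.whisk _ = (s.whisk g).comp (s.whisk f)
    apply PseudoalgHom.ext <;> simp (maxDischargeDepth := 9) [h]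
  · change k.whisk _ = (PseudoalgTwo.wl (k.tgt.whisk g) (k.whisk f)).vcomp
      ((k.whisk g).wr (k.src.whisk f))
    have e' : ((k.whisk g).wr (k.src.whisk f)).tgt =
        (PseudoalgTwo.wl (k.tgt.whisk g) (k.whisk f)).src := by
      apply PseudoalgHom.ext <;> simp (maxDischargeDepth := 9) [h]
    apply PseudoalgTwo.ext <;> (try apply PseudoalgHom.ext) <;>
      simp (maxDischargeDepth := 9) [h, PseudoalgTwo.src_vcomp e', PseudoalgTwo.tgt_vcomp e',
        PseudoalgTwo.vcomp_ξ e']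

theorem algBase_comp {K : GrayCat.{u, w}} {A A' A'' B : K.Obj} (T : Pseudomonad K B)
    (F : (K.hom A' A).Ob) (G : (K.hom A'' A').Ob) :
    algBase T (F ⋆ G) = (algBase T G).comp (algBase T F) := by
  refine TwoFunctor.ext (funext fun (s : Pseudoalgebra T _) => ?_)
    (funext fun (f : PseudoalgHom T _) => ?_) (funext fun (x : PseudoalgTwo T _) => ?_)
  · change s.base _ = (s.base F).base G
    apply Pseudoalgebra.ext <;> simp
  · change f.base _ = (f.base F).base G
    apply PseudoalgHom.ext <;> (try apply Pseudoalgebra.ext) <;> simp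
  · change x.base _ = (x.base F).base G
    apply PseudoalgTwo.ext <;> (try apply PseudoalgHom.ext) <;> (try apply Pseudoalgebra.ext) <;>
      simp

theorem algPs_pre {K : GrayCat.{u, w}} {A A' A'' B : K.Obj} (T : Pseudomonad K B)
    (f : (K.hom A' A).One) (G : (K.hom A'' A').Ob) :
    algPs T (f ⋆ᵣ G) = PsNat.post (algBase T G) (algPs T f) := by
  refine PsNat.ext (by simp [algBase_comp]) (by simp [algBase_comp])
    (funext fun (s : Pseudoalgebra T _) => ?_) (funext fun (k : PseudoalgHom T _) => ?_)
  · change s.whisk _ = (s.whisk f).base G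
    apply PseudoalgHom.ext <;> (try apply Pseudoalgebra.ext) <;> simp
  · change k.whisk _ = (k.whisk f).base G
    apply PseudoalgTwo.ext <;> (try apply PseudoalgHom.ext) <;> (try apply Pseudoalgebra.ext) <;>
      simp (maxDischargeDepth := 9)

theorem algPs_post {K : GrayCat.{u, w}} {A A' A'' B : K.Obj} (T : Pseudomonad K B)
    (F : (K.hom A' A).Ob) (g : (K.hom A'' A').One) :
    algPs T (F ⋆ₗ g) = PsNat.pre (algBase T F) (algPs T g) := by
  refine PsNat.ext (by simp [algBase_comp]) (by simp [algBase_comp])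
    (funext fun (s : Pseudoalgebra T _) => ?_) (funext fun (k : PseudoalgHom T _) => ?_)
  · change s.whisk _ = (s.base F).whisk g
    apply PseudoalgHom.ext <;> (try apply Pseudoalgebra.ext) <;> simp
  · change k.whisk _ = (k.base F).whisk g
    apply PseudoalgTwo.ext <;> (try apply PseudoalgHom.ext) <;> (try apply Pseudoalgebra.ext) <;>
      simp (maxDischargeDepth := 9)

/-- The Gray-functor `T-Alg : Kᵒᵖ → Gray` of pseudoalgebras, their morphisms and 2-cells. -/
noncomputable def algGray {K : GrayCat.{u, w}} {B : K.Obj} (T : Pseudomonad K B) :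
    GrayFunctor K.op Gray.{w} :=
  GrayPresheaf.toGrayFunctor
  { obj := fun A => algTwoCat T A
    ob := fun F => algBase T F
    one := fun k => algPs T k
    two := fun x => algModif T x
    src_one := fun _ => rfl
    tgt_one := fun _ => rfl
    src_two := fun _ => rfl
    tgt_two := fun _ => rfl
    map_id := fun F => algPs_id T F
    map_comp := fun g f h => algPs_comp T g f h
    map_id₂ := fun f => by
      refine Modif.ext (by simp) (by simp) (funext fun (s : Pseudoalgebra T _) => ?_)
      change s.whisk₂ _ = PseudoalgTwo.id (s.whisk f)
      apply PseudoalgTwo.ext <;> simp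
    map_vcomp := fun y x h => by
      have e : (algModif T x).tgt = (algModif T y).src := by simp [h]
      refine Modif.ext (by simp [e, h]) (by simp [e, h])
        ((funext fun (s : Pseudoalgebra T _) => ?_).trans (funext (Modif.vcomp_app e)).symm)
      change s.whisk₂ _ = (s.whisk₂ y).vcomp (s.whisk₂ x)
      apply PseudoalgTwo.ext <;> simp (maxDischargeDepth := 9) [h]
    map_wl := fun g x h => by
      have e : (algModif T x).tgt.tgt = (algPs T g).src := by simp [h]
      refine Modif.ext (by simp [e, h, algPs_comp]) (by simp [e, h, algPs_comp])
        ((funext fun (s : Pseudoalgebra T _) => ?_).trans (funext (Modif.wl_app e)).symm)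
      change s.whisk₂ _ = PseudoalgTwo.wl (s.whisk g) (s.whisk₂ x)
      apply PseudoalgTwo.ext <;> (try apply PseudoalgHom.ext) <;>
        simp (maxDischargeDepth := 9) [h]
    map_wr := fun x f h => by
      have e : (algPs T f).tgt = (algModif T x).tgt.src := by simp [h]
      refine Modif.ext (by simp [e, h, algPs_comp]) (by simp [e, h, algPs_comp])
        ((funext fun (s : Pseudoalgebra T _) => ?_).trans (funext (Modif.wr_app e)).symm)
      change s.whisk₂ _ = (s.whisk₂ x).wr (s.whisk f)
      apply PseudoalgTwo.ext <;> (try apply PseudoalgHom.ext) <;>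
        simp (maxDischargeDepth := 9) [h]
    ob_one := fun A => by
      refine TwoFunctor.ext (funext fun (s : Pseudoalgebra T _) => ?_)
        (funext fun (f : PseudoalgHom T _) => ?_) (funext fun (x : PseudoalgTwo T _) => ?_)
      · change s.base _ = s
        apply Pseudoalgebra.ext <;> simp
      · change f.base _ = f
        apply PseudoalgHom.ext <;> (try apply Pseudoalgebra.ext) <;> simp
      · change x.base _ = x
        apply PseudoalgTwo.ext <;> (try apply PseudoalgHom.ext) <;>
          (try apply Pseudoalgebra.ext) <;> simp
    ob_comp := fun F G => algBase_comp T F G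
    one_pre := fun f G => algPs_pre T f G
    one_post := fun F g => algPs_post T F g
    two_pre := fun x G => by
      refine Modif.ext (by simp [algPs_pre]) (by simp [algPs_pre])
        (funext fun (s : Pseudoalgebra T _) => ?_)
      change s.whisk₂ _ = (s.whisk₂ x).base G
      apply PseudoalgTwo.ext <;> (try apply PseudoalgHom.ext) <;>
        (try apply Pseudoalgebra.ext) <;> simp
    two_post := fun F y => by
      refine Modif.ext (by simp [algPs_post]) (by simp [algPs_post])
        (funext fun (s : Pseudoalgebra T _) => ?_)
      change s.whisk₂ _ = (s.base F).whisk₂ y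
      apply PseudoalgTwo.ext <;> (try apply PseudoalgHom.ext) <;>
        (try apply Pseudoalgebra.ext) <;> simp
    two_ix := fun f g => by
      refine Modif.ext ?_ ?_ (funext fun (s : Pseudoalgebra T _) => ?_)
      · simp (maxDischargeDepth := 9) [algPs_comp, algPs_pre, algPs_post]
      · simp (maxDischargeDepth := 9) [algPs_comp, algPs_pre, algPs_post]
      · change s.whisk₂ _ = (s.whisk f).whisk g
        apply PseudoalgTwo.ext <;> (try apply PseudoalgHom.ext) <;>
          (try apply Pseudoalgebra.ext) <;> simp (maxDischargeDepth := 9) }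

/-- The forgetful 2-functor from pseudoalgebras with domain `A` to `K(A, B)`. -/
@[simps] noncomputable def algForget {K : GrayCat.{u, w}} {B : K.Obj} (T : Pseudomonad K B)
    (A : K.Obj) : TwoFunctor (algTwoCat T A) (K.hom A B) where
  ob s := s.s
  one f := f.h
  two x := x.ξ
  src_one f := f.src_h
  tgt_one f := f.tgt_h
  src_two x := x.src_ξ
  tgt_two x := x.tgt_ξ
  map_id _ := rfl
  map_comp _ _ h := PseudoalgHom.comp_h h
  map_id₂ _ := rfl
  map_vcomp _ _ h := PseudoalgTwo.vcomp_ξ h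
  map_wl _ _ h := PseudoalgTwo.wl_ξ h
  map_wr _ _ h := PseudoalgTwo.wr_ξ h

/-- The forgetful Gray-natural transformation `U : T-Alg → K(-, B)`. -/
noncomputable def forget {K : GrayCat.{u, w}} {B : K.Obj} (T : Pseudomonad K B) :
    GrayNat (algGray T) (repGray K B) where
  app A := algForget T A
  naturality A A' := by
    have h : ∀ k : (K.hom A' A).Ob,
        (algForget T A').comp (algBase T k) = (K.pre k).comp (algForget T A) := fun k =>
      TwoFunctor.ext (funext fun s => (K.pre_ob k s.s).symm) rfl rfl
    have h' : ∀ k : (K.hom A' A).One, PsNat.post (algForget T A') (algPs T k) =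
        PsNat.pre (algForget T A) (repPs B k) := fun k =>
      PsNat.ext (h _) (h _) rfl rfl
    exact TwoFunctor.ext (funext h) (funext h') (funext fun x => Modif.ext (h' _) (h' _) rfl)

/-! ### Pseudocomonads, their pseudocoalgebras, and the Gray-functor `G-CoAlg` -/

/-- The data underlying a pseudocomonad: an endomorphism, a counit, a comultiplication, and three
3-cells. -/
@[ext] structure PseudocomonadData (K : GrayCat.{u, w}) (B : K.Obj) where
  G : (K.hom B B).Ob
  ε : (K.hom B B).One
  δ : (K.hom B B).One
  lam : (K.hom B B).Two
  rho : (K.hom B B).Two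
  alpha : (K.hom B B).Two

/-- A pseudocomonad on `B`: a pseudomonad with all 2-cells reversed. -/
structure Pseudocomonad (K : GrayCat.{u, w}) (B : K.Obj) extends PseudocomonadData K B where
  src_ε : (K.hom B B).src ε = G
  tgt_ε : (K.hom B B).tgt ε = K.one B
  src_δ : (K.hom B B).src δ = G
  tgt_δ : (K.hom B B).tgt δ = G ⋆ G
  src_lam : (K.hom B B).src₂ lam = ε ⋆ᵣ G ∘₁ δ
  tgt_lam : (K.hom B B).tgt₂ lam = (K.hom B B).id G
  src_rho : (K.hom B B).src₂ rho = (K.hom B B).id G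
  tgt_rho : (K.hom B B).tgt₂ rho = G ⋆ₗ ε ∘₁ δ
  src_alpha : (K.hom B B).src₂ alpha = G ⋆ₗ δ ∘₁ δ
  tgt_alpha : (K.hom B B).tgt₂ alpha = δ ⋆ᵣ G ∘₁ δ
  lam_iso : TwoCat.IsIso lam
  rho_iso : TwoCat.IsIso rho
  alpha_iso : TwoCat.IsIso alpha
  coassoc : ((alpha ⋆ᵣᵣ G) ▷ δ) ∘₂ ((G ⋆ₗ δ ⋆ᵣ G) ◁ alpha) ∘₂ ((G ⋆ₗₗ alpha) ▷ δ) =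
    ((δ ⋆ᵣ G ⋆ᵣ G) ◁ alpha) ∘₂ (K.ix δ δ ▷ δ) ∘₂ ((G ⋆ₗ G ⋆ₗ δ) ◁ alpha)
  counit : (G ⋆ₗ ε ⋆ᵣ G) ◁ alpha = ((rho ⋆ᵣᵣ G) ▷ δ) ∘₂ ((G ⋆ₗₗ lam) ▷ δ)

attribute [simp] Pseudocomonad.src_ε Pseudocomonad.tgt_ε Pseudocomonad.src_δ Pseudocomonad.tgt_δ
  Pseudocomonad.src_lam Pseudocomonad.tgt_lam Pseudocomonad.src_rho Pseudocomonad.tgt_rho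
  Pseudocomonad.src_alpha Pseudocomonad.tgt_alpha Pseudocomonad.lam_iso Pseudocomonad.rho_iso
  Pseudocomonad.alpha_iso

/-- A pseudocoalgebra with domain `A` for a pseudocomonad. -/
@[ext] structure Pseudocoalgebra {K : GrayCat.{u, w}} {B : K.Obj} (G : Pseudocomonad K B)
    (A : K.Obj) where
  s : (K.hom A B).Ob
  ν : (K.hom A B).One
  ψ : (K.hom A B).Two
  χ : (K.hom A B).Two
  src_ν : (K.hom A B).src ν = s
  tgt_ν : (K.hom A B).tgt ν = G.G ⋆ s
  src_ψ : (K.hom A B).src₂ ψ = G.ε ⋆ᵣ s ∘₁ ν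
  tgt_ψ : (K.hom A B).tgt₂ ψ = (K.hom A B).id s
  src_χ : (K.hom A B).src₂ χ = G.G ⋆ₗ ν ∘₁ ν
  tgt_χ : (K.hom A B).tgt₂ χ = G.δ ⋆ᵣ s ∘₁ ν
  ψ_iso : TwoCat.IsIso ψ
  χ_iso : TwoCat.IsIso χ
  coassoc : ((G.alpha ⋆ᵣᵣ s) ▷ ν) ∘₂ ((G.G ⋆ₗ G.δ ⋆ᵣ s) ◁ χ) ∘₂ ((G.G ⋆ₗₗ χ) ▷ ν) =
    ((G.δ ⋆ᵣ G.G ⋆ᵣ s) ◁ χ) ∘₂ (K.ix G.δ ν ▷ ν) ∘₂ ((G.G ⋆ₗ G.G ⋆ₗ ν) ◁ χ)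
  counit : (G.G ⋆ₗ G.ε ⋆ᵣ s) ◁ χ = ((G.rho ⋆ᵣᵣ s) ▷ ν) ∘₂ ((G.G ⋆ₗₗ ψ) ▷ ν)

attribute [simp] Pseudocoalgebra.src_ν Pseudocoalgebra.tgt_ν Pseudocoalgebra.src_ψ
  Pseudocoalgebra.tgt_ψ Pseudocoalgebra.src_χ Pseudocoalgebra.tgt_χ Pseudocoalgebra.ψ_iso
  Pseudocoalgebra.χ_iso

/-- A (pseudo-)morphism of pseudocoalgebras with domain `A`. -/
@[ext] structure PseudocoalgHom {K : GrayCat.{u, w}} {B : K.Obj} (G : Pseudocomonad K B)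
    (A : K.Obj) where
  src : Pseudocoalgebra G A
  tgt : Pseudocoalgebra G A
  h : (K.hom A B).One
  ϱ : (K.hom A B).Two
  src_h : (K.hom A B).src h = src.s
  tgt_h : (K.hom A B).tgt h = tgt.s
  src_ϱ : (K.hom A B).src₂ ϱ = tgt.ν ∘₁ h
  tgt_ϱ : (K.hom A B).tgt₂ ϱ = G.G ⋆ₗ h ∘₁ src.ν
  ϱ_iso : TwoCat.IsIso ϱ
  counit : (h ◁ src.ψ) ∘₂ (TwoCat.inv (K.ix G.ε h) ▷ src.ν) ∘₂ ((G.ε ⋆ᵣ tgt.s) ◁ ϱ) = tgt.ψ ▷ h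
  comult : ((G.G ⋆ₗ G.G ⋆ₗ h) ◁ src.χ) ∘₂ ((G.G ⋆ₗₗ ϱ) ▷ src.ν) ∘₂ ((G.G ⋆ₗ tgt.ν) ◁ ϱ) =
    (TwoCat.inv (K.ix G.δ h) ▷ src.ν) ∘₂ ((G.δ ⋆ᵣ tgt.s) ◁ ϱ) ∘₂ (tgt.χ ▷ h)

attribute [simp] PseudocoalgHom.src_h PseudocoalgHom.tgt_h PseudocoalgHom.src_ϱ
  PseudocoalgHom.tgt_ϱ PseudocoalgHom.ϱ_iso

/-- A 2-cell of pseudocoalgebras with domain `A`. -/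
@[ext] structure PseudocoalgTwo {K : GrayCat.{u, w}} {B : K.Obj} (G : Pseudocomonad K B)
    (A : K.Obj) where
  src : PseudocoalgHom G A
  tgt : PseudocoalgHom G A
  src_eq : src.src = tgt.src
  tgt_eq : src.tgt = tgt.tgt
  ξ : (K.hom A B).Two
  src_ξ : (K.hom A B).src₂ ξ = src.h
  tgt_ξ : (K.hom A B).tgt₂ ξ = tgt.h
  comm : tgt.ϱ ∘₂ (tgt.tgt.ν ◁ ξ) = ((G.G ⋆ₗₗ ξ) ▷ tgt.src.ν) ∘₂ src.ϱ

attribute [simp] PseudocoalgTwo.src_eq PseudocoalgTwo.tgt_eq PseudocoalgTwo.src_ξ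
  PseudocoalgTwo.tgt_ξ

namespace PseudocoalgHom

variable {K : GrayCat.{u, w}} {B : K.Obj} {G : Pseudocomonad K B} {A : K.Obj}

/-- The identity morphism of a pseudocoalgebra. -/
@[simps] def id (s : Pseudocoalgebra G A) : PseudocoalgHom G A where
  src := s
  tgt := s
  h := (K.hom A B).id s.s
  ϱ := (K.hom A B).id₂ s.ν
  src_h := by simp
  tgt_h := by simp
  src_ϱ := by simp
  tgt_ϱ := by simp
  ϱ_iso := by simp
  counit := by simp (maxDischargeDepth := 9)
  comult := by simp (maxDischargeDepth := 9)

/-- The composite of composable morphisms of pseudocoalgebras. -/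
def comp' (g f : PseudocoalgHom G A) (e : f.tgt = g.src) : PseudocoalgHom G A where
  src := f.src
  tgt := g.tgt
  h := g.h ∘₁ f.h
  ϱ := ((G.G ⋆ₗ g.h) ◁ f.ϱ) ∘₂ (g.ϱ ▷ f.h)
  src_h := by simp (maxDischargeDepth := 9) [e]
  tgt_h := by simp (maxDischargeDepth := 9) [e]
  src_ϱ := by simp (maxDischargeDepth := 9) [e]
  tgt_ϱ := by simp (maxDischargeDepth := 9) [e]
  ϱ_iso := by simp (maxDischargeDepth := 9) [e]
  counit := by
    have h1 := congrArg ((K.hom A B).wl g.h) f.counit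
    have h2 := congrArg (fun y => (K.hom A B).wr y f.h) g.counit
    have I := (K.hom A B).interchange (TwoCat.inv (K.ix G.ε g.h)) f.ϱ
      (by simp (maxDischargeDepth := 9) [e])
    simp (maxDischargeDepth := 9) [e] at h1 h2 I
    have I' := TwoCat.reassoc I.symm (by simp (maxDischargeDepth := 9) [e])
      (by simp (maxDischargeDepth := 9) [e]) ((G.ε ⋆ᵣ g.tgt.s) ◁ g.ϱ ▷ f.h)
      (by simp (maxDischargeDepth := 9) [e])
    have h1' := congrArg (fun y => (K.hom A B).vcomp y
      (((TwoCat.inv (K.ix G.ε g.h) ▷ g.src.ν) ▷ f.h) ∘₂ ((G.ε ⋆ᵣ g.tgt.s) ◁ g.ϱ ▷ f.h))) h1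
    simp (maxDischargeDepth := 9) [e] at h1'
    simp (maxDischargeDepth := 9) [e]
    rw [I', h1', h2]
  comult := by
    have h1 := congrArg ((K.hom A B).wl (G.G ⋆ₗ G.G ⋆ₗ g.h)) f.comult
    have h2 := congrArg (fun y => (K.hom A B).wr y f.h) g.comult
    have I := (K.hom A B).interchange (G.G ⋆ₗₗ g.ϱ) f.ϱ (by simp (maxDischargeDepth := 9) [e])
    have J := (K.hom A B).interchange (TwoCat.inv (K.ix G.δ g.h)) f.ϱ
      (by simp (maxDischargeDepth := 9) [e])
    simp (maxDischargeDepth := 9) [e] at h1 h2 I J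
    have I' := TwoCat.reassoc I.symm (by simp (maxDischargeDepth := 9) [e])
      (by simp (maxDischargeDepth := 9) [e]) ((G.G ⋆ₗ g.tgt.ν) ◁ g.ϱ ▷ f.h)
      (by simp (maxDischargeDepth := 9) [e])
    have h1' := TwoCat.reassoc3 h1 (by simp (maxDischargeDepth := 9) [e])
      (by simp (maxDischargeDepth := 9) [e]) (by simp (maxDischargeDepth := 9) [e])
      (by simp (maxDischargeDepth := 9) [e])
      ((((G.G ⋆ₗₗ g.ϱ) ▷ g.src.ν) ▷ f.h) ∘₂ ((G.G ⋆ₗ g.tgt.ν) ◁ g.ϱ ▷ f.h))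
      (by simp (maxDischargeDepth := 9) [e])
    have J' := TwoCat.reassoc J (by simp (maxDischargeDepth := 9) [e])
      (by simp (maxDischargeDepth := 9) [e])
      (((G.δ ⋆ᵣ g.tgt.s) ◁ g.ϱ ▷ f.h) ∘₂ ((g.tgt.χ ▷ g.h) ▷ f.h))
      (by simp (maxDischargeDepth := 9) [e])
    simp (maxDischargeDepth := 9) [e]
    rw [I', h1', h2, J']

open Classical in
/-- Composition of morphisms of pseudocoalgebras. -/
noncomputable def comp (g f : PseudocoalgHom G A) : PseudocoalgHom G A :=
  if e : f.tgt = g.src then comp' g f e else f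

@[simp] theorem src_comp {g f : PseudocoalgHom G A} (e : f.tgt = g.src) :
    (comp g f).src = f.src := by rw [comp, dif_pos e]; rfl
@[simp] theorem tgt_comp {g f : PseudocoalgHom G A} (e : f.tgt = g.src) :
    (comp g f).tgt = g.tgt := by rw [comp, dif_pos e]; rfl
@[simp] theorem comp_h {g f : PseudocoalgHom G A} (e : f.tgt = g.src) :
    (comp g f).h = g.h ∘₁ f.h := by rw [comp, dif_pos e]; rfl
@[simp] theorem comp_ϱ {g f : PseudocoalgHom G A} (e : f.tgt = g.src) :
    (comp g f).ϱ = ((G.G ⋆ₗ g.h) ◁ f.ϱ) ∘₂ (g.ϱ ▷ f.h) := by rw [comp, dif_pos e]; rfl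

end PseudocoalgHom

namespace PseudocoalgTwo

variable {K : GrayCat.{u, w}} {B : K.Obj} {G : Pseudocomonad K B} {A : K.Obj}

/-- The identity 2-cell of a morphism of pseudocoalgebras. -/
@[simps] def id (f : PseudocoalgHom G A) : PseudocoalgTwo G A where
  src := f
  tgt := f
  src_eq := rfl
  tgt_eq := rfl
  ξ := (K.hom A B).id₂ f.h
  src_ξ := by simp
  tgt_ξ := by simp
  comm := by simp (maxDischargeDepth := 9)

/-- The vertical composite of composable 2-cells of pseudocoalgebras. -/
def vcomp' (y x : PseudocoalgTwo G A) (e : x.tgt = y.src) : PseudocoalgTwo G A where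
  src := x.src
  tgt := y.tgt
  src_eq := by simp (maxDischargeDepth := 9) [e]
  tgt_eq := by simp (maxDischargeDepth := 9) [e]
  ξ := y.ξ ∘₂ x.ξ
  src_ξ := by simp (maxDischargeDepth := 9) [e]
  tgt_ξ := by simp (maxDischargeDepth := 9) [e]
  comm := by
    have h1 := y.comm
    have h2 := x.comm
    simp (maxDischargeDepth := 9) [e] at h1 h2
    have h1' := TwoCat.reassoc h1 (by simp (maxDischargeDepth := 9) [e])
      (by simp (maxDischargeDepth := 9) [e]) (y.tgt.tgt.ν ◁ x.ξ)
      (by simp (maxDischargeDepth := 9) [e])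
    simp (maxDischargeDepth := 9) [e, h1', h2]

open Classical in
/-- Vertical composition of 2-cells of pseudocoalgebras. -/
noncomputable def vcomp (y x : PseudocoalgTwo G A) : PseudocoalgTwo G A :=
  if e : x.tgt = y.src then vcomp' y x e else x

/-- Whiskering of a 2-cell by a morphism of pseudocoalgebras (if composable). -/
noncomputable def wl' (g : PseudocoalgHom G A) (x : PseudocoalgTwo G A) (e : x.tgt.tgt = g.src) :
    PseudocoalgTwo G A where
  src := g.comp x.src
  tgt := g.comp x.tgt
  src_eq := by simp (maxDischargeDepth := 9) [e]
  tgt_eq := by simp (maxDischargeDepth := 9) [e]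
  ξ := g.h ◁ x.ξ
  src_ξ := by simp (maxDischargeDepth := 9) [e]
  tgt_ξ := by simp (maxDischargeDepth := 9) [e]
  comm := by
    have h1 := congrArg ((K.hom A B).wl (G.G ⋆ₗ g.h)) x.comm
    have I := (K.hom A B).interchange g.ϱ x.ξ (by simp (maxDischargeDepth := 9) [e])
    simp (maxDischargeDepth := 9) [e] at h1 I
    have h1' := TwoCat.reassoc h1 (by simp (maxDischargeDepth := 9) [e])
      (by simp (maxDischargeDepth := 9) [e]) (g.ϱ ▷ x.src.h)
      (by simp (maxDischargeDepth := 9) [e])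
    simp (maxDischargeDepth := 9) [e, ← I, h1']

open Classical in
/-- Whiskering of a 2-cell by a morphism of pseudocoalgebras. -/
noncomputable def wl (g : PseudocoalgHom G A) (x : PseudocoalgTwo G A) : PseudocoalgTwo G A :=
  if e : x.tgt.tgt = g.src then wl' g x e else x

/-- Whiskering of a 2-cell by a morphism of pseudocoalgebras (if composable). -/
noncomputable def wr' (x : PseudocoalgTwo G A) (f : PseudocoalgHom G A) (e : f.tgt = x.tgt.src) :
    PseudocoalgTwo G A where
  src := x.src.comp f
  tgt := x.tgt.comp f
  src_eq := by simp (maxDischargeDepth := 9) [e]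
  tgt_eq := by simp (maxDischargeDepth := 9) [e]
  ξ := x.ξ ▷ f.h
  src_ξ := by simp (maxDischargeDepth := 9) [e]
  tgt_ξ := by simp (maxDischargeDepth := 9) [e]
  comm := by
    have h1 := congrArg (fun y => (K.hom A B).wr y f.h) x.comm
    have I := (K.hom A B).interchange (G.G ⋆ₗₗ x.ξ) f.ϱ (by simp (maxDischargeDepth := 9) [e])
    simp (maxDischargeDepth := 9) [e] at h1 I
    have I' := TwoCat.reassoc I (by simp (maxDischargeDepth := 9) [e])
      (by simp (maxDischargeDepth := 9) [e]) (x.src.ϱ ▷ f.h)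
      (by simp (maxDischargeDepth := 9) [e])
    simp (maxDischargeDepth := 9) [e, h1, I']

open Classical in
/-- Whiskering of a 2-cell by a morphism of pseudocoalgebras. -/
noncomputable def wr (x : PseudocoalgTwo G A) (f : PseudocoalgHom G A) : PseudocoalgTwo G A :=
  if e : f.tgt = x.tgt.src then wr' x f e else x

@[simp] theorem src_vcomp {y x : PseudocoalgTwo G A} (e : x.tgt = y.src) :
    (vcomp y x).src = x.src := by rw [vcomp, dif_pos e]; rfl
@[simp] theorem tgt_vcomp {y x : PseudocoalgTwo G A} (e : x.tgt = y.src) :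
    (vcomp y x).tgt = y.tgt := by rw [vcomp, dif_pos e]; rfl
@[simp] theorem vcomp_ξ {y x : PseudocoalgTwo G A} (e : x.tgt = y.src) :
    (vcomp y x).ξ = y.ξ ∘₂ x.ξ := by rw [vcomp, dif_pos e]; rfl
@[simp] theorem src_wl {g : PseudocoalgHom G A} {x : PseudocoalgTwo G A} (e : x.tgt.tgt = g.src) :
    (wl g x).src = g.comp x.src := by rw [wl, dif_pos e]; rfl
@[simp] theorem tgt_wl {g : PseudocoalgHom G A} {x : PseudocoalgTwo G A} (e : x.tgt.tgt = g.src) :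
    (wl g x).tgt = g.comp x.tgt := by rw [wl, dif_pos e]; rfl
@[simp] theorem wl_ξ {g : PseudocoalgHom G A} {x : PseudocoalgTwo G A} (e : x.tgt.tgt = g.src) :
    (wl g x).ξ = g.h ◁ x.ξ := by rw [wl, dif_pos e]; rfl
@[simp] theorem src_wr {x : PseudocoalgTwo G A} {f : PseudocoalgHom G A} (e : f.tgt = x.tgt.src) :
    (wr x f).src = x.src.comp f := by rw [wr, dif_pos e]; rfl
@[simp] theorem tgt_wr {x : PseudocoalgTwo G A} {f : PseudocoalgHom G A} (e : f.tgt = x.tgt.src) :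
    (wr x f).tgt = x.tgt.comp f := by rw [wr, dif_pos e]; rfl
@[simp] theorem wr_ξ {x : PseudocoalgTwo G A} {f : PseudocoalgHom G A} (e : f.tgt = x.tgt.src) :
    (wr x f).ξ = x.ξ ▷ f.h := by rw [wr, dif_pos e]; rfl

end PseudocoalgTwo

/-- The 2-category of pseudocoalgebras with domain `A` for a pseudocomonad. -/
noncomputable def coalgTwoCat {K : GrayCat.{u, w}} {B : K.Obj} (G : Pseudocomonad K B) (A : K.Obj) :
    TwoCat.{w} where
  Ob := Pseudocoalgebra G A
  One := PseudocoalgHom G A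
  Two := PseudocoalgTwo G A
  src := PseudocoalgHom.src
  tgt := PseudocoalgHom.tgt
  src₂ := PseudocoalgTwo.src
  tgt₂ := PseudocoalgTwo.tgt
  id := PseudocoalgHom.id
  comp := PseudocoalgHom.comp
  id₂ := PseudocoalgTwo.id
  vcomp := PseudocoalgTwo.vcomp
  wl := PseudocoalgTwo.wl
  wr := PseudocoalgTwo.wr
  src_src₂ x := by simp
  tgt_src₂ x := by simp
  src_id _ := rfl
  tgt_id _ := rfl
  src_comp g f e := by simp (maxDischargeDepth := 9) [e]
  tgt_comp g f e := by simp (maxDischargeDepth := 9) [e]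
  comp_id f := by ext <;> simp (maxDischargeDepth := 9)
  id_comp f := by ext <;> simp (maxDischargeDepth := 9)
  comp_assoc h g f e k := by ext <;> simp (maxDischargeDepth := 9) [e, k]
  src_id₂ _ := rfl
  tgt_id₂ _ := rfl
  src_vcomp y x e := by simp (maxDischargeDepth := 9) [e]
  tgt_vcomp y x e := by simp (maxDischargeDepth := 9) [e]
  vcomp_id x := by ext <;> simp (maxDischargeDepth := 9)
  id_vcomp x := by ext <;> simp (maxDischargeDepth := 9)
  vcomp_assoc z y x e k := by ext <;> simp (maxDischargeDepth := 9) [e, k]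
  src_wl g x e := by simp (maxDischargeDepth := 9) [e]
  tgt_wl g x e := by simp (maxDischargeDepth := 9) [e]
  wl_id₂ g f e := by ext <;> simp (maxDischargeDepth := 9) [e]
  wl_vcomp g y x e k := by ext <;> simp (maxDischargeDepth := 9) [e, k]
  id_wl x := by ext <;> simp (maxDischargeDepth := 9)
  comp_wl h g x e k := by ext <;> simp (maxDischargeDepth := 9) [e, k]
  src_wr x f e := by simp (maxDischargeDepth := 9) [e]
  tgt_wr x f e := by simp (maxDischargeDepth := 9) [e]
  id₂_wr g f e := by ext <;> simp (maxDischargeDepth := 9) [e]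
  vcomp_wr y x f e k := by ext <;> simp (maxDischargeDepth := 9) [e, k]
  wr_id x := by ext <;> simp (maxDischargeDepth := 9)
  wr_comp x g f e k := by ext <;> simp (maxDischargeDepth := 9) [e, k]
  wl_wr h x f e k := by ext <;> simp (maxDischargeDepth := 9) [e, k]
  interchange y x e := by
    ext
    all_goals try simp (maxDischargeDepth := 9) [e]
    simpa using (K.hom A B).interchange y.ξ x.ξ (by simp [e])

section CoalgBase

variable {K : GrayCat.{u, w}} {B : K.Obj} {G : Pseudocomonad K B} {A A' A'' : K.Obj}

/-- Change of domain of a pseudocoalgebra along `k : A' → A`. -/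
@[simps] def Pseudocoalgebra.base (k : (K.hom A' A).Ob) (s : Pseudocoalgebra G A) :
    Pseudocoalgebra G A' where
  s := s.s ⋆ k
  ν := s.ν ⋆ᵣ k
  ψ := s.ψ ⋆ᵣᵣ k
  χ := s.χ ⋆ᵣᵣ k
  src_ν := by simp
  tgt_ν := by simp
  src_ψ := by simp
  tgt_ψ := by simp
  src_χ := by simp
  tgt_χ := by simp
  ψ_iso := by simp
  χ_iso := by simp
  coassoc := by
    have := congrArg (K.pre k).two s.coassoc
    simpa (maxDischargeDepth := 9) using this
  counit := by
    have := congrArg (K.pre k).two s.counit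
    simpa (maxDischargeDepth := 9) using this

/-- Change of domain of a morphism of pseudocoalgebras. -/
@[simps] def PseudocoalgHom.base (k : (K.hom A' A).Ob) (f : PseudocoalgHom G A) :
    PseudocoalgHom G A' where
  src := f.src.base k
  tgt := f.tgt.base k
  h := f.h ⋆ᵣ k
  ϱ := f.ϱ ⋆ᵣᵣ k
  src_h := by simp
  tgt_h := by simp
  src_ϱ := by simp
  tgt_ϱ := by simp
  ϱ_iso := by simp
  counit := by
    have := congrArg (K.pre k).two f.counit
    simpa (maxDischargeDepth := 9) using this
  comult := by
    have := congrArg (K.pre k).two f.comult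
    simpa (maxDischargeDepth := 9) using this

/-- Change of domain of a 2-cell of pseudocoalgebras. -/
@[simps] def PseudocoalgTwo.base (k : (K.hom A' A).Ob) (x : PseudocoalgTwo G A) :
    PseudocoalgTwo G A' where
  src := x.src.base k
  tgt := x.tgt.base k
  src_eq := by simp
  tgt_eq := by simp
  ξ := x.ξ ⋆ᵣᵣ k
  src_ξ := by simp
  tgt_ξ := by simp
  comm := by
    have := congrArg (K.pre k).two x.comm
    simpa (maxDischargeDepth := 9) using this

/-- Change of domain along `k : A' → A`, as a 2-functor. -/
@[simps] noncomputable def coalgBase (G : Pseudocomonad K B) (k : (K.hom A' A).Ob) :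
    TwoFunctor (coalgTwoCat G A) (coalgTwoCat G A') where
  ob s := s.base k
  one f := f.base k
  two x := x.base k
  src_one _ := rfl
  tgt_one _ := rfl
  src_two _ := rfl
  tgt_two _ := rfl
  map_id (s : Pseudocoalgebra G A) := by
    change (PseudocoalgHom.id s).base k = PseudocoalgHom.id (s.base k)
    apply PseudocoalgHom.ext <;> simp
  map_comp (g f : PseudocoalgHom G A) (h : f.tgt = g.src) := by
    change (g.comp f).base k = (g.base k).comp (f.base k)
    apply PseudocoalgHom.ext <;> simp (maxDischargeDepth := 9) [h]
  map_id₂ (f : PseudocoalgHom G A) := by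
    change (PseudocoalgTwo.id f).base k = PseudocoalgTwo.id (f.base k)
    apply PseudocoalgTwo.ext <;> simp
  map_vcomp (y x : PseudocoalgTwo G A) (h : x.tgt = y.src) := by
    change (y.vcomp x).base k = (y.base k).vcomp (x.base k)
    apply PseudocoalgTwo.ext <;> simp (maxDischargeDepth := 9) [h]
  map_wl (g : PseudocoalgHom G A) (x : PseudocoalgTwo G A) (h : x.tgt.tgt = g.src) := by
    change (PseudocoalgTwo.wl g x).base k = PseudocoalgTwo.wl (g.base k) (x.base k)
    apply PseudocoalgTwo.ext <;> (try apply PseudocoalgHom.ext) <;>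
      simp (maxDischargeDepth := 9) [h]
  map_wr (x : PseudocoalgTwo G A) (f : PseudocoalgHom G A) (h : f.tgt = x.tgt.src) := by
    change (x.wr f).base k = (x.base k).wr (f.base k)
    apply PseudocoalgTwo.ext <;> (try apply PseudocoalgHom.ext) <;>
      simp (maxDischargeDepth := 9) [h]

/-- The component at a pseudocoalgebra of the pseudonatural transformation induced by a 2-cell
`k : F ⇒ F'` between domains. -/
@[simps] noncomputable def Pseudocoalgebra.whisk (s : Pseudocoalgebra G A) (k : (K.hom A' A).One) :
    PseudocoalgHom G A' where
  src := s.base ((K.hom A' A).src k)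
  tgt := s.base ((K.hom A' A).tgt k)
  h := s.s ⋆ₗ k
  ϱ := TwoCat.inv (K.ix s.ν k)
  src_h := by simp
  tgt_h := by simp
  src_ϱ := by simp
  tgt_ϱ := by simp
  ϱ_iso := by simp
  counit := by
    have h1 := K.ix_two_left s.ψ k
    have h2 := TwoCat.inv_square (by simp (maxDischargeDepth := 9))
      (by simp (maxDischargeDepth := 9)) (by simp (maxDischargeDepth := 9))
      (by simp (maxDischargeDepth := 9)) h1.symm
    simp (maxDischargeDepth := 9) at h2
    simp (maxDischargeDepth := 9) [h2]
  comult := by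
    have h1 := K.ix_two_left s.χ k
    have h2 := TwoCat.inv_square (by simp (maxDischargeDepth := 9))
      (by simp (maxDischargeDepth := 9)) (by simp (maxDischargeDepth := 9))
      (by simp (maxDischargeDepth := 9)) h1.symm
    simp (maxDischargeDepth := 9) at h2
    simp (maxDischargeDepth := 9) [h2]

/-- The structure cell at a morphism of pseudocoalgebras of the pseudonatural transformation induced
by a 2-cell `k : F ⇒ F'` between domains. -/
noncomputable def PseudocoalgHom.whisk (f : PseudocoalgHom G A) (k : (K.hom A' A).One) :
    PseudocoalgTwo G A' where
  src := (f.base ((K.hom A' A).tgt k)).comp (f.src.whisk k)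
  tgt := (f.tgt.whisk k).comp (f.base ((K.hom A' A).src k))
  src_eq := by simp
  tgt_eq := by simp
  ξ := TwoCat.inv (K.ix f.h k)
  src_ξ := by simp
  tgt_ξ := by simp
  comm := by
    have h1 := K.ix_two_left f.ϱ k
    have h2 := TwoCat.inv_square (by simp (maxDischargeDepth := 9))
      (by simp (maxDischargeDepth := 9)) (by simp (maxDischargeDepth := 9))
      (by simp (maxDischargeDepth := 9)) h1.symm
    simp (maxDischargeDepth := 9) at h2
    simp (maxDischargeDepth := 9) [h2]

@[simp] theorem PseudocoalgHom.src_whisk (f : PseudocoalgHom G A) (k : (K.hom A' A).One) :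
    (f.whisk k).src = (f.base ((K.hom A' A).tgt k)).comp (f.src.whisk k) := rfl
@[simp] theorem PseudocoalgHom.tgt_whisk (f : PseudocoalgHom G A) (k : (K.hom A' A).One) :
    (f.whisk k).tgt = (f.tgt.whisk k).comp (f.base ((K.hom A' A).src k)) := rfl
@[simp] theorem PseudocoalgHom.whisk_ξ (f : PseudocoalgHom G A) (k : (K.hom A' A).One) :
    (f.whisk k).ξ = TwoCat.inv (K.ix f.h k) := rfl

/-- The component at a pseudocoalgebra of the modification induced by a 3-cell between domains. -/
@[simps] noncomputable def Pseudocoalgebra.whisk₂ (s : Pseudocoalgebra G A) (x : (K.hom A' A).Two) :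
    PseudocoalgTwo G A' where
  src := s.whisk ((K.hom A' A).src₂ x)
  tgt := s.whisk ((K.hom A' A).tgt₂ x)
  src_eq := by simp
  tgt_eq := by simp
  ξ := s.s ⋆ₗₗ x
  src_ξ := by simp
  tgt_ξ := by simp
  comm := by
    have h := TwoCat.inv_square (by simp) (by simp) (by simp) (by simp)
      (K.ix_two_right s.ν x).symm
    simp at h
    simp [h]

/-- A 2-cell of pseudocoalgebras is invertible if its underlying 2-cell is. -/
theorem PseudocoalgTwo.isIso {x : PseudocoalgTwo G A} (h : TwoCat.IsIso x.ξ) :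
    TwoCat.IsIso (X := coalgTwoCat G A) x := by
  refine ⟨(⟨x.tgt, x.src, x.src_eq.symm, x.tgt_eq.symm, TwoCat.inv x.ξ, by simp [h], by simp [h],
    ?_⟩ : PseudocoalgTwo G A), rfl, rfl, ?_, ?_⟩
  · have := TwoCat.inv_square (by simp (maxDischargeDepth := 9) [h])
      (by simp (maxDischargeDepth := 9) [h]) (by simp (maxDischargeDepth := 9) [h])
      (by simp (maxDischargeDepth := 9) [h]) x.comm
    simpa (maxDischargeDepth := 9) [h] using this.symm
  · exact PseudocoalgTwo.ext (by simp [coalgTwoCat]) (by simp [coalgTwoCat]) (by simp [coalgTwoCat, h])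
  · exact PseudocoalgTwo.ext (by simp [coalgTwoCat]) (by simp [coalgTwoCat]) (by simp [coalgTwoCat, h])

/-- The pseudonatural transformation induced by a 2-cell between domains. -/
@[simps] noncomputable def coalgPs (G : Pseudocomonad K B) (k : (K.hom A' A).One) :
    PsNat (coalgTwoCat G A) (coalgTwoCat G A') where
  src := coalgBase G ((K.hom A' A).src k)
  tgt := coalgBase G ((K.hom A' A).tgt k)
  app s := s.whisk k
  nat f := f.whisk k
  src_app _ := rfl
  tgt_app _ := rfl
  src_nat _ := rfl
  tgt_nat _ := rfl
  nat_iso (f : PseudocoalgHom G A) := PseudocoalgTwo.isIso (by simp)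
  nat_id (s : Pseudocoalgebra G A) := by
    change (PseudocoalgHom.id s).whisk k = PseudocoalgTwo.id (s.whisk k)
    apply PseudocoalgTwo.ext <;> (try apply PseudocoalgHom.ext) <;> simp (maxDischargeDepth := 9)
  nat_comp (g f : PseudocoalgHom G A) (h : f.tgt = g.src) := by
    change (g.comp f).whisk k =
      ((g.whisk k).wr (f.base ((K.hom A' A).src k))).vcomp
        (PseudocoalgTwo.wl (g.base ((K.hom A' A).tgt k)) (f.whisk k))
    have e : (PseudocoalgTwo.wl (g.base ((K.hom A' A).tgt k)) (f.whisk k)).tgt =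
        ((g.whisk k).wr (f.base ((K.hom A' A).src k))).src := by
      apply PseudocoalgHom.ext <;> simp (maxDischargeDepth := 9) [h]
    apply PseudocoalgTwo.ext <;> (try apply PseudocoalgHom.ext) <;>
      simp (maxDischargeDepth := 9) [h, PseudocoalgTwo.src_vcomp e, PseudocoalgTwo.tgt_vcomp e,
        PseudocoalgTwo.vcomp_ξ e]
  nat_two (x : PseudocoalgTwo G A) := by
    change (x.tgt.whisk k).vcomp ((x.base ((K.hom A' A).tgt k)).wr (x.tgt.src.whisk k)) =
      (PseudocoalgTwo.wl (x.tgt.tgt.whisk k) (x.base ((K.hom A' A).src k))).vcomp (x.src.whisk k)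
    have h := TwoCat.inv_square (by simp) (by simp) (by simp) (by simp) (K.ix_two_left x.ξ k).symm
    simp at h
    have e₁ : ((x.base ((K.hom A' A).tgt k)).wr (x.tgt.src.whisk k)).tgt =
        (x.tgt.whisk k).src := by simp
    have e₂ : (x.src.whisk k).tgt =
        (PseudocoalgTwo.wl (x.tgt.tgt.whisk k) (x.base ((K.hom A' A).src k))).src := by simp
    apply PseudocoalgTwo.ext <;> (try apply PseudocoalgHom.ext) <;>
      simp (maxDischargeDepth := 9) [h, PseudocoalgTwo.src_vcomp e₁, PseudocoalgTwo.tgt_vcomp e₁,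
        PseudocoalgTwo.vcomp_ξ e₁, PseudocoalgTwo.src_vcomp e₂, PseudocoalgTwo.tgt_vcomp e₂,
        PseudocoalgTwo.vcomp_ξ e₂]

/-- The modification induced by a 3-cell between domains. -/
@[simps] noncomputable def coalgModif (G : Pseudocomonad K B) (x : (K.hom A' A).Two) :
    Modif (coalgTwoCat G A) (coalgTwoCat G A') where
  src := coalgPs G ((K.hom A' A).src₂ x)
  tgt := coalgPs G ((K.hom A' A).tgt₂ x)
  src_eq := by simp
  tgt_eq := by simp
  app s := s.whisk₂ x
  src_app _ := rfl
  tgt_app _ := rfl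
  naturality (f : PseudocoalgHom G A) := by
    change (f.whisk ((K.hom A' A).tgt₂ x)).vcomp
        (PseudocoalgTwo.wl (f.base ((K.hom A' A).tgt ((K.hom A' A).tgt₂ x))) (f.src.whisk₂ x)) =
      ((f.tgt.whisk₂ x).wr (f.base ((K.hom A' A).src ((K.hom A' A).tgt₂ x)))).vcomp
        (f.whisk ((K.hom A' A).src₂ x))
    have h := TwoCat.inv_square (by simp) (by simp) (by simp) (by simp)
      (K.ix_two_right f.h x).symm
    simp at h
    have e₁ : (PseudocoalgTwo.wl (f.base ((K.hom A' A).tgt ((K.hom A' A).tgt₂ x)))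
        (f.src.whisk₂ x)).tgt = (f.whisk ((K.hom A' A).tgt₂ x)).src := by simp
    have e₂ : (f.whisk ((K.hom A' A).src₂ x)).tgt =
        ((f.tgt.whisk₂ x).wr (f.base ((K.hom A' A).src ((K.hom A' A).tgt₂ x)))).src := by simp
    apply PseudocoalgTwo.ext <;> (try apply PseudocoalgHom.ext) <;>
      simp (maxDischargeDepth := 9) [h, PseudocoalgTwo.src_vcomp e₁, PseudocoalgTwo.tgt_vcomp e₁,
        PseudocoalgTwo.vcomp_ξ e₁, PseudocoalgTwo.src_vcomp e₂, PseudocoalgTwo.tgt_vcomp e₂,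
        PseudocoalgTwo.vcomp_ξ e₂]

end CoalgBase

theorem coalgPs_id {K : GrayCat.{u, w}} {A A' B : K.Obj} (G : Pseudocomonad K B)
    (F : (K.hom A' A).Ob) : coalgPs G ((K.hom A' A).id F) = PsNat.id (coalgBase G F) := by
  refine PsNat.ext (by simp) (by simp) (funext fun (s : Pseudocoalgebra G _) => ?_)
    (funext fun (f : PseudocoalgHom G _) => ?_)
  · change s.whisk _ = PseudocoalgHom.id (s.base F)
    apply PseudocoalgHom.ext <;> simp
  · change f.whisk _ = PseudocoalgTwo.id (f.base F)
    apply PseudocoalgTwo.ext <;> (try apply PseudocoalgHom.ext) <;> simp (maxDischargeDepth := 9)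

theorem coalgPs_comp {K : GrayCat.{u, w}} {A A' B : K.Obj} (G : Pseudocomonad K B)
    (g f : (K.hom A' A).One) (h : (K.hom A' A).tgt f = (K.hom A' A).src g) :
    coalgPs G (g ∘₁ f) = (coalgPs G g).comp (coalgPs G f) := by
  have e : (coalgPs G f).tgt = (coalgPs G g).src := by simp [h]
  refine PsNat.ext (by simp [e, h]) (by simp [e, h])
    ((funext fun (s : Pseudocoalgebra G _) => ?_).trans (funext (PsNat.comp_app e)).symm)
    ((funext fun (k : PseudocoalgHom G _) => ?_).trans (funext (PsNat.comp_nat e)).symm)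
  · change s.whisk _ = (s.whisk g).comp (s.whisk f)
    apply PseudocoalgHom.ext <;> simp (maxDischargeDepth := 9) [h]
  · change k.whisk _ = (PseudocoalgTwo.wl (k.tgt.whisk g) (k.whisk f)).vcomp
      ((k.whisk g).wr (k.src.whisk f))
    have e' : ((k.whisk g).wr (k.src.whisk f)).tgt =
        (PseudocoalgTwo.wl (k.tgt.whisk g) (k.whisk f)).src := by
      apply PseudocoalgHom.ext <;> simp (maxDischargeDepth := 9) [h]
    apply PseudocoalgTwo.ext <;> (try apply PseudocoalgHom.ext) <;>
      simp (maxDischargeDepth := 9) [h, PseudocoalgTwo.src_vcomp e', PseudocoalgTwo.tgt_vcomp e',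
        PseudocoalgTwo.vcomp_ξ e']

theorem coalgBase_comp {K : GrayCat.{u, w}} {A A' A'' B : K.Obj} (G : Pseudocomonad K B)
    (F : (K.hom A' A).Ob) (L : (K.hom A'' A').Ob) :
    coalgBase G (F ⋆ L) = (coalgBase G L).comp (coalgBase G F) := by
  refine TwoFunctor.ext (funext fun (s : Pseudocoalgebra G _) => ?_)
    (funext fun (f : PseudocoalgHom G _) => ?_) (funext fun (x : PseudocoalgTwo G _) => ?_)
  · change s.base _ = (s.base F).base L
    apply Pseudocoalgebra.ext <;> simp
  · change f.base _ = (f.base F).base L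
    apply PseudocoalgHom.ext <;> (try apply Pseudocoalgebra.ext) <;> simp
  · change x.base _ = (x.base F).base L
    apply PseudocoalgTwo.ext <;> (try apply PseudocoalgHom.ext) <;> (try apply Pseudocoalgebra.ext) <;>
      simp

theorem coalgPs_pre {K : GrayCat.{u, w}} {A A' A'' B : K.Obj} (G : Pseudocomonad K B)
    (f : (K.hom A' A).One) (L : (K.hom A'' A').Ob) :
    coalgPs G (f ⋆ᵣ L) = PsNat.post (coalgBase G L) (coalgPs G f) := by
  refine PsNat.ext (by simp [coalgBase_comp]) (by simp [coalgBase_comp])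
    (funext fun (s : Pseudocoalgebra G _) => ?_) (funext fun (k : PseudocoalgHom G _) => ?_)
  · change s.whisk _ = (s.whisk f).base L
    apply PseudocoalgHom.ext <;> (try apply Pseudocoalgebra.ext) <;> simp
  · change k.whisk _ = (k.whisk f).base L
    apply PseudocoalgTwo.ext <;> (try apply PseudocoalgHom.ext) <;> (try apply Pseudocoalgebra.ext) <;>
      simp (maxDischargeDepth := 9)

theorem coalgPs_post {K : GrayCat.{u, w}} {A A' A'' B : K.Obj} (G : Pseudocomonad K B)
    (F : (K.hom A' A).Ob) (g : (K.hom A'' A').One) :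
    coalgPs G (F ⋆ₗ g) = PsNat.pre (coalgBase G F) (coalgPs G g) := by
  refine PsNat.ext (by simp [coalgBase_comp]) (by simp [coalgBase_comp])
    (funext fun (s : Pseudocoalgebra G _) => ?_) (funext fun (k : PseudocoalgHom G _) => ?_)
  · change s.whisk _ = (s.base F).whisk g
    apply PseudocoalgHom.ext <;> (try apply Pseudocoalgebra.ext) <;> simp
  · change k.whisk _ = (k.base F).whisk g
    apply PseudocoalgTwo.ext <;> (try apply PseudocoalgHom.ext) <;> (try apply Pseudocoalgebra.ext) <;>
      simp (maxDischargeDepth := 9)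

/-- The Gray-functor `G-CoAlg : Kᵒᵖ → Gray` of pseudocoalgebras, their morphisms and 2-cells. -/
noncomputable def coalgGray {K : GrayCat.{u, w}} {B : K.Obj} (G : Pseudocomonad K B) :
    GrayFunctor K.op Gray.{w} :=
  GrayPresheaf.toGrayFunctor
  { obj := fun A => coalgTwoCat G A
    ob := fun F => coalgBase G F
    one := fun k => coalgPs G k
    two := fun x => coalgModif G x
    src_one := fun _ => rfl
    tgt_one := fun _ => rfl
    src_two := fun _ => rfl
    tgt_two := fun _ => rfl
    map_id := fun F => coalgPs_id G F
    map_comp := fun g f h => coalgPs_comp G g f h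
    map_id₂ := fun f => by
      refine Modif.ext (by simp) (by simp) (funext fun (s : Pseudocoalgebra G _) => ?_)
      change s.whisk₂ _ = PseudocoalgTwo.id (s.whisk f)
      apply PseudocoalgTwo.ext <;> simp
    map_vcomp := fun y x h => by
      have e : (coalgModif G x).tgt = (coalgModif G y).src := by simp [h]
      refine Modif.ext (by simp [e, h]) (by simp [e, h])
        ((funext fun (s : Pseudocoalgebra G _) => ?_).trans (funext (Modif.vcomp_app e)).symm)
      change s.whisk₂ _ = (s.whisk₂ y).vcomp (s.whisk₂ x)
      apply PseudocoalgTwo.ext <;> simp (maxDischargeDepth := 9) [h]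
    map_wl := fun g x h => by
      have e : (coalgModif G x).tgt.tgt = (coalgPs G g).src := by simp [h]
      refine Modif.ext (by simp [e, h, coalgPs_comp]) (by simp [e, h, coalgPs_comp])
        ((funext fun (s : Pseudocoalgebra G _) => ?_).trans (funext (Modif.wl_app e)).symm)
      change s.whisk₂ _ = PseudocoalgTwo.wl (s.whisk g) (s.whisk₂ x)
      apply PseudocoalgTwo.ext <;> (try apply PseudocoalgHom.ext) <;>
        simp (maxDischargeDepth := 9) [h]
    map_wr := fun x f h => by
      have e : (coalgPs G f).tgt = (coalgModif G x).tgt.src := by simp [h]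
      refine Modif.ext (by simp [e, h, coalgPs_comp]) (by simp [e, h, coalgPs_comp])
        ((funext fun (s : Pseudocoalgebra G _) => ?_).trans (funext (Modif.wr_app e)).symm)
      change s.whisk₂ _ = (s.whisk₂ x).wr (s.whisk f)
      apply PseudocoalgTwo.ext <;> (try apply PseudocoalgHom.ext) <;>
        simp (maxDischargeDepth := 9) [h]
    ob_one := fun A => by
      refine TwoFunctor.ext (funext fun (s : Pseudocoalgebra G _) => ?_)
        (funext fun (f : PseudocoalgHom G _) => ?_) (funext fun (x : PseudocoalgTwo G _) => ?_)
      · change s.base _ = s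
        apply Pseudocoalgebra.ext <;> simp
      · change f.base _ = f
        apply PseudocoalgHom.ext <;> (try apply Pseudocoalgebra.ext) <;> simp
      · change x.base _ = x
        apply PseudocoalgTwo.ext <;> (try apply PseudocoalgHom.ext) <;>
          (try apply Pseudocoalgebra.ext) <;> simp
    ob_comp := fun F L => coalgBase_comp G F L
    one_pre := fun f L => coalgPs_pre G f L
    one_post := fun F g => coalgPs_post G F g
    two_pre := fun x L => by
      refine Modif.ext (by simp [coalgPs_pre]) (by simp [coalgPs_pre])
        (funext fun (s : Pseudocoalgebra G _) => ?_)
      change s.whisk₂ _ = (s.whisk₂ x).base L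
      apply PseudocoalgTwo.ext <;> (try apply PseudocoalgHom.ext) <;>
        (try apply Pseudocoalgebra.ext) <;> simp
    two_post := fun F y => by
      refine Modif.ext (by simp [coalgPs_post]) (by simp [coalgPs_post])
        (funext fun (s : Pseudocoalgebra G _) => ?_)
      change s.whisk₂ _ = (s.base F).whisk₂ y
      apply PseudocoalgTwo.ext <;> (try apply PseudocoalgHom.ext) <;>
        (try apply Pseudocoalgebra.ext) <;> simp
    two_ix := fun f g => by
      refine Modif.ext ?_ ?_ (funext fun (s : Pseudocoalgebra G _) => ?_)
      · simp (maxDischargeDepth := 9) [coalgPs_comp, coalgPs_pre, coalgPs_post]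
      · simp (maxDischargeDepth := 9) [coalgPs_comp, coalgPs_pre, coalgPs_post]
      · change s.whisk₂ _ = (s.whisk f).whisk g
        apply PseudocoalgTwo.ext <;> (try apply PseudocoalgHom.ext) <;>
          (try apply Pseudocoalgebra.ext) <;> simp (maxDischargeDepth := 9) }

/-- The forgetful 2-functor from pseudocoalgebras with domain `A` to `K(A, B)`. -/
@[simps] noncomputable def coalgForget {K : GrayCat.{u, w}} {B : K.Obj} (G : Pseudocomonad K B)
    (A : K.Obj) : TwoFunctor (coalgTwoCat G A) (K.hom A B) where
  ob s := s.s
  one f := f.h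
  two x := x.ξ
  src_one f := f.src_h
  tgt_one f := f.tgt_h
  src_two x := x.src_ξ
  tgt_two x := x.tgt_ξ
  map_id _ := rfl
  map_comp _ _ h := PseudocoalgHom.comp_h h
  map_id₂ _ := rfl
  map_vcomp _ _ h := PseudocoalgTwo.vcomp_ξ h
  map_wl _ _ h := PseudocoalgTwo.wl_ξ h
  map_wr _ _ h := PseudocoalgTwo.wr_ξ h

/-- The forgetful Gray-natural transformation `U : G-CoAlg → K(-, B)`. -/
noncomputable def forgetCo {K : GrayCat.{u, w}} {B : K.Obj} (G : Pseudocomonad K B) :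
    GrayNat (coalgGray G) (repGray K B) where
  app A := coalgForget G A
  naturality A A' := by
    have h : ∀ k : (K.hom A' A).Ob,
        (coalgForget G A').comp (coalgBase G k) = (K.pre k).comp (coalgForget G A) := fun k =>
      TwoFunctor.ext (funext fun s => (K.pre_ob k s.s).symm) rfl rfl
    have h' : ∀ k : (K.hom A' A).One, PsNat.post (coalgForget G A') (coalgPs G k) =
        PsNat.pre (coalgForget G A) (repPs B k) := fun k =>
      PsNat.ext (h _) (h _) rfl rfl
    exact TwoFunctor.ext (funext h) (funext h') (funext fun x => Modif.ext (h' _) (h' _) rfl)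

/-! ### Pseudoadjunctions and pseudo-mates -/

/-- The data of a pseudoadjunction `F ⊣ U : A → B`: the 1-cells `F : B → A` and `U : A → B`, the
unit `i : 1 ⇒ UF`, the counit `e : FU ⇒ 1`, and the 3-cells `I` and `E` filling the two
triangles. -/
structure AdjData (K : GrayCat.{u, w}) (A B : K.Obj) where
  F : (K.hom B A).Ob
  U : (K.hom A B).Ob
  i : (K.hom B B).One
  e : (K.hom A A).One
  I : (K.hom A B).Two
  E : (K.hom B A).Two

/-- A pseudoadjunction `I, E, i, e : F ⊣ U : A → B`, with invertible 3-cells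
`I : 1_U ⇛ Ue ∘ iU` and `E : eF ∘ Fi ⇛ 1_F` satisfying the two swallowtail (coherence) laws. -/
structure Pseudoadjunction (K : GrayCat.{u, w}) {A B : K.Obj} (F : (K.hom B A).Ob)
    (U : (K.hom A B).Ob) where
  i : (K.hom B B).One
  e : (K.hom A A).One
  I : (K.hom A B).Two
  E : (K.hom B A).Two
  src_i : (K.hom B B).src i = K.one B
  tgt_i : (K.hom B B).tgt i = U ⋆ F
  src_e : (K.hom A A).src e = F ⋆ U
  tgt_e : (K.hom A A).tgt e = K.one A
  src_I : (K.hom A B).src₂ I = (K.hom A B).id U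
  tgt_I : (K.hom A B).tgt₂ I = U ⋆ₗ e ∘₁ i ⋆ᵣ U
  src_E : (K.hom B A).src₂ E = e ⋆ᵣ F ∘₁ F ⋆ₗ i
  tgt_E : (K.hom B A).tgt₂ E = (K.hom B A).id F
  I_iso : TwoCat.IsIso I
  E_iso : TwoCat.IsIso E
  swallowtail_counit : (e ◁ (E ⋆ᵣᵣ U)) ∘₂ (TwoCat.inv (K.ix e e) ▷ (F ⋆ₗ i ⋆ᵣ U)) ∘₂
    (e ◁ (F ⋆ₗₗ I)) = (K.hom A A).id₂ e
  swallowtail_unit : ((U ⋆ₗₗ E) ▷ i) ∘₂ ((U ⋆ₗ e ⋆ᵣ F) ◁ TwoCat.inv (K.ix i i)) ∘₂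
    ((I ⋆ᵣᵣ F) ▷ i) = (K.hom B B).id₂ i

/-- The data underlying a pseudoadjunction. -/
def Pseudoadjunction.data {K : GrayCat.{u, w}} {A B : K.Obj} {F : (K.hom B A).Ob}
    {U : (K.hom A B).Ob} (P : Pseudoadjunction K F U) : AdjData K A B where
  F := F
  U := U
  i := P.i
  e := P.e
  I := P.I
  E := P.E

namespace AdjData

variable {K : GrayCat.{u, w}} {A B C : K.Obj}

/-- The identity pseudoadjunction. -/
def id (K : GrayCat.{u, w}) (B : K.Obj) : AdjData K B B where
  F := K.one B
  U := K.one B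
  i := (K.hom B B).id (K.one B)
  e := (K.hom B B).id (K.one B)
  I := (K.hom B B).id₂ ((K.hom B B).id (K.one B))
  E := (K.hom B B).id₂ ((K.hom B B).id (K.one B))

/-- The composite `FF' ⊣ U'U : A → C` of `F ⊣ U : A → B` and `F' ⊣ U' : B → C`. -/
noncomputable def comp (P : AdjData K A B) (P' : AdjData K B C) : AdjData K A C where
  F := P.F ⋆ P'.F
  U := P'.U ⋆ P.U
  i := P'.U ⋆ₗ P.i ⋆ᵣ P'.F ∘₁ P'.i
  e := P.e ∘₁ P.F ⋆ₗ P'.e ⋆ᵣ P.U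
  I := ((P'.U ⋆ₗ P.U ⋆ₗ P.e) ◁ (P'.U ⋆ₗₗ TwoCat.inv (K.ix P.i P'.e) ⋆ᵣᵣ P.U) ▷
      (P'.i ⋆ᵣ P'.U ⋆ᵣ P.U)) ∘₂
    ((P'.U ⋆ₗₗ P.I) ▷ (P'.U ⋆ₗ P'.e ⋆ᵣ P.U ∘₁ P'.i ⋆ᵣ P'.U ⋆ᵣ P.U)) ∘₂ (P'.I ⋆ᵣᵣ P.U)
  E := (P.F ⋆ₗₗ P'.E) ∘₂
    ((P.E ⋆ᵣᵣ P'.F) ▷ (P.F ⋆ₗ P'.e ⋆ᵣ P'.F ∘₁ P.F ⋆ₗ P'.F ⋆ₗ P'.i)) ∘₂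
    ((P.e ⋆ᵣ P.F ⋆ᵣ P'.F) ◁ (P.F ⋆ₗₗ TwoCat.inv (K.ix P'.e P.i) ⋆ᵣᵣ P'.F) ▷
      (P.F ⋆ₗ P'.F ⋆ₗ P'.i))

/-- The pseudo-mate `Φ(ζ) = U'e ∘ U'ζU ∘ i'U : U ⇒ U'` of `ζ : F' ⇒ F`, for `F ⊣ U` and
`F' ⊣ U'`. -/
noncomputable def mate (P P' : AdjData K A B) (ζ : (K.hom B A).One) : (K.hom A B).One :=
  P'.U ⋆ₗ P.e ∘₁ P'.U ⋆ₗ ζ ⋆ᵣ P.U ∘₁ P'.i ⋆ᵣ P.U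

/-- The pseudo-mate of a 3-cell. -/
noncomputable def mate₂ (P P' : AdjData K A B) (x : (K.hom B A).Two) : (K.hom A B).Two :=
  (P'.U ⋆ₗ P.e) ◁ (P'.U ⋆ₗₗ x ⋆ᵣᵣ P.U) ▷ (P'.i ⋆ᵣ P.U)

/-- For `F ⊣ U`, `F' ⊣ U'` between `A` and `B`, `F₁ ⊣ U₁`, `F₁' ⊣ U₁'` between `B` and `C`,
`ζ : F' ⇒ F` and `ζ₁ : F₁' ⇒ F₁`, the invertible 3-cell
`U₁' Φ(ζ) ∘ Φ(ζ₁) U ⇛ Φ(ζF₁ ∘ F'ζ₁)` expressing that mates respect horizontal composition. -/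
noncomputable def mateX (P P' : AdjData K A B) (P₁ P₁' : AdjData K B C) (ζ : (K.hom B A).One)
    (ζ₁ : (K.hom C B).One) : (K.hom A C).Two :=
  ((P₁'.U ⋆ₗ P'.U ⋆ₗ P.e) ◁ (P₁'.U ⋆ₗₗ P'.U ⋆ₗₗ TwoCat.inv (K.ix ζ P₁.e) ⋆ᵣᵣ P.U) ▷
    (P₁'.U ⋆ₗ P'.U ⋆ₗ P'.F ⋆ₗ ζ₁ ⋆ᵣ P₁.U ⋆ᵣ P.U ∘₁ P₁'.U ⋆ₗ P'.i ⋆ᵣ P₁'.F ⋆ᵣ P₁.U ⋆ᵣ P.U ∘₁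
      P₁'.i ⋆ᵣ P₁.U ⋆ᵣ P.U)) ∘₂
  ((P₁'.U ⋆ₗ P'.U ⋆ₗ P.e ∘₁ P₁'.U ⋆ₗ P'.U ⋆ₗ ζ ⋆ᵣ P.U ∘₁
      P₁'.U ⋆ₗ P'.U ⋆ₗ P'.F ⋆ₗ P₁.e ⋆ᵣ P.U) ◁
    (P₁'.U ⋆ₗₗ TwoCat.inv (K.ix P'.i ζ₁) ⋆ᵣᵣ P₁.U ⋆ᵣᵣ P.U) ▷ (P₁'.i ⋆ᵣ P₁.U ⋆ᵣ P.U)) ∘₂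
  ((P₁'.U ⋆ₗ P'.U ⋆ₗ P.e ∘₁ P₁'.U ⋆ₗ P'.U ⋆ₗ ζ ⋆ᵣ P.U) ◁
    (P₁'.U ⋆ₗₗ TwoCat.inv (K.ix P'.i P₁.e) ⋆ᵣᵣ P.U) ▷
    (P₁'.U ⋆ₗ ζ₁ ⋆ᵣ P₁.U ⋆ᵣ P.U ∘₁ P₁'.i ⋆ᵣ P₁.U ⋆ᵣ P.U))

/-- For `F ⊣ U`, `F' ⊣ U'`, `F'' ⊣ U''`, `ζ : F' ⇒ F` and `ζ' : F'' ⇒ F'`, the invertible 3-cell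
`Φ(ζ') ∘ Φ(ζ) ⇛ Φ(ζ ∘ ζ')` expressing that mates respect vertical composition. -/
noncomputable def mateY (P P' P'' : AdjData K A B) (ζ ζ' : (K.hom B A).One) : (K.hom A B).Two :=
  ((P''.U ⋆ₗ P.e ∘₁ P''.U ⋆ₗ ζ ⋆ᵣ P.U) ◁ (P''.U ⋆ₗₗ P'.E ⋆ᵣᵣ P.U) ▷
    (P''.U ⋆ₗ ζ' ⋆ᵣ P.U ∘₁ P''.i ⋆ᵣ P.U)) ∘₂
  ((P''.U ⋆ₗₗ TwoCat.inv (K.ix P'.e (P.e ∘₁ ζ ⋆ᵣ P.U))) ▷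
    (P''.U ⋆ₗ P'.F ⋆ₗ P'.i ⋆ᵣ P.U ∘₁ P''.U ⋆ₗ ζ' ⋆ᵣ P.U ∘₁ P''.i ⋆ᵣ P.U)) ∘₂
  ((P''.U ⋆ₗ P'.e) ◁ (P''.U ⋆ₗₗ TwoCat.inv (K.ix ζ' (mate P P' ζ))) ▷ (P''.i ⋆ᵣ P.U)) ∘₂
  ((P''.U ⋆ₗ P'.e ∘₁ P''.U ⋆ₗ ζ' ⋆ᵣ P'.U) ◁ TwoCat.inv (K.ix P''.i (mate P P' ζ)))

end AdjData

section MateComonad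

variable {K : GrayCat.{u, w}} {B : K.Obj} (T : Pseudomonad K B) {G : (K.hom B B).Ob}
  (adj : Pseudoadjunction K T.T G)

/-- The counit `ε = Φ(η) : G ⇒ 1`. -/
noncomputable def mateCounit : (K.hom B B).One :=
  AdjData.mate adj.data (AdjData.id K B) T.η

/-- The comultiplication `δ = Φ(μ) : G ⇒ GG`. -/
noncomputable def mateComult : (K.hom B B).One :=
  AdjData.mate adj.data (adj.data.comp adj.data) T.μ

/-- The 3-cell `Gε ∘ δ ⇛ 1` induced by `λ`: the composite
`Gε ∘ δ ⇛ Gε ∘ Φ(1)G ∘ δ ⇛ Φ(ηT) ∘ Φ(μ) ⇛ Φ(μ ∘ ηT) ⇛ Φ(1) ⇛ 1`. -/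
noncomputable def mateLam : (K.hom B B).Two :=
  TwoCat.inv adj.I ∘₂
  AdjData.mate₂ adj.data adj.data T.lam ∘₂
  AdjData.mateY adj.data (adj.data.comp adj.data) adj.data T.μ (T.η ⋆ᵣ T.T) ∘₂
  (AdjData.mateX adj.data (AdjData.id K B) adj.data adj.data T.η ((K.hom B B).id T.T) ▷
    mateComult T adj) ∘₂
  ((G ⋆ₗ mateCounit T adj) ◁ (adj.I ⋆ᵣᵣ G) ▷ mateComult T adj)

/-- The 3-cell `1 ⇛ εG ∘ δ` induced by `ρ`: the composite
`1 ⇛ Φ(1) ⇛ Φ(μ ∘ Tη) ⇛ Φ(Tη) ∘ Φ(μ) ⇛ Φ(1) ∘ εG ∘ δ ⇛ εG ∘ δ`. -/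
noncomputable def mateRho : (K.hom B B).Two :=
  (TwoCat.inv adj.I ▷ (mateCounit T adj ⋆ᵣ G ∘₁ mateComult T adj)) ∘₂
  (TwoCat.inv (AdjData.mateX adj.data adj.data adj.data (AdjData.id K B) ((K.hom B B).id T.T)
    T.η) ▷ mateComult T adj) ∘₂
  TwoCat.inv (AdjData.mateY adj.data (adj.data.comp adj.data) adj.data T.μ (T.T ⋆ₗ T.η)) ∘₂
  AdjData.mate₂ adj.data adj.data T.rho ∘₂
  adj.I

/-- The 3-cell `δG ∘ δ ⇛ Gδ ∘ δ` induced by `α`: the composite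
`δG ∘ δ ⇛ GGΦ(1) ∘ δG ∘ δ ⇛ Φ(Tμ) ∘ Φ(μ) ⇛ Φ(μ ∘ Tμ) ⇛ Φ(μ ∘ μT) ⇛ Φ(μT) ∘ Φ(μ) ⇛
Gδ ∘ Φ(1)G ∘ δ ⇛ Gδ ∘ δ`. -/
noncomputable def mateAlpha : (K.hom B B).Two :=
  ((G ⋆ₗ mateComult T adj) ◁ (TwoCat.inv adj.I ⋆ᵣᵣ G) ▷ mateComult T adj) ∘₂
  (TwoCat.inv (AdjData.mateX adj.data (adj.data.comp adj.data) adj.data adj.data T.μ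
    ((K.hom B B).id T.T)) ▷ mateComult T adj) ∘₂
  TwoCat.inv (AdjData.mateY adj.data (adj.data.comp adj.data)
    ((adj.data.comp adj.data).comp adj.data) T.μ (T.μ ⋆ᵣ T.T)) ∘₂
  AdjData.mate₂ adj.data ((adj.data.comp adj.data).comp adj.data) T.alpha ∘₂
  AdjData.mateY adj.data (adj.data.comp adj.data) (adj.data.comp (adj.data.comp adj.data)) T.μ
    (T.T ⋆ₗ T.μ) ∘₂
  (AdjData.mateX adj.data adj.data adj.data (adj.data.comp adj.data) ((K.hom B B).id T.T) T.μ ▷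
    mateComult T adj) ∘₂
  ((G ⋆ₗₗ G ⋆ₗₗ adj.I) ▷ (mateComult T adj ⋆ᵣ G ∘₁ mateComult T adj))

/-- The pseudocomonad data on a right pseudoadjoint `G` of a pseudomonad `T` given by the
pseudo-mates.  Taking mates reverses the order of the 1-cell composition in
`λ : μ ∘ ηT ⇛ 1`, `ρ : 1 ⇛ μ ∘ Tη` and `α : μ ∘ Tμ ⇛ μ ∘ μT`; in the orientation chosen for
pseudocomonads the 3-cells are therefore the inverses of the mates of `ρ`, `λ`, `α`. -/
noncomputable def mateComonadData : PseudocomonadData K B where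
  G := G
  ε := mateCounit T adj
  δ := mateComult T adj
  lam := TwoCat.inv (mateRho T adj)
  rho := TwoCat.inv (mateLam T adj)
  alpha := TwoCat.inv (mateAlpha T adj)

end MateComonad

set_option linter.unusedSimpArgs false
set_option linter.checkUnivs false

open TwoCat

/-! ### Vertical composition as a total operation -/

namespace TwoCat

variable {X : TwoCat.{w}}

open Classical in
/-- The partial function `z ↦ x ∘₂ z` on 2-cells.  On composable 2-cells it turns the partial
operation of vertical composition into multiplication in a monoid. -/
noncomputable def act (x : X.Two) : Function.End (Option X.Two) := fun o =>
  o.bind fun z => if X.tgt₂ z = X.src₂ x then some (x ∘₂ z) else none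

@[simp] theorem act_vcomp (y x : X.Two) (h : X.tgt₂ x = X.src₂ y) :
    act (y ∘₂ x) = act y * act x := by
  funext o
  cases o with
  | none => rfl
  | some z =>
    change _ = act y (act x (some z))
    by_cases e : X.tgt₂ z = X.src₂ x <;> simp [act, h, e]

theorem act_injective {x y : X.Two} (h : act x = act y) : x = y := by
  have := congrFun h (some (X.id₂ (X.src₂ x)))
  by_cases e : X.src₂ x = X.src₂ y
  · simpa [act, e] using this
  · simp [act, e] at this

theorem act_eq {x y : X.Two} (h : x = y) : act x = act y := congrArg act h

@[simp] theorem act_id_mul (f : X.One) (x : X.Two) (h : X.tgt₂ x = f) :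
    act (X.id₂ f) * act x = act x := by
  rw [← act_vcomp _ _ (by simp [h]), id_vcomp' _ _ h]

@[simp] theorem act_id_mul_assoc (f : X.One) (x : X.Two) (h : X.tgt₂ x = f)
    (z : Function.End (Option X.Two)) : act (X.id₂ f) * (act x * z) = act x * z := by
  rw [← mul_assoc, act_id_mul f x h]

@[simp] theorem act_mul_id (f : X.One) (x : X.Two) (h : X.src₂ x = f) :
    act x * act (X.id₂ f) = act x := by
  rw [← act_vcomp _ _ (by simp [h]), vcomp_id' _ _ h]

theorem act_inv_mul {x : X.Two} (h : IsIso x) : act (inv x) * act x = act (X.id₂ (X.src₂ x)) := by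
  rw [← act_vcomp _ _ (by simp [h]), inv_vcomp h]

theorem act_mul_inv {x : X.Two} (h : IsIso x) : act x * act (inv x) = act (X.id₂ (X.tgt₂ x)) := by
  rw [← act_vcomp _ _ (by simp [h]), vcomp_inv h]

theorem act_interchange (y x : X.Two) (h : X.tgt (X.tgt₂ x) = X.src (X.tgt₂ y)) :
    act (X.tgt₂ y ◁ x) * act (y ▷ X.src₂ x) = act (y ▷ X.tgt₂ x) * act (X.src₂ y ◁ x) := by
  have := act_eq (X.interchange y x h)
  rwa [act_vcomp _ _ (by simp [h]), act_vcomp _ _ (by simp [h])] at this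

/-- Cancelling an invertible 2-cell on the left. -/
theorem act_cancel_left {a x y : X.Two} (ha : IsIso a) (hx : X.tgt₂ x = X.src₂ a)
    (hy : X.tgt₂ y = X.src₂ a) (h : act a * act x = act a * act y) : x = y := by
  have := congrArg (fun z => act (inv a) * z) h
  simp only [← mul_assoc, act_inv_mul ha] at this
  rw [act_id_mul _ _ hx, act_id_mul _ _ hy] at this
  exact act_injective this

/-- Cancelling an invertible 2-cell on the right. -/
theorem act_cancel_right {a x y : X.Two} (ha : IsIso a) (hx : X.src₂ x = X.tgt₂ a)
    (hy : X.src₂ y = X.tgt₂ a) (h : act x * act a = act y * act a) : x = y := by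
  have := congrArg (fun z => z * act (inv a)) h
  simp only [mul_assoc, act_mul_inv ha] at this
  rw [act_mul_id _ _ hx, act_mul_id _ _ hy] at this
  exact act_injective this

end TwoCat

theorem mul_reassoc {M : Type*} [Semigroup M] {a b c d : M} (h : a * b = c * d) (z : M) :
    a * (b * z) = c * (d * z) := by
  rw [← mul_assoc, h, mul_assoc]

theorem mul_reassoc_left {M : Type*} [Semigroup M] {a b c : M} (h : a * b = c) (z : M) :
    a * (b * z) = c * z := by
  rw [← mul_assoc, h]

theorem mul_reassoc₃ {M : Type*} [Semigroup M] {a b c d e f : M}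
    (h : a * (b * c) = d * (e * f)) (z : M) : a * (b * (c * z)) = d * (e * (f * z)) := by
  simpa only [mul_assoc] using congrArg (· * z) h

namespace GrayCat

variable {K : GrayCat.{u, w}} {A B C : K.Obj}

end GrayCat

/-! ### Adjunction data -/

namespace AdjData

variable {K : GrayCat.{u, w}} {A B C D : K.Obj}

/-- The unit, the counit and the 3-cell `E` of an adjunction datum have the expected sources and
targets, and `E` is invertible. -/
class IsTyped (P : AdjData K A B) : Prop where
  src_i : (K.hom B B).src P.i = K.one B
  tgt_i : (K.hom B B).tgt P.i = P.U ⋆ P.F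
  src_e : (K.hom A A).src P.e = P.F ⋆ P.U
  tgt_e : (K.hom A A).tgt P.e = K.one A
  src_E : (K.hom B A).src₂ P.E = P.e ⋆ᵣ P.F ∘₁ P.F ⋆ₗ P.i
  tgt_E : (K.hom B A).tgt₂ P.E = (K.hom B A).id P.F
  E_iso : TwoCat.IsIso P.E

attribute [simp] IsTyped.src_i IsTyped.tgt_i IsTyped.src_e IsTyped.tgt_e IsTyped.src_E
  IsTyped.tgt_E IsTyped.E_iso

/-- The comparison `e ∘ F(Uf ∘ i) ⇛ f` for `f : Fs ⇒ t`. -/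
noncomputable def cmp (P : AdjData K A B) (s : (K.hom D B).Ob) (f : (K.hom D A).One) :
    (K.hom D A).Two :=
  (f ◁ (P.E ⋆ᵣᵣ s)) ∘₂ (TwoCat.inv (K.ix P.e f) ▷ (P.F ⋆ₗ P.i ⋆ᵣ s))

section cmp

variable (P : AdjData K A B) [P.IsTyped] {s s' : (K.hom D B).Ob} {f g : (K.hom D A).One}

@[simp] theorem src_cmp (hf : (K.hom D A).src f = P.F ⋆ s) : (K.hom D A).src₂ (P.cmp s f) =
    P.e ⋆ᵣ (K.hom D A).tgt f ∘₁ P.F ⋆ₗ P.U ⋆ₗ f ∘₁ P.F ⋆ₗ P.i ⋆ᵣ s := by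
  simp (maxDischargeDepth := 9) [cmp, hf]

@[simp] theorem tgt_cmp (hf : (K.hom D A).src f = P.F ⋆ s) :
    (K.hom D A).tgt₂ (P.cmp s f) = f := by
  simp (maxDischargeDepth := 9) [cmp, hf]

@[simp] theorem isIso_cmp (hf : (K.hom D A).src f = P.F ⋆ s) : TwoCat.IsIso (P.cmp s f) := by
  simp (maxDischargeDepth := 9) [cmp, hf]

end cmp

/-- The 3-cell `(Uf ∘ i) ∘ h ⇛ Ug ∘ i` induced by `x : f ∘ Fh ⇛ g`. -/
noncomputable def curry (P : AdjData K A B) (s : (K.hom D B).Ob) (f : (K.hom D A).One)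
    (h : (K.hom D B).One) (x : (K.hom D A).Two) : (K.hom D B).Two :=
  ((P.U ⋆ₗₗ x) ▷ (P.i ⋆ᵣ s)) ∘₂ ((P.U ⋆ₗ f) ◁ TwoCat.inv (K.ix P.i h))

section curry

variable (P : AdjData K A B) [P.IsTyped] {s s' : (K.hom D B).Ob} {f : (K.hom D A).One}
  {h : (K.hom D B).One} {x : (K.hom D A).Two}

theorem src_curry (hf : (K.hom D A).src f = P.F ⋆ s') (hs : (K.hom D B).src h = s)
    (ht : (K.hom D B).tgt h = s') (hx : (K.hom D A).src₂ x = f ∘₁ P.F ⋆ₗ h) :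
    (K.hom D B).src₂ (P.curry s f h x) = P.U ⋆ₗ f ∘₁ P.i ⋆ᵣ s' ∘₁ h := by
  simp (maxDischargeDepth := 9) [curry, hf, hs, ht, hx, ← TwoCat.src_src₂]

end curry

end AdjData

namespace AdjData

variable {K : GrayCat.{u, w}} {A B C D : K.Obj}

section mates

variable (P P' P'' : AdjData K A B) [P.IsTyped] [P'.IsTyped] [P''.IsTyped]
  {ζ ζ' : (K.hom B A).One}

@[simp] theorem src_mate (hs : (K.hom B A).src ζ = P'.F) (ht : (K.hom B A).tgt ζ = P.F) :
    (K.hom A B).src (P.mate P' ζ) = P.U := by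
  simp (maxDischargeDepth := 9) [mate, hs, ht]

@[simp] theorem tgt_mate (hs : (K.hom B A).src ζ = P'.F) (ht : (K.hom B A).tgt ζ = P.F) :
    (K.hom A B).tgt (P.mate P' ζ) = P'.U := by
  simp (maxDischargeDepth := 9) [mate, hs, ht]

theorem mateY_eq (hs : (K.hom B A).src ζ = P'.F) (ht : (K.hom B A).tgt ζ = P.F)
    (hs' : (K.hom B A).src ζ' = P''.F) (ht' : (K.hom B A).tgt ζ' = P'.F) :
    mateY P P' P'' ζ ζ' = P''.curry P.U (P'.e ∘₁ ζ' ⋆ᵣ P'.U) (P.mate P' ζ)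
      ((P'.cmp P.U (P.e ∘₁ ζ ⋆ᵣ P.U) ▷ ζ' ⋆ᵣ P.U) ∘₂
        (P'.e ◁ TwoCat.inv (K.ix ζ' (P.mate P' ζ)))) := by
  obtain ⟨p, hp⟩ : ∃ p, p = P.e ∘₁ ζ ⋆ᵣ P.U := ⟨_, rfl⟩
  obtain ⟨m, hm⟩ : ∃ m, m = P.mate P' ζ := ⟨_, rfl⟩
  have e : P''.U ⋆ₗ P.e ∘₁ P''.U ⋆ₗ ζ ⋆ᵣ P.U = P''.U ⋆ₗ p := by simp [hp, hs, ht]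
  have h1 : (K.hom A A).src p = P'.F ⋆ P.U := by simp [hp, hs, ht]
  have h2 : (K.hom A A).tgt p = K.one A := by simp [hp, hs, ht]
  have h3 : (K.hom A B).src m = P.U := by simp [hm, hs, ht]
  have h4 : (K.hom A B).tgt m = P'.U := by simp [hm, hs, ht]
  have hF : P'.F ⋆ₗ m = P'.F ⋆ₗ P'.U ⋆ₗ p ∘₁ P'.F ⋆ₗ P'.i ⋆ᵣ P.U := by
    simp (maxDischargeDepth := 9) [hm, mate, hp, hs, ht]
  rw [mateY, e, ← hm, ← hp]
  clear hp hm e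
  simp (maxDischargeDepth := 20) [curry, cmp, h1, h2, h3, h4, hF, hs', ht']

theorem mateX_eq (P₁ P₁' : AdjData K B C) [P₁.IsTyped] [P₁'.IsTyped] {ζ₁ : (K.hom C B).One}
    (hs : (K.hom B A).src ζ = P'.F) (ht : (K.hom B A).tgt ζ = P.F)
    (hs' : (K.hom C B).src ζ₁ = P₁'.F) (ht' : (K.hom C B).tgt ζ₁ = P₁.F) :
    mateX P P' P₁ P₁' ζ ζ₁ = (P₁'.U ⋆ₗₗ P'.curry (P₁'.F ⋆ P₁.U ⋆ P.U) (P.e ∘₁ ζ ⋆ᵣ P.U)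
      ((P₁.e ∘₁ ζ₁ ⋆ᵣ P₁.U) ⋆ᵣ P.U) (P.e ◁ (TwoCat.inv (K.ix ζ P₁.e) ⋆ᵣᵣ P.U) ▷
        (P'.F ⋆ₗ ζ₁ ⋆ᵣ P₁.U ⋆ᵣ P.U))) ▷ (P₁'.i ⋆ᵣ P₁.U ⋆ᵣ P.U) := by
  simp (maxDischargeDepth := 20) [mateX, curry, hs, ht, hs', ht']

end mates
end AdjData

/-! ### Cells with prescribed 0-dimensional boundary -/

namespace TwoCat

/-- The 1-cells `a → b`. -/
@[ext] structure Hom (X : TwoCat.{w}) (a b : X.Ob) where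
  val : X.One
  src_val : X.src val = a
  tgt_val : X.tgt val = b

/-- The 2-cells between 1-cells `a → b`. -/
@[ext] structure Cell (X : TwoCat.{w}) (a b : X.Ob) where
  val : X.Two
  src_val : X.src (X.tgt₂ val) = a
  tgt_val : X.tgt (X.tgt₂ val) = b

attribute [simp] Hom.src_val Hom.tgt_val Cell.src_val Cell.tgt_val

variable {X Y : TwoCat.{w}} {a b c e : X.Ob}

namespace Hom

/-- The identity 1-cell. -/
@[simps] def id (a : X.Ob) : X.Hom a a := ⟨X.id a, by simp, by simp⟩

/-- Composition of 1-cells. -/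
@[simps] def comp (g : X.Hom b c) (f : X.Hom a b) : X.Hom a c :=
  ⟨g.val ∘₁ f.val, by simp, by simp⟩

end Hom

infixr:80 " ⊚ " => Hom.comp

namespace Hom

@[simp] theorem comp_id (f : X.Hom a b) : f ⊚ id a = f := Hom.ext (by simp)
@[simp] theorem id_comp (f : X.Hom a b) : id b ⊚ f = f := Hom.ext (by simp)
@[simp] theorem comp_assoc (h : X.Hom c e) (g : X.Hom b c) (f : X.Hom a b) :
    (h ⊚ g) ⊚ f = h ⊚ g ⊚ f := Hom.ext (by simp)

end Hom

namespace Cell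

/-- The source of a 2-cell. -/
@[simps] def dom (x : X.Cell a b) : X.Hom a b := ⟨X.src₂ x.val, by simp, by simp⟩

/-- The target of a 2-cell. -/
@[simps] def cod (x : X.Cell a b) : X.Hom a b := ⟨X.tgt₂ x.val, by simp, by simp⟩

/-- The identity 2-cell. -/
@[simps] def id (f : X.Hom a b) : X.Cell a b := ⟨X.id₂ f.val, by simp, by simp⟩

theorem composable {y x : X.Cell a b} (h : x.cod = y.dom) : X.tgt₂ x.val = X.src₂ y.val :=
  congrArg Hom.val h

open Classical in
/-- Vertical composition. -/
noncomputable def vcomp (y x : X.Cell a b) : X.Cell a b :=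
  if h : x.cod = y.dom then
    ⟨y.val ∘₂ x.val, by simp [composable h], by simp [composable h]⟩
  else x

/-- Left whiskering. -/
@[simps] def wl (g : X.Hom b c) (x : X.Cell a b) : X.Cell a c := ⟨g.val ◁ x.val, by simp, by simp⟩

/-- Right whiskering. -/
@[simps] def wr (x : X.Cell b c) (f : X.Hom a b) : X.Cell a c := ⟨x.val ▷ f.val, by simp, by simp⟩

/-- Invertibility. -/
def IsIso (x : X.Cell a b) : Prop := TwoCat.IsIso x.val

/-- The inverse of an invertible 2-cell. -/
@[simps] noncomputable def inv (x : X.Cell a b) : X.Cell a b :=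
  ⟨TwoCat.inv x.val,
    by by_cases h : TwoCat.IsIso x.val
       · simp [h]
       · simp [TwoCat.inv, h],
    by by_cases h : TwoCat.IsIso x.val
       · simp [h]
       · simp [TwoCat.inv, h]⟩

/-- The partial function `TwoCat.act` of a 2-cell. -/
noncomputable def act (x : X.Cell a b) : Function.End (Option X.Two) := TwoCat.act x.val

end Cell

infixr:70 " ⊙ " => Cell.vcomp
infixr:75 " ◃ " => Cell.wl
infixl:76 " ▹ " => Cell.wr

namespace Cell

theorem vcomp_val {y x : X.Cell a b} (h : x.cod = y.dom) : (y ⊙ x).val = y.val ∘₂ x.val := by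
  rw [vcomp, dif_pos h]

@[simp] theorem dom_id (f : X.Hom a b) : (id f).dom = f := Hom.ext (by simp)
@[simp] theorem cod_id (f : X.Hom a b) : (id f).cod = f := Hom.ext (by simp)
@[simp] theorem dom_vcomp {y x : X.Cell a b} (h : x.cod = y.dom) : (y ⊙ x).dom = x.dom :=
  Hom.ext (by simp [vcomp_val h, composable h])
@[simp] theorem cod_vcomp {y x : X.Cell a b} (h : x.cod = y.dom) : (y ⊙ x).cod = y.cod :=
  Hom.ext (by simp [vcomp_val h, composable h])
@[simp] theorem dom_wl (g : X.Hom b c) (x : X.Cell a b) : (g ◃ x).dom = g ⊚ x.dom :=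
  Hom.ext (by simp)
@[simp] theorem cod_wl (g : X.Hom b c) (x : X.Cell a b) : (g ◃ x).cod = g ⊚ x.cod :=
  Hom.ext (by simp)
@[simp] theorem dom_wr (x : X.Cell b c) (f : X.Hom a b) : (x ▹ f).dom = x.dom ⊚ f :=
  Hom.ext (by simp)
@[simp] theorem cod_wr (x : X.Cell b c) (f : X.Hom a b) : (x ▹ f).cod = x.cod ⊚ f :=
  Hom.ext (by simp)
@[simp] theorem id_wl (x : X.Cell a b) : Hom.id b ◃ x = x := Cell.ext (by simp)
@[simp] theorem wr_id (x : X.Cell a b) : x ▹ Hom.id a = x := Cell.ext (by simp)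
@[simp] theorem comp_wl (h : X.Hom c e) (g : X.Hom b c) (x : X.Cell a b) :
    (h ⊚ g) ◃ x = h ◃ g ◃ x := Cell.ext (by simp)
@[simp] theorem wr_comp (x : X.Cell c e) (g : X.Hom b c) (f : X.Hom a b) :
    x ▹ (g ⊚ f) = x ▹ g ▹ f := Cell.ext (by simp)
@[simp] theorem wl_wr (h : X.Hom c e) (x : X.Cell b c) (f : X.Hom a b) :
    (h ◃ x) ▹ f = h ◃ (x ▹ f) := Cell.ext (by simp)
@[simp] theorem wl_id (g : X.Hom b c) (f : X.Hom a b) : g ◃ id f = id (g ⊚ f) :=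
  Cell.ext (by simp)
@[simp] theorem id_wr (g : X.Hom b c) (f : X.Hom a b) : id g ▹ f = id (g ⊚ f) :=
  Cell.ext (by simp)
@[simp] theorem wl_vcomp (g : X.Hom b c) {y x : X.Cell a b} (h : x.cod = y.dom) :
    g ◃ (y ⊙ x) = (g ◃ y) ⊙ (g ◃ x) :=
  Cell.ext (by rw [vcomp_val (by simp [h]), wl_val, vcomp_val h]; simp [composable h])
@[simp] theorem vcomp_wr {y x : X.Cell b c} (f : X.Hom a b) (h : x.cod = y.dom) :
    (y ⊙ x) ▹ f = (y ▹ f) ⊙ (x ▹ f) :=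
  Cell.ext (by rw [vcomp_val (by simp [h]), wr_val, vcomp_val h]; simp [composable h])

@[simp] theorem isIso_id (f : X.Hom a b) : (id f).IsIso := TwoCat.isIso_id₂ _
@[simp] theorem isIso_wl {x : X.Cell a b} (h : x.IsIso) (g : X.Hom b c) : (g ◃ x).IsIso :=
  TwoCat.isIso_wl h _ (by simp)
@[simp] theorem isIso_wr {x : X.Cell b c} (h : x.IsIso) (f : X.Hom a b) : (x ▹ f).IsIso :=
  TwoCat.isIso_wr h _ (by simp)
@[simp] theorem isIso_vcomp {y x : X.Cell a b} (hy : y.IsIso) (hx : x.IsIso) (h : x.cod = y.dom) :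
    (y ⊙ x).IsIso := by
  rw [IsIso, vcomp_val h]; exact TwoCat.isIso_vcomp hx hy (composable h)
@[simp] theorem isIso_inv {x : X.Cell a b} (h : x.IsIso) : (inv x).IsIso := TwoCat.isIso_inv h
@[simp] theorem dom_inv {x : X.Cell a b} (h : x.IsIso) : (inv x).dom = x.cod :=
  Hom.ext (TwoCat.src_inv h)
@[simp] theorem cod_inv {x : X.Cell a b} (h : x.IsIso) : (inv x).cod = x.dom :=
  Hom.ext (TwoCat.tgt_inv h)
@[simp] theorem inv_inv {x : X.Cell a b} (h : x.IsIso) : inv (inv x) = x :=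
  Cell.ext (TwoCat.inv_inv h)
@[simp] theorem inv_wl {x : X.Cell a b} (h : x.IsIso) (g : X.Hom b c) :
    inv (g ◃ x) = g ◃ inv x := Cell.ext (TwoCat.inv_wl h _ (by simp))
@[simp] theorem inv_wr {x : X.Cell b c} (h : x.IsIso) (f : X.Hom a b) :
    inv (x ▹ f) = inv x ▹ f := Cell.ext (TwoCat.inv_wr h _ (by simp))
@[simp] theorem inv_vcomp {y x : X.Cell a b} (hy : y.IsIso) (hx : x.IsIso) (h : x.cod = y.dom) :
    inv (y ⊙ x) = inv x ⊙ inv y := by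
  refine Cell.ext ?_
  rw [vcomp_val (by simp [hx, hy, h]), inv_val, vcomp_val h]
  exact TwoCat.inv_vcomp' hx hy (composable h)

@[simp] theorem act_vcomp {y x : X.Cell a b} (h : x.cod = y.dom) :
    act (y ⊙ x) = act y * act x := by
  rw [act, vcomp_val h]; exact TwoCat.act_vcomp _ _ (composable h)

theorem act_injective {x y : X.Cell a b} (h : act x = act y) : x = y :=
  Cell.ext (TwoCat.act_injective h)

@[simp] theorem act_id_mul (f : X.Hom a b) (x : X.Cell a b) (h : x.cod = f) :
    act (id f) * act x = act x := TwoCat.act_id_mul _ _ (congrArg Hom.val h)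
@[simp] theorem act_id_mul_assoc (f : X.Hom a b) (x : X.Cell a b) (h : x.cod = f)
    (z : Function.End (Option X.Two)) : act (id f) * (act x * z) = act x * z :=
  TwoCat.act_id_mul_assoc _ _ (congrArg Hom.val h) z
@[simp] theorem act_mul_id (f : X.Hom a b) (x : X.Cell a b) (h : x.dom = f) :
    act x * act (id f) = act x := TwoCat.act_mul_id _ _ (congrArg Hom.val h)
theorem act_inv_mul {x : X.Cell a b} (h : x.IsIso) : act (inv x) * act x = act (id x.dom) :=
  TwoCat.act_inv_mul h
theorem act_mul_inv {x : X.Cell a b} (h : x.IsIso) : act x * act (inv x) = act (id x.cod) :=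
  TwoCat.act_mul_inv h

/-- The middle four interchange. -/
theorem interchange (y : X.Cell b c) (x : X.Cell a b) :
    act (y.cod ◃ x) * act (y ▹ x.dom) = act (y ▹ x.cod) * act (y.dom ◃ x) :=
  TwoCat.act_interchange _ _ (by simp)

theorem cancel_left {p x y : X.Cell a b} (hp : p.IsIso) (hx : x.cod = p.dom) (hy : y.cod = p.dom)
    (h : act p * act x = act p * act y) : x = y :=
  Cell.ext (TwoCat.act_cancel_left hp (composable hx) (composable hy) h)

theorem cancel_right {p x y : X.Cell a b} (hp : p.IsIso) (hx : x.dom = p.cod) (hy : y.dom = p.cod)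
    (h : act x * act p = act y * act p) : x = y :=
  Cell.ext (TwoCat.act_cancel_right hp (congrArg Hom.val hx) (congrArg Hom.val hy) h)

theorem act_inv_mul_assoc {p x : X.Cell a b} (hp : p.IsIso) (hx : x.cod = p.dom)
    (z : Function.End (Option X.Two)) : act (inv p) * (act p * (act x * z)) = act x * z := by
  rw [← mul_assoc, act_inv_mul hp, act_id_mul_assoc _ _ hx]

theorem act_mul_inv_assoc {p x : X.Cell a b} (hp : p.IsIso) (hx : x.cod = p.cod)
    (z : Function.End (Option X.Two)) : act p * (act (inv p) * (act x * z)) = act x * z := by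
  rw [← mul_assoc, act_mul_inv hp, act_id_mul_assoc _ _ hx]

theorem mul_cancel_left {p x y : X.Cell a b} (hp : p.IsIso) (hx : x.cod = p.dom)
    (hy : y.cod = p.dom) {z w : Function.End (Option X.Two)}
    (h : act p * (act x * z) = act p * (act y * w)) : act x * z = act y * w := by
  rw [← act_inv_mul_assoc hp hx, h, act_inv_mul_assoc hp hy]

theorem cancel_both {p q x y : X.Cell a b} (hp : p.IsIso) (hq : q.IsIso) (hx : x.cod = p.dom)
    (hy : y.cod = p.dom) (hx' : x.dom = q.cod) (hy' : y.dom = q.cod)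
    (h : act p * (act x * act q) = act p * (act y * act q)) : x = y :=
  cancel_right hq hx' hy' (mul_cancel_left hp hx hy h)

theorem eq_inv_of_vcomp {x y : X.Cell a b} (hy : y.IsIso) (hxy : y.cod = x.dom)
    (h : x ⊙ y = id y.dom) : x = inv y := by
  refine cancel_right hy hxy.symm (by simp [hy]) ?_
  rw [← act_vcomp hxy, h, act_inv_mul hy]

theorem square_inv {p q r t : X.Cell a b} (hq : q.IsIso) (hr : r.IsIso) (hpq : p.cod = q.dom)
    (hrt : r.cod = t.dom) (h : q ⊙ p = t ⊙ r) : p ⊙ inv r = inv q ⊙ t := by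
  have e : q.cod = t.cod := by rw [← cod_vcomp hpq, h, cod_vcomp hrt]
  have e' : p.dom = r.dom := by rw [← dom_vcomp hpq, h, dom_vcomp hrt]
  refine act_injective ?_
  rw [act_vcomp (by simp [hr, e']), act_vcomp (by simp [hq, e])]
  have h' := congrArg act h
  rw [act_vcomp hpq, act_vcomp hrt] at h'
  have := congrArg (fun z => act (inv q) * z * act (inv r)) h'
  simp only [mul_assoc, act_mul_inv hr] at this
  rwa [act_inv_mul_assoc hq hpq, act_mul_id _ _ hrt.symm] at this

end Cell

end TwoCat

namespace TwoFunctor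

variable {X Y : TwoCat.{w}} {a b c e : X.Ob} (F : TwoFunctor X Y)

/-- The action of a 2-functor on 1-cells. -/
@[simps] def hom (f : X.Hom a b) : Y.Hom (F.ob a) (F.ob b) := ⟨F.one f.val, by simp, by simp⟩

/-- The action of a 2-functor on 2-cells. -/
@[simps] def cell (x : X.Cell a b) : Y.Cell (F.ob a) (F.ob b) := ⟨F.two x.val, by simp, by simp⟩

@[simp] theorem hom_id (a : X.Ob) : F.hom (Hom.id a) = Hom.id (F.ob a) := Hom.ext (by simp)
@[simp] theorem hom_comp (g : X.Hom b c) (f : X.Hom a b) : F.hom (g ⊚ f) = F.hom g ⊚ F.hom f :=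
  Hom.ext (by simp)
@[simp] theorem dom_cell (x : X.Cell a b) : (F.cell x).dom = F.hom x.dom := Hom.ext (by simp)
@[simp] theorem cod_cell (x : X.Cell a b) : (F.cell x).cod = F.hom x.cod := Hom.ext (by simp)
@[simp] theorem cell_id (f : X.Hom a b) : F.cell (Cell.id f) = Cell.id (F.hom f) :=
  Cell.ext (by simp)
@[simp] theorem cell_wl (g : X.Hom b c) (x : X.Cell a b) : F.cell (g ◃ x) = F.hom g ◃ F.cell x :=
  Cell.ext (by simp)
@[simp] theorem cell_wr (x : X.Cell b c) (f : X.Hom a b) : F.cell (x ▹ f) = F.cell x ▹ F.hom f :=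
  Cell.ext (by simp)
@[simp] theorem cell_vcomp {y x : X.Cell a b} (h : x.cod = y.dom) :
    F.cell (y ⊙ x) = F.cell y ⊙ F.cell x := Cell.ext (by
  rw [Cell.vcomp_val (by simp [h]), cell_val, Cell.vcomp_val h]
  simp [Cell.composable h])
@[simp] theorem isIso_cell {x : X.Cell a b} (h : x.IsIso) : (F.cell x).IsIso := F.map_isIso h
@[simp] theorem cell_inv {x : X.Cell a b} (h : x.IsIso) :
    F.cell (Cell.inv x) = Cell.inv (F.cell x) := Cell.ext (F.map_inv h)

end TwoFunctor

/-- A pseudomonad `T` and a pseudofunctor `G` on a 2-category, with a "counit" `σ : TG ⇒ 1` such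
that `x ↦ σ ∘ Tx` is fully faithful, a comultiplication `δ` of `G` whose transpose is `σ ∘ μG` (via
`d`), and cells `lam'`, `rho'`, `alpha'` whose transposes are `rho`, `lam`, `alpha`. -/
structure Frame (X : TwoCat.{w}) where
  T : TwoFunctor X X
  G : TwoFunctor X X
  σ (t : X.Ob) : X.Hom (T.ob (G.ob t)) t
  μ (s : X.Ob) : X.Hom (T.ob (T.ob s)) (T.ob s)
  η (s : X.Ob) : X.Hom s (T.ob s)
  δ (t : X.Ob) : X.Hom (G.ob t) (G.ob (G.ob t))
  σn {s t : X.Ob} (g : X.Hom s t) : X.Cell (T.ob (G.ob s)) t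
  μn {s t : X.Ob} (g : X.Hom s t) : X.Cell (T.ob (T.ob s)) (T.ob t)
  ηn {s t : X.Ob} (g : X.Hom s t) : X.Cell s (T.ob t)
  δn {s t : X.Ob} (g : X.Hom s t) : X.Cell (G.ob s) (G.ob (G.ob t))
  dom_σn : ∀ {s t : X.Ob} (g : X.Hom s t), (σn g).dom = g ⊚ σ s
  cod_σn : ∀ {s t : X.Ob} (g : X.Hom s t), (σn g).cod = σ t ⊚ T.hom (G.hom g)
  dom_μn : ∀ {s t : X.Ob} (g : X.Hom s t), (μn g).dom = T.hom g ⊚ μ s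
  cod_μn : ∀ {s t : X.Ob} (g : X.Hom s t), (μn g).cod = μ t ⊚ T.hom (T.hom g)
  dom_ηn : ∀ {s t : X.Ob} (g : X.Hom s t), (ηn g).dom = T.hom g ⊚ η s
  cod_ηn : ∀ {s t : X.Ob} (g : X.Hom s t), (ηn g).cod = η t ⊚ g
  dom_δn : ∀ {s t : X.Ob} (g : X.Hom s t), (δn g).dom = G.hom (G.hom g) ⊚ δ s
  cod_δn : ∀ {s t : X.Ob} (g : X.Hom s t), (δn g).cod = δ t ⊚ G.hom g
  iso_σn : ∀ {s t : X.Ob} (g : X.Hom s t), (σn g).IsIso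
  iso_μn : ∀ {s t : X.Ob} (g : X.Hom s t), (μn g).IsIso
  iso_ηn : ∀ {s t : X.Ob} (g : X.Hom s t), (ηn g).IsIso
  iso_δn : ∀ {s t : X.Ob} (g : X.Hom s t), (δn g).IsIso
  σn_id : ∀ s, σn (Hom.id s) = Cell.id (σ s)
  σn_comp : ∀ {r s t : X.Ob} (g : X.Hom s t) (f : X.Hom r s),
    σn (g ⊚ f) = (σn g ▹ T.hom (G.hom f)) ⊙ (g ◃ σn f)
  μn_comp : ∀ {r s t : X.Ob} (g : X.Hom s t) (f : X.Hom r s),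
    μn (g ⊚ f) = (μn g ▹ T.hom (T.hom f)) ⊙ (T.hom g ◃ μn f)
  ηn_comp : ∀ {r s t : X.Ob} (g : X.Hom s t) (f : X.Hom r s),
    ηn (g ⊚ f) = (ηn g ▹ f) ⊙ (T.hom g ◃ ηn f)
  σn_two : ∀ {s t : X.Ob} (x : X.Cell s t), (σn x.cod) ⊙ (x ▹ σ s) =
    (σ t ◃ T.cell (G.cell x)) ⊙ (σn x.dom)
  μn_two : ∀ {s t : X.Ob} (x : X.Cell s t), (μn x.cod) ⊙ (T.cell x ▹ μ s) =
    (μ t ◃ T.cell (T.cell x)) ⊙ (μn x.dom)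
  ηn_two : ∀ {s t : X.Ob} (x : X.Cell s t), (ηn x.cod) ⊙ (T.cell x ▹ η s) =
    (η t ◃ x) ⊙ (ηn x.dom)
  lam (s : X.Ob) : X.Cell (T.ob s) (T.ob s)
  rho (s : X.Ob) : X.Cell (T.ob s) (T.ob s)
  alpha (s : X.Ob) : X.Cell (T.ob (T.ob (T.ob s))) (T.ob s)
  d (t : X.Ob) : X.Cell (T.ob (T.ob (G.ob t))) t
  lam' (t : X.Ob) : X.Cell (G.ob t) (G.ob t)
  rho' (t : X.Ob) : X.Cell (G.ob t) (G.ob t)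
  alpha' (t : X.Ob) : X.Cell (G.ob t) (G.ob (G.ob (G.ob t)))
  dom_lam : ∀ s, (lam s).dom = μ s ⊚ η (T.ob s)
  cod_lam : ∀ s, (lam s).cod = Hom.id (T.ob s)
  dom_rho : ∀ s, (rho s).dom = Hom.id (T.ob s)
  cod_rho : ∀ s, (rho s).cod = μ s ⊚ T.hom (η s)
  dom_alpha : ∀ s, (alpha s).dom = μ s ⊚ T.hom (μ s)
  cod_alpha : ∀ s, (alpha s).cod = μ s ⊚ μ (T.ob s)
  dom_d : ∀ t, (d t).dom = σ t ⊚ T.hom (σ (G.ob t)) ⊚ T.hom (T.hom (δ t))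
  cod_d : ∀ t, (d t).cod = σ t ⊚ μ (G.ob t)
  dom_lam' : ∀ t, (lam' t).dom = σ (G.ob t) ⊚ η (G.ob (G.ob t)) ⊚ δ t
  cod_lam' : ∀ t, (lam' t).cod = Hom.id (G.ob t)
  dom_rho' : ∀ t, (rho' t).dom = Hom.id (G.ob t)
  cod_rho' : ∀ t, (rho' t).cod = G.hom (σ t) ⊚ G.hom (η (G.ob t)) ⊚ δ t
  dom_alpha' : ∀ t, (alpha' t).dom = G.hom (δ t) ⊚ δ t
  cod_alpha' : ∀ t, (alpha' t).cod = δ (G.ob t) ⊚ δ t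
  iso_lam : ∀ s, (lam s).IsIso
  iso_rho : ∀ s, (rho s).IsIso
  iso_alpha : ∀ s, (alpha s).IsIso
  iso_d : ∀ s, (d s).IsIso
  iso_lam' : ∀ s, (lam' s).IsIso
  iso_rho' : ∀ s, (rho' s).IsIso
  iso_alpha' : ∀ s, (alpha' s).IsIso
  lam_n : ∀ {s t : X.Ob} (g : X.Hom s t), (T.hom g ◃ lam s) = (lam t ▹ T.hom g) ⊙
    ((μ t ◃ ηn (T.hom g)) ⊙ (μn g ▹ η (T.ob s)))
  rho_n : ∀ {s t : X.Ob} (g : X.Hom s t), (μ t ◃ T.cell (ηn g)) ⊙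
    ((μn g ▹ T.hom (η s)) ⊙ (T.hom g ◃ rho s)) = (rho t ▹ T.hom g)
  alpha_n : ∀ {s t : X.Ob} (g : X.Hom s t), (μ t ◃ μn (T.hom g)) ⊙
    ((μn g ▹ μ (T.ob s)) ⊙ (T.hom g ◃ alpha s)) =
    (alpha t ▹ T.hom (T.hom (T.hom g))) ⊙
      ((μ t ◃ T.cell (μn g)) ⊙ (μn g ▹ T.hom (μ s)))
  d_n : ∀ {s t : X.Ob} (g : X.Hom s t), (σ t ◃ μn (G.hom g)) ⊙
    ((σn g ▹ μ (G.ob s)) ⊙ (g ◃ d s)) = (d t ▹ T.hom (T.hom (G.hom g))) ⊙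
      ((σ t ◃ T.hom (σ (G.ob t)) ◃ T.cell (T.cell (δn g))) ⊙
        ((σ t ◃ T.cell (σn (G.hom g)) ▹ T.hom (T.hom (δ s))) ⊙
          (σn g ▹ T.hom (σ (G.ob s)) ▹ T.hom (T.hom (δ s)))))
  assoc : ∀ s, (μ s ◃ alpha (T.ob s)) ⊙
      ((alpha s ▹ T.hom (μ (T.ob s))) ⊙ (μ s ◃ T.cell (alpha s))) =
    (alpha s ▹ μ (T.ob (T.ob s))) ⊙ ((μ s ◃ (μn (μ s)).inv) ⊙
      (alpha s ▹ T.hom (T.hom (μ s))))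
  unit : ∀ s, (alpha s ▹ T.hom (η (T.ob s))) =
    (μ s ◃ rho (T.ob s)) ⊙ (μ s ◃ T.cell (lam s))
  transpose_alpha : ∀ t, (σ t ◃ alpha (G.ob t)) ⊙ ((d t ▹ T.hom (μ (G.ob t))) ⊙
      ((σ t ◃ T.hom (σ (G.ob t)) ◃ T.cell (μn (δ t)).inv) ⊙
        ((σ t ◃ T.cell (d (G.ob t)) ▹ T.hom (T.hom (T.hom (δ t)))) ⊙
          (σ t ◃ T.hom (σ (G.ob t)) ◃ T.hom (T.hom (σ (G.ob (G.ob t)))) ◃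
            T.cell (T.cell (T.cell (alpha' t))))))) =
    (d t ▹ μ (T.ob (G.ob t))) ⊙ ((σ t ◃ (μn (σ (G.ob t) ⊚ T.hom (δ t))).inv) ⊙
      ((d t ▹ T.hom (T.hom (σ (G.ob t))) ▹ T.hom (T.hom (T.hom (δ t)))) ⊙
        (σ t ◃ T.hom (σ (G.ob t)) ◃ T.cell (T.cell (σn (δ t)).inv) ▹
          T.hom (T.hom (T.hom (δ t))))))
  transpose_lam : ∀ t, (σ t ◃ lam (G.ob t)) ⊙ ((d t ▹ η (T.ob (G.ob t))) ⊙
      ((σ t ◃ (ηn (σ (G.ob t) ⊚ T.hom (δ t))).inv) ⊙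
        (((σn (σ t ⊚ η (G.ob t))).inv ▹ T.hom (δ t)) ⊙ (σ t ◃ T.cell (rho' t))))) =
    (Cell.id (σ t))
  transpose_rho : ∀ t, (σ t ◃ T.cell (lam' t)) = (σ t ◃ (rho (G.ob t)).inv) ⊙
    ((d t ▹ T.hom (η (G.ob t))) ⊙ (σ t ◃ T.hom (σ (G.ob t)) ◃ T.cell (ηn (δ t)).inv))
  faithful : ∀ {s t : X.Ob} (x y : X.Cell s (G.ob t)), x.dom = y.dom → x.cod = y.cod →
    σ t ◃ T.cell x = σ t ◃ T.cell y → x = y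
  full : ∀ {s t : X.Ob} (f g : X.Hom s (G.ob t)) (y : X.Cell (T.ob s) t),
    y.dom = σ t ⊚ T.hom f → y.cod = σ t ⊚ T.hom g →
      ∃ x : X.Cell s (G.ob t), x.dom = f ∧ x.cod = g ∧ σ t ◃ T.cell x = y

namespace Frame

attribute [simp] dom_σn cod_σn dom_μn cod_μn dom_ηn cod_ηn dom_δn cod_δn iso_σn iso_μn iso_ηn
  iso_δn σn_id σn_comp μn_comp ηn_comp dom_lam cod_lam dom_rho cod_rho dom_alpha cod_alpha
  dom_d cod_d dom_lam' cod_lam' dom_rho' cod_rho' dom_alpha' cod_alpha' iso_lam iso_rho iso_alpha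
  iso_d iso_lam' iso_rho' iso_alpha'

variable {X : TwoCat.{w}} (W : Frame X) {r s t : X.Ob}

/-- The typing of the data of a pseudoalgebra. -/
structure AlgData (s : X.Ob) where
  ν : X.Hom (W.T.ob s) s
  ψ : X.Cell s s
  χ : X.Cell (W.T.ob (W.T.ob s)) s
  dom_ψ : ψ.dom = ν ⊚ W.η s
  cod_ψ : ψ.cod = Hom.id s
  dom_χ : χ.dom = ν ⊚ W.T.hom ν
  cod_χ : χ.cod = ν ⊚ W.μ s
  iso_ψ : ψ.IsIso
  iso_χ : χ.IsIso

namespace AlgData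

attribute [simp] dom_ψ cod_ψ dom_χ cod_χ iso_ψ iso_χ

variable {W} (a : W.AlgData s)

/-- The associativity axiom of a pseudoalgebra. -/
def Assoc : Prop := (a.ν ◃ W.alpha s) ⊙ ((a.χ ▹ W.T.hom (W.μ s)) ⊙
    (a.ν ◃ W.T.cell a.χ)) = (a.χ ▹ W.μ (W.T.ob s)) ⊙
      ((a.ν ◃ (W.μn a.ν).inv) ⊙ (a.χ ▹ W.T.hom (W.T.hom a.ν)))

/-- The unit axiom of a pseudoalgebra. -/
def Unit : Prop := (a.χ ▹ W.T.hom (W.η s)) = (a.ν ◃ W.rho s) ⊙ (a.ν ◃ W.T.cell a.ψ)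

/-- The other unit law of a pseudoalgebra. -/
def LeftUnit : Prop := (a.ψ ▹ a.ν) ⊙ (a.ν ◃ W.ηn a.ν) =
  (a.ν ◃ W.lam s) ⊙ (a.χ ▹ W.η (W.T.ob s))

theorem faithful_left {x y : X.Cell r s} (hd : x.dom = y.dom) (hc : x.cod = y.cod)
    (h : a.ν ◃ W.T.cell x = a.ν ◃ W.T.cell y) : x = y := by
  have k (x : X.Cell r s) : (a.ν ◃ W.ηn x.cod).act * (a.ν ◃ W.T.cell x ▹ W.η r).act =
      (a.ν ◃ W.η s ◃ x).act * (a.ν ◃ W.ηn x.dom).act := by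
    simpa using congrArg (fun z => (a.ν ◃ z).act) (W.ηn_two x)
  have h' := congrArg (fun z => (z ▹ W.η r).act) h
  have h2 : a.ν ◃ W.η s ◃ x = a.ν ◃ W.η s ◃ y := by
    refine Cell.cancel_right (p := a.ν ◃ W.ηn x.dom) (by simp) (by simp) (by simp [hd]) ?_
    rw [← k x, hd, ← k y, hc]
    simp only [Cell.wl_wr] at h'
    rw [h']
  have I := Cell.interchange a.ψ x
  have J := Cell.interchange a.ψ y
  simp [hd, hc, h2] at I J
  exact Cell.cancel_right (p := a.ψ ▹ y.dom) (by simp) (by simp [hd]) (by simp) (I.trans J.symm)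

theorem faithful_right {x y : X.Cell (W.T.ob s) t} (hd : x.dom = y.dom) (hc : x.cod = y.cod)
    (h : x ▹ W.T.hom a.ν = y ▹ W.T.hom a.ν) : x = y := by
  have I := Cell.interchange x (W.T.cell a.ψ)
  have J := Cell.interchange y (W.T.cell a.ψ)
  have h' := congrArg (fun z => z ▹ W.T.hom (W.η s)) h
  simp at I J h'
  rw [h', hd, hc] at I
  exact Cell.cancel_right (p := y.dom ◃ W.T.cell a.ψ) (by simp) (by simp [hd]) (by simp)
    (I.symm.trans J)

/-- The consequence of the associativity axiom that relates the two unit laws. -/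
theorem Assoc.unit_laws (h : a.Assoc) :
    (a.χ ▹ W.T.hom (W.η s) ▹ W.T.hom a.ν).act * (a.ν ◃ W.T.hom a.ν ◃ W.T.cell (W.ηn a.ν)).act =
    (a.ν ◃ W.rho s ▹ W.T.hom a.ν).act * ((a.ν ◃ W.T.hom a.ν ◃ W.T.cell (W.lam s)).act *
      (a.ν ◃ W.T.cell a.χ ▹ W.T.hom (W.η (W.T.ob s))).act) := by
  have h1 : (a.χ ▹ W.T.hom (W.T.hom a.ν) ▹ W.T.hom (W.η (W.T.ob s))).act =
    (a.ν ◃ W.μn a.ν ▹ W.T.hom (W.η (W.T.ob s))).act * ((a.ν ◃ W.T.hom a.ν ◃ W.rho (W.T.ob s)).act *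
      ((a.ν ◃ W.T.hom a.ν ◃ W.T.cell (W.lam s)).act *
      (a.ν ◃ W.T.cell a.χ ▹ W.T.hom (W.η (W.T.ob s))).act)) := by
    have e := congrArg (fun z => (z ▹ W.T.hom (W.η (W.T.ob s))).act) h
    have u := congrArg (fun z => (a.ν ◃ z).act) (W.unit s)
    have i1 := Cell.interchange a.χ (W.T.cell (W.lam s))
    have i2 := Cell.interchange a.χ (W.rho (W.T.ob s))
    have c := Cell.act_mul_inv (x := a.ν ◃ W.μn a.ν ▹ W.T.hom (W.η (W.T.ob s))) (by simp)
    simp (maxDischargeDepth := 9) at e u i1 i2 c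
    rw [u, mul_assoc, mul_reassoc i1, mul_reassoc i2] at e
    have e2 := Cell.mul_cancel_left (by simp) (by simp) (by simp) e
    rw [e2, ← mul_assoc, c, Cell.act_id_mul _ _ (by simp)]
  have h2 := Cell.interchange a.χ (W.T.cell (W.ηn a.ν))
  have h3 := congrArg (fun z => (a.ν ◃ z).act) (W.rho_n a.ν)
  simp at h2 h3
  rw [← h2, h1, ← h3]
  simp only [mul_assoc]

theorem Assoc.leftUnit_of_unit (h : a.Assoc) (k : a.Unit) : a.LeftUnit := by
  have e := h.unit_laws
  have k' := congrArg (fun z => (z ▹ W.T.hom a.ν).act) k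
  simp at k'
  rw [k', mul_assoc] at e
  have e2 := Cell.mul_cancel_left (by simp) (by simp) (by simp) e
  refine a.faithful_left (by simp) (by simp) (Cell.act_injective ?_)
  simpa using e2

theorem Assoc.unit_of_leftUnit (h : a.Assoc) (k : a.LeftUnit) : a.Unit := by
  have e := h.unit_laws
  have k' := congrArg (fun z => (a.ν ◃ W.T.cell z).act) k
  simp at k'
  rw [← k', ← mul_assoc] at e
  have c := Cell.cancel_right (p := a.ν ◃ W.T.hom a.ν ◃ W.T.cell (W.ηn a.ν))
    (x := a.χ ▹ W.T.hom (W.η s) ▹ W.T.hom a.ν) (y := (a.ν ◃ W.rho s ▹ W.T.hom a.ν) ⊙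
      (a.ν ◃ W.T.cell a.ψ ▹ W.T.hom a.ν)) (by simp (maxDischargeDepth := 9)) (by simp) (by simp)
      (by simpa [mul_assoc] using e)
  refine a.faithful_right (by simp) (by simp) ?_
  simpa using c

end AlgData

end Frame

namespace Frame

variable {X : TwoCat.{w}} (W : Frame X) {r s t : X.Ob}

theorem μn_inv_two (x : X.Cell s t) : W.T.cell x ▹ W.μ s ⊙ (W.μn x.dom).inv =
    (W.μn x.cod).inv ⊙ W.μ t ◃ W.T.cell (W.T.cell x) :=
  Cell.square_inv (by simp) (by simp) (by simp) (by simp) (W.μn_two x)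

theorem alpha_n_inv (g : X.Hom s t) : W.T.hom g ◃ W.alpha s ⊙ (W.μn g).inv ▹ W.T.hom (W.μ s) ⊙
    W.μ t ◃ W.T.cell (W.μn g).inv = (W.μn g).inv ▹ W.μ (W.T.ob s) ⊙ W.μ t ◃ (W.μn (W.T.hom g)).inv ⊙
      W.alpha t ▹ W.T.hom (W.T.hom (W.T.hom g)) := by
  have h' := congrArg Cell.act (W.alpha_n g)
  have h := Cell.square_inv (p := W.T.hom g ◃ W.alpha s)
    (q := W.μ t ◃ W.μn (W.T.hom g) ⊙ W.μn g ▹ W.μ (W.T.ob s))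
    (r := W.μ t ◃ W.T.cell (W.μn g) ⊙ W.μn g ▹ W.T.hom (W.μ s))
    (t := W.alpha t ▹ W.T.hom (W.T.hom (W.T.hom g)))
    (by simp (maxDischargeDepth := 9)) (by simp (maxDischargeDepth := 9))
    (by simp (maxDischargeDepth := 9)) (by simp (maxDischargeDepth := 9))
    (Cell.act_injective (by simpa (maxDischargeDepth := 9) [mul_assoc] using h'))
  refine Cell.act_injective ?_
  simpa (maxDischargeDepth := 9) [mul_assoc] using congrArg Cell.act h

/-- The typing of the data of a pseudocoalgebra for `G`. -/
structure CoalgData (t : X.Ob) where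
  n : X.Hom t (W.G.ob t)
  ψ' : X.Cell t t
  χ' : X.Cell t (W.G.ob (W.G.ob t))
  dom_ψ' : ψ'.dom = W.σ t ⊚ W.η (W.G.ob t) ⊚ n
  cod_ψ' : ψ'.cod = Hom.id t
  dom_χ' : χ'.dom = W.G.hom n ⊚ n
  cod_χ' : χ'.cod = W.δ t ⊚ n
  iso_ψ' : ψ'.IsIso
  iso_χ' : χ'.IsIso

namespace CoalgData

attribute [simp] dom_ψ' cod_ψ' dom_χ' cod_χ' iso_ψ' iso_χ'

variable {W} (c : W.CoalgData t)

/-- The coassociativity axiom of a pseudocoalgebra. -/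
def Coassoc : Prop := W.alpha' t ▹ c.n ⊙ W.G.hom (W.δ t) ◃ c.χ' ⊙ W.G.cell c.χ' ▹ c.n =
  W.δ (W.G.ob t) ◃ c.χ' ⊙ W.δn c.n ▹ c.n ⊙ W.G.hom (W.G.hom c.n) ◃ c.χ'

/-- The counit axiom of a pseudocoalgebra. -/
def Counit : Prop := W.G.hom (W.σ t) ◃ W.G.hom (W.η (W.G.ob t)) ◃ c.χ' =
  W.rho' t ▹ c.n ⊙ W.G.cell c.ψ' ▹ c.n

/-- The transpose of the data of a pseudocoalgebra. -/
@[simps] noncomputable def alg : W.AlgData t where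
  ν := W.σ t ⊚ W.T.hom c.n
  ψ := c.ψ' ⊙ W.σ t ◃ W.ηn c.n
  χ := W.σ t ◃ (W.μn c.n).inv ⊙ W.d t ▹ W.T.hom (W.T.hom c.n) ⊙
    W.σ t ◃ W.T.hom (W.σ (W.G.ob t)) ◃ W.T.cell (W.T.cell c.χ') ⊙
      W.σ t ◃ W.T.cell (W.σn c.n) ▹ W.T.hom (W.T.hom c.n)
  dom_ψ := by simp (maxDischargeDepth := 9)
  cod_ψ := by simp (maxDischargeDepth := 9)
  dom_χ := by simp (maxDischargeDepth := 9)
  cod_χ := by simp (maxDischargeDepth := 9)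
  iso_ψ := by simp (maxDischargeDepth := 9)
  iso_χ := by simp (maxDischargeDepth := 9)

/-- The comparison of the two iterated transposes. -/
noncomputable def Q : X.Cell (W.T.ob (W.T.ob (W.T.ob t))) t :=
  W.σ t ◃ W.T.hom (W.σ _) ◃ W.T.cell (W.T.cell (W.σn (W.G.hom c.n))) ▹
      W.T.hom (W.T.hom (W.T.hom (W.G.hom c.n))) ▹ W.T.hom (W.T.hom (W.T.hom c.n)) ⊙
    W.σ t ◃ W.T.hom (W.σ _) ◃ W.T.hom (W.T.hom (W.G.hom c.n)) ◃ W.T.cell (W.T.cell (W.σn c.n)) ▹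
      W.T.hom (W.T.hom (W.T.hom c.n)) ⊙
    W.σ t ◃ W.T.cell (W.σn c.n) ▹ W.T.hom (W.T.hom c.n) ▹ W.T.hom (W.T.hom (W.σ t)) ▹
      W.T.hom (W.T.hom (W.T.hom c.n))

/-- The comparison of the two iterated comultiplications. -/
noncomputable def P : X.Cell (W.T.ob (W.T.ob (W.T.ob t))) t :=
  W.σ t ◃ W.T.hom c.n ◃ W.alpha t ⊙ W.σ t ◃ (W.μn c.n).inv ▹ W.T.hom (W.μ t) ⊙
    W.d t ▹ W.T.hom (W.T.hom c.n) ▹ W.T.hom (W.μ t) ⊙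
    W.σ t ◃ W.T.hom (W.σ _) ◃ W.T.cell (W.μn (W.δ t ⊚ c.n)).inv ⊙
    W.σ t ◃ W.T.cell (W.d _) ▹ W.T.hom (W.T.hom (W.T.hom (W.δ t))) ▹
      W.T.hom (W.T.hom (W.T.hom c.n))

theorem alg_assoc_left :
    (c.alg.ν ◃ W.alpha t).act * ((c.alg.χ ▹ W.T.hom (W.μ t)).act *
      (c.alg.ν ◃ W.T.cell c.alg.χ).act) =
    c.P.act * ((W.σ t ◃ W.T.cell (W.σ _ ◃ W.T.cell (W.σ _ ◃ W.T.cell (W.δ (W.G.ob t) ◃ c.χ' ⊙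
      W.δn c.n ▹ c.n ⊙ W.G.hom (W.G.hom c.n) ◃ c.χ')))).act * c.Q.act) := by
  have e1 := Cell.interchange (W.σ t ◃ W.T.cell (W.d (W.G.ob t))) (W.T.cell (W.T.cell (W.T.cell c.χ')))
  have e2 := congrArg (fun z => (W.σ t ◃ W.T.hom (W.σ _) ◃ W.T.cell z).act) (W.μn_inv_two c.χ')
  have e3 := Cell.interchange (W.σ t ◃ W.T.cell (W.σn c.n)) (W.T.cell (W.μn c.n).inv)
  have e4 := congrArg (fun z => (W.σ t ◃ W.T.cell z ▹ W.T.hom (W.T.hom (W.T.hom c.n))).act) (W.d_n c.n)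
  have e5 := Cell.interchange (W.σ t ◃ W.T.cell (W.σn c.n))
    (W.T.hom (W.T.hom (W.σ _)) ◃ W.T.cell (W.T.cell (W.T.cell c.χ')))
  have e6 := Cell.interchange (W.σ t ◃ W.T.cell (W.σn c.n))
    (W.T.cell (W.T.cell (W.σn c.n)) ▹ W.T.hom (W.T.hom (W.T.hom c.n)))
  have e7 := Cell.interchange (W.σ t ◃ W.T.hom (W.σ _) ◃ W.T.cell (W.T.cell (W.σn (W.G.hom c.n))))
    (W.T.cell (W.T.cell (W.T.cell c.χ')))
  simp (maxDischargeDepth := 12) [P, Q, mul_assoc] at e1 e2 e3 e4 e5 e6 e7 ⊢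
  have e8 := Cell.act_inv_mul_assoc (p := W.σ t ◃ W.T.hom (W.σ (W.G.ob t)) ◃
    W.T.cell (W.μn (W.G.hom c.n)) ▹ W.T.hom (W.T.hom (W.T.hom c.n))) (x := W.σ t ◃ W.T.cell (W.σn c.n) ▹
      W.T.hom (W.μ (W.G.ob t)) ▹ W.T.hom (W.T.hom (W.T.hom c.n))) (by simp (maxDischargeDepth := 12))
      (by simp (maxDischargeDepth := 12))
      (W.σ t ◃ W.T.hom c.n ◃ W.T.cell (W.d t) ▹ W.T.hom (W.T.hom (W.T.hom c.n))).act
  simp (maxDischargeDepth := 12) at e8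
  rw [e4] at e8
  have e8' := fun z => congrArg (· * z) e8
  simp only [mul_assoc] at e8'
  rw [mul_reassoc e3.symm, ← e8', mul_reassoc e1.symm, mul_reassoc₃ e2.symm, mul_reassoc e7, e6,
    mul_reassoc e5]

theorem alg_assoc_right :
    (c.alg.χ ▹ W.μ (W.T.ob t)).act * ((c.alg.ν ◃ (W.μn c.alg.ν).inv).act *
      (c.alg.χ ▹ W.T.hom (W.T.hom c.alg.ν)).act) =
    c.P.act * ((W.σ t ◃ W.T.cell (W.σ _ ◃ W.T.cell (W.σ _ ◃ W.T.cell (W.alpha' t ▹ c.n ⊙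
      W.G.hom (W.δ t) ◃ c.χ' ⊙ W.G.cell c.χ' ▹ c.n)))).act * c.Q.act) := by
  have e1 := congrArg (fun z => (W.σ t ◃ W.T.hom (W.σ _) ◃ W.T.cell (W.T.cell z) ▹
    W.T.hom (W.T.hom (W.T.hom c.n))).act) (W.σn_two c.χ')
  have e2 := Cell.interchange (W.σ t ◃ W.T.hom (W.σ _) ◃ W.T.cell (W.T.cell (W.σn (W.δ t))))
    (W.T.cell (W.T.cell (W.T.cell c.χ')))
  have e3 := Cell.interchange (W.d t) (W.T.cell (W.μn c.n).inv)
  have e4 := congrArg (fun z => (W.σ t ◃ z).act) (W.alpha_n_inv c.n)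
  have e5 := congrArg (fun z => (z ▹ W.T.hom (W.T.hom (W.T.hom c.n))).act) (W.transpose_alpha t)
  have e6 := Cell.interchange (W.d t) (W.T.hom (W.T.hom (W.σ _)) ◃ W.T.cell (W.T.cell (W.T.cell c.χ')))
  have e7 := Cell.interchange (W.d t) (W.T.cell (W.T.cell (W.σn c.n)) ▹ W.T.hom (W.T.hom (W.T.hom c.n)))
  have e8 := congrArg (fun z => (W.σ t ◃ z).act) (W.μn_inv_two ((W.σ _ ◃ W.T.cell c.χ') ⊙
    (W.σn c.n ▹ W.T.hom c.n)))
  have e9 := Cell.interchange (W.d t) (W.μn (W.T.hom c.n)).inv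
  simp (maxDischargeDepth := 12) [P, Q, mul_assoc] at e1 e2 e3 e4 e5 e6 e7 e8 e9 ⊢
  have e10 := Cell.act_inv_mul (x := W.σ t ◃ W.T.hom (W.σ (W.G.ob t)) ◃
    W.T.cell (W.T.cell (W.σn (W.δ t))) ▹ W.T.hom (W.T.hom (W.T.hom (W.δ t))) ▹
      W.T.hom (W.T.hom (W.T.hom c.n))) (by simp (maxDischargeDepth := 12))
  simp (maxDischargeDepth := 12) at e10
  have e5' := fun z => congrArg (· * z) e5
  have e8' := fun z => congrArg (· * z) e8
  simp only [mul_assoc] at e5' e8'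
  rw [e8', mul_reassoc e9.symm, mul_reassoc e7, mul_reassoc e6, mul_reassoc₃ e1.symm,
    mul_reassoc e2, mul_reassoc e3.symm, mul_reassoc₃ e4, e5', mul_reassoc_left e10,
    Cell.act_id_mul_assoc _ _ (by simp)]

theorem assoc_iff : c.alg.Assoc ↔ c.Coassoc := by
  have hP : c.P.IsIso := by simp (maxDischargeDepth := 12) [P]
  have hQ : c.Q.IsIso := by simp (maxDischargeDepth := 12) [Q]
  have hl := c.alg_assoc_left
  have hr := c.alg_assoc_right
  constructor
  · intro h
    have h' := congrArg Cell.act h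
    rw [Cell.act_vcomp (by simp (maxDischargeDepth := 12)),
      Cell.act_vcomp (by simp (maxDischargeDepth := 12)),
      Cell.act_vcomp (by simp (maxDischargeDepth := 12)),
      Cell.act_vcomp (by simp (maxDischargeDepth := 12)), hl, hr] at h'
    have h3 := Cell.cancel_both hP hQ (by simp (maxDischargeDepth := 12) [P, Q])
      (by simp (maxDischargeDepth := 12) [P, Q]) (by simp (maxDischargeDepth := 12) [P, Q])
      (by simp (maxDischargeDepth := 12) [P, Q]) h'
    have d : (W.alpha' t ▹ c.n ⊙ W.G.hom (W.δ t) ◃ c.χ' ⊙ W.G.cell c.χ' ▹ c.n).dom =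
        (W.δ (W.G.ob t) ◃ c.χ' ⊙ W.δn c.n ▹ c.n ⊙ W.G.hom (W.G.hom c.n) ◃ c.χ').dom := by
      simp (maxDischargeDepth := 12)
    have e : (W.alpha' t ▹ c.n ⊙ W.G.hom (W.δ t) ◃ c.χ' ⊙ W.G.cell c.χ' ▹ c.n).cod =
        (W.δ (W.G.ob t) ◃ c.χ' ⊙ W.δn c.n ▹ c.n ⊙ W.G.hom (W.G.hom c.n) ◃ c.χ').cod := by
      simp (maxDischargeDepth := 12)
    have h4 := W.faithful _ _ (by simp [d]) (by simp [e]) h3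
    have h5 := W.faithful _ _ (by simp [d]) (by simp [e]) h4
    exact (W.faithful _ _ d.symm e.symm h5).symm
  · intro h
    refine Cell.act_injective ?_
    rw [Cell.act_vcomp (by simp (maxDischargeDepth := 12)),
      Cell.act_vcomp (by simp (maxDischargeDepth := 12)),
      Cell.act_vcomp (by simp (maxDischargeDepth := 12)),
      Cell.act_vcomp (by simp (maxDischargeDepth := 12)), hl, hr, h]

end CoalgData

end Frame

namespace Frame

variable {X : TwoCat.{w}} (W : Frame X) {r s t : X.Ob}

theorem transpose_lam_inv (t : X.Ob) : W.σ t ◃ W.lam (W.G.ob t) ⊙ W.d t ▹ W.η (W.T.ob (W.G.ob t)) =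
    W.σ t ◃ W.T.cell (W.rho' t).inv ⊙ W.σn (W.σ t ⊚ W.η (W.G.ob t)) ▹ W.T.hom (W.δ t) ⊙
      W.σ t ◃ W.ηn (W.σ (W.G.ob t) ⊚ W.T.hom (W.δ t)) := by
  have h' := congrArg Cell.act (W.transpose_lam t)
  have h := congrArg Cell.act (Cell.eq_inv_of_vcomp
    (x := W.σ t ◃ W.lam (W.G.ob t) ⊙ W.d t ▹ W.η (W.T.ob (W.G.ob t)))
    (y := W.σ t ◃ (W.ηn (W.σ (W.G.ob t) ⊚ W.T.hom (W.δ t))).inv ⊙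
      (W.σn (W.σ t ⊚ W.η (W.G.ob t))).inv ▹ W.T.hom (W.δ t) ⊙ W.σ t ◃ W.T.cell (W.rho' t))
    (by simp (maxDischargeDepth := 12)) (by simp (maxDischargeDepth := 12))
    (Cell.act_injective (by simpa (maxDischargeDepth := 12) [mul_assoc] using h')))
  refine Cell.act_injective ?_
  simpa (maxDischargeDepth := 12) [mul_assoc] using h

namespace CoalgData

variable {W} (c : W.CoalgData t)

/-- The comparison used in transposing the counit law. -/
noncomputable def F : X.Cell (W.T.ob t) t :=
  W.σn (W.σ t ⊚ W.η (W.G.ob t)) ▹ W.T.hom (W.G.hom c.n) ▹ W.T.hom c.n ⊙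
    W.σ t ◃ W.η _ ◃ W.σn c.n ▹ W.T.hom c.n ⊙ W.σ t ◃ W.ηn (c.n ⊚ W.σ t ⊚ W.T.hom c.n)

theorem alg_leftUnit_left :
    (c.alg.ψ ▹ c.alg.ν).act * (c.alg.ν ◃ W.ηn c.alg.ν).act =
    (W.σ t ◃ W.T.cell (W.rho' t).inv ▹ W.T.hom c.n).act *
      ((W.σ t ◃ W.T.cell (W.rho' t ▹ c.n ⊙ W.G.cell c.ψ' ▹ c.n)).act * c.F.act) := by
  have e1 := congrArg (fun z => (z ▹ W.T.hom c.n).act) (W.σn_two c.ψ')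
  have e2 := Cell.act_inv_mul (x := W.σ t ◃ W.T.cell (W.rho' t) ▹ W.T.hom c.n)
    (by simp (maxDischargeDepth := 12))
  simp (maxDischargeDepth := 12) [F, mul_assoc] at e1 e2 ⊢
  rw [mul_reassoc_left e2, Cell.act_id_mul_assoc _ _ (by simp), e1]
  simp only [mul_assoc]

theorem alg_leftUnit_right :
    (c.alg.ν ◃ W.lam t).act * (c.alg.χ ▹ W.η (W.T.ob t)).act =
    (W.σ t ◃ W.T.cell (W.rho' t).inv ▹ W.T.hom c.n).act *
      ((W.σ t ◃ W.T.cell (W.G.hom (W.σ t) ◃ W.G.hom (W.η (W.G.ob t)) ◃ c.χ')).act * c.F.act) := by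
  have e1 := congrArg (fun z => (W.σ t ◃ z).act) (W.lam_n c.n)
  have e2 := Cell.interchange (W.d t) (W.ηn (W.T.hom c.n))
  have e3 := congrArg (fun z => (z ▹ W.T.hom c.n).act) (W.transpose_lam_inv t)
  have e4 := congrArg (fun z => (W.σ t ◃ z).act) (W.ηn_two ((W.σ _ ◃ W.T.cell c.χ') ⊙
    (W.σn c.n ▹ W.T.hom c.n)))
  have e5 := Cell.interchange (W.σn (W.σ t ⊚ W.η (W.G.ob t))) (W.T.cell c.χ')
  simp (maxDischargeDepth := 12) [F, mul_assoc] at e1 e2 e3 e4 e5 ⊢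
  have e6 := Cell.act_mul_inv_assoc (p := W.σ t ◃ W.μn c.n ▹ W.η (W.T.ob t))
    (x := W.d t ▹ W.T.hom (W.T.hom c.n) ▹ W.η (W.T.ob t)) (by simp (maxDischargeDepth := 12))
    (by simp (maxDischargeDepth := 12))
  simp (maxDischargeDepth := 12) at e6
  have e3' := fun z => congrArg (· * z) e3
  simp only [mul_assoc] at e3'
  rw [e1, mul_assoc, mul_assoc, e6, mul_reassoc e2, e3', mul_reassoc₃ e5, ← e4]

theorem leftUnit_iff : c.alg.LeftUnit ↔ c.Counit := by
  have hl := c.alg_leftUnit_left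
  have hr := c.alg_leftUnit_right
  constructor
  · intro h
    have h' := congrArg Cell.act h
    rw [Cell.act_vcomp (by simp (maxDischargeDepth := 12)),
      Cell.act_vcomp (by simp (maxDischargeDepth := 12)), hl, hr] at h'
    have h2 := Cell.cancel_both (by simp (maxDischargeDepth := 12))
      (by simp (maxDischargeDepth := 12) [F]) (by simp (maxDischargeDepth := 12))
      (by simp (maxDischargeDepth := 12)) (by simp (maxDischargeDepth := 12) [F])
      (by simp (maxDischargeDepth := 12) [F]) h'
    exact (W.faithful _ _ (by simp (maxDischargeDepth := 12)) (by simp (maxDischargeDepth := 12))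
      h2).symm
  · intro h
    refine Cell.act_injective ?_
    rw [Cell.act_vcomp (by simp (maxDischargeDepth := 12)),
      Cell.act_vcomp (by simp (maxDischargeDepth := 12)), hl, hr, h]

theorem axioms_iff : c.alg.Assoc ∧ c.alg.Unit ↔ c.Coassoc ∧ c.Counit := by
  rw [← c.assoc_iff, ← c.leftUnit_iff]
  exact ⟨fun h => ⟨h.1, h.1.leftUnit_of_unit _ h.2⟩, fun h => ⟨h.1, h.1.unit_of_leftUnit _ h.2⟩⟩

end CoalgData

end Frame

namespace Frame

variable {X : TwoCat.{w}} (W : Frame X) {r s t : X.Ob}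

theorem d_n_inv (g : X.Hom s t) :
    g ◃ W.d s ⊙ (W.σn g).inv ▹ W.T.hom (W.σ (W.G.ob s)) ▹ W.T.hom (W.T.hom (W.δ s)) =
    (W.σn g).inv ▹ W.μ (W.G.ob s) ⊙ W.σ t ◃ (W.μn (W.G.hom g)).inv ⊙
      W.d t ▹ W.T.hom (W.T.hom (W.G.hom g)) ⊙
      W.σ t ◃ W.T.hom (W.σ (W.G.ob t)) ◃ W.T.cell (W.T.cell (W.δn g)) ⊙
        W.σ t ◃ W.T.cell (W.σn (W.G.hom g)) ▹ W.T.hom (W.T.hom (W.δ s)) := by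
  have h' := congrArg Cell.act (W.d_n g)
  have h := Cell.square_inv (p := g ◃ W.d s)
    (q := W.σ t ◃ W.μn (W.G.hom g) ⊙ W.σn g ▹ W.μ (W.G.ob s))
    (r := W.σn g ▹ W.T.hom (W.σ (W.G.ob s)) ▹ W.T.hom (W.T.hom (W.δ s)))
    (t := W.d t ▹ W.T.hom (W.T.hom (W.G.hom g)) ⊙
      W.σ t ◃ W.T.hom (W.σ (W.G.ob t)) ◃ W.T.cell (W.T.cell (W.δn g)) ⊙
        W.σ t ◃ W.T.cell (W.σn (W.G.hom g)) ▹ W.T.hom (W.T.hom (W.δ s)))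
    (by simp (maxDischargeDepth := 12)) (by simp (maxDischargeDepth := 12))
    (by simp (maxDischargeDepth := 12)) (by simp (maxDischargeDepth := 12))
    (Cell.act_injective (by simpa (maxDischargeDepth := 12) [mul_assoc] using h'))
  refine Cell.act_injective ?_
  simpa (maxDischargeDepth := 12) [mul_assoc] using congrArg Cell.act h

/-- The naturality cells of the counit `ε = σ ∘ ηG`. -/
noncomputable def εn (g : X.Hom s t) : X.Cell (W.G.ob s) t :=
  W.σ t ◃ W.ηn (W.G.hom g) ⊙ W.σn g ▹ W.η (W.G.ob s)

/-- The typing of the structure cell of a morphism of pseudocoalgebras. -/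
structure CoalgHomData (c : W.CoalgData s) (e : W.CoalgData t) (h : X.Hom s t) where
  ϱ' : X.Cell s (W.G.ob t)
  dom_ϱ' : ϱ'.dom = e.n ⊚ h
  cod_ϱ' : ϱ'.cod = W.G.hom h ⊚ c.n
  iso_ϱ' : ϱ'.IsIso

attribute [simp] CoalgHomData.dom_ϱ' CoalgHomData.cod_ϱ' CoalgHomData.iso_ϱ'

/-- The unit axiom of a morphism of pseudoalgebras. -/
def AlgData.HomUnit (a : W.AlgData s) (b : W.AlgData t) (h : X.Hom s t)
    (ϱ : X.Cell (W.T.ob s) t) : Prop :=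
  h ◃ a.ψ ⊙ ϱ ▹ W.η s = b.ψ ▹ h ⊙ b.ν ◃ W.ηn h

/-- The multiplication axiom of a morphism of pseudoalgebras. -/
def AlgData.HomMult (a : W.AlgData s) (b : W.AlgData t) (h : X.Hom s t)
    (ϱ : X.Cell (W.T.ob s) t) : Prop :=
  h ◃ a.χ ⊙ ϱ ▹ W.T.hom a.ν ⊙ b.ν ◃ W.T.cell ϱ =
    ϱ ▹ W.μ s ⊙ b.ν ◃ (W.μn h).inv ⊙ b.χ ▹ W.T.hom (W.T.hom h)

namespace CoalgHomData

variable {W} {c : W.CoalgData s} {e : W.CoalgData t} {h : X.Hom s t} (k : W.CoalgHomData c e h)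

/-- The counit axiom of a morphism of pseudocoalgebras. -/
def Counit : Prop :=
  h ◃ c.ψ' ⊙ (W.εn h).inv ▹ c.n ⊙ W.σ t ◃ W.η (W.G.ob t) ◃ k.ϱ' = e.ψ' ▹ h

/-- The comultiplication axiom of a morphism of pseudocoalgebras. -/
def Comult : Prop :=
  W.G.hom (W.G.hom h) ◃ c.χ' ⊙ W.G.cell k.ϱ' ▹ c.n ⊙ W.G.hom e.n ◃ k.ϱ' =
    (W.δn h).inv ▹ c.n ⊙ W.δ t ◃ k.ϱ' ⊙ e.χ' ▹ h

/-- The transpose of the structure cell of a morphism of pseudocoalgebras. -/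
noncomputable def ϱ : X.Cell (W.T.ob s) t :=
  (W.σn h).inv ▹ W.T.hom c.n ⊙ W.σ t ◃ W.T.cell k.ϱ'

@[simp] theorem dom_ϱ : k.ϱ.dom = e.alg.ν ⊚ W.T.hom h := by simp (maxDischargeDepth := 12) [ϱ]
@[simp] theorem cod_ϱ : k.ϱ.cod = h ⊚ c.alg.ν := by simp (maxDischargeDepth := 12) [ϱ]
@[simp] theorem iso_ϱ : k.ϱ.IsIso := by simp (maxDischargeDepth := 12) [ϱ]

theorem homUnit_iff : c.alg.HomUnit W e.alg h k.ϱ ↔ k.Counit := by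
  have h1 := Cell.interchange (W.σn h).inv (W.ηn c.n)
  have h2 := congrArg (fun z => (W.σ t ◃ z).act) (W.ηn_two k.ϱ')
  have h3 := Cell.act_inv_mul_assoc (p := W.σ t ◃ W.ηn (W.G.hom h) ▹ c.n)
    (x := W.σ t ◃ W.T.hom (W.G.hom h) ◃ W.ηn c.n)
    (by simp (maxDischargeDepth := 12)) (by simp (maxDischargeDepth := 12))
    (W.σ t ◃ W.T.cell k.ϱ' ▹ W.η s).act
  have key : (h ◃ c.alg.ψ ⊙ k.ϱ ▹ W.η s).act =
      (h ◃ c.ψ' ⊙ (W.εn h).inv ▹ c.n ⊙ W.σ t ◃ W.η (W.G.ob t) ◃ k.ϱ').act *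
        (W.σ t ◃ W.ηn (e.n ⊚ h)).act := by
    simp (maxDischargeDepth := 12) [mul_assoc, ϱ, εn] at h1 h2 h3 ⊢
    rw [h2] at h3
    rw [mul_reassoc h1, ← h3]
  have key' : (e.alg.ψ ▹ h ⊙ e.alg.ν ◃ W.ηn h).act =
      (e.ψ' ▹ h).act * (W.σ t ◃ W.ηn (e.n ⊚ h)).act := by
    simp (maxDischargeDepth := 12) [mul_assoc]
  constructor
  · intro h
    have h' := congrArg Cell.act h
    rw [key, key'] at h'
    exact Cell.cancel_right (by simp (maxDischargeDepth := 12))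
      (by simp (maxDischargeDepth := 12) [εn]) (by simp (maxDischargeDepth := 12)) h'
  · intro h
    refine Cell.act_injective ?_
    rw [key, key', h]

theorem homMult_iff : c.alg.HomMult W e.alg h k.ϱ ↔ k.Comult := by
  let E : X.Cell (W.T.ob (W.T.ob s)) t := (W.σn h).inv ▹ W.T.hom c.n ▹ W.μ s ⊙
    W.σ t ◃ (W.μn (W.G.hom h ⊚ c.n)).inv ⊙ W.d t ▹ W.T.hom (W.T.hom (W.G.hom h ⊚ c.n))
  let Q : X.Cell (W.T.ob (W.T.ob s)) t := W.σ t ◃ W.T.cell (W.σn e.n) ▹ W.T.hom (W.T.hom e.n) ▹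
    W.T.hom (W.T.hom h)
  have key : (h ◃ c.alg.χ ⊙ k.ϱ ▹ W.T.hom c.alg.ν ⊙ e.alg.ν ◃ W.T.cell k.ϱ).act =
      E.act * ((W.σ t ◃ W.T.cell (W.σ _ ◃ W.T.cell (W.δn h ▹ c.n ⊙
        W.G.hom (W.G.hom h) ◃ c.χ' ⊙ W.G.cell k.ϱ' ▹ c.n ⊙ W.G.hom e.n ◃ k.ϱ'))).act * Q.act) := by
    have e1 := Cell.interchange (W.σ t ◃ W.T.cell (W.σn e.n)) (W.T.cell (W.T.cell k.ϱ'))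
    have e2 := congrArg (fun z => (W.σ t ◃ W.T.cell z ▹ W.T.hom (W.T.hom c.n)).act) (W.σn_two k.ϱ')
    have e3 := Cell.interchange (W.σ t ◃ W.T.cell (W.σn (W.G.hom h))) (W.T.cell (W.T.cell c.χ'))
    have e5 := Cell.interchange (W.σn h).inv (W.T.cell (W.σn c.n) ▹ W.T.hom (W.T.hom c.n))
    have e6 := Cell.interchange (W.σn h).inv (W.T.hom (W.σ _) ◃ W.T.cell (W.T.cell c.χ'))
    have e9 := congrArg (fun z => (z ▹ W.T.hom (W.T.hom c.n)).act) (W.d_n_inv h)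
    have e7 := Cell.interchange (W.σn h).inv (W.μn c.n).inv
    simp (maxDischargeDepth := 12) [mul_assoc, ϱ, E, Q] at e1 e2 e3 e5 e6 e7 e9 ⊢
    have e9' := fun z => congrArg (· * z) e9
    have e2' := fun z => congrArg (· * ((W.σ t ◃ W.T.hom e.n ◃ (W.T.cell (W.σn h)).inv ▹
      W.T.hom (W.T.hom c.n)).act * z)) e2
    simp only [mul_assoc] at e9' e2'
    rw [mul_reassoc e5, mul_reassoc e6, e9', e1, ← mul_reassoc e7]
    have e10 := e2' (W.σ t ◃ W.T.hom e.n ◃ W.T.hom (W.σ t) ◃ W.T.cell (W.T.cell k.ϱ')).act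
    have e11 := Cell.act_mul_inv_assoc (p := W.σ t ◃ W.T.hom e.n ◃ W.T.cell (W.σn h) ▹
      W.T.hom (W.T.hom c.n)) (x := W.σ t ◃ W.T.hom e.n ◃ W.T.hom (W.σ t) ◃ W.T.cell (W.T.cell k.ϱ'))
      (by simp (maxDischargeDepth := 12)) (by simp (maxDischargeDepth := 12)) 1
    simp (maxDischargeDepth := 12) at e11
    rw [e11] at e10
    rw [← e10, mul_reassoc e3]
  have key' : (k.ϱ ▹ W.μ s ⊙ e.alg.ν ◃ (W.μn h).inv ⊙ e.alg.χ ▹ W.T.hom (W.T.hom h)).act =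
      E.act * ((W.σ t ◃ W.T.cell (W.σ _ ◃ W.T.cell (W.δ t ◃ k.ϱ' ⊙ e.χ' ▹ h))).act * Q.act) := by
    have e1 := congrArg (fun z => (W.σ t ◃ z).act) (W.μn_inv_two k.ϱ')
    have e2 := Cell.interchange (W.d t) (W.T.cell (W.T.cell k.ϱ'))
    simp (maxDischargeDepth := 12) [mul_assoc, ϱ, E, Q] at e1 e2 ⊢
    rw [mul_reassoc₃ e1, mul_reassoc e2]
  have hE : E.IsIso := by simp (maxDischargeDepth := 12) [E]
  have hQ : Q.IsIso := by simp (maxDischargeDepth := 12) [Q]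
  have key2 : W.δn h ▹ c.n ⊙ W.G.hom (W.G.hom h) ◃ c.χ' ⊙ W.G.cell k.ϱ' ▹ c.n ⊙ W.G.hom e.n ◃ k.ϱ' =
      W.δ t ◃ k.ϱ' ⊙ e.χ' ▹ h ↔ k.Comult := by
    constructor
    · intro h'
      refine Cell.cancel_left (p := W.δn h ▹ c.n) (by simp) (by simp (maxDischargeDepth := 12))
        (by simp (maxDischargeDepth := 12)) ?_
      have h2 := congrArg Cell.act h'
      have h3 := Cell.act_mul_inv_assoc (p := W.δn h ▹ c.n) (x := W.δ t ◃ k.ϱ')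
        (by simp (maxDischargeDepth := 12)) (by simp (maxDischargeDepth := 12))
      simp (maxDischargeDepth := 12) [mul_assoc] at h2 h3 ⊢
      rw [h2, h3]
    · intro h'
      refine Cell.act_injective ?_
      have h2 := congrArg Cell.act h'
      have h3 := Cell.act_mul_inv_assoc (p := W.δn h ▹ c.n) (x := W.δ t ◃ k.ϱ')
        (by simp (maxDischargeDepth := 12)) (by simp (maxDischargeDepth := 12))
      simp (maxDischargeDepth := 12) [mul_assoc] at h2 h3 ⊢
      rw [h2, h3]
  rw [← key2]
  constructor
  · intro h'
    have h' := congrArg Cell.act h'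
    rw [key, key'] at h'
    have h2 := Cell.cancel_both hE hQ (by simp (maxDischargeDepth := 12) [E])
      (by simp (maxDischargeDepth := 12) [E]) (by simp (maxDischargeDepth := 12) [Q])
      (by simp (maxDischargeDepth := 12) [Q]) h'
    have h3 := W.faithful _ _ (by simp (maxDischargeDepth := 12)) (by simp (maxDischargeDepth := 12)) h2
    exact W.faithful _ _ (by simp (maxDischargeDepth := 12)) (by simp (maxDischargeDepth := 12)) h3
  · intro h'
    refine Cell.act_injective ?_
    rw [key, key', h']

end CoalgHomData

end Frame

namespace Frame

variable {X : TwoCat.{w}} (W : Frame X) {r s t : X.Ob}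

/-- The cofree pseudocoalgebra. -/
@[simps] def cofree (t : X.Ob) : W.CoalgData (W.G.ob t) where
  n := W.δ t
  ψ' := W.lam' t
  χ' := W.alpha' t
  dom_ψ' := by simp
  cod_ψ' := by simp
  dom_χ' := by simp
  cod_χ' := by simp
  iso_ψ' := by simp
  iso_χ' := by simp

theorem cofree_χ (t : X.Ob) : W.σ t ◃ W.alpha (W.G.ob t) ⊙ W.d t ▹ W.T.hom (W.μ (W.G.ob t)) ⊙
    W.σ t ◃ W.T.cell (W.cofree t).alg.χ = W.d t ▹ W.μ (W.T.ob (W.G.ob t)) ⊙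
      W.σ t ◃ (W.μn (W.cofree t).alg.ν).inv ⊙
      W.d t ▹ W.T.hom (W.T.hom (W.cofree t).alg.ν) := by
  have h := fun z => congrArg (fun y => Cell.act y * z) (W.transpose_alpha t)
  have h2 := Cell.act_inv_mul (x := W.σ t ◃ W.T.hom (W.σ (W.G.ob t)) ◃
    W.T.cell (W.T.cell (W.σn (W.δ t))) ▹ W.T.hom (W.T.hom (W.T.hom (W.δ t))))
    (by simp (maxDischargeDepth := 12))
  refine Cell.act_injective ?_
  simp (maxDischargeDepth := 12) [mul_assoc] at h h2 ⊢
  rw [h, h2, Cell.act_mul_id _ _ (by simp)]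

theorem cofree_ψ (t : X.Ob) : W.σ t ◃ W.rho (W.G.ob t) ⊙ W.σ t ◃ W.T.cell (W.cofree t).alg.ψ =
    W.d t ▹ W.T.hom (W.η (W.G.ob t)) := by
  have h := congrArg Cell.act (W.transpose_rho t)
  have h2 := Cell.act_inv_mul (x := W.σ t ◃ W.T.hom (W.σ (W.G.ob t)) ◃ W.T.cell (W.ηn (W.δ t)))
    (by simp (maxDischargeDepth := 12))
  have h3 := Cell.act_mul_inv_assoc (p := W.σ t ◃ W.rho (W.G.ob t))
    (x := W.d t ▹ W.T.hom (W.η (W.G.ob t))) (by simp) (by simp)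
  refine Cell.act_injective ?_
  simp (maxDischargeDepth := 12) [mul_assoc] at h h2 h3 ⊢
  rw [h, mul_assoc, mul_assoc, h2, Cell.act_mul_id _ _ (by simp)]
  simpa using h3 1

theorem cofree_assoc (t : X.Ob) : (W.cofree t).alg.Assoc := by
  obtain ⟨a, ha⟩ : ∃ a, a = (W.cofree t).alg := ⟨_, rfl⟩
  have hν : W.σ (W.G.ob t) ⊚ W.T.hom (W.δ t) = a.ν := by rw [ha]; rfl
  have hd : (W.d t).dom = W.σ t ⊚ W.T.hom a.ν := by simp [← hν]
  have E := W.cofree_χ t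
  rw [← ha] at E ⊢
  have E1 := fun z => congrArg (fun y => (y ▹ W.T.hom (W.T.hom (W.μ (W.G.ob t)))).act * z) E
  have E2 := fun z => congrArg (fun y => (y ▹ W.μ (W.T.ob (W.T.ob (W.G.ob t)))).act * z) E
  have E3 := fun z => congrArg (fun y => (y ▹ W.T.hom (W.μ (W.T.ob (W.G.ob t)))).act * z) E
  have E4 := congrArg (fun y => (y ▹ W.T.hom (W.T.hom (W.T.hom a.ν))).act) E
  have i1 := Cell.interchange (W.d t) (W.T.cell (W.alpha (W.G.ob t)))
  have i2 := Cell.interchange (W.d t) (W.T.cell (W.T.cell a.χ))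
  have i3 := Cell.interchange (W.d t) (W.μn (W.μ (W.G.ob t))).inv
  have i4 := Cell.interchange (W.d t) (W.T.cell (W.μn a.ν).inv)
  have i5 := Cell.interchange (W.d t) (W.alpha (W.T.ob (W.G.ob t)))
  have i6 := Cell.interchange (W.d t) (W.μn (W.T.hom a.ν)).inv
  have n1 := congrArg (fun z => (W.σ t ◃ z).act) (W.μn_inv_two a.χ)
  have n2 := congrArg (fun z => (W.σ t ◃ z).act) (W.alpha_n_inv a.ν)
  have p := fun z => congrArg (fun y => (W.σ t ◃ y).act * z) (W.assoc (W.G.ob t))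
  let Y : X.Cell (W.T.ob (W.T.ob (W.T.ob (W.T.ob (W.G.ob t))))) t :=
    W.σ t ◃ W.μ _ ◃ W.alpha (W.T.ob (W.G.ob t)) ⊙ W.σ t ◃ W.alpha _ ▹ W.T.hom (W.μ _) ⊙
      W.d t ▹ W.T.hom (W.μ _) ▹ W.T.hom (W.μ _)
  have hY : Y.IsIso := by simp (maxDischargeDepth := 12) [Y, hd]
  refine W.faithful _ _ (by simp (maxDischargeDepth := 12)) (by simp (maxDischargeDepth := 12)) ?_
  refine Cell.cancel_left hY (by simp (maxDischargeDepth := 12) [Y, hd])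
    (by simp (maxDischargeDepth := 12) [Y, hd]) ?_
  simp (maxDischargeDepth := 12) [Y, hd, mul_assoc] at E1 E2 E3 E4 i1 i2 i3 i4 i5 i6 n1 n2 p ⊢
  rw [mul_reassoc i1.symm, p, E1, ← i2, mul_reassoc i3, mul_reassoc₃ n1.symm, E2, E3,
    mul_reassoc i4.symm, mul_reassoc i5, mul_reassoc₃ n2, E4, mul_reassoc i6]

theorem cofree_leftUnit (t : X.Ob) : (W.cofree t).alg.LeftUnit := by
  obtain ⟨a, ha⟩ : ∃ a, a = (W.cofree t).alg := ⟨_, rfl⟩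
  have hν : W.σ (W.G.ob t) ⊚ W.T.hom (W.δ t) = a.ν := by rw [ha]; rfl
  have hd : (W.d t).dom = W.σ t ⊚ W.T.hom a.ν := by simp [← hν]
  have E := W.cofree_χ t
  have Eψ := W.cofree_ψ t
  rw [← ha] at E Eψ ⊢
  have E1 := congrArg (fun y => (y ▹ W.T.hom (W.η (W.T.ob (W.G.ob t)))).act) E
  have E2 := fun z => congrArg (fun y => (y ▹ W.T.hom a.ν).act * z) Eψ
  have i1 := Cell.interchange (W.d t) (W.T.cell (W.ηn a.ν))
  have i2 := Cell.interchange (W.d t) (W.T.cell (W.lam (W.G.ob t)))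
  have i3 := Cell.interchange (W.d t) (W.rho (W.T.ob (W.G.ob t)))
  have n1 := fun z => congrArg (fun y => (W.σ t ◃ y).act * z) (W.rho_n a.ν)
  have u := congrArg (fun z => (W.σ t ◃ z).act) (W.unit (W.G.ob t))
  have m := Cell.act_mul_inv_assoc (p := W.σ t ◃ W.μn a.ν ▹ W.T.hom (W.η (W.T.ob (W.G.ob t))))
    (x := W.d t ▹ W.T.hom (W.T.hom a.ν) ▹ W.T.hom (W.η (W.T.ob (W.G.ob t))))
    (by simp (maxDischargeDepth := 12)) (by simp (maxDischargeDepth := 12)) 1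
  have h : (W.d t ▹ W.T.hom (W.T.hom a.ν) ▹ W.T.hom (W.η (W.T.ob (W.G.ob t)))).act =
      (W.σ t ◃ W.μn a.ν ▹ W.T.hom (W.η (W.T.ob (W.G.ob t)))).act *
        ((W.σ t ◃ W.T.hom a.ν ◃ W.rho (W.T.ob (W.G.ob t))).act *
          ((W.σ t ◃ W.T.hom a.ν ◃ W.T.cell (W.lam (W.G.ob t))).act *
            (W.σ t ◃ W.T.cell a.χ ▹ W.T.hom (W.η (W.T.ob (W.G.ob t)))).act)) := by
    simp (maxDischargeDepth := 12) [hd, mul_assoc] at E1 i2 i3 u m ⊢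
    rw [u, mul_assoc, mul_reassoc i2, mul_reassoc i3] at E1
    have e := Cell.mul_cancel_left (by simp) (by simp [hd]) (by simp [hd]) E1
    rw [e, m]
  refine W.faithful _ _ (by simp (maxDischargeDepth := 12)) (by simp (maxDischargeDepth := 12)) ?_
  refine Cell.cancel_left (p := W.σ t ◃ W.rho (W.G.ob t) ▹ W.T.hom a.ν)
    (by simp (maxDischargeDepth := 12)) (by simp (maxDischargeDepth := 12))
    (by simp (maxDischargeDepth := 12)) ?_
  simp (maxDischargeDepth := 12) [hd, mul_assoc] at E2 i1 n1 ⊢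
  rw [E2, ← i1, ← n1, h]

theorem cofree_axioms (t : X.Ob) : (W.cofree t).Coassoc ∧ (W.cofree t).Counit :=
  ⟨(W.cofree t).assoc_iff.1 (W.cofree_assoc t), (W.cofree t).leftUnit_iff.1 (W.cofree_leftUnit t)⟩

end Frame

/-! ### Transposition along a pseudoadjunction -/

attribute [simp] Pseudoadjunction.src_i Pseudoadjunction.tgt_i Pseudoadjunction.src_e
  Pseudoadjunction.tgt_e Pseudoadjunction.src_I Pseudoadjunction.tgt_I Pseudoadjunction.src_E
  Pseudoadjunction.tgt_E Pseudoadjunction.I_iso Pseudoadjunction.E_iso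

namespace Pseudoadjunction

variable {K : GrayCat.{u, w}} {A B : K.Obj} {T G : (K.hom B B).Ob} (P : Pseudoadjunction K T G)

instance : P.data.IsTyped :=
  ⟨P.src_i, P.tgt_i, P.src_e, P.tgt_e, P.src_E, P.tgt_E, P.E_iso⟩

/-- The components of the counit. -/
@[simps] def σ (t : (K.hom A B).Ob) : (K.hom A B).Hom (T ⋆ G ⋆ t) t :=
  ⟨P.e ⋆ᵣ t, by simp, by simp⟩

/-- The components of the unit. -/
@[simps] def ι (s : (K.hom A B).Ob) : (K.hom A B).Hom s (G ⋆ T ⋆ s) :=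
  ⟨P.i ⋆ᵣ s, by simp, by simp⟩

variable {r s t : (K.hom A B).Ob}

/-- The naturality cells of the counit. -/
@[simps] def σn (g : (K.hom A B).Hom s t) : (K.hom A B).Cell (T ⋆ G ⋆ s) t :=
  ⟨K.ix P.e g.val, by simp, by simp⟩

/-- The naturality cells of the unit. -/
@[simps] def ιn (g : (K.hom A B).Hom s t) : (K.hom A B).Cell s (G ⋆ T ⋆ t) :=
  ⟨K.ix P.i g.val, by simp, by simp⟩

/-- The components of the 3-cell `I`. -/
@[simps] def Ic (t : (K.hom A B).Ob) : (K.hom A B).Cell (G ⋆ t) (G ⋆ t) :=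
  ⟨P.I ⋆ᵣᵣ t, by simp, by simp⟩

/-- The components of the 3-cell `E`. -/
@[simps] def Ec (s : (K.hom A B).Ob) : (K.hom A B).Cell (T ⋆ s) (T ⋆ s) :=
  ⟨P.E ⋆ᵣᵣ s, by simp, by simp⟩

@[simp] theorem dom_σn (g : (K.hom A B).Hom s t) : (P.σn g).dom = g ⊚ P.σ s :=
  Hom.ext (by simp)
@[simp] theorem cod_σn (g : (K.hom A B).Hom s t) :
    (P.σn g).cod = P.σ t ⊚ (K.post T).hom ((K.post G).hom g) := Hom.ext (by simp)
@[simp] theorem dom_ιn (g : (K.hom A B).Hom s t) :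
    (P.ιn g).dom = (K.post G).hom ((K.post T).hom g) ⊚ P.ι s := Hom.ext (by simp)
@[simp] theorem cod_ιn (g : (K.hom A B).Hom s t) : (P.ιn g).cod = P.ι t ⊚ g :=
  Hom.ext (by simp)
@[simp] theorem dom_Ic (t : (K.hom A B).Ob) : (P.Ic t).dom = Hom.id (G ⋆ t) := Hom.ext (by simp)
@[simp] theorem cod_Ic (t : (K.hom A B).Ob) :
    (P.Ic t).cod = (K.post G).hom (P.σ t) ⊚ P.ι (G ⋆ t) := Hom.ext (by simp)
@[simp] theorem dom_Ec (s : (K.hom A B).Ob) :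
    (P.Ec s).dom = P.σ (T ⋆ s) ⊚ (K.post T).hom (P.ι s) := Hom.ext (by simp)
@[simp] theorem cod_Ec (s : (K.hom A B).Ob) : (P.Ec s).cod = Hom.id (T ⋆ s) := Hom.ext (by simp)
@[simp] theorem iso_σn (g : (K.hom A B).Hom s t) : (P.σn g).IsIso := by simp [Cell.IsIso]
@[simp] theorem iso_ιn (g : (K.hom A B).Hom s t) : (P.ιn g).IsIso := by simp [Cell.IsIso]
@[simp] theorem iso_Ic (t : (K.hom A B).Ob) : (P.Ic t).IsIso := by simp [Cell.IsIso]
@[simp] theorem iso_Ec (s : (K.hom A B).Ob) : (P.Ec s).IsIso := by simp [Cell.IsIso]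

@[simp] theorem σn_id (s : (K.hom A B).Ob) : P.σn (Hom.id s) = Cell.id (P.σ s) :=
  Cell.ext (by simp)
@[simp] theorem σn_comp (g : (K.hom A B).Hom s t) (f : (K.hom A B).Hom r s) :
    P.σn (g ⊚ f) = P.σn g ▹ (K.post T).hom ((K.post G).hom f) ⊙ g ◃ P.σn f :=
  Cell.ext (by rw [Cell.vcomp_val (by simp)]; simp)
@[simp] theorem ιn_comp (g : (K.hom A B).Hom s t) (f : (K.hom A B).Hom r s) :
    P.ιn (g ⊚ f) = P.ιn g ▹ f ⊙ (K.post G).hom ((K.post T).hom g) ◃ P.ιn f :=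
  Cell.ext (by rw [Cell.vcomp_val (by simp)]; simp)
theorem σn_two (x : (K.hom A B).Cell s t) : P.σn x.cod ⊙ x ▹ P.σ s =
    P.σ t ◃ (K.post T).cell ((K.post G).cell x) ⊙ P.σn x.dom :=
  Cell.ext (by
    rw [Cell.vcomp_val (by simp), Cell.vcomp_val (by simp)]
    simpa using K.ix_two_right P.e x.val)
theorem ιn_two (x : (K.hom A B).Cell s t) :
    P.ιn x.cod ⊙ (K.post G).cell ((K.post T).cell x) ▹ P.ι s = P.ι t ◃ x ⊙ P.ιn x.dom :=
  Cell.ext (by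
    rw [Cell.vcomp_val (by simp), Cell.vcomp_val (by simp)]
    simpa using K.ix_two_right P.i x.val)
theorem Ec_n (g : (K.hom A B).Hom s t) : (K.post T).hom g ◃ P.Ec s =
    P.Ec t ▹ (K.post T).hom g ⊙ P.σ (T ⋆ t) ◃ (K.post T).cell (P.ιn g) ⊙
      P.σn ((K.post T).hom g) ▹ (K.post T).hom (P.ι s) := by
  refine Cell.ext ?_
  rw [Cell.vcomp_val (by simp), Cell.vcomp_val (by simp)]
  simpa using K.ix_two_left P.E g.val

/-- The comparison `σ ∘ T(Gf ∘ ι) ⇛ f`. -/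
noncomputable def cmp {s t : (K.hom A B).Ob} (f : (K.hom A B).Hom (T ⋆ s) t) :
    (K.hom A B).Cell (T ⋆ s) t :=
  f ◃ P.Ec s ⊙ (P.σn f).inv ▹ (K.post T).hom (P.ι s)

@[simp] theorem dom_cmp (f : (K.hom A B).Hom (T ⋆ s) t) : (P.cmp f).dom =
    P.σ t ⊚ (K.post T).hom ((K.post G).hom f) ⊚ (K.post T).hom (P.ι s) := by simp [cmp]
@[simp] theorem cod_cmp (f : (K.hom A B).Hom (T ⋆ s) t) : (P.cmp f).cod = f := by simp [cmp]
@[simp] theorem iso_cmp (f : (K.hom A B).Hom (T ⋆ s) t) : (P.cmp f).IsIso := by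
  simp (maxDischargeDepth := 9) [cmp]

theorem cmp_natural (x : (K.hom A B).Cell (T ⋆ s) t) :
    P.cmp x.cod ⊙ P.σ t ◃ (K.post T).cell ((K.post G).cell x) ▹ (K.post T).hom (P.ι s) =
      x ⊙ P.cmp x.dom := by
  have h1 := Cell.square_inv (by simp) (by simp) (by simp) (by simp) (P.σn_two x)
  have h2 := congrArg (fun z => (z ▹ (K.post T).hom (P.ι s)).act) h1
  have I := Cell.interchange x (P.Ec s)
  refine Cell.act_injective ?_
  simp (maxDischargeDepth := 9) [cmp, mul_assoc] at h2 I ⊢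
  rw [← h2, mul_reassoc I]

theorem cmp_comp (f : (K.hom A B).Hom (T ⋆ s) t) (h : (K.hom A B).Hom r s) :
    P.cmp (f ⊚ (K.post T).hom h) ⊙
        P.σ t ◃ (K.post T).hom ((K.post G).hom f) ◃ (K.post T).cell (P.ιn h).inv =
      P.cmp f ▹ (K.post T).hom h := by
  have h1 := fun z => congrArg (fun y => (f ◃ y).act * z) (P.Ec_n h)
  have I := Cell.interchange (P.σn f).inv ((K.post T).cell (P.ιn h).inv)
  have c := Cell.act_mul_inv_assoc (p := f ◃ P.σn ((K.post T).hom h) ▹ (K.post T).hom (P.ι r))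
    (x := (P.σn f).inv ▹ (K.post T).hom ((K.post G).hom ((K.post T).hom h)) ▹
      (K.post T).hom (P.ι r)) (by simp (maxDischargeDepth := 9)) (by simp (maxDischargeDepth := 9))
  have c2 := Cell.act_mul_inv_assoc (p := f ◃ P.σ (T ⋆ s) ◃ (K.post T).cell (P.ιn h))
    (x := (P.σn f).inv ▹ (K.post T).hom (P.ι s) ▹ (K.post T).hom h)
    (by simp (maxDischargeDepth := 9)) (by simp (maxDischargeDepth := 9)) 1
  refine Cell.act_injective ?_
  simp (maxDischargeDepth := 9) [cmp, mul_assoc] at h1 I c c2 ⊢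
  rw [h1, c, ← I, c2]

theorem cmp_post (g : (K.hom A B).Hom t r) (f : (K.hom A B).Hom (T ⋆ s) t) :
    P.cmp (g ⊚ f) = g ◃ P.cmp f ⊙
      (P.σn g).inv ▹ (K.post T).hom ((K.post G).hom f) ▹ (K.post T).hom (P.ι s) := by
  refine Cell.act_injective ?_
  simp (maxDischargeDepth := 9) [cmp, mul_assoc]

theorem cmp_σ (t : (K.hom A B).Ob) : P.cmp (P.σ t) ⊙ P.σ t ◃ (K.post T).cell (P.Ic t) =
    Cell.id (P.σ t) := by
  refine Cell.ext ?_
  have h := congrArg (fun z => z ⋆ᵣᵣ t) P.swallowtail_counit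
  rw [cmp, Cell.vcomp_val (by simp), Cell.vcomp_val (by simp)]
  simp (maxDischargeDepth := 9) at h ⊢
  exact h

/-- The comparison `f ⇛ G(σ ∘ Tf) ∘ ι`. -/
noncomputable def ucmp {s t : (K.hom A B).Ob} (f : (K.hom A B).Hom s (G ⋆ t)) :
    (K.hom A B).Cell s (G ⋆ t) :=
  (K.post G).hom (P.σ t) ◃ (P.ιn f).inv ⊙ P.Ic t ▹ f

@[simp] theorem dom_ucmp (f : (K.hom A B).Hom s (G ⋆ t)) : (P.ucmp f).dom = f := by simp [ucmp]
@[simp] theorem cod_ucmp (f : (K.hom A B).Hom s (G ⋆ t)) : (P.ucmp f).cod =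
    (K.post G).hom (P.σ t) ⊚ (K.post G).hom ((K.post T).hom f) ⊚ P.ι s := by simp [ucmp]
@[simp] theorem iso_ucmp (f : (K.hom A B).Hom s (G ⋆ t)) : (P.ucmp f).IsIso := by
  simp (maxDischargeDepth := 9) [ucmp]

theorem ucmp_natural (x : (K.hom A B).Cell s (G ⋆ t)) :
    P.ucmp x.cod ⊙ x =
      (K.post G).hom (P.σ t) ◃ (K.post G).cell ((K.post T).cell x) ▹ P.ι s ⊙ P.ucmp x.dom := by
  have h1 := Cell.square_inv (by simp) (by simp) (by simp) (by simp) (P.ιn_two x)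
  have h2 := congrArg (fun z => ((K.post G).hom (P.σ t) ◃ z).act) h1
  have I := Cell.interchange (P.Ic t) x
  refine Cell.act_injective ?_
  simp (maxDischargeDepth := 9) [ucmp, mul_assoc] at h2 I ⊢
  rw [mul_reassoc h2, I]

theorem cmp_ucmp (f : (K.hom A B).Hom s (G ⋆ t)) :
    P.cmp (P.σ t ⊚ (K.post T).hom f) ⊙ P.σ t ◃ (K.post T).cell (P.ucmp f) =
      Cell.id (P.σ t ⊚ (K.post T).hom f) := by
  have h1 := fun z => congrArg (fun y => y.act * z) (P.cmp_comp (P.σ t) f)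
  have h2 := congrArg (fun y => (y ▹ (K.post T).hom f).act) (P.cmp_σ t)
  refine Cell.act_injective ?_
  simp (maxDischargeDepth := 9) [ucmp, mul_assoc] at h1 h2 ⊢
  rw [h1, h2]

theorem faithful (x y : (K.hom A B).Cell s (G ⋆ t)) (hd : x.dom = y.dom) (hc : x.cod = y.cod)
    (h : P.σ t ◃ (K.post T).cell x = P.σ t ◃ (K.post T).cell y) : x = y := by
  have h1 := congrArg Cell.act (P.ucmp_natural x)
  have h2 := congrArg Cell.act (P.ucmp_natural y)
  have h3 := congrArg (fun z => ((K.post G).cell z ▹ P.ι s).act) h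
  simp [hd, hc] at h1 h2 h3
  rw [h3, ← h2] at h1
  exact Cell.cancel_left (by simp) (by simp [hc]) (by simp) h1

theorem full (f g : (K.hom A B).Hom s (G ⋆ t)) (y : (K.hom A B).Cell (T ⋆ s) t)
    (hd : y.dom = P.σ t ⊚ (K.post T).hom f) (hc : y.cod = P.σ t ⊚ (K.post T).hom g) :
    ∃ x : (K.hom A B).Cell s (G ⋆ t), x.dom = f ∧ x.cod = g ∧ P.σ t ◃ (K.post T).cell x = y := by
  refine ⟨(P.ucmp g).inv ⊙ (K.post G).cell y ▹ P.ι s ⊙ P.ucmp f, ?_, ?_, ?_⟩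
  · simp (maxDischargeDepth := 9) [hd, hc]
  · simp (maxDischargeDepth := 9) [hd, hc]
  · have h1 := fun z => congrArg (fun y => y.act * z) (P.cmp_natural y)
    have h2 := Cell.eq_inv_of_vcomp (by simp (maxDischargeDepth := 9))
      (by simp (maxDischargeDepth := 9)) ((P.cmp_ucmp g).trans (by simp))
    have h3 := congrArg Cell.act (P.cmp_ucmp f)
    refine Cell.act_injective ?_
    simp (maxDischargeDepth := 9) [hd, hc, mul_assoc] at h1 h2 h3 ⊢
    rw [← h2, h1, h3, Cell.act_mul_id _ _ (by simp [hd])]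

/-- The transpose `(Gf ∘ ι) ∘ h ⇛ Gg ∘ ι` of a cell `x : f ∘ Th ⇛ g`. -/
noncomputable def curry {r s t : (K.hom A B).Ob} (f : (K.hom A B).Hom (T ⋆ s) t)
    (h : (K.hom A B).Hom r s) (x : (K.hom A B).Cell (T ⋆ r) t) : (K.hom A B).Cell r (G ⋆ t) :=
  (K.post G).cell x ▹ P.ι r ⊙ (K.post G).hom f ◃ (P.ιn h).inv

section curry

variable {f : (K.hom A B).Hom (T ⋆ s) t} {h : (K.hom A B).Hom r s}
  {x : (K.hom A B).Cell (T ⋆ r) t}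

@[simp] theorem dom_curry (hx : x.dom = f ⊚ (K.post T).hom h) :
    (P.curry f h x).dom = (K.post G).hom f ⊚ P.ι s ⊚ h := by
  simp (maxDischargeDepth := 9) [curry, hx]
@[simp] theorem cod_curry (hx : x.dom = f ⊚ (K.post T).hom h) :
    (P.curry f h x).cod = (K.post G).hom x.cod ⊚ P.ι r := by
  simp (maxDischargeDepth := 9) [curry, hx]
@[simp] theorem iso_curry (hx : x.dom = f ⊚ (K.post T).hom h) (hi : x.IsIso) : (P.curry f h x).IsIso := by
  simp (maxDischargeDepth := 9) [curry, hx, hi]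

theorem cmp_curry (hx : x.dom = f ⊚ (K.post T).hom h) :
    P.cmp x.cod ⊙ P.σ t ◃ (K.post T).cell (P.curry f h x) =
    x ⊙ P.cmp f ▹ (K.post T).hom h := by
  have h1 := fun z => congrArg (fun y => y.act * z) (P.cmp_natural x)
  have h2 := congrArg Cell.act (P.cmp_comp f h)
  refine Cell.act_injective ?_
  simp (maxDischargeDepth := 9) [curry, hx, mul_assoc] at h1 h2 ⊢
  rw [h1, h2]

end curry

end Pseudoadjunction

namespace AdjData

variable {K : GrayCat.{u, w}} {A B C : K.Obj}

section

variable (P : AdjData K A B) (P' : AdjData K B C)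

@[simp] theorem comp_F : (P.comp P').F = P.F ⋆ P'.F := rfl
@[simp] theorem comp_U : (P.comp P').U = P'.U ⋆ P.U := rfl
@[simp] theorem comp_i : (P.comp P').i = P'.U ⋆ₗ P.i ⋆ᵣ P'.F ∘₁ P'.i := rfl
@[simp] theorem comp_e : (P.comp P').e = P.e ∘₁ P.F ⋆ₗ P'.e ⋆ᵣ P.U := rfl
@[simp] theorem id_F : (AdjData.id K B).F = K.one B := rfl
@[simp] theorem id_U : (AdjData.id K B).U = K.one B := rfl
@[simp] theorem id_i : (AdjData.id K B).i = (K.hom B B).id (K.one B) := rfl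
@[simp] theorem id_e : (AdjData.id K B).e = (K.hom B B).id (K.one B) := rfl

end

instance (P : AdjData K A B) (P' : AdjData K B C) [P.IsTyped] [P'.IsTyped] :
    (P.comp P').IsTyped := by
  constructor <;> simp (maxDischargeDepth := 12) [comp]

instance : (AdjData.id K B).IsTyped := by
  constructor <;> simp [AdjData.id]

section

variable {D E : K.Obj} (P : AdjData K A B) (P' : AdjData K B C) [P.IsTyped] [P'.IsTyped]

theorem curry_comp {s s' : (K.hom D C).Ob} {f : (K.hom D A).One} {h : (K.hom D C).One}
    {x : (K.hom D A).Two} (hf : (K.hom D A).src f = P.F ⋆ P'.F ⋆ s')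
    (hs : (K.hom D C).src h = s) (ht : (K.hom D C).tgt h = s')
    (hx : (K.hom D A).src₂ x = f ∘₁ P.F ⋆ₗ P'.F ⋆ₗ h) :
    (P.comp P').curry s f h x = P'.curry s (P.U ⋆ₗ f ∘₁ P.i ⋆ᵣ (P'.F ⋆ s')) h
      (P.curry (P'.F ⋆ s) f (P'.F ⋆ₗ h) x) := by
  simp (maxDischargeDepth := 12) [curry, comp, hf, hs, ht, hx, ← TwoCat.src_src₂]

theorem curry_id {s : (K.hom D B).Ob} {f h : (K.hom D B).One} {x : (K.hom D B).Two}
    (hs : (K.hom D B).src h = s) (hf : (K.hom D B).src f = (K.hom D B).tgt h)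
    (hx : (K.hom D B).src₂ x = f ∘₁ h) : (AdjData.id K B).curry s f h x = x := by
  simp (maxDischargeDepth := 12) [curry, id, hf, hs, hx, ← TwoCat.src_src₂]

theorem curry_pre {s s' : (K.hom D B).Ob} {f : (K.hom D A).One} {h : (K.hom D B).One}
    {x : (K.hom D A).Two} (hf : (K.hom D A).src f = P.F ⋆ s')
    (hs : (K.hom D B).src h = s) (ht : (K.hom D B).tgt h = s')
    (hx : (K.hom D A).src₂ x = f ∘₁ P.F ⋆ₗ h) (t : (K.hom E D).Ob) :
    P.curry s f h x ⋆ᵣᵣ t = P.curry (s ⋆ t) (f ⋆ᵣ t) (h ⋆ᵣ t) (x ⋆ᵣᵣ t) := by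
  simp (maxDischargeDepth := 12) [curry, hf, hs, ht, hx, ← TwoCat.src_src₂]

theorem cmp_pre {s : (K.hom D B).Ob} {f : (K.hom D A).One}
    (hf : (K.hom D A).src f = P.F ⋆ s) (t : (K.hom E D).Ob) :
    P.cmp s f ⋆ᵣᵣ t = P.cmp (s ⋆ t) (f ⋆ᵣ t) := by
  simp (maxDischargeDepth := 12) [cmp, hf]

end

end AdjData

namespace Pseudoadjunction

variable {K : GrayCat.{u, w}} {A B : K.Obj} {T G : (K.hom B B).Ob} (P : Pseudoadjunction K T G)
  {r s t : (K.hom A B).Ob}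

@[simp] theorem data_F : P.data.F = T := rfl
@[simp] theorem data_U : P.data.U = G := rfl
@[simp] theorem data_i : P.data.i = P.i := rfl
@[simp] theorem data_e : P.data.e = P.e := rfl
@[simp] theorem data_I : P.data.I = P.I := rfl
@[simp] theorem data_E : P.data.E = P.E := rfl

theorem curry_val {f : (K.hom A B).Hom (T ⋆ s) t} {h : (K.hom A B).Hom r s}
    {x : (K.hom A B).Cell (T ⋆ r) t} (hx : x.dom = f ⊚ (K.post T).hom h) :
    (P.curry f h x).val = P.data.curry r f.val h.val x.val := by
  rw [curry, Cell.vcomp_val (by simp [hx])]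
  simp [AdjData.curry]

theorem cmp_val (f : (K.hom A B).Hom (T ⋆ s) t) : (P.cmp f).val = P.data.cmp s f.val := by
  rw [cmp, Cell.vcomp_val (by simp)]
  simp [AdjData.cmp]

/-- The twofold transpose. -/
noncomputable def curry₂ (f : (K.hom A B).Hom (T ⋆ T ⋆ s) t) (h : (K.hom A B).Hom r s)
    (x : (K.hom A B).Cell (T ⋆ T ⋆ r) t) : (K.hom A B).Cell r (G ⋆ G ⋆ t) :=
  P.curry ((K.post G).hom f ⊚ P.ι (T ⋆ s)) h (P.curry f ((K.post T).hom h) x)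

/-- The threefold transpose. -/
noncomputable def curry₃ (f : (K.hom A B).Hom (T ⋆ T ⋆ T ⋆ s) t) (h : (K.hom A B).Hom r s)
    (x : (K.hom A B).Cell (T ⋆ T ⋆ T ⋆ r) t) : (K.hom A B).Cell r (G ⋆ G ⋆ G ⋆ t) :=
  P.curry₂ ((K.post G).hom f ⊚ P.ι (T ⋆ T ⋆ s)) h (P.curry f ((K.post T).hom ((K.post T).hom h)) x)

section

variable {f : (K.hom A B).Hom (T ⋆ T ⋆ s) t} {h : (K.hom A B).Hom r s}
  {x : (K.hom A B).Cell (T ⋆ T ⋆ r) t}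

@[simp] theorem dom_curry₂ (hx : x.dom = f ⊚ (K.post T).hom ((K.post T).hom h)) :
    (P.curry₂ f h x).dom = (K.post G).hom ((K.post G).hom f) ⊚
      (K.post G).hom (P.ι (T ⋆ s)) ⊚ P.ι s ⊚ h := by
  simp (maxDischargeDepth := 9) [curry₂, hx]
@[simp] theorem cod_curry₂ (hx : x.dom = f ⊚ (K.post T).hom ((K.post T).hom h)) :
    (P.curry₂ f h x).cod = (K.post G).hom ((K.post G).hom x.cod) ⊚
      (K.post G).hom (P.ι (T ⋆ r)) ⊚ P.ι r := by
  simp (maxDischargeDepth := 9) [curry₂, hx]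
@[simp] theorem iso_curry₂ (hx : x.dom = f ⊚ (K.post T).hom ((K.post T).hom h)) (hi : x.IsIso) :
    (P.curry₂ f h x).IsIso := by
  simp (maxDischargeDepth := 9) [curry₂, hx, hi]

theorem curry₂_val (hx : x.dom = f ⊚ (K.post T).hom ((K.post T).hom h)) :
    (P.curry₂ f h x).val = (P.data.comp P.data).curry r f.val h.val x.val := by
  have hx' : (K.hom A B).src₂ x.val = f.val ∘₁ T ⋆ₗ T ⋆ₗ h.val := congrArg Hom.val hx
  rw [curry₂, curry_val _ (by simp [hx]), curry_val _ (by simp [hx]),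
    AdjData.curry_comp _ _ (s' := s) (by simp) (by simp) (by simp) (by simpa using hx')]
  simp

end

section

variable {f : (K.hom A B).Hom (T ⋆ T ⋆ T ⋆ s) t} {h : (K.hom A B).Hom r s}
  {x : (K.hom A B).Cell (T ⋆ T ⋆ T ⋆ r) t}

@[simp] theorem dom_curry₃ (hx : x.dom = f ⊚ (K.post T).hom ((K.post T).hom ((K.post T).hom h))) :
    (P.curry₃ f h x).dom = (K.post G).hom ((K.post G).hom ((K.post G).hom f)) ⊚
      (K.post G).hom ((K.post G).hom (P.ι (T ⋆ T ⋆ s))) ⊚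
      (K.post G).hom (P.ι (T ⋆ s)) ⊚ P.ι s ⊚ h := by
  simp (maxDischargeDepth := 9) [curry₃, hx]
@[simp] theorem cod_curry₃ (hx : x.dom = f ⊚ (K.post T).hom ((K.post T).hom ((K.post T).hom h))) :
    (P.curry₃ f h x).cod = (K.post G).hom ((K.post G).hom ((K.post G).hom x.cod)) ⊚
      (K.post G).hom ((K.post G).hom (P.ι (T ⋆ T ⋆ r))) ⊚
      (K.post G).hom (P.ι (T ⋆ r)) ⊚ P.ι r := by
  simp (maxDischargeDepth := 9) [curry₃, hx]
@[simp] theorem iso_curry₃ (hx : x.dom = f ⊚ (K.post T).hom ((K.post T).hom ((K.post T).hom h)))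
    (hi : x.IsIso) : (P.curry₃ f h x).IsIso := by
  simp (maxDischargeDepth := 9) [curry₃, hx, hi]

theorem curry₃_val (hx : x.dom = f ⊚ (K.post T).hom ((K.post T).hom ((K.post T).hom h))) :
    (P.curry₃ f h x).val = (P.data.comp (P.data.comp P.data)).curry r f.val h.val x.val := by
  have hx' : (K.hom A B).src₂ x.val = f.val ∘₁ T ⋆ₗ T ⋆ₗ T ⋆ₗ h.val := congrArg Hom.val hx
  rw [curry₃, curry₂_val _ (by simp [hx]), curry_val _ (by simp [hx]),
    AdjData.curry_comp P.data (P.data.comp P.data) (s' := s) (by simp) (by simp) (by simp)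
      (by simpa using hx')]
  simp

theorem curry₃_val' (hx : x.dom = f ⊚ (K.post T).hom ((K.post T).hom ((K.post T).hom h))) :
    (P.curry₃ f h x).val = ((P.data.comp P.data).comp P.data).curry r f.val h.val x.val := by
  have hx' : (K.hom A B).src₂ x.val = f.val ∘₁ T ⋆ₗ T ⋆ₗ T ⋆ₗ h.val := congrArg Hom.val hx
  have e : P.curry₃ f h x = P.curry ((K.post G).hom ((K.post G).hom f) ⊚
      (K.post G).hom (P.ι (T ⋆ T ⋆ s)) ⊚ P.ι (T ⋆ s)) h (P.curry₂ f ((K.post T).hom h) x) := by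
    simp [curry₃, curry₂]
  rw [e, curry_val _ (by simp [hx]), curry₂_val _ (by simp [hx]),
    AdjData.curry_comp (P.data.comp P.data) P.data (s' := s) (by simp) (by simp) (by simp)
      (by simpa using hx')]
  simp

end

/-- The twofold comparison. -/
noncomputable def cmp₂ (f : (K.hom A B).Hom (T ⋆ T ⋆ s) t) : (K.hom A B).Cell (T ⋆ T ⋆ s) t :=
  P.cmp f ⊙ P.σ t ◃ (K.post T).cell (P.cmp ((K.post G).hom f ⊚ P.ι (T ⋆ s)))

@[simp] theorem dom_cmp₂ (f : (K.hom A B).Hom (T ⋆ T ⋆ s) t) : (P.cmp₂ f).dom =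
    P.σ t ⊚ (K.post T).hom (P.σ (G ⋆ t)) ⊚
      (K.post T).hom ((K.post T).hom ((K.post G).hom ((K.post G).hom f))) ⊚
      (K.post T).hom ((K.post T).hom ((K.post G).hom (P.ι (T ⋆ s)))) ⊚
      (K.post T).hom ((K.post T).hom (P.ι s)) := by simp [cmp₂]
@[simp] theorem cod_cmp₂ (f : (K.hom A B).Hom (T ⋆ T ⋆ s) t) : (P.cmp₂ f).cod = f := by
  simp [cmp₂]
theorem cmp₂_natural (x : (K.hom A B).Cell (T ⋆ T ⋆ s) t) :
    P.cmp₂ x.cod ⊙ P.σ t ◃ (K.post T).hom (P.σ (G ⋆ t)) ◃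
      (K.post T).cell ((K.post T).cell ((K.post G).cell ((K.post G).cell x ▹ P.ι (T ⋆ s)) ▹
        P.ι s)) = x ⊙ P.cmp₂ x.dom := by
  have h1 := congrArg (fun z => (P.σ t ◃ (K.post T).cell z).act)
    (P.cmp_natural ((K.post G).cell x ▹ P.ι (T ⋆ s)))
  have h2 := fun z => congrArg (fun y => y.act * z) (P.cmp_natural x)
  refine Cell.act_injective ?_
  simp (maxDischargeDepth := 9) [cmp₂, mul_assoc] at h1 h2 ⊢
  rw [h1, h2]

theorem cmp₂_curry {f : (K.hom A B).Hom (T ⋆ T ⋆ s) t} {h : (K.hom A B).Hom r s}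
    {x : (K.hom A B).Cell (T ⋆ T ⋆ r) t}
    (hx : x.dom = f ⊚ (K.post T).hom ((K.post T).hom h)) :
    P.cmp₂ x.cod ⊙ P.σ t ◃ (K.post T).hom (P.σ (G ⋆ t)) ◃ (K.post T).cell ((K.post T).cell
      (P.curry₂ f h x)) =
    x ⊙ P.cmp₂ f ▹ (K.post T).hom ((K.post T).hom h) := by
  have h1 := congrArg (fun z => (P.σ t ◃ (K.post T).cell z).act)
    (P.cmp_curry (f := (K.post G).hom f ⊚ P.ι (T ⋆ s)) (h := h)
      (x := P.curry f ((K.post T).hom h) x) (by simp [hx]))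
  have h2 := fun z => congrArg (fun y => y.act * z) (P.cmp_curry hx)
  refine Cell.act_injective ?_
  simp (maxDischargeDepth := 9) [cmp₂, curry₂, hx, mul_assoc] at h1 h2 ⊢
  rw [h1, h2]

/-- The threefold comparison. -/
noncomputable def cmp₃ (f : (K.hom A B).Hom (T ⋆ T ⋆ T ⋆ s) t) :
    (K.hom A B).Cell (T ⋆ T ⋆ T ⋆ s) t :=
  P.cmp f ⊙ P.σ t ◃ (K.post T).cell (P.cmp₂ ((K.post G).hom f ⊚ P.ι (T ⋆ T ⋆ s)))

@[simp] theorem dom_cmp₃ (f : (K.hom A B).Hom (T ⋆ T ⋆ T ⋆ s) t) : (P.cmp₃ f).dom =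
    P.σ t ⊚ (K.post T).hom (P.σ (G ⋆ t)) ⊚ (K.post T).hom ((K.post T).hom (P.σ (G ⋆ G ⋆ t))) ⊚
      (K.post T).hom ((K.post T).hom ((K.post T).hom
        ((K.post G).hom ((K.post G).hom ((K.post G).hom f))))) ⊚
      (K.post T).hom ((K.post T).hom ((K.post T).hom
        ((K.post G).hom ((K.post G).hom (P.ι (T ⋆ T ⋆ s)))))) ⊚
      (K.post T).hom ((K.post T).hom ((K.post T).hom ((K.post G).hom (P.ι (T ⋆ s))))) ⊚
      (K.post T).hom ((K.post T).hom ((K.post T).hom (P.ι s))) := by simp [cmp₃]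
@[simp] theorem cod_cmp₃ (f : (K.hom A B).Hom (T ⋆ T ⋆ T ⋆ s) t) : (P.cmp₃ f).cod = f := by
  simp [cmp₃]
theorem cmp₃_natural (x : (K.hom A B).Cell (T ⋆ T ⋆ T ⋆ s) t) :
    P.cmp₃ x.cod ⊙ P.σ t ◃ (K.post T).hom (P.σ (G ⋆ t)) ◃ (K.post T).hom ((K.post T).hom
      (P.σ (G ⋆ G ⋆ t))) ◃ (K.post T).cell ((K.post T).cell ((K.post T).cell ((K.post G).cell
        ((K.post G).cell ((K.post G).cell x ▹ P.ι (T ⋆ T ⋆ s)) ▹ P.ι (T ⋆ s)) ▹ P.ι s))) =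
      x ⊙ P.cmp₃ x.dom := by
  have h1 := congrArg (fun z => (P.σ t ◃ (K.post T).cell z).act)
    (P.cmp₂_natural ((K.post G).cell x ▹ P.ι (T ⋆ T ⋆ s)))
  have h2 := fun z => congrArg (fun y => y.act * z) (P.cmp_natural x)
  refine Cell.act_injective ?_
  simp (maxDischargeDepth := 9) [cmp₃, mul_assoc] at h1 h2 ⊢
  rw [h1, h2]

theorem cmp₃_curry {f : (K.hom A B).Hom (T ⋆ T ⋆ T ⋆ s) t} {h : (K.hom A B).Hom r s}
    {x : (K.hom A B).Cell (T ⋆ T ⋆ T ⋆ r) t}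
    (hx : x.dom = f ⊚ (K.post T).hom ((K.post T).hom ((K.post T).hom h))) :
    P.cmp₃ x.cod ⊙ P.σ t ◃ (K.post T).hom (P.σ (G ⋆ t)) ◃ (K.post T).hom ((K.post T).hom
      (P.σ (G ⋆ G ⋆ t))) ◃ (K.post T).cell ((K.post T).cell ((K.post T).cell
        (P.curry₃ f h x))) =
    x ⊙ P.cmp₃ f ▹ (K.post T).hom ((K.post T).hom ((K.post T).hom h)) := by
  have h1 := congrArg (fun z => (P.σ t ◃ (K.post T).cell z).act)
    (P.cmp₂_curry (f := (K.post G).hom f ⊚ P.ι (T ⋆ T ⋆ s)) (h := h)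
      (x := P.curry f ((K.post T).hom ((K.post T).hom h)) x) (by simp [hx]))
  have h2 := fun z => congrArg (fun y => y.act * z) (P.cmp_curry hx)
  refine Cell.act_injective ?_
  simp (maxDischargeDepth := 9) [cmp₃, curry₃, hx, mul_assoc] at h1 h2 ⊢
  rw [h1, h2]

/-- The 3-cell `E` of the composite of the pseudoadjunction with itself. -/
noncomputable def Ec₂ (s : (K.hom A B).Ob) : (K.hom A B).Cell (T ⋆ T ⋆ s) (T ⋆ T ⋆ s) :=
  (K.post T).cell (P.Ec s) ⊙
    P.Ec (T ⋆ s) ▹ ((K.post T).hom (P.σ (T ⋆ s)) ⊚ (K.post T).hom ((K.post T).hom (P.ι s))) ⊙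
    P.σ (T ⋆ T ⋆ s) ◃ (K.post T).cell (P.σn (P.ι (T ⋆ s))).inv ▹
      (K.post T).hom ((K.post T).hom (P.ι s))

theorem Ec₂_val (s : (K.hom A B).Ob) : (P.Ec₂ s).val = (P.data.comp P.data).E ⋆ᵣᵣ s := by
  rw [Ec₂, Cell.vcomp_val (by simp (maxDischargeDepth := 9)), Cell.vcomp_val (by simp)]
  simp (maxDischargeDepth := 12) [AdjData.comp]

/-- The naturality cells of the counit of the composite of the pseudoadjunction with itself. -/
noncomputable def σn₂ (f : (K.hom A B).Hom s t) : (K.hom A B).Cell (T ⋆ T ⋆ G ⋆ G ⋆ s) t :=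
  P.σ t ◃ (K.post T).cell (P.σn ((K.post G).hom f)) ⊙ P.σn f ▹ (K.post T).hom (P.σ (G ⋆ s))

theorem σn₂_val (f : (K.hom A B).Hom s t) :
    (P.σn₂ f).val = K.ix (P.data.comp P.data).e f.val := by
  rw [σn₂, Cell.vcomp_val (by simp)]
  simp (maxDischargeDepth := 12) [AdjData.comp]

@[simp] theorem dom_σn₂ (g : (K.hom A B).Hom s t) :
    (P.σn₂ g).dom = g ⊚ P.σ s ⊚ (K.post T).hom (P.σ (G ⋆ s)) := by
  simp (maxDischargeDepth := 9) [σn₂]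
@[simp] theorem iso_σn₂ (g : (K.hom A B).Hom s t) : (P.σn₂ g).IsIso := by
  simp (maxDischargeDepth := 9) [σn₂]
@[simp] theorem dom_Ec₂ (s : (K.hom A B).Ob) : (P.Ec₂ s).dom = P.σ (T ⋆ T ⋆ s) ⊚
    (K.post T).hom (P.σ (G ⋆ T ⋆ T ⋆ s)) ⊚ (K.post T).hom ((K.post T).hom
      ((K.post G).hom (P.ι (T ⋆ s)))) ⊚ (K.post T).hom ((K.post T).hom (P.ι s)) := by
  simp (maxDischargeDepth := 9) [Ec₂]
theorem cmp₂_eq (f : (K.hom A B).Hom (T ⋆ T ⋆ s) t) : P.cmp₂ f = f ◃ P.Ec₂ s ⊙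
    (P.σn₂ f).inv ▹ ((K.post T).hom ((K.post T).hom ((K.post G).hom (P.ι (T ⋆ s)))) ⊚
      (K.post T).hom ((K.post T).hom (P.ι s))) := by
  have I1 := Cell.interchange (P.σn f).inv ((K.post T).cell (P.ι (T ⋆ s) ◃ P.Ec s))
  have I2 := Cell.interchange (f ◃ P.Ec (T ⋆ s)) ((K.post T).cell (P.Ec s))
  have I3 := Cell.interchange (P.σn f).inv ((K.post T).cell ((P.σn (P.ι (T ⋆ s))).inv ▹
    (K.post T).hom (P.ι s)))
  refine Cell.act_injective ?_
  simp (maxDischargeDepth := 9) [cmp₂, cmp, σn₂, Ec₂, mul_assoc] at I1 I2 I3 ⊢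
  rw [← mul_reassoc I1, ← mul_reassoc I2, ← mul_reassoc I3]

theorem cmp₂_val (f : (K.hom A B).Hom (T ⋆ T ⋆ s) t) :
    (P.cmp₂ f).val = (P.data.comp P.data).cmp s f.val := by
  rw [cmp₂_eq, Cell.vcomp_val (by simp)]
  simp [AdjData.cmp, σn₂_val, Ec₂_val]
  simp (maxDischargeDepth := 12) [AdjData.comp]

end Pseudoadjunction

namespace Pseudomonad

variable {K : GrayCat.{u, w}} {A B : K.Obj} (T : Pseudomonad K B)

/-- The components of the multiplication. -/
@[simps] def μc (s : (K.hom A B).Ob) : (K.hom A B).Hom (T.T ⋆ T.T ⋆ s) (T.T ⋆ s) :=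
  ⟨T.μ ⋆ᵣ s, by simp, by simp⟩

/-- The components of the unit. -/
@[simps] def ηc (s : (K.hom A B).Ob) : (K.hom A B).Hom s (T.T ⋆ s) :=
  ⟨T.η ⋆ᵣ s, by simp, by simp⟩

/-- The components of `λ`. -/
@[simps] def lamc (s : (K.hom A B).Ob) : (K.hom A B).Cell (T.T ⋆ s) (T.T ⋆ s) :=
  ⟨T.lam ⋆ᵣᵣ s, by simp, by simp⟩

/-- The components of `ρ`. -/
@[simps] def rhoc (s : (K.hom A B).Ob) : (K.hom A B).Cell (T.T ⋆ s) (T.T ⋆ s) :=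
  ⟨T.rho ⋆ᵣᵣ s, by simp, by simp⟩

/-- The components of `α`. -/
@[simps] def alphac (s : (K.hom A B).Ob) : (K.hom A B).Cell (T.T ⋆ T.T ⋆ T.T ⋆ s) (T.T ⋆ s) :=
  ⟨T.alpha ⋆ᵣᵣ s, by simp, by simp⟩

variable {r s t : (K.hom A B).Ob}

/-- The naturality cells of the multiplication. -/
@[simps] def μn (g : (K.hom A B).Hom s t) : (K.hom A B).Cell (T.T ⋆ T.T ⋆ s) (T.T ⋆ t) :=
  ⟨K.ix T.μ g.val, by simp, by simp⟩

/-- The naturality cells of the unit. -/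
@[simps] def ηn (g : (K.hom A B).Hom s t) : (K.hom A B).Cell s (T.T ⋆ t) :=
  ⟨K.ix T.η g.val, by simp, by simp⟩

@[simp] theorem dom_μn (g : (K.hom A B).Hom s t) : (T.μn g).dom = (K.post T.T).hom g ⊚ T.μc s :=
  Hom.ext (by simp)
@[simp] theorem cod_μn (g : (K.hom A B).Hom s t) :
    (T.μn g).cod = T.μc t ⊚ (K.post T.T).hom ((K.post T.T).hom g) := Hom.ext (by simp)
@[simp] theorem iso_μn (g : (K.hom A B).Hom s t) : (T.μn g).IsIso := by simp [Cell.IsIso]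
@[simp] theorem dom_ηn (g : (K.hom A B).Hom s t) : (T.ηn g).dom = (K.post T.T).hom g ⊚ T.ηc s :=
  Hom.ext (by simp)
@[simp] theorem cod_ηn (g : (K.hom A B).Hom s t) : (T.ηn g).cod = T.ηc t ⊚ g := Hom.ext (by simp)
@[simp] theorem iso_ηn (g : (K.hom A B).Hom s t) : (T.ηn g).IsIso := by simp [Cell.IsIso]
@[simp] theorem μn_comp (g : (K.hom A B).Hom s t) (f : (K.hom A B).Hom r s) : T.μn (g ⊚ f) =
    T.μn g ▹ (K.post T.T).hom ((K.post T.T).hom f) ⊙ (K.post T.T).hom g ◃ T.μn f :=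
  Cell.ext (by rw [Cell.vcomp_val (by simp)]; simp)
@[simp] theorem ηn_comp (g : (K.hom A B).Hom s t) (f : (K.hom A B).Hom r s) : T.ηn (g ⊚ f) =
    T.ηn g ▹ f ⊙ (K.post T.T).hom g ◃ T.ηn f :=
  Cell.ext (by rw [Cell.vcomp_val (by simp)]; simp)
theorem μn_two (x : (K.hom A B).Cell s t) : T.μn x.cod ⊙ (K.post T.T).cell x ▹ T.μc s =
    T.μc t ◃ (K.post T.T).cell ((K.post T.T).cell x) ⊙ T.μn x.dom :=
  Cell.ext (by
    rw [Cell.vcomp_val (by simp), Cell.vcomp_val (by simp)]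
    simpa using K.ix_two_right T.μ x.val)
theorem ηn_two (x : (K.hom A B).Cell s t) : T.ηn x.cod ⊙ (K.post T.T).cell x ▹ T.ηc s =
    T.ηc t ◃ x ⊙ T.ηn x.dom :=
  Cell.ext (by
    rw [Cell.vcomp_val (by simp), Cell.vcomp_val (by simp)]
    simpa using K.ix_two_right T.η x.val)
@[simp] theorem dom_lamc (s : (K.hom A B).Ob) : (T.lamc s).dom = T.μc s ⊚ T.ηc (T.T ⋆ s) :=
  Hom.ext (by simp)
@[simp] theorem cod_lamc (s : (K.hom A B).Ob) : (T.lamc s).cod = Hom.id (T.T ⋆ s) :=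
  Hom.ext (by simp)
@[simp] theorem dom_rhoc (s : (K.hom A B).Ob) : (T.rhoc s).dom = Hom.id (T.T ⋆ s) :=
  Hom.ext (by simp)
@[simp] theorem cod_rhoc (s : (K.hom A B).Ob) :
    (T.rhoc s).cod = T.μc s ⊚ (K.post T.T).hom (T.ηc s) := Hom.ext (by simp)
@[simp] theorem dom_alphac (s : (K.hom A B).Ob) :
    (T.alphac s).dom = T.μc s ⊚ (K.post T.T).hom (T.μc s) := Hom.ext (by simp)
@[simp] theorem cod_alphac (s : (K.hom A B).Ob) : (T.alphac s).cod = T.μc s ⊚ T.μc (T.T ⋆ s) :=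
  Hom.ext (by simp)
@[simp] theorem iso_lamc (s : (K.hom A B).Ob) : (T.lamc s).IsIso := by simp [Cell.IsIso]
@[simp] theorem iso_rhoc (s : (K.hom A B).Ob) : (T.rhoc s).IsIso := by simp [Cell.IsIso]
@[simp] theorem iso_alphac (s : (K.hom A B).Ob) : (T.alphac s).IsIso := by simp [Cell.IsIso]
theorem lamc_n (g : (K.hom A B).Hom s t) : (K.post T.T).hom g ◃ T.lamc s =
    T.lamc t ▹ (K.post T.T).hom g ⊙ T.μc t ◃ T.ηn ((K.post T.T).hom g) ⊙
      T.μn g ▹ T.ηc (T.T ⋆ s) := by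
  refine Cell.ext ?_
  rw [Cell.vcomp_val (by simp), Cell.vcomp_val (by simp)]
  simpa (maxDischargeDepth := 9) using K.ix_two_left T.lam g.val
theorem rhoc_n (g : (K.hom A B).Hom s t) : T.μc t ◃ (K.post T.T).cell (T.ηn g) ⊙
    T.μn g ▹ (K.post T.T).hom (T.ηc s) ⊙ (K.post T.T).hom g ◃ T.rhoc s =
      T.rhoc t ▹ (K.post T.T).hom g := by
  refine Cell.ext ?_
  rw [Cell.vcomp_val (by simp), Cell.vcomp_val (by simp)]
  simpa (maxDischargeDepth := 9) using K.ix_two_left T.rho g.val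
theorem alphac_n (g : (K.hom A B).Hom s t) : T.μc t ◃ T.μn ((K.post T.T).hom g) ⊙
    T.μn g ▹ T.μc (T.T ⋆ s) ⊙ (K.post T.T).hom g ◃ T.alphac s =
      T.alphac t ▹ (K.post T.T).hom ((K.post T.T).hom ((K.post T.T).hom g)) ⊙
        T.μc t ◃ (K.post T.T).cell (T.μn g) ⊙ T.μn g ▹ (K.post T.T).hom (T.μc s) := by
  refine Cell.ext ?_
  rw [Cell.vcomp_val (by simp), Cell.vcomp_val (by simp), Cell.vcomp_val (by simp),
    Cell.vcomp_val (by simp)]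
  simpa (maxDischargeDepth := 9) using K.ix_two_left T.alpha g.val
theorem assocc (s : (K.hom A B).Ob) : T.μc s ◃ T.alphac (T.T ⋆ s) ⊙
    T.alphac s ▹ (K.post T.T).hom (T.μc (T.T ⋆ s)) ⊙
      T.μc s ◃ (K.post T.T).cell (T.alphac s) =
    T.alphac s ▹ T.μc (T.T ⋆ T.T ⋆ s) ⊙ T.μc s ◃ (T.μn (T.μc s)).inv ⊙
      T.alphac s ▹ (K.post T.T).hom ((K.post T.T).hom (T.μc s)) := by
  refine Cell.ext ?_
  rw [Cell.vcomp_val (by simp), Cell.vcomp_val (by simp), Cell.vcomp_val (by simp),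
    Cell.vcomp_val (by simp)]
  have := congrArg (fun z => z ⋆ᵣᵣ s) T.assoc
  simp (maxDischargeDepth := 9) at this ⊢
  exact this
theorem unitc (s : (K.hom A B).Ob) : T.alphac s ▹ (K.post T.T).hom (T.ηc (T.T ⋆ s)) =
    T.μc s ◃ T.rhoc (T.T ⋆ s) ⊙ T.μc s ◃ (K.post T.T).cell (T.lamc s) := by
  refine Cell.ext ?_
  rw [Cell.vcomp_val (by simp)]
  have := congrArg (fun z => z ⋆ᵣᵣ s) T.unit
  simp (maxDischargeDepth := 9) at this ⊢
  exact this

end Pseudomonad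

section

variable {K : GrayCat.{u, w}} {A B : K.Obj} (T : Pseudomonad K B) {G : (K.hom B B).Ob}
  (P : Pseudoadjunction K T.T G)

theorem mateCounit_eq : mateCounit T P = P.e ∘₁ T.η ⋆ᵣ G := by
  simp [mateCounit, AdjData.mate, AdjData.id]

theorem mateComult_eq : mateComult T P = G ⋆ₗ G ⋆ₗ P.e ∘₁ G ⋆ₗ G ⋆ₗ T.μ ⋆ᵣ G ∘₁
    G ⋆ₗ P.i ⋆ᵣ T.T ⋆ᵣ G ∘₁ P.i ⋆ᵣ G := by
  simp (maxDischargeDepth := 9) [mateComult, AdjData.mate, AdjData.comp]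

@[simp] theorem src_mateComult : (K.hom B B).src (mateComult T P) = G := by
  simp (maxDischargeDepth := 9) [mateComult_eq]
@[simp] theorem tgt_mateComult : (K.hom B B).tgt (mateComult T P) = G ⋆ G := by
  simp (maxDischargeDepth := 9) [mateComult_eq]

/-- The comparison `σ ∘ T(σG ∘ Tδ) ⇛ σ ∘ μG`. -/
noncomputable def comultCmp : (K.hom B B).Two :=
  (P.data.comp P.data).cmp G (P.e ∘₁ T.μ ⋆ᵣ G)

@[simp] theorem src_comultCmp : (K.hom B B).src₂ (comultCmp T P) =
    P.e ∘₁ T.T ⋆ₗ P.e ⋆ᵣ G ∘₁ T.T ⋆ₗ T.T ⋆ₗ mateComult T P := by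
  rw [comultCmp, AdjData.src_cmp _ (by simp)]
  simp (maxDischargeDepth := 9) [mateComult_eq]
@[simp] theorem tgt_comultCmp : (K.hom B B).tgt₂ (comultCmp T P) = P.e ∘₁ T.μ ⋆ᵣ G := by
  rw [comultCmp, AdjData.tgt_cmp _ (by simp)]
@[simp] theorem isIso_comultCmp : TwoCat.IsIso (comultCmp T P) :=
  AdjData.isIso_cmp _ (by simp)

/-- The components of the comultiplication. -/
@[simps] noncomputable def δc (t : (K.hom A B).Ob) : (K.hom A B).Hom (G ⋆ t) (G ⋆ G ⋆ t) :=
  ⟨mateComult T P ⋆ᵣ t, by simp, by simp⟩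

/-- The naturality cells of the comultiplication. -/
@[simps] noncomputable def δn {s t : (K.hom A B).Ob} (g : (K.hom A B).Hom s t) :
    (K.hom A B).Cell (G ⋆ s) (G ⋆ G ⋆ t) :=
  ⟨K.ix (mateComult T P) g.val, by simp, by simp⟩

/-- The components of the comparison `comultCmp`. -/
@[simps] noncomputable def dc (t : (K.hom A B).Ob) : (K.hom A B).Cell (T.T ⋆ T.T ⋆ G ⋆ t) t :=
  ⟨comultCmp T P ⋆ᵣᵣ t, by simp, by simp⟩

@[simp] theorem dom_dc (t : (K.hom A B).Ob) : (dc T P t).dom = P.σ t ⊚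
    (K.post T.T).hom (P.σ (G ⋆ t)) ⊚ (K.post T.T).hom ((K.post T.T).hom (δc T P t)) :=
  Hom.ext (by simp)
@[simp] theorem cod_dc (t : (K.hom A B).Ob) : (dc T P t).cod = P.σ t ⊚ T.μc (G ⋆ t) :=
  Hom.ext (by simp)
@[simp] theorem iso_dc (t : (K.hom A B).Ob) : (dc T P t).IsIso := by simp [Cell.IsIso]

theorem δc_eq (t : (K.hom A B).Ob) : δc T P t =
    (K.post G).hom ((K.post G).hom (P.σ t)) ⊚ (K.post G).hom ((K.post G).hom (T.μc (G ⋆ t))) ⊚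
      (K.post G).hom (P.ι (T.T ⋆ G ⋆ t)) ⊚ P.ι (G ⋆ t) :=
  Hom.ext (by simp (maxDischargeDepth := 9) [mateComult_eq])

theorem dc_eq (t : (K.hom A B).Ob) : dc T P t = P.cmp₂ (P.σ t ⊚ T.μc (G ⋆ t)) := by
  refine Cell.ext ?_
  rw [P.cmp₂_val, dc_val, comultCmp, AdjData.cmp_pre]
  · simp
  · simp [AdjData.comp]

variable {s t : (K.hom A B).Ob}

@[simp] theorem dom_δn (g : (K.hom A B).Hom s t) : (δn T P g).dom =
    (K.post G).hom ((K.post G).hom g) ⊚ δc T P s := Hom.ext (by simp)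
@[simp] theorem cod_δn (g : (K.hom A B).Hom s t) : (δn T P g).cod =
    δc T P t ⊚ (K.post G).hom g := Hom.ext (by simp)
@[simp] theorem iso_δn (g : (K.hom A B).Hom s t) : (δn T P g).IsIso := by simp [Cell.IsIso]

theorem dc_n (g : (K.hom A B).Hom s t) : (P.σ t ◃ T.μn ((K.post G).hom g)) ⊙
    ((P.σn g ▹ T.μc (G ⋆ s)) ⊙ (g ◃ dc T P s)) =
    (dc T P t ▹ (K.post T.T).hom ((K.post T.T).hom ((K.post G).hom g))) ⊙
      ((P.σ t ◃ (K.post T.T).hom (P.σ (G ⋆ t)) ◃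
        (K.post T.T).cell ((K.post T.T).cell (δn T P g))) ⊙
        ((P.σ t ◃ (K.post T.T).cell (P.σn ((K.post G).hom g)) ▹
          (K.post T.T).hom ((K.post T.T).hom (δc T P s))) ⊙
          (P.σn g ▹ (K.post T.T).hom (P.σ (G ⋆ s)) ▹
            (K.post T.T).hom ((K.post T.T).hom (δc T P s))))) := by
  refine Cell.ext ?_
  rw [Cell.vcomp_val (by simp), Cell.vcomp_val (by simp), Cell.vcomp_val (by simp),
    Cell.vcomp_val (by simp), Cell.vcomp_val (by simp)]
  have := K.ix_two_left (comultCmp T P) g.val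
  simp (maxDischargeDepth := 9) at this ⊢
  exact this

end

namespace AdjData

variable {K : GrayCat.{u, w}} {A B C D : K.Obj} (P P' P'' : AdjData K A B) [P.IsTyped] [P'.IsTyped]
  [P''.IsTyped] {ζ ζ' : (K.hom B A).One}

@[simp] theorem src_tgt_curry {s : (K.hom D B).Ob} {f : (K.hom D A).One}
    {h : (K.hom D B).One} {x : (K.hom D A).Two}
    (hf : (K.hom D A).src f = P.F ⋆ (K.hom D B).tgt h) (hs : (K.hom D B).src h = s)
    (hx : (K.hom D A).src₂ x = f ∘₁ P.F ⋆ₗ h) :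
    (K.hom D B).src ((K.hom D B).tgt₂ (P.curry s f h x)) = s := by
  rw [← TwoCat.src_src₂, P.src_curry hf hs rfl hx]
  simp [hf, hs]

theorem mateX_pre (P₁ P₁' : AdjData K B C) [P₁.IsTyped] [P₁'.IsTyped] {ζ₁ : (K.hom C B).One}
    (hs : (K.hom B A).src ζ = P'.F) (ht : (K.hom B A).tgt ζ = P.F)
    (hs' : (K.hom C B).src ζ₁ = P₁'.F) (ht' : (K.hom C B).tgt ζ₁ = P₁.F) (t : (K.hom D A).Ob) :
    mateX P P' P₁ P₁' ζ ζ₁ ⋆ᵣᵣ t = (P₁'.U ⋆ₗₗ P'.curry (P₁'.F ⋆ P₁.U ⋆ P.U ⋆ t)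
      ((P.e ∘₁ ζ ⋆ᵣ P.U) ⋆ᵣ t) ((P₁.e ∘₁ ζ₁ ⋆ᵣ P₁.U) ⋆ᵣ (P.U ⋆ t))
        (P.e ⋆ᵣ t ◁ (TwoCat.inv (K.ix ζ P₁.e) ⋆ᵣᵣ (P.U ⋆ t)) ▷
        (P'.F ⋆ₗ ζ₁ ⋆ᵣ (P₁.U ⋆ P.U ⋆ t)))) ▷ (P₁'.i ⋆ᵣ (P₁.U ⋆ P.U ⋆ t)) := by
  have h1 : (K.hom A A).src₂ (P.e ◁ (TwoCat.inv (K.ix ζ P₁.e) ⋆ᵣᵣ P.U) ▷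
      (P'.F ⋆ₗ ζ₁ ⋆ᵣ P₁.U ⋆ᵣ P.U)) = (P.e ∘₁ ζ ⋆ᵣ P.U) ∘₁ P'.F ⋆ₗ (P₁.e ∘₁ ζ₁ ⋆ᵣ P₁.U) ⋆ᵣ P.U := by
    simp (maxDischargeDepth := 9) [hs, ht, hs', ht']
  have h2 := P'.src_tgt_curry (s := P₁'.F ⋆ P₁.U ⋆ P.U) (by simp [hs, ht, hs', ht'])
    (by simp [hs', ht']) h1
  have h3 := congrArg (K.post P₁'.U).ob h2.symm
  rw [← TwoFunctor.src_one, ← TwoFunctor.tgt_two] at h3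
  replace h3 := (show (K.hom A C).tgt (P₁'.i ⋆ᵣ P₁.U ⋆ᵣ P.U) = _ by simp).trans h3
  rw [mateX_eq _ _ _ _ hs ht hs' ht', (K.pre t).map_wr _ _ h3]
  rw [GrayCat.two_mid]
  rw [curry_pre (s' := P.U) _ (by simp [hs, ht]) (by simp [hs', ht']) (by simp [hs', ht']) h1]
  simp (maxDischargeDepth := 9) [hs, ht, hs', ht']

theorem mateY_pre (hs : (K.hom B A).src ζ = P'.F) (ht : (K.hom B A).tgt ζ = P.F)
    (hs' : (K.hom B A).src ζ' = P''.F) (ht' : (K.hom B A).tgt ζ' = P'.F) (t : (K.hom D A).Ob) :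
    mateY P P' P'' ζ ζ' ⋆ᵣᵣ t = P''.curry (P.U ⋆ t) ((P'.e ∘₁ ζ' ⋆ᵣ P'.U) ⋆ᵣ t) (P.mate P' ζ ⋆ᵣ t)
      ((P'.cmp P.U (P.e ∘₁ ζ ⋆ᵣ P.U) ⋆ᵣᵣ t ▷ ζ' ⋆ᵣ (P.U ⋆ t)) ∘₂
        (P'.e ⋆ᵣ t ◁ TwoCat.inv (K.ix ζ' (P.mate P' ζ ⋆ᵣ t)))) := by
  have h : P'.F ⋆ₗ P.mate P' ζ = P'.F ⋆ₗ P'.U ⋆ₗ P.e ∘₁ P'.F ⋆ₗ P'.U ⋆ₗ ζ ⋆ᵣ P.U ∘₁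
      P'.F ⋆ₗ P'.i ⋆ᵣ P.U := by
    simp (maxDischargeDepth := 9) [mate, hs, ht]
  rw [mateY_eq _ _ _ hs ht hs' ht', curry_pre (s' := P'.U) P'']
  · simp (maxDischargeDepth := 9) [hs, ht, hs', ht', h]
  · simp (maxDischargeDepth := 9) [hs, ht, hs', ht']
  · simp (maxDischargeDepth := 9) [hs, ht, hs', ht']
  · simp (maxDischargeDepth := 9) [hs, ht, hs', ht']
  · simp (maxDischargeDepth := 9) [hs, ht, hs', ht', h]

end AdjData

namespace MateCells

variable {K : GrayCat.{u, w}} {A B : K.Obj} (T : Pseudomonad K B) {G : (K.hom B B).Ob}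
  (P : Pseudoadjunction K T.T G) (t : (K.hom A B).Ob)

/-- The cell `mateX` in the definition of `mateLam`. -/
noncomputable def lamX : (K.hom A B).Cell (G ⋆ G ⋆ t) (G ⋆ t) :=
  (K.post G).cell (P.σ t ◃ (T.ηn (P.σ (G ⋆ t))).inv) ▹ P.ι (G ⋆ G ⋆ t)

/-- The cell `mateY` in the definition of `mateLam`. -/
noncomputable def lamY : (K.hom A B).Cell (G ⋆ t) (G ⋆ t) :=
  P.curry (P.σ t ⊚ (K.post T.T).hom (P.σ (G ⋆ t)) ⊚ T.ηc (T.T ⋆ G ⋆ G ⋆ t)) (δc T P t)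
    (dc T P t ▹ T.ηc (T.T ⋆ G ⋆ t) ⊙ P.σ t ◃ (K.post T.T).hom (P.σ (G ⋆ t)) ◃
      (T.ηn ((K.post T.T).hom (δc T P t))).inv)

/-- The cell `mateX` in the definition of `mateRho`. -/
noncomputable def rhoX : (K.hom A B).Cell (G ⋆ G ⋆ t) (G ⋆ t) :=
  P.curry (P.σ t) (P.σ (G ⋆ t) ⊚ T.ηc (G ⋆ G ⋆ t))
    (Cell.id (P.σ t ⊚ (K.post T.T).hom (P.σ (G ⋆ t)) ⊚ (K.post T.T).hom (T.ηc (G ⋆ G ⋆ t))))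

/-- The cell `mateY` in the definition of `mateRho`. -/
noncomputable def rhoY : (K.hom A B).Cell (G ⋆ t) (G ⋆ t) :=
  P.curry (P.σ t ⊚ (K.post T.T).hom (P.σ (G ⋆ t)) ⊚ (K.post T.T).hom (T.ηc (G ⋆ G ⋆ t)))
    (δc T P t) (dc T P t ▹ (K.post T.T).hom (T.ηc (G ⋆ t)) ⊙
      P.σ t ◃ (K.post T.T).hom (P.σ (G ⋆ t)) ◃ (K.post T.T).cell (T.ηn (δc T P t)).inv)

/-- The first cell `mateX` in the definition of `mateAlpha`. -/
noncomputable def alphaX : (K.hom A B).Cell (G ⋆ G ⋆ t) (G ⋆ G ⋆ G ⋆ t) :=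
  (K.post G).cell ((K.post G).cell (P.curry (P.σ t) (P.σ (G ⋆ t) ⊚ T.μc (G ⋆ G ⋆ t))
    (Cell.id (P.σ t ⊚ (K.post T.T).hom (P.σ (G ⋆ t)) ⊚
      (K.post T.T).hom (T.μc (G ⋆ G ⋆ t)))))) ▹
    ((K.post G).hom (P.ι (T.T ⋆ G ⋆ G ⋆ t)) ⊚ P.ι (G ⋆ G ⋆ t))

/-- The first cell `mateY` in the definition of `mateAlpha`. -/
noncomputable def alphaY : (K.hom A B).Cell (G ⋆ t) (G ⋆ G ⋆ G ⋆ t) :=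
  P.curry₃ (P.σ t ⊚ (K.post T.T).hom (P.σ (G ⋆ t)) ⊚ (K.post T.T).hom (T.μc (G ⋆ G ⋆ t)))
    (δc T P t) (dc T P t ▹ (K.post T.T).hom (T.μc (G ⋆ t)) ⊙
      P.σ t ◃ (K.post T.T).hom (P.σ (G ⋆ t)) ◃ (K.post T.T).cell (T.μn (δc T P t)).inv)

/-- The second cell `mateX` in the definition of `mateAlpha`. -/
noncomputable def alphaX' : (K.hom A B).Cell (G ⋆ G ⋆ t) (G ⋆ G ⋆ G ⋆ t) :=
  (K.post G).cell (P.curry₂ (P.σ t ⊚ T.μc (G ⋆ t)) (P.σ (G ⋆ t))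
    (P.σ t ◃ (T.μn (P.σ (G ⋆ t))).inv)) ▹ P.ι (G ⋆ G ⋆ t)

/-- The second cell `mateY` in the definition of `mateAlpha`. -/
noncomputable def alphaY' : (K.hom A B).Cell (G ⋆ t) (G ⋆ G ⋆ G ⋆ t) :=
  P.curry₃ (P.σ t ⊚ (K.post T.T).hom (P.σ (G ⋆ t)) ⊚ T.μc (T.T ⋆ G ⋆ G ⋆ t))
    (δc T P t) (dc T P t ▹ T.μc (T.T ⋆ G ⋆ t) ⊙
      P.σ t ◃ (K.post T.T).hom (P.σ (G ⋆ t)) ◃ (T.μn ((K.post T.T).hom (δc T P t))).inv)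

theorem mate_μ : P.data.mate (P.data.comp P.data) T.μ = mateComult T P := rfl

theorem cmp_σμ : (P.data.comp P.data).cmp G (P.e ∘₁ T.μ ⋆ᵣ G) = comultCmp T P := rfl

theorem lamX_val : (lamX T P t).val = AdjData.mateX P.data (AdjData.id K B) P.data P.data T.η
    ((K.hom B B).id T.T) ⋆ᵣᵣ t := by
  rw [AdjData.mateX_pre _ _ _ _ (by simp) (by simp) (by simp) (by simp),
    AdjData.curry_id (by simp) (by simp) (by simp (maxDischargeDepth := 9))]
  simp (maxDischargeDepth := 9) [lamX]

theorem alphaX_val : (alphaX T P t).val = AdjData.mateX P.data P.data P.data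
    (P.data.comp P.data) ((K.hom B B).id T.T) T.μ ⋆ᵣᵣ t := by
  rw [AdjData.mateX_pre _ _ _ _ (by simp) (by simp) (by simp) (by simp)]
  simp (maxDischargeDepth := 9) [alphaX, P.curry_val, -Cell.wr_comp]

theorem rhoX_val : (rhoX T P t).val = AdjData.mateX P.data P.data P.data
    (AdjData.id K B) ((K.hom B B).id T.T) T.η ⋆ᵣᵣ t := by
  rw [AdjData.mateX_pre _ _ _ _ (by simp) (by simp) (by simp) (by simp)]
  simp (maxDischargeDepth := 9) [rhoX, P.curry_val]

theorem alphaX'_val : (alphaX' T P t).val = AdjData.mateX P.data (P.data.comp P.data) P.data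
    P.data T.μ ((K.hom B B).id T.T) ⋆ᵣᵣ t := by
  rw [AdjData.mateX_pre _ _ _ _ (by simp) (by simp) (by simp) (by simp)]
  simp (maxDischargeDepth := 9) [alphaX', P.curry₂_val]

theorem lamY_val : (lamY T P t).val = AdjData.mateY P.data (P.data.comp P.data) P.data T.μ
    (T.η ⋆ᵣ T.T) ⋆ᵣᵣ t := by
  rw [AdjData.mateY_pre _ _ _ (by simp) (by simp) (by simp) (by simp), lamY,
    P.curry_val (by simp (maxDischargeDepth := 9)), Cell.vcomp_val (by simp)]
  simp (maxDischargeDepth := 9) [mate_μ, cmp_σμ]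

theorem rhoY_val : (rhoY T P t).val = AdjData.mateY P.data (P.data.comp P.data) P.data T.μ
    (T.T ⋆ₗ T.η) ⋆ᵣᵣ t := by
  rw [AdjData.mateY_pre _ _ _ (by simp) (by simp) (by simp) (by simp), rhoY,
    P.curry_val (by simp (maxDischargeDepth := 9)), Cell.vcomp_val (by simp)]
  simp (maxDischargeDepth := 9) [mate_μ, cmp_σμ]

theorem alphaY_val : (alphaY T P t).val = AdjData.mateY P.data (P.data.comp P.data)
    (P.data.comp (P.data.comp P.data)) T.μ (T.T ⋆ₗ T.μ) ⋆ᵣᵣ t := by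
  rw [AdjData.mateY_pre _ _ _ (by simp) (by simp) (by simp) (by simp), alphaY,
    P.curry₃_val (by simp (maxDischargeDepth := 9)), Cell.vcomp_val (by simp)]
  simp (maxDischargeDepth := 9) [mate_μ, cmp_σμ]

theorem alphaY'_val : (alphaY' T P t).val = AdjData.mateY P.data (P.data.comp P.data)
    ((P.data.comp P.data).comp P.data) T.μ (T.μ ⋆ᵣ T.T) ⋆ᵣᵣ t := by
  rw [AdjData.mateY_pre _ _ _ (by simp) (by simp) (by simp) (by simp), alphaY',
    P.curry₃_val' (by simp (maxDischargeDepth := 9)), Cell.vcomp_val (by simp)]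
  simp (maxDischargeDepth := 9) [mate_μ, cmp_σμ]

end MateCells

theorem TwoFunctor.two_vcomp_val {X Y : TwoCat.{w}} (F : TwoFunctor X Y) {a b : X.Ob}
    {y x : X.Cell a b} (h : x.cod = y.dom) : F.two (y ⊙ x).val = F.two y.val ∘₂ F.two x.val := by
  rw [Cell.vcomp_val h, F.map_vcomp _ _ (Cell.composable h)]

theorem TwoFunctor.two_inv_val {X Y : TwoCat.{w}} (F : TwoFunctor X Y) {a b : X.Ob}
    {x : X.Cell a b} (h : x.IsIso) : F.two x.inv.val = TwoCat.inv (F.two x.val) :=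
  F.map_inv h

theorem TwoFunctor.two_wr_val {X Y : TwoCat.{w}} (F : TwoFunctor X Y) {a b c : X.Ob}
    (x : X.Cell b c) (f : X.Hom a b) : F.two (x ▹ f).val = F.two x.val ▷ F.one f.val :=
  F.map_wr _ _ (by simp)

namespace MateCells

variable {K : GrayCat.{u, w}} {A B : K.Obj} (T : Pseudomonad K B) {G : (K.hom B B).Ob}
  (P : Pseudoadjunction K T.T G) (t : (K.hom A B).Ob)

@[simp] theorem dom_lamX : (lamX T P t).dom = (K.post G).hom (P.σ t) ⊚
    (K.post G).hom (T.ηc (G ⋆ t)) ⊚ (K.post G).hom (P.σ (G ⋆ t)) ⊚ P.ι (G ⋆ G ⋆ t) := by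
  simp [lamX]
@[simp] theorem cod_lamX : (lamX T P t).cod = (K.post G).hom (P.σ t) ⊚
    (K.post G).hom ((K.post T.T).hom (P.σ (G ⋆ t))) ⊚ (K.post G).hom (T.ηc (T.T ⋆ G ⋆ G ⋆ t)) ⊚
      P.ι (G ⋆ G ⋆ t) := by simp [lamX]
@[simp] theorem iso_lamX : (lamX T P t).IsIso := by simp (maxDischargeDepth := 9) [lamX]

@[simp] theorem dom_lamY : (lamY T P t).dom = (K.post G).hom (P.σ t) ⊚
    (K.post G).hom ((K.post T.T).hom (P.σ (G ⋆ t))) ⊚ (K.post G).hom (T.ηc (T.T ⋆ G ⋆ G ⋆ t)) ⊚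
      P.ι (G ⋆ G ⋆ t) ⊚ δc T P t := by simp (maxDischargeDepth := 9) [lamY]
@[simp] theorem cod_lamY : (lamY T P t).cod = (K.post G).hom (P.σ t) ⊚
    (K.post G).hom (T.μc (G ⋆ t)) ⊚ (K.post G).hom (T.ηc (T.T ⋆ G ⋆ t)) ⊚ P.ι (G ⋆ t) := by
  simp (maxDischargeDepth := 9) [lamY]
@[simp] theorem iso_lamY : (lamY T P t).IsIso := by
  rw [lamY]
  exact P.iso_curry (by simp) (by simp (maxDischargeDepth := 9))

@[simp] theorem dom_rhoX : (rhoX T P t).dom = (K.post G).hom (P.σ t) ⊚ P.ι (G ⋆ t) ⊚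
    P.σ (G ⋆ t) ⊚ T.ηc (G ⋆ G ⋆ t) := by simp [rhoX]
@[simp] theorem cod_rhoX : (rhoX T P t).cod = (K.post G).hom (P.σ t) ⊚
    (K.post G).hom ((K.post T.T).hom (P.σ (G ⋆ t))) ⊚
      (K.post G).hom ((K.post T.T).hom (T.ηc (G ⋆ G ⋆ t))) ⊚ P.ι (G ⋆ G ⋆ t) := by simp [rhoX]
@[simp] theorem iso_rhoX : (rhoX T P t).IsIso := by
  rw [rhoX]
  exact P.iso_curry (by simp) (by simp)

@[simp] theorem dom_rhoY : (rhoY T P t).dom = (K.post G).hom (P.σ t) ⊚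
    (K.post G).hom ((K.post T.T).hom (P.σ (G ⋆ t))) ⊚
      (K.post G).hom ((K.post T.T).hom (T.ηc (G ⋆ G ⋆ t))) ⊚ P.ι (G ⋆ G ⋆ t) ⊚ δc T P t := by
  simp (maxDischargeDepth := 9) [rhoY]
@[simp] theorem cod_rhoY : (rhoY T P t).cod = (K.post G).hom (P.σ t) ⊚
    (K.post G).hom (T.μc (G ⋆ t)) ⊚ (K.post G).hom ((K.post T.T).hom (T.ηc (G ⋆ t))) ⊚
      P.ι (G ⋆ t) := by simp (maxDischargeDepth := 9) [rhoY]
@[simp] theorem iso_rhoY : (rhoY T P t).IsIso := by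
  rw [rhoY]
  exact P.iso_curry (by simp (maxDischargeDepth := 9)) (by simp (maxDischargeDepth := 9))

@[simp] theorem dom_alphaX : (alphaX T P t).dom =
    (K.post G).hom ((K.post G).hom ((K.post G).hom (P.σ t))) ⊚
      (K.post G).hom ((K.post G).hom (P.ι (G ⋆ t))) ⊚ δc T P (G ⋆ t) := by simp [alphaX, δc_eq]
@[simp] theorem cod_alphaX : (alphaX T P t).cod =
    (K.post G).hom ((K.post G).hom ((K.post G).hom (P.σ t))) ⊚
      (K.post G).hom ((K.post G).hom ((K.post G).hom ((K.post T.T).hom (P.σ (G ⋆ t))))) ⊚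
      (K.post G).hom ((K.post G).hom ((K.post G).hom ((K.post T.T).hom (T.μc (G ⋆ G ⋆ t))))) ⊚
      (K.post G).hom ((K.post G).hom (P.ι (T.T ⋆ T.T ⋆ G ⋆ G ⋆ t))) ⊚
      (K.post G).hom (P.ι (T.T ⋆ G ⋆ G ⋆ t)) ⊚ P.ι (G ⋆ G ⋆ t) := by simp [alphaX]
@[simp] theorem iso_alphaX : (alphaX T P t).IsIso := by
  rw [alphaX]
  exact Cell.isIso_wr (TwoFunctor.isIso_cell _ (TwoFunctor.isIso_cell _
    (P.iso_curry (by simp) (by simp)))) _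

@[simp] theorem dom_alphaY : (alphaY T P t).dom =
    (K.post G).hom ((K.post G).hom ((K.post G).hom (P.σ t))) ⊚
      (K.post G).hom ((K.post G).hom ((K.post G).hom ((K.post T.T).hom (P.σ (G ⋆ t))))) ⊚
      (K.post G).hom ((K.post G).hom ((K.post G).hom ((K.post T.T).hom (T.μc (G ⋆ G ⋆ t))))) ⊚
      (K.post G).hom ((K.post G).hom (P.ι (T.T ⋆ T.T ⋆ G ⋆ G ⋆ t))) ⊚
      (K.post G).hom (P.ι (T.T ⋆ G ⋆ G ⋆ t)) ⊚ P.ι (G ⋆ G ⋆ t) ⊚ δc T P t := by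
  simp (maxDischargeDepth := 9) [alphaY]
@[simp] theorem cod_alphaY : (alphaY T P t).cod =
    (K.post G).hom ((K.post G).hom ((K.post G).hom (P.σ t))) ⊚
      (K.post G).hom ((K.post G).hom ((K.post G).hom (T.μc (G ⋆ t)))) ⊚
      (K.post G).hom ((K.post G).hom ((K.post G).hom ((K.post T.T).hom (T.μc (G ⋆ t))))) ⊚
      (K.post G).hom ((K.post G).hom (P.ι (T.T ⋆ T.T ⋆ G ⋆ t))) ⊚
      (K.post G).hom (P.ι (T.T ⋆ G ⋆ t)) ⊚ P.ι (G ⋆ t) := by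
  simp (maxDischargeDepth := 9) [alphaY]
@[simp] theorem iso_alphaY : (alphaY T P t).IsIso := by
  rw [alphaY]
  exact P.iso_curry₃ (by simp (maxDischargeDepth := 9)) (by simp (maxDischargeDepth := 9))

@[simp] theorem dom_alphaX' : (alphaX' T P t).dom = (K.post G).hom (δc T P t) ⊚
    (K.post G).hom (P.σ (G ⋆ t)) ⊚ P.ι (G ⋆ G ⋆ t) := by simp [alphaX', δc_eq]
@[simp] theorem cod_alphaX' : (alphaX' T P t).cod =
    (K.post G).hom ((K.post G).hom ((K.post G).hom (P.σ t))) ⊚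
      (K.post G).hom ((K.post G).hom ((K.post G).hom ((K.post T.T).hom (P.σ (G ⋆ t))))) ⊚
      (K.post G).hom ((K.post G).hom ((K.post G).hom (T.μc (T.T ⋆ G ⋆ G ⋆ t)))) ⊚
      (K.post G).hom ((K.post G).hom (P.ι (T.T ⋆ T.T ⋆ G ⋆ G ⋆ t))) ⊚
      (K.post G).hom (P.ι (T.T ⋆ G ⋆ G ⋆ t)) ⊚ P.ι (G ⋆ G ⋆ t) := by simp [alphaX']
@[simp] theorem iso_alphaX' : (alphaX' T P t).IsIso := by
  rw [alphaX']
  exact Cell.isIso_wr (TwoFunctor.isIso_cell _ (P.iso_curry₂ (by simp)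
    (by simp (maxDischargeDepth := 9)))) _

@[simp] theorem dom_alphaY' : (alphaY' T P t).dom =
    (K.post G).hom ((K.post G).hom ((K.post G).hom (P.σ t))) ⊚
      (K.post G).hom ((K.post G).hom ((K.post G).hom ((K.post T.T).hom (P.σ (G ⋆ t))))) ⊚
      (K.post G).hom ((K.post G).hom ((K.post G).hom (T.μc (T.T ⋆ G ⋆ G ⋆ t)))) ⊚
      (K.post G).hom ((K.post G).hom (P.ι (T.T ⋆ T.T ⋆ G ⋆ G ⋆ t))) ⊚
      (K.post G).hom (P.ι (T.T ⋆ G ⋆ G ⋆ t)) ⊚ P.ι (G ⋆ G ⋆ t) ⊚ δc T P t := by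
  simp (maxDischargeDepth := 9) [alphaY']
@[simp] theorem cod_alphaY' : (alphaY' T P t).cod =
    (K.post G).hom ((K.post G).hom ((K.post G).hom (P.σ t))) ⊚
      (K.post G).hom ((K.post G).hom ((K.post G).hom (T.μc (G ⋆ t)))) ⊚
      (K.post G).hom ((K.post G).hom ((K.post G).hom (T.μc (T.T ⋆ G ⋆ t)))) ⊚
      (K.post G).hom ((K.post G).hom (P.ι (T.T ⋆ T.T ⋆ G ⋆ t))) ⊚
      (K.post G).hom (P.ι (T.T ⋆ G ⋆ t)) ⊚ P.ι (G ⋆ t) := by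
  simp (maxDischargeDepth := 9) [alphaY']
@[simp] theorem iso_alphaY' : (alphaY' T P t).IsIso := by
  rw [alphaY']
  exact P.iso_curry₃ (by simp (maxDischargeDepth := 9)) (by simp (maxDischargeDepth := 9))

/-- The components of `mateLam`. -/
noncomputable def lam : (K.hom A B).Cell (G ⋆ t) (G ⋆ t) :=
  (P.Ic t).inv ⊙ (K.post G).cell (P.σ t ◃ T.lamc (G ⋆ t)) ▹ P.ι (G ⋆ t) ⊙ lamY T P t ⊙
    lamX T P t ▹ δc T P t ⊙
    ((K.post G).hom (P.σ t ⊚ T.ηc (G ⋆ t))) ◃ P.Ic (G ⋆ t) ▹ δc T P t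

/-- The components of `mateRho`. -/
noncomputable def rho : (K.hom A B).Cell (G ⋆ t) (G ⋆ t) :=
  (P.Ic t).inv ▹ (P.σ (G ⋆ t) ⊚ T.ηc (G ⋆ G ⋆ t) ⊚ δc T P t) ⊙
    (rhoX T P t).inv ▹ δc T P t ⊙ (rhoY T P t).inv ⊙
    (K.post G).cell (P.σ t ◃ T.rhoc (G ⋆ t)) ▹ P.ι (G ⋆ t) ⊙ P.Ic t

/-- The components of `mateAlpha`. -/
noncomputable def alpha : (K.hom A B).Cell (G ⋆ t) (G ⋆ G ⋆ G ⋆ t) :=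
  (K.post G).hom (δc T P t) ◃ (P.Ic (G ⋆ t)).inv ▹ δc T P t ⊙
    (alphaX' T P t).inv ▹ δc T P t ⊙ (alphaY' T P t).inv ⊙
    (K.post G).cell ((K.post G).cell ((K.post G).cell (P.σ t ◃ T.alphac (G ⋆ t)))) ▹
      ((K.post G).hom ((K.post G).hom (P.ι (T.T ⋆ T.T ⋆ G ⋆ t))) ⊚
      (K.post G).hom (P.ι (T.T ⋆ G ⋆ t)) ⊚ P.ι (G ⋆ t)) ⊙
    alphaY T P t ⊙ alphaX T P t ▹ δc T P t ⊙
    (K.post G).cell ((K.post G).cell (P.Ic t)) ▹ (δc T P (G ⋆ t) ⊚ δc T P t)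

@[simp] theorem dom_lam : (lam T P t).dom =
    (K.post G).hom (P.σ t) ⊚ (K.post G).hom (T.ηc (G ⋆ t)) ⊚ δc T P t := by
  simp (maxDischargeDepth := 12) [lam]
@[simp] theorem cod_lam : (lam T P t).cod = Hom.id (G ⋆ t) := by
  simp (maxDischargeDepth := 12) [lam]
@[simp] theorem iso_lam : (lam T P t).IsIso := by simp (maxDischargeDepth := 12) [lam]
@[simp] theorem dom_rho : (rho T P t).dom = Hom.id (G ⋆ t) := by
  simp (maxDischargeDepth := 12) [rho]
@[simp] theorem cod_rho : (rho T P t).cod = P.σ (G ⋆ t) ⊚ T.ηc (G ⋆ G ⋆ t) ⊚ δc T P t := by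
  simp (maxDischargeDepth := 12) [rho]
@[simp] theorem iso_rho : (rho T P t).IsIso := by simp (maxDischargeDepth := 12) [rho]
@[simp] theorem dom_alpha : (alpha T P t).dom = δc T P (G ⋆ t) ⊚ δc T P t := by
  simp (maxDischargeDepth := 12) [alpha]
@[simp] theorem cod_alpha : (alpha T P t).cod = (K.post G).hom (δc T P t) ⊚ δc T P t := by
  simp (maxDischargeDepth := 12) [alpha]
@[simp] theorem iso_alpha : (alpha T P t).IsIso := by simp (maxDischargeDepth := 12) [alpha]

end MateCells

namespace MateCells

variable {K : GrayCat.{u, w}} {A B : K.Obj} (T : Pseudomonad K B) {G : (K.hom B B).Ob}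
  (P : Pseudoadjunction K T.T G) (t : (K.hom A B).Ob)

theorem lam_val_one : (lam T P (K.one B)).val = mateLam T P := by
  rw [lam, Cell.vcomp_val (by simp (maxDischargeDepth := 12)),
    Cell.vcomp_val (by simp (maxDischargeDepth := 12)),
    Cell.vcomp_val (by simp (maxDischargeDepth := 12)),
    Cell.vcomp_val (by simp (maxDischargeDepth := 12)), mateLam, mateCounit_eq]
  simp (maxDischargeDepth := 12) [lamX_val, lamY_val, AdjData.mate₂]

theorem lam_val : (lam T P t).val = mateLam T P ⋆ᵣᵣ t := by
  rw [← lam_val_one, lam, lam, TwoFunctor.two_vcomp_val _ (by simp (maxDischargeDepth := 12)),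
    TwoFunctor.two_vcomp_val _ (by simp (maxDischargeDepth := 12)),
    TwoFunctor.two_vcomp_val _ (by simp (maxDischargeDepth := 12)),
    TwoFunctor.two_vcomp_val _ (by simp (maxDischargeDepth := 12)),
    Cell.vcomp_val (by simp (maxDischargeDepth := 12)),
    Cell.vcomp_val (by simp (maxDischargeDepth := 12)),
    Cell.vcomp_val (by simp (maxDischargeDepth := 12)),
    Cell.vcomp_val (by simp (maxDischargeDepth := 12)), TwoFunctor.two_wr_val _ (lamX T P _)]
  simp (maxDischargeDepth := 12) [lamX_val, lamY_val]

theorem rho_val_one : (rho T P (K.one B)).val = mateRho T P := by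
  rw [rho, Cell.vcomp_val (by simp (maxDischargeDepth := 12)),
    Cell.vcomp_val (by simp (maxDischargeDepth := 12)),
    Cell.vcomp_val (by simp (maxDischargeDepth := 12)),
    Cell.vcomp_val (by simp (maxDischargeDepth := 12)), mateRho, mateCounit_eq]
  simp (maxDischargeDepth := 12) [rhoX_val, rhoY_val, AdjData.mate₂]

theorem rho_val : (rho T P t).val = mateRho T P ⋆ᵣᵣ t := by
  rw [← rho_val_one, rho, rho, TwoFunctor.two_vcomp_val _ (by simp (maxDischargeDepth := 12)),
    TwoFunctor.two_vcomp_val _ (by simp (maxDischargeDepth := 12)),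
    TwoFunctor.two_vcomp_val _ (by simp (maxDischargeDepth := 12)),
    TwoFunctor.two_vcomp_val _ (by simp (maxDischargeDepth := 12)),
    Cell.vcomp_val (by simp (maxDischargeDepth := 12)),
    Cell.vcomp_val (by simp (maxDischargeDepth := 12)),
    Cell.vcomp_val (by simp (maxDischargeDepth := 12)),
    Cell.vcomp_val (by simp (maxDischargeDepth := 12)), TwoFunctor.two_wr_val _ (rhoX T P _).inv,
    TwoFunctor.two_inv_val _ (iso_rhoX T P _), TwoFunctor.two_inv_val _ (iso_rhoY T P _)]
  simp (maxDischargeDepth := 12) [rhoX_val, rhoY_val]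

theorem alpha_val_one : (alpha T P (K.one B)).val = mateAlpha T P := by
  rw [alpha, Cell.vcomp_val (by simp (maxDischargeDepth := 12)),
    Cell.vcomp_val (by simp (maxDischargeDepth := 12)),
    Cell.vcomp_val (by simp (maxDischargeDepth := 12)),
    Cell.vcomp_val (by simp (maxDischargeDepth := 12)),
    Cell.vcomp_val (by simp (maxDischargeDepth := 12)),
    Cell.vcomp_val (by simp (maxDischargeDepth := 12)), mateAlpha]
  simp (maxDischargeDepth := 12) [alphaX_val, alphaY_val, alphaX'_val, alphaY'_val, AdjData.mate₂]

theorem alpha_val : (alpha T P t).val = mateAlpha T P ⋆ᵣᵣ t := by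
  rw [← alpha_val_one, alpha, alpha,
    TwoFunctor.two_vcomp_val _ (by simp (maxDischargeDepth := 12)),
    TwoFunctor.two_vcomp_val _ (by simp (maxDischargeDepth := 12)),
    TwoFunctor.two_vcomp_val _ (by simp (maxDischargeDepth := 12)),
    TwoFunctor.two_vcomp_val _ (by simp (maxDischargeDepth := 12)),
    TwoFunctor.two_vcomp_val _ (by simp (maxDischargeDepth := 12)),
    TwoFunctor.two_vcomp_val _ (by simp (maxDischargeDepth := 12)),
    Cell.vcomp_val (by simp (maxDischargeDepth := 12)),
    Cell.vcomp_val (by simp (maxDischargeDepth := 12)),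
    Cell.vcomp_val (by simp (maxDischargeDepth := 12)),
    Cell.vcomp_val (by simp (maxDischargeDepth := 12)),
    Cell.vcomp_val (by simp (maxDischargeDepth := 12)),
    Cell.vcomp_val (by simp (maxDischargeDepth := 12)),
    TwoFunctor.two_wr_val _ (alphaX' T P _).inv, TwoFunctor.two_wr_val _ (alphaX T P _),
    TwoFunctor.two_inv_val _ (iso_alphaX' T P _), TwoFunctor.two_inv_val _ (iso_alphaY' T P _)]
  simp (maxDischargeDepth := 12) [alphaX_val, alphaY_val, alphaX'_val, alphaY'_val]

end MateCells

theorem Pseudoadjunction.cmp_post_σ {K : GrayCat.{u, w}} {A B : K.Obj} {T G : (K.hom B B).Ob}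
    (P : Pseudoadjunction K T G) {s t : (K.hom A B).Ob} (g : (K.hom A B).Hom s t) :
    P.cmp (g ⊚ P.σ s) ⊙ P.σ t ◃ (K.post T).cell ((K.post G).hom g ◃ P.Ic s) = (P.σn g).inv := by
  have h1 := congrArg (fun z => (g ◃ z).act) (P.cmp_σ s)
  have I := Cell.interchange (P.σn g).inv ((K.post T).cell (P.Ic s))
  refine Cell.act_injective ?_
  simp (maxDischargeDepth := 9) [P.cmp_post, mul_assoc] at h1 I ⊢
  rw [← I, mul_reassoc_left h1, Cell.act_id_mul _ _ (by simp)]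

namespace MateCells

variable {K : GrayCat.{u, w}} {A B : K.Obj} (T : Pseudomonad K B) {G : (K.hom B B).Ob}
  (P : Pseudoadjunction K T.T G) (t : (K.hom A B).Ob)

/-- The composite `Gε ∘ δ ⇛ Φ(μ ∘ ηT)`. -/
noncomputable def lamZ : (K.hom A B).Cell (G ⋆ t) (G ⋆ t) :=
  lamY T P t ⊙ lamX T P t ▹ δc T P t ⊙
    ((K.post G).hom (P.σ t ⊚ T.ηc (G ⋆ t))) ◃ P.Ic (G ⋆ t) ▹ δc T P t

/-- The composite `εG ∘ δ ⇛ Φ(μ ∘ Tη)`. -/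
noncomputable def rhoZ : (K.hom A B).Cell (G ⋆ t) (G ⋆ t) :=
  rhoY T P t ⊙ rhoX T P t ▹ δc T P t ⊙
    P.Ic t ▹ (P.σ (G ⋆ t) ⊚ T.ηc (G ⋆ G ⋆ t) ⊚ δc T P t)

/-- The composite `δG ∘ δ ⇛ Φ(μ ∘ Tμ)`. -/
noncomputable def alphaZ : (K.hom A B).Cell (G ⋆ t) (G ⋆ G ⋆ G ⋆ t) :=
  alphaY T P t ⊙ alphaX T P t ▹ δc T P t ⊙
    (K.post G).cell ((K.post G).cell (P.Ic t)) ▹ (δc T P (G ⋆ t) ⊚ δc T P t)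

/-- The composite `Gδ ∘ δ ⇛ Φ(μ ∘ μT)`. -/
noncomputable def alphaZ' : (K.hom A B).Cell (G ⋆ t) (G ⋆ G ⋆ G ⋆ t) :=
  alphaY' T P t ⊙ alphaX' T P t ▹ δc T P t ⊙
    (K.post G).hom (δc T P t) ◃ P.Ic (G ⋆ t) ▹ δc T P t

theorem cmp_rhoZ : P.cmp (P.σ t ⊚ T.μc (G ⋆ t) ⊚ (K.post T.T).hom (T.ηc (G ⋆ t))) ⊙
      P.σ t ◃ (K.post T.T).cell (rhoZ T P t) = dc T P t ▹ (K.post T.T).hom (T.ηc (G ⋆ t)) ⊙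
        P.σ t ◃ (K.post T.T).hom (P.σ (G ⋆ t)) ◃ (K.post T.T).cell (T.ηn (δc T P t)).inv := by
  have h1 := fun z => congrArg (fun y => y.act * z) (P.cmp_curry (f := P.σ t ⊚
    (K.post T.T).hom (P.σ (G ⋆ t)) ⊚ (K.post T.T).hom (T.ηc (G ⋆ G ⋆ t))) (h := δc T P t)
    (x := dc T P t ▹ (K.post T.T).hom (T.ηc (G ⋆ t)) ⊙
      P.σ t ◃ (K.post T.T).hom (P.σ (G ⋆ t)) ◃ (K.post T.T).cell (T.ηn (δc T P t)).inv)
    (by simp (maxDischargeDepth := 9)))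
  have h2 := congrArg (fun y => (y ▹ (K.post T.T).hom (δc T P t)).act)
    (P.cmp_ucmp (P.σ (G ⋆ t) ⊚ T.ηc (G ⋆ G ⋆ t)))
  have e : rhoZ T P t = rhoY T P t ⊙
      P.ucmp (P.σ (G ⋆ t) ⊚ T.ηc (G ⋆ G ⋆ t)) ▹ δc T P t := by
    refine Cell.act_injective ?_
    simp (maxDischargeDepth := 9) [rhoZ, rhoX, Pseudoadjunction.ucmp, Pseudoadjunction.curry, mul_assoc]
  refine Cell.act_injective ?_
  rw [e, rhoY]
  simp (maxDischargeDepth := 12) [mul_assoc] at h1 h2 ⊢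
  rw [h1, h2]
  simp (maxDischargeDepth := 9)

theorem cmp_lamZ : P.cmp (P.σ t ⊚ T.μc (G ⋆ t) ⊚ T.ηc (T.T ⋆ G ⋆ t)) ⊙
      P.σ t ◃ (K.post T.T).cell (lamZ T P t) = dc T P t ▹ T.ηc (T.T ⋆ G ⋆ t) ⊙
        P.σ t ◃ (K.post T.T).hom (P.σ (G ⋆ t)) ◃ (T.ηn ((K.post T.T).hom (δc T P t))).inv ⊙
        P.σ t ◃ (T.ηn (P.σ (G ⋆ t))).inv ▹ (K.post T.T).hom (δc T P t) ⊙
        (P.σn (P.σ t ⊚ T.ηc (G ⋆ t))).inv ▹ (K.post T.T).hom (δc T P t) := by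
  have h1 := fun z => congrArg (fun y => y.act * z) (P.cmp_curry (f := P.σ t ⊚
    (K.post T.T).hom (P.σ (G ⋆ t)) ⊚ T.ηc (T.T ⋆ G ⋆ G ⋆ t)) (h := δc T P t)
    (x := dc T P t ▹ T.ηc (T.T ⋆ G ⋆ t) ⊙
      P.σ t ◃ (K.post T.T).hom (P.σ (G ⋆ t)) ◃ (T.ηn ((K.post T.T).hom (δc T P t))).inv)
    (by simp (maxDischargeDepth := 9)))
  have h2 := fun z => congrArg (fun y => (y ▹ (K.post T.T).hom (δc T P t)).act * z)
    (P.cmp_natural (P.σ t ◃ (T.ηn (P.σ (G ⋆ t))).inv))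
  have h3 := congrArg (fun y => (y ▹ (K.post T.T).hom (δc T P t)).act)
    (P.cmp_post_σ (P.σ t ⊚ T.ηc (G ⋆ t)))
  refine Cell.act_injective ?_
  rw [lamZ, lamY]
  simp (maxDischargeDepth := 12) [lamX, mul_assoc] at h1 h2 h3 ⊢
  rw [h1, h2, h3]

@[simp] theorem cod_lamZ : (lamZ T P t).cod = (K.post G).hom (P.σ t) ⊚
    (K.post G).hom (T.μc (G ⋆ t)) ⊚ (K.post G).hom (T.ηc (T.T ⋆ G ⋆ t)) ⊚ P.ι (G ⋆ t) := by
  simp (maxDischargeDepth := 12) [lamZ]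
@[simp] theorem dom_rhoZ : (rhoZ T P t).dom =
    P.σ (G ⋆ t) ⊚ T.ηc (G ⋆ G ⋆ t) ⊚ δc T P t := by
  simp (maxDischargeDepth := 12) [rhoZ]
@[simp] theorem cod_rhoZ : (rhoZ T P t).cod = (K.post G).hom (P.σ t) ⊚
    (K.post G).hom (T.μc (G ⋆ t)) ⊚ (K.post G).hom ((K.post T.T).hom (T.ηc (G ⋆ t))) ⊚
      P.ι (G ⋆ t) := by simp (maxDischargeDepth := 12) [rhoZ]
@[simp] theorem iso_rhoZ : (rhoZ T P t).IsIso := by simp (maxDischargeDepth := 12) [rhoZ]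

theorem lam_eq : lam T P t =
    (P.Ic t).inv ⊙ (K.post G).cell (P.σ t ◃ T.lamc (G ⋆ t)) ▹ P.ι (G ⋆ t) ⊙ lamZ T P t := rfl

theorem rho_eq : rho T P t = (rhoZ T P t).inv ⊙
    (K.post G).cell (P.σ t ◃ T.rhoc (G ⋆ t)) ▹ P.ι (G ⋆ t) ⊙ P.Ic t := by
  refine Cell.act_injective ?_
  simp (maxDischargeDepth := 12) [rho, rhoZ, mul_assoc]

theorem transpose_lam : (P.σ t ◃ T.lamc (G ⋆ t)) ⊙ ((dc T P t ▹ T.ηc (T.T ⋆ G ⋆ t)) ⊙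
      ((P.σ t ◃ (T.ηn (P.σ (G ⋆ t) ⊚ (K.post T.T).hom (δc T P t))).inv) ⊙
        (((P.σn (P.σ t ⊚ T.ηc (G ⋆ t))).inv ▹ (K.post T.T).hom (δc T P t)) ⊙
          (P.σ t ◃ (K.post T.T).cell (lam T P t).inv)))) = Cell.id (P.σ t) := by
  have h1 := fun z => congrArg (fun y => y.act * z) (P.cmp_natural (P.σ t ◃ T.lamc (G ⋆ t)))
  have h2 := fun z => congrArg (fun y => y.act * z) (cmp_lamZ T P t)
  have h3 := fun z => congrArg (fun y => y.act * ((P.σ t ◃ (K.post T.T).cell (lam T P t)).act * z))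
    (P.cmp_σ t)
  have h4 : P.Ic t ⊙ lam T P t = (K.post G).cell (P.σ t ◃ T.lamc (G ⋆ t)) ▹ P.ι (G ⋆ t) ⊙
      lamZ T P t := by
    refine Cell.act_injective ?_
    rw [lam_eq]
    simp (maxDischargeDepth := 12)
    rw [Cell.act_mul_inv_assoc (by simp) (by simp)]
  have h5 := fun z => congrArg (fun y => (P.σ t ◃ (K.post T.T).cell y).act * z) h4
  have h6 := Cell.act_mul_inv (x := P.σ t ◃ (K.post T.T).cell (lam T P t)) (by simp)
  refine Cell.act_injective ?_
  simp (maxDischargeDepth := 12) [mul_assoc] at h1 h2 h3 h5 h6 ⊢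
  rw [← h2, ← h1, ← h5, h3, h6]

theorem transpose_rho : (P.σ t ◃ (K.post T.T).cell (rho T P t).inv) =
    (P.σ t ◃ (T.rhoc (G ⋆ t)).inv) ⊙ ((dc T P t ▹ (K.post T.T).hom (T.ηc (G ⋆ t))) ⊙
      (P.σ t ◃ (K.post T.T).hom (P.σ (G ⋆ t)) ◃
        (K.post T.T).cell (T.ηn (δc T P t)).inv)) := by
  have h1 := fun z => congrArg (fun y => y.act * z) (P.cmp_natural (P.σ t ◃ T.rhoc (G ⋆ t)))
  have h2 := fun z => congrArg (fun y => y.act * z) (cmp_rhoZ T P t)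
  have h3 := congrArg Cell.act (P.cmp_σ t)
  have h4 : (K.post G).cell (P.σ t ◃ T.rhoc (G ⋆ t)) ▹ P.ι (G ⋆ t) ⊙ P.Ic t =
      rhoZ T P t ⊙ rho T P t := by
    refine Cell.act_injective ?_
    rw [rho_eq]
    simp (maxDischargeDepth := 12)
    rw [Cell.act_mul_inv_assoc (by simp) (by simp)]
  have h5 := congrArg (fun z => (P.σ t ◃ (K.post T.T).cell z).act) h4
  have h6 := Cell.act_inv_mul (x := P.σ t ◃ (K.post T.T).cell (rho T P t)) (by simp)
  have h7 := Cell.act_inv_mul (x := P.σ t ◃ T.rhoc (G ⋆ t)) (by simp)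
  refine Cell.cancel_right (p := P.σ t ◃ (K.post T.T).cell (rho T P t)) (by simp) (by simp)
    (by simp (maxDischargeDepth := 9)) ?_
  simp (maxDischargeDepth := 12) [mul_assoc] at h1 h2 h3 h5 h6 h7 ⊢
  rw [h6, ← h2, ← h5, h1, h3]
  simp [h7]

end MateCells

namespace MateCells

variable {K : GrayCat.{u, w}} {A B : K.Obj} (T : Pseudomonad K B) {G : (K.hom B B).Ob}
  (P : Pseudoadjunction K T.T G) (t : (K.hom A B).Ob)

theorem alphaX_eq : alphaX T P t ⊙ (K.post G).cell ((K.post G).cell (P.Ic t)) ▹ δc T P (G ⋆ t) =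
    (K.post G).cell ((K.post G).cell (P.ucmp (P.σ (G ⋆ t) ⊚ T.μc (G ⋆ G ⋆ t)))) ▹
      ((K.post G).hom (P.ι (T.T ⋆ G ⋆ G ⋆ t)) ⊚ P.ι (G ⋆ G ⋆ t)) := by
  refine Cell.act_injective ?_
  rw [Cell.act_vcomp (by simp)]
  simp (maxDischargeDepth := 12) [alphaX, Pseudoadjunction.ucmp, Pseudoadjunction.curry,
    δc_eq T P (G ⋆ t)]

/-- The 3-cell `δ ∘ σ ⇛ Φ(σ ∘ Tσ ∘ μ)`. -/
noncomputable def comultσ : (K.hom A B).Cell (T.T ⋆ G ⋆ G ⋆ t) (G ⋆ G ⋆ t) :=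
  P.curry₂ (P.σ t ⊚ T.μc (G ⋆ t)) (P.σ (G ⋆ t)) (P.σ t ◃ (T.μn (P.σ (G ⋆ t))).inv)

@[simp] theorem dom_comultσ : (comultσ T P t).dom = δc T P t ⊚ P.σ (G ⋆ t) := by
  simp [comultσ, δc_eq]
@[simp] theorem cod_comultσ : (comultσ T P t).cod = (K.post G).hom ((K.post G).hom (P.σ t)) ⊚
    (K.post G).hom ((K.post G).hom ((K.post T.T).hom (P.σ (G ⋆ t)))) ⊚
    (K.post G).hom ((K.post G).hom (T.μc (T.T ⋆ G ⋆ G ⋆ t))) ⊚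
    (K.post G).hom (P.ι (T.T ⋆ T.T ⋆ G ⋆ G ⋆ t)) ⊚ P.ι (T.T ⋆ G ⋆ G ⋆ t) := by
  simp [comultσ]

theorem alphaX'_eq : alphaX' T P t = (K.post G).cell (comultσ T P t) ▹ P.ι (G ⋆ G ⋆ t) := rfl

theorem cmp_comultσ : P.cmp₂ (P.σ t ⊚ (K.post T.T).hom (P.σ (G ⋆ t)) ⊚ T.μc (T.T ⋆ G ⋆ G ⋆ t)) ⊙
    P.σ t ◃ (K.post T.T).hom (P.σ (G ⋆ t)) ◃
      (K.post T.T).cell ((K.post T.T).cell (comultσ T P t)) =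
    P.σ t ◃ (T.μn (P.σ (G ⋆ t))).inv ⊙
      dc T P t ▹ (K.post T.T).hom ((K.post T.T).hom (P.σ (G ⋆ t))) := by
  have := P.cmp₂_curry (f := P.σ t ⊚ T.μc (G ⋆ t)) (h := P.σ (G ⋆ t))
    (x := P.σ t ◃ (T.μn (P.σ (G ⋆ t))).inv) (by simp)
  simpa [comultσ, dc_eq] using this

theorem cmp_alphaZ : P.cmp₃ (P.σ t ⊚ T.μc (G ⋆ t) ⊚ (K.post T.T).hom (T.μc (G ⋆ t))) ⊙
      P.σ t ◃ (K.post T.T).hom (P.σ (G ⋆ t)) ◃ (K.post T.T).hom ((K.post T.T).hom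
        (P.σ (G ⋆ G ⋆ t))) ◃ (K.post T.T).cell ((K.post T.T).cell ((K.post T.T).cell
          (alphaZ T P t))) = dc T P t ▹ (K.post T.T).hom (T.μc (G ⋆ t)) ⊙
        P.σ t ◃ (K.post T.T).hom (P.σ (G ⋆ t)) ◃ (K.post T.T).cell (T.μn (δc T P t)).inv ⊙
        P.σ t ◃ (K.post T.T).cell (dc T P (G ⋆ t)) ▹
          (K.post T.T).hom ((K.post T.T).hom ((K.post T.T).hom (δc T P t))) := by
  have h1 := fun z => congrArg (fun y => y.act * z) (P.cmp₃_curry (f := P.σ t ⊚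
    (K.post T.T).hom (P.σ (G ⋆ t)) ⊚ (K.post T.T).hom (T.μc (G ⋆ G ⋆ t))) (h := δc T P t)
    (x := dc T P t ▹ (K.post T.T).hom (T.μc (G ⋆ t)) ⊙
      P.σ t ◃ (K.post T.T).hom (P.σ (G ⋆ t)) ◃ (K.post T.T).cell (T.μn (δc T P t)).inv)
    (by simp (maxDischargeDepth := 9)))
  have h2 := congrArg (fun y => (P.σ t ◃ (K.post T.T).cell y ▹
    (K.post T.T).hom ((K.post T.T).hom ((K.post T.T).hom (δc T P t)))).act)
    (P.cmp₂_natural (P.ucmp (P.σ (G ⋆ t) ⊚ T.μc (G ⋆ G ⋆ t))))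
  have h3 := fun z => congrArg (fun y => (y ▹
    (K.post T.T).hom ((K.post T.T).hom ((K.post T.T).hom (δc T P t)))).act * z)
    (P.cmp_ucmp (P.σ (G ⋆ t) ⊚ T.μc (G ⋆ G ⋆ t)))
  have e : alphaZ T P t = alphaY T P t ⊙
      (K.post G).cell ((K.post G).cell (P.ucmp (P.σ (G ⋆ t) ⊚ T.μc (G ⋆ G ⋆ t)))) ▹
      ((K.post G).hom (P.ι (T.T ⋆ G ⋆ G ⋆ t)) ⊚ P.ι (G ⋆ G ⋆ t)) ▹ δc T P t := by
    rw [← alphaX_eq, alphaZ]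
    refine Cell.act_injective ?_
    simp (maxDischargeDepth := 12)
  refine Cell.act_injective ?_
  rw [e, alphaY, dc_eq T P (G ⋆ t)]
  simp (maxDischargeDepth := 12) [mul_assoc] at h1 h2 h3 ⊢
  rw [h1]
  simp (maxDischargeDepth := 12) [Pseudoadjunction.cmp₃, mul_assoc]
  rw [h2, h3]
  simp (maxDischargeDepth := 12)

theorem cmp_alphaZ' : P.cmp₃ (P.σ t ⊚ T.μc (G ⋆ t) ⊚ T.μc (T.T ⋆ G ⋆ t)) ⊙
      P.σ t ◃ (K.post T.T).hom (P.σ (G ⋆ t)) ◃ (K.post T.T).hom ((K.post T.T).hom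
        (P.σ (G ⋆ G ⋆ t))) ◃ (K.post T.T).cell ((K.post T.T).cell ((K.post T.T).cell
          (alphaZ' T P t))) = dc T P t ▹ T.μc (T.T ⋆ G ⋆ t) ⊙
        P.σ t ◃ (K.post T.T).hom (P.σ (G ⋆ t)) ◃ (T.μn ((K.post T.T).hom (δc T P t))).inv ⊙
        P.σ t ◃ (T.μn (P.σ (G ⋆ t))).inv ▹
          (K.post T.T).hom ((K.post T.T).hom ((K.post T.T).hom (δc T P t))) ⊙
        dc T P t ▹ (K.post T.T).hom ((K.post T.T).hom (P.σ (G ⋆ t))) ▹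
          (K.post T.T).hom ((K.post T.T).hom ((K.post T.T).hom (δc T P t))) ⊙
        P.σ t ◃ (K.post T.T).hom (P.σ (G ⋆ t)) ◃
          (K.post T.T).cell ((K.post T.T).cell (P.σn (δc T P t)).inv) ▹
          (K.post T.T).hom ((K.post T.T).hom ((K.post T.T).hom (δc T P t))) := by
  have h1 := fun z => congrArg (fun y => y.act * z) (P.cmp₃_curry (f := P.σ t ⊚
    (K.post T.T).hom (P.σ (G ⋆ t)) ⊚ T.μc (T.T ⋆ G ⋆ G ⋆ t)) (h := δc T P t)
    (x := dc T P t ▹ T.μc (T.T ⋆ G ⋆ t) ⊙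
      P.σ t ◃ (K.post T.T).hom (P.σ (G ⋆ t)) ◃ (T.μn ((K.post T.T).hom (δc T P t))).inv)
    (by simp (maxDischargeDepth := 9)))
  have h2 := fun z => congrArg (fun y => (P.σ t ◃ (K.post T.T).hom (P.σ (G ⋆ t)) ◃
    (K.post T.T).cell ((K.post T.T).cell y) ▹
    (K.post T.T).hom ((K.post T.T).hom ((K.post T.T).hom (δc T P t)))).act * z)
    (P.cmp_natural (comultσ T P t))
  have h3 := fun z => congrArg (fun y => (y ▹
    (K.post T.T).hom ((K.post T.T).hom ((K.post T.T).hom (δc T P t)))).act * z)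
    (cmp_comultσ T P t)
  have h4 := congrArg (fun y => (P.σ t ◃ (K.post T.T).hom (P.σ (G ⋆ t)) ◃
    (K.post T.T).cell ((K.post T.T).cell y) ▹
    (K.post T.T).hom ((K.post T.T).hom ((K.post T.T).hom (δc T P t)))).act)
    (P.cmp_post_σ (δc T P t))
  refine Cell.act_injective ?_
  rw [alphaZ', alphaY']
  simp (maxDischargeDepth := 12) [mul_assoc, Pseudoadjunction.cmp₂] at h1 h2 h3 h4 ⊢
  rw [h1]
  simp (maxDischargeDepth := 12) [Pseudoadjunction.cmp₃, Pseudoadjunction.cmp₂, mul_assoc, alphaX'_eq]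
  rw [h2, h3, h4]

@[simp] theorem dom_alphaZ : (alphaZ T P t).dom = δc T P (G ⋆ t) ⊚ δc T P t := by
  simp (maxDischargeDepth := 12) [alphaZ]
@[simp] theorem cod_alphaZ : (alphaZ T P t).cod =
    (K.post G).hom ((K.post G).hom ((K.post G).hom (P.σ t))) ⊚
      (K.post G).hom ((K.post G).hom ((K.post G).hom (T.μc (G ⋆ t)))) ⊚
      (K.post G).hom ((K.post G).hom ((K.post G).hom ((K.post T.T).hom (T.μc (G ⋆ t))))) ⊚
      (K.post G).hom ((K.post G).hom (P.ι (T.T ⋆ T.T ⋆ G ⋆ t))) ⊚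
      (K.post G).hom (P.ι (T.T ⋆ G ⋆ t)) ⊚ P.ι (G ⋆ t) := by
  simp (maxDischargeDepth := 12) [alphaZ]
@[simp] theorem dom_alphaZ' : (alphaZ' T P t).dom = (K.post G).hom (δc T P t) ⊚ δc T P t := by
  simp (maxDischargeDepth := 12) [alphaZ']
@[simp] theorem cod_alphaZ' : (alphaZ' T P t).cod =
    (K.post G).hom ((K.post G).hom ((K.post G).hom (P.σ t))) ⊚
      (K.post G).hom ((K.post G).hom ((K.post G).hom (T.μc (G ⋆ t)))) ⊚
      (K.post G).hom ((K.post G).hom ((K.post G).hom (T.μc (T.T ⋆ G ⋆ t)))) ⊚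
      (K.post G).hom ((K.post G).hom (P.ι (T.T ⋆ T.T ⋆ G ⋆ t))) ⊚
      (K.post G).hom (P.ι (T.T ⋆ G ⋆ t)) ⊚ P.ι (G ⋆ t) := by
  simp (maxDischargeDepth := 12) [alphaZ']
@[simp] theorem iso_alphaZ' : (alphaZ' T P t).IsIso := by simp (maxDischargeDepth := 12) [alphaZ']

theorem alpha_eq : alpha T P t = (alphaZ' T P t).inv ⊙
    (K.post G).cell ((K.post G).cell ((K.post G).cell (P.σ t ◃ T.alphac (G ⋆ t)))) ▹
      ((K.post G).hom ((K.post G).hom (P.ι (T.T ⋆ T.T ⋆ G ⋆ t))) ⊚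
      (K.post G).hom (P.ι (T.T ⋆ G ⋆ t)) ⊚ P.ι (G ⋆ t)) ⊙ alphaZ T P t := by
  refine Cell.act_injective ?_
  simp (maxDischargeDepth := 12) [alpha, alphaZ, alphaZ', mul_assoc]

theorem transpose_alpha : (P.σ t ◃ T.alphac (G ⋆ t)) ⊙
    ((dc T P t ▹ (K.post T.T).hom (T.μc (G ⋆ t))) ⊙
      ((P.σ t ◃ (K.post T.T).hom (P.σ (G ⋆ t)) ◃ (K.post T.T).cell (T.μn (δc T P t)).inv) ⊙
        ((P.σ t ◃ (K.post T.T).cell (dc T P (G ⋆ t)) ▹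
          (K.post T.T).hom ((K.post T.T).hom ((K.post T.T).hom (δc T P t)))) ⊙
          (P.σ t ◃ (K.post T.T).hom (P.σ (G ⋆ t)) ◃
            (K.post T.T).hom ((K.post T.T).hom (P.σ (G ⋆ G ⋆ t))) ◃
            (K.post T.T).cell ((K.post T.T).cell ((K.post T.T).cell (alpha T P t).inv)))))) =
    (dc T P t ▹ T.μc (T.T ⋆ G ⋆ t)) ⊙
      ((P.σ t ◃ (T.μn (P.σ (G ⋆ t) ⊚ (K.post T.T).hom (δc T P t))).inv) ⊙
        ((dc T P t ▹ (K.post T.T).hom ((K.post T.T).hom (P.σ (G ⋆ t))) ▹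
          (K.post T.T).hom ((K.post T.T).hom ((K.post T.T).hom (δc T P t)))) ⊙
          (P.σ t ◃ (K.post T.T).hom (P.σ (G ⋆ t)) ◃
            (K.post T.T).cell ((K.post T.T).cell (P.σn (δc T P t)).inv) ▹
            (K.post T.T).hom ((K.post T.T).hom ((K.post T.T).hom (δc T P t)))))) := by
  have h1 := fun z => congrArg (fun y => y.act * z) (P.cmp₃_natural (P.σ t ◃ T.alphac (G ⋆ t)))
  have h2 := fun z => congrArg (fun y => y.act * z) (cmp_alphaZ T P t)
  have h3 := congrArg Cell.act (cmp_alphaZ' T P t)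
  have h4 : (K.post G).cell ((K.post G).cell ((K.post G).cell (P.σ t ◃ T.alphac (G ⋆ t)))) ▹
      ((K.post G).hom ((K.post G).hom (P.ι (T.T ⋆ T.T ⋆ G ⋆ t))) ⊚
      (K.post G).hom (P.ι (T.T ⋆ G ⋆ t)) ⊚ P.ι (G ⋆ t)) ⊙ alphaZ T P t ⊙ (alpha T P t).inv =
      alphaZ' T P t := by
    refine Cell.cancel_right (p := alpha T P t) (by simp)
      (by simp (maxDischargeDepth := 12)) (by simp) ?_
    have h := Cell.act_inv_mul (iso_alpha T P t)
    simp (maxDischargeDepth := 12) [mul_assoc] at h ⊢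
    rw [h, alpha_eq, Cell.act_vcomp (by simp (maxDischargeDepth := 12)),
      Cell.act_vcomp (by simp (maxDischargeDepth := 12)),
      Cell.act_mul_inv_assoc (by simp) (by simp (maxDischargeDepth := 12))]
    simp
  have h5 := congrArg (fun y => (P.σ t ◃ (K.post T.T).hom (P.σ (G ⋆ t)) ◃
    (K.post T.T).hom ((K.post T.T).hom (P.σ (G ⋆ G ⋆ t))) ◃ (K.post T.T).cell
      ((K.post T.T).cell ((K.post T.T).cell y))).act) h4
  refine Cell.act_injective ?_
  simp (maxDischargeDepth := 12) [mul_assoc] at h1 h2 h3 h5 ⊢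
  rw [← h2, ← h1, h5, h3]

end MateCells

/-- The frame given by a pseudomonad `T` and a pseudoadjunction `T ⊣ G`. -/
@[simps T G]
noncomputable def mateFrame {K : GrayCat.{u, w}} {B : K.Obj} (T : Pseudomonad K B)
    {G : (K.hom B B).Ob} (P : Pseudoadjunction K T.T G) (A : K.Obj) : Frame (K.hom A B) where
  T := K.post T.T
  G := K.post G
  σ := P.σ
  μ := T.μc
  η := T.ηc
  δ := δc T P
  σn := P.σn
  μn := T.μn
  ηn := T.ηn
  δn := δn T P
  dom_σn := P.dom_σn
  cod_σn := P.cod_σn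
  dom_μn := T.dom_μn
  cod_μn := T.cod_μn
  dom_ηn := T.dom_ηn
  cod_ηn := T.cod_ηn
  dom_δn := dom_δn T P
  cod_δn := cod_δn T P
  iso_σn := P.iso_σn
  iso_μn := T.iso_μn
  iso_ηn := T.iso_ηn
  iso_δn := iso_δn T P
  σn_id := P.σn_id
  σn_comp := P.σn_comp
  μn_comp := T.μn_comp
  ηn_comp := T.ηn_comp
  σn_two := P.σn_two
  μn_two := T.μn_two
  ηn_two := T.ηn_two
  lam := T.lamc
  rho := T.rhoc
  alpha := T.alphac
  d := dc T P
  lam' t := (MateCells.rho T P t).inv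
  rho' t := (MateCells.lam T P t).inv
  alpha' t := (MateCells.alpha T P t).inv
  dom_lam := T.dom_lamc
  cod_lam := T.cod_lamc
  dom_rho := T.dom_rhoc
  cod_rho := T.cod_rhoc
  dom_alpha := T.dom_alphac
  cod_alpha := T.cod_alphac
  dom_d := dom_dc T P
  cod_d := cod_dc T P
  dom_lam' t := by simp
  cod_lam' t := by simp
  dom_rho' t := by simp
  cod_rho' t := by simp
  dom_alpha' t := by simp
  cod_alpha' t := by simp
  iso_lam := T.iso_lamc
  iso_rho := T.iso_rhoc
  iso_alpha := T.iso_alphac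
  iso_d := iso_dc T P
  iso_lam' t := by simp
  iso_rho' t := by simp
  iso_alpha' t := by simp
  lam_n := T.lamc_n
  rho_n := T.rhoc_n
  alpha_n := T.alphac_n
  d_n := dc_n T P
  assoc := T.assocc
  unit := T.unitc
  transpose_alpha := MateCells.transpose_alpha T P
  transpose_lam := MateCells.transpose_lam T P
  transpose_rho := MateCells.transpose_rho T P
  faithful := P.faithful
  full := P.full

section

variable {K : GrayCat.{u, w}} {A B : K.Obj} (T : Pseudomonad K B) {G : (K.hom B B).Ob}
  (P : Pseudoadjunction K T.T G) {s : (K.hom A B).Ob} (t : (K.hom A B).Ob)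

@[simp] theorem mateFrame_σ_val : ((mateFrame T P A).σ t).val = P.e ⋆ᵣ t := rfl
@[simp] theorem mateFrame_μ_val : ((mateFrame T P A).μ t).val = T.μ ⋆ᵣ t := rfl
@[simp] theorem mateFrame_η_val : ((mateFrame T P A).η t).val = T.η ⋆ᵣ t := rfl
@[simp] theorem mateFrame_δ_val : ((mateFrame T P A).δ t).val = mateComult T P ⋆ᵣ t := rfl
@[simp] theorem mateFrame_lam_val : ((mateFrame T P A).lam t).val = T.lam ⋆ᵣᵣ t := rfl
@[simp] theorem mateFrame_rho_val : ((mateFrame T P A).rho t).val = T.rho ⋆ᵣᵣ t := rfl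
@[simp] theorem mateFrame_alpha_val : ((mateFrame T P A).alpha t).val = T.alpha ⋆ᵣᵣ t := rfl
@[simp] theorem mateFrame_d_val : ((mateFrame T P A).d t).val = comultCmp T P ⋆ᵣᵣ t := rfl

@[simp] theorem mateFrame_lam'_val :
    ((mateFrame T P A).lam' t).val = TwoCat.inv (mateRho T P) ⋆ᵣᵣ t := by
  change (MateCells.rho T P t).inv.val = _
  have h : TwoCat.IsIso (mateRho T P) := by
    rw [← MateCells.rho_val_one]; exact MateCells.iso_rho T P _
  rw [Cell.inv_val, MateCells.rho_val, TwoFunctor.map_inv _ h]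

@[simp] theorem mateFrame_rho'_val :
    ((mateFrame T P A).rho' t).val = TwoCat.inv (mateLam T P) ⋆ᵣᵣ t := by
  change (MateCells.lam T P t).inv.val = _
  have h : TwoCat.IsIso (mateLam T P) := by
    rw [← MateCells.lam_val_one]; exact MateCells.iso_lam T P _
  rw [Cell.inv_val, MateCells.lam_val, TwoFunctor.map_inv _ h]

@[simp] theorem mateFrame_alpha'_val :
    ((mateFrame T P A).alpha' t).val = TwoCat.inv (mateAlpha T P) ⋆ᵣᵣ t := by
  change (MateCells.alpha T P t).inv.val = _
  have h : TwoCat.IsIso (mateAlpha T P) := by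
    rw [← MateCells.alpha_val_one]; exact MateCells.iso_alpha T P _
  rw [Cell.inv_val, MateCells.alpha_val, TwoFunctor.map_inv _ h]

variable {t} (g : (K.hom A B).Hom s t)

@[simp] theorem mateFrame_σn_val : ((mateFrame T P A).σn g).val = K.ix P.e g.val := rfl
@[simp] theorem mateFrame_μn_val : ((mateFrame T P A).μn g).val = K.ix T.μ g.val := rfl
@[simp] theorem mateFrame_ηn_val : ((mateFrame T P A).ηn g).val = K.ix T.η g.val := rfl
@[simp] theorem mateFrame_δn_val : ((mateFrame T P A).δn g).val = K.ix (mateComult T P) g.val :=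
  rfl

end

namespace TwoCat.Cell

theorem ext_iff_of_eq {X : TwoCat.{w}} {a b : X.Ob} {x y : X.Cell a b} {p q : X.Two}
    (hx : x.val = p) (hy : y.val = q) : x = y ↔ p = q := by
  rw [Cell.ext_iff, hx, hy]

end TwoCat.Cell

namespace Frame

variable {X : TwoCat.{w}} {W : Frame X} {s t : X.Ob}

namespace AlgData

variable (a : W.AlgData s) (b : W.AlgData t)

theorem assoc_iff_val : a.Assoc ↔
    (a.ν.val ◁ (W.alpha s).val) ∘₂ (a.χ.val ▷ W.T.one (W.μ s).val) ∘₂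
      (a.ν.val ◁ W.T.two a.χ.val) =
    (a.χ.val ▷ (W.μ (W.T.ob s)).val) ∘₂ (a.ν.val ◁ TwoCat.inv (W.μn a.ν).val) ∘₂
      (a.χ.val ▷ W.T.one (W.T.one a.ν.val)) :=
  Cell.ext_iff_of_eq (by simp (maxDischargeDepth := 12) [Cell.vcomp_val])
    (by simp (maxDischargeDepth := 12) [Cell.vcomp_val])

theorem unit_iff_val : a.Unit ↔
    a.χ.val ▷ W.T.one (W.η s).val =
      (a.ν.val ◁ (W.rho s).val) ∘₂ (a.ν.val ◁ W.T.two a.ψ.val) :=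
  Cell.ext_iff_of_eq (by simp (maxDischargeDepth := 12) [Cell.vcomp_val])
    (by simp (maxDischargeDepth := 12) [Cell.vcomp_val])

theorem homUnit_iff_val {h : X.Hom s t} {ϱ : X.Cell (W.T.ob s) t} 
    (hc : ϱ.cod = h ⊚ a.ν) : a.HomUnit W b h ϱ ↔
    (h.val ◁ a.ψ.val) ∘₂ (ϱ.val ▷ (W.η s).val) =
      (b.ψ.val ▷ h.val) ∘₂ (b.ν.val ◁ (W.ηn h).val) :=
  Cell.ext_iff_of_eq (by simp (maxDischargeDepth := 12) [Cell.vcomp_val, hc])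
    (by simp (maxDischargeDepth := 12) [Cell.vcomp_val])

theorem homMult_iff_val {h : X.Hom s t} {ϱ : X.Cell (W.T.ob s) t} (hd : ϱ.dom = b.ν ⊚ W.T.hom h)
    (hc : ϱ.cod = h ⊚ a.ν) : a.HomMult W b h ϱ ↔
    (h.val ◁ a.χ.val) ∘₂ (ϱ.val ▷ W.T.one a.ν.val) ∘₂ (b.ν.val ◁ W.T.two ϱ.val) =
      (ϱ.val ▷ (W.μ s).val) ∘₂ (b.ν.val ◁ TwoCat.inv (W.μn h).val) ∘₂
        (b.χ.val ▷ W.T.one (W.T.one h.val)) :=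
  Cell.ext_iff_of_eq (by simp (maxDischargeDepth := 12) [Cell.vcomp_val, hd, hc])
    (by simp (maxDischargeDepth := 12) [Cell.vcomp_val, hd, hc])

end AlgData

namespace CoalgData

variable (c : W.CoalgData s) (e : W.CoalgData t)

theorem coassoc_iff_val : c.Coassoc ↔
    ((W.alpha' s).val ▷ c.n.val) ∘₂ (W.G.one (W.δ s).val ◁ c.χ'.val) ∘₂
      (W.G.two c.χ'.val ▷ c.n.val) =
    ((W.δ (W.G.ob s)).val ◁ c.χ'.val) ∘₂ ((W.δn c.n).val ▷ c.n.val) ∘₂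
      (W.G.one (W.G.one c.n.val) ◁ c.χ'.val) :=
  Cell.ext_iff_of_eq (by simp (maxDischargeDepth := 12) [Cell.vcomp_val])
    (by simp (maxDischargeDepth := 12) [Cell.vcomp_val])

theorem counit_iff_val : c.Counit ↔
    W.G.one ((W.σ s).val ∘₁ (W.η (W.G.ob s)).val) ◁ c.χ'.val =
      ((W.rho' s).val ▷ c.n.val) ∘₂ (W.G.two c.ψ'.val ▷ c.n.val) :=
  Cell.ext_iff_of_eq (by simp (maxDischargeDepth := 12) [Cell.vcomp_val])
    (by simp (maxDischargeDepth := 12) [Cell.vcomp_val])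

theorem alg_ψ_val : c.alg.ψ.val = c.ψ'.val ∘₂ ((W.σ s).val ◁ (W.ηn c.n).val) := by
  simp (maxDischargeDepth := 12) [Cell.vcomp_val]

theorem alg_χ_val : c.alg.χ.val = ((W.σ s).val ◁ TwoCat.inv (W.μn c.n).val) ∘₂
    ((W.d s).val ▷ W.T.one (W.T.one c.n.val)) ∘₂
    (((W.σ s).val ∘₁ W.T.one (W.σ (W.G.ob s)).val) ◁ W.T.two (W.T.two c.χ'.val)) ∘₂
    ((W.σ s).val ◁ W.T.two (W.σn c.n).val ▷ W.T.one (W.T.one c.n.val)) := by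
  simp (maxDischargeDepth := 12) [Cell.vcomp_val]

end CoalgData

namespace CoalgHomData

variable {c : W.CoalgData s} {e : W.CoalgData t} {h : X.Hom s t} (k : W.CoalgHomData c e h)

theorem dom_εn : (W.εn h).dom = h ⊚ W.σ s ⊚ W.η (W.G.ob s) := by
  simp (maxDischargeDepth := 12) [εn]
theorem cod_εn : (W.εn h).cod = W.σ t ⊚ W.η (W.G.ob t) ⊚ W.G.hom h := by
  simp (maxDischargeDepth := 12) [εn]
theorem iso_εn : (W.εn h).IsIso := by
  simp (maxDischargeDepth := 12) [εn]

theorem counit_iff_val : k.Counit ↔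
    (h.val ◁ c.ψ'.val) ∘₂ (TwoCat.inv (W.εn h).val ▷ c.n.val) ∘₂
      (((W.σ t).val ∘₁ (W.η (W.G.ob t)).val) ◁ k.ϱ'.val) = e.ψ'.val ▷ h.val :=
  Cell.ext_iff_of_eq
    (by simp (maxDischargeDepth := 12) [Cell.vcomp_val, dom_εn, cod_εn, iso_εn])
    (by simp (maxDischargeDepth := 12) [Cell.vcomp_val])

theorem comult_iff_val : k.Comult ↔
    (W.G.one (W.G.one h.val) ◁ c.χ'.val) ∘₂ (W.G.two k.ϱ'.val ▷ c.n.val) ∘₂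
      (W.G.one e.n.val ◁ k.ϱ'.val) =
    (TwoCat.inv (W.δn h).val ▷ c.n.val) ∘₂ ((W.δ t).val ◁ k.ϱ'.val) ∘₂ (e.χ'.val ▷ h.val) :=
  Cell.ext_iff_of_eq (by simp (maxDischargeDepth := 12) [Cell.vcomp_val])
    (by simp (maxDischargeDepth := 12) [Cell.vcomp_val])

theorem ϱ_val : k.ϱ.val = (TwoCat.inv (W.σn h).val ▷ W.T.one c.n.val) ∘₂
    ((W.σ t).val ◁ W.T.two k.ϱ'.val) := by
  simp (maxDischargeDepth := 12) [Cell.vcomp_val, ϱ]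

end CoalgHomData

end Frame

section

variable {K : GrayCat.{u, w}} {B : K.Obj} (T : Pseudomonad K B) {G : (K.hom B B).Ob}
  (P : Pseudoadjunction K T.T G)

@[simp] theorem isIso_mateLam : TwoCat.IsIso (mateLam T P) := by
  rw [← MateCells.lam_val_one]; exact MateCells.iso_lam T P _

@[simp] theorem isIso_mateRho : TwoCat.IsIso (mateRho T P) := by
  rw [← MateCells.rho_val_one]; exact MateCells.iso_rho T P _

@[simp] theorem isIso_mateAlpha : TwoCat.IsIso (mateAlpha T P) := by
  rw [← MateCells.alpha_val_one]; exact MateCells.iso_alpha T P _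

@[simp] theorem src_mateCounit : (K.hom B B).src (mateCounit T P) = G := by
  simp [mateCounit_eq]
@[simp] theorem tgt_mateCounit : (K.hom B B).tgt (mateCounit T P) = K.one B := by
  simp [mateCounit_eq]

@[simp] theorem src_mateLam : (K.hom B B).src₂ (mateLam T P) =
    G ⋆ₗ mateCounit T P ∘₁ mateComult T P := by
  rw [← MateCells.lam_val_one]
  exact (congrArg Hom.val (MateCells.dom_lam T P (K.one B))).trans (by simp [mateCounit_eq])
@[simp] theorem tgt_mateLam : (K.hom B B).tgt₂ (mateLam T P) = (K.hom B B).id G := by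
  rw [← MateCells.lam_val_one]
  exact (congrArg Hom.val (MateCells.cod_lam T P (K.one B))).trans (by simp)
@[simp] theorem src_mateRho : (K.hom B B).src₂ (mateRho T P) = (K.hom B B).id G := by
  rw [← MateCells.rho_val_one]
  exact (congrArg Hom.val (MateCells.dom_rho T P (K.one B))).trans (by simp)
@[simp] theorem tgt_mateRho : (K.hom B B).tgt₂ (mateRho T P) =
    mateCounit T P ⋆ᵣ G ∘₁ mateComult T P := by
  rw [← MateCells.rho_val_one]
  exact (congrArg Hom.val (MateCells.cod_rho T P (K.one B))).trans (by simp [mateCounit_eq])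
@[simp] theorem src_mateAlpha : (K.hom B B).src₂ (mateAlpha T P) =
    mateComult T P ⋆ᵣ G ∘₁ mateComult T P := by
  rw [← MateCells.alpha_val_one]
  exact (congrArg Hom.val (MateCells.dom_alpha T P (K.one B))).trans (by simp)
@[simp] theorem tgt_mateAlpha : (K.hom B B).tgt₂ (mateAlpha T P) =
    G ⋆ₗ mateComult T P ∘₁ mateComult T P := by
  rw [← MateCells.alpha_val_one]
  exact (congrArg Hom.val (MateCells.cod_alpha T P (K.one B))).trans (by simp)

/-- The pseudocomonad on a right pseudoadjoint of a pseudomonad. -/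
noncomputable def mateComonad : Pseudocomonad K B where
  toPseudocomonadData := mateComonadData T P
  src_ε := by simp [mateComonadData]
  tgt_ε := by simp [mateComonadData]
  src_δ := by simp [mateComonadData]
  tgt_δ := by simp [mateComonadData]
  src_lam := by simp [mateComonadData]
  tgt_lam := by simp [mateComonadData]
  src_rho := by simp [mateComonadData]
  tgt_rho := by simp [mateComonadData]
  src_alpha := by simp [mateComonadData]
  tgt_alpha := by simp [mateComonadData]
  lam_iso := by simp [mateComonadData]
  rho_iso := by simp [mateComonadData]
  alpha_iso := by simp [mateComonadData]
  coassoc := by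
    have h := (Frame.CoalgData.coassoc_iff_val _).1
      ((mateFrame T P B).cofree_axioms (K.one B)).1
    simp [mateComonadData] at h ⊢
    exact h
  counit := by
    have h := (Frame.CoalgData.counit_iff_val _).1
      ((mateFrame T P B).cofree_axioms (K.one B)).2
    simp [mateComonadData, mateCounit_eq] at h ⊢
    exact h

end

section

variable {K : GrayCat.{u, w}} {B : K.Obj} (T : Pseudomonad K B) {G : (K.hom B B).Ob}
  (P : Pseudoadjunction K T.T G)

@[simp] theorem mateComonad_G : (mateComonad T P).G = G := rfl
@[simp] theorem mateComonad_ε : (mateComonad T P).ε = mateCounit T P := rfl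
@[simp] theorem mateComonad_δ : (mateComonad T P).δ = mateComult T P := rfl
@[simp] theorem mateComonad_lam : (mateComonad T P).lam = TwoCat.inv (mateRho T P) := rfl
@[simp] theorem mateComonad_rho : (mateComonad T P).rho = TwoCat.inv (mateLam T P) := rfl
@[simp] theorem mateComonad_alpha : (mateComonad T P).alpha = TwoCat.inv (mateAlpha T P) := rfl

variable {T P} {A : K.Obj}

theorem mateFrame_εn_val {s t : (K.hom A B).Ob} (g : (K.hom A B).Hom s t) :
    ((mateFrame T P A).εn g).val = K.ix (mateCounit T P) g.val := by
  rw [Frame.εn, Cell.vcomp_val (by simp (maxDischargeDepth := 12)), mateCounit_eq]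
  simp

/-- The typed form of the data of a pseudoalgebra. -/
@[simps] def Pseudoalgebra.toAlgData (P : Pseudoadjunction K T.T G) (a : Pseudoalgebra T A) :
    (mateFrame T P A).AlgData a.s where
  ν := ⟨a.ν, by simp, by simp⟩
  ψ := ⟨a.ψ, by simp, by simp⟩
  χ := ⟨a.χ, by simp, by simp⟩
  dom_ψ := Hom.ext (by simp)
  cod_ψ := Hom.ext (by simp)
  dom_χ := Hom.ext (by simp)
  cod_χ := Hom.ext (by simp)
  iso_ψ := a.ψ_iso
  iso_χ := a.χ_iso

theorem Pseudoalgebra.toAlgData_assoc (a : Pseudoalgebra T A) : (a.toAlgData P).Assoc :=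
  (Frame.AlgData.assoc_iff_val _).2 (by simpa using a.assoc)

theorem Pseudoalgebra.toAlgData_unit (a : Pseudoalgebra T A) : (a.toAlgData P).Unit :=
  (Frame.AlgData.unit_iff_val _).2 (by simpa using a.unit)

/-- The pseudoalgebra with given typed data. -/
@[simps] def Frame.AlgData.toPseudoalgebra {s : (K.hom A B).Ob} (a : (mateFrame T P A).AlgData s)
    (h : a.Assoc ∧ a.Unit) : Pseudoalgebra T A where
  s := s
  ν := a.ν.val
  ψ := a.ψ.val
  χ := a.χ.val
  src_ν := by simp
  tgt_ν := by simp
  src_ψ := (congrArg Hom.val a.dom_ψ).trans (by simp)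
  tgt_ψ := (congrArg Hom.val a.cod_ψ).trans (by simp)
  src_χ := (congrArg Hom.val a.dom_χ).trans (by simp)
  tgt_χ := (congrArg Hom.val a.cod_χ).trans (by simp)
  ψ_iso := a.iso_ψ
  χ_iso := a.iso_χ
  assoc := by simpa using (Frame.AlgData.assoc_iff_val _).1 h.1
  unit := by simpa using (Frame.AlgData.unit_iff_val _).1 h.2

/-- The typed form of the data of a pseudocoalgebra. -/
@[simps] def Pseudocoalgebra.toCoalgData (c : Pseudocoalgebra (mateComonad T P) A) :
    (mateFrame T P A).CoalgData c.s where
  n := ⟨c.ν, by simp, by simp⟩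
  ψ' := ⟨c.ψ, by simp, by simp⟩
  χ' := ⟨c.χ, by simp, by simp⟩
  dom_ψ' := Hom.ext (by simp [mateCounit_eq])
  cod_ψ' := Hom.ext (by simp)
  dom_χ' := Hom.ext (by simp)
  cod_χ' := Hom.ext (by simp)
  iso_ψ' := c.ψ_iso
  iso_χ' := c.χ_iso

theorem Pseudocoalgebra.toCoalgData_coassoc (c : Pseudocoalgebra (mateComonad T P) A) :
    c.toCoalgData.Coassoc :=
  (Frame.CoalgData.coassoc_iff_val _).2 (by
    simpa using c.coassoc)

theorem Pseudocoalgebra.toCoalgData_counit (c : Pseudocoalgebra (mateComonad T P) A) :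
    c.toCoalgData.Counit :=
  (Frame.CoalgData.counit_iff_val _).2 (by simpa [mateCounit_eq] using c.counit)

/-- The pseudocoalgebra with given typed data. -/
@[simps] def Frame.CoalgData.toPseudocoalgebra {s : (K.hom A B).Ob}
    (c : (mateFrame T P A).CoalgData s) (h : c.Coassoc ∧ c.Counit) :
    Pseudocoalgebra (mateComonad T P) A where
  s := s
  ν := c.n.val
  ψ := c.ψ'.val
  χ := c.χ'.val
  src_ν := by simp
  tgt_ν := by simp
  src_ψ := (congrArg Hom.val c.dom_ψ').trans (by simp [mateCounit_eq])
  tgt_ψ := (congrArg Hom.val c.cod_ψ').trans (by simp)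
  src_χ := (congrArg Hom.val c.dom_χ').trans (by simp)
  tgt_χ := (congrArg Hom.val c.cod_χ').trans (by simp)
  ψ_iso := c.iso_ψ'
  χ_iso := c.iso_χ'
  coassoc := by
    have h := (Frame.CoalgData.coassoc_iff_val _).1 h.1
    simpa using h
  counit := by simpa [mateCounit_eq] using (Frame.CoalgData.counit_iff_val _).1 h.2

/-- The typed form of the structure cell of a morphism of pseudocoalgebras. -/
@[simps] def PseudocoalgHom.toCoalgHomData (f : PseudocoalgHom (mateComonad T P) A) :
    (mateFrame T P A).CoalgHomData f.src.toCoalgData f.tgt.toCoalgData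
      ⟨f.h, f.src_h, f.tgt_h⟩ where
  ϱ' := ⟨f.ϱ, by simp, by simp⟩
  dom_ϱ' := Hom.ext (by simp)
  cod_ϱ' := Hom.ext (by simp)
  iso_ϱ' := f.ϱ_iso

theorem PseudocoalgHom.toCoalgHomData_counit (f : PseudocoalgHom (mateComonad T P) A) :
    f.toCoalgHomData.Counit :=
  (Frame.CoalgHomData.counit_iff_val _).2 (by
    rw [mateFrame_εn_val]
    simpa [mateCounit_eq] using f.counit)

theorem PseudocoalgHom.toCoalgHomData_comult (f : PseudocoalgHom (mateComonad T P) A) :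
    f.toCoalgHomData.Comult :=
  (Frame.CoalgHomData.comult_iff_val _).2 (by
    simpa using f.comult)

/-- The pseudoalgebra for `T` given by a pseudocoalgebra for its right pseudoadjoint. -/
noncomputable def Pseudocoalgebra.toAlg (c : Pseudocoalgebra (mateComonad T P) A) :
    Pseudoalgebra T A :=
  c.toCoalgData.alg.toPseudoalgebra
    (c.toCoalgData.axioms_iff.2 ⟨c.toCoalgData_coassoc, c.toCoalgData_counit⟩)

section

variable (c : Pseudocoalgebra (mateComonad T P) A)

@[simp] theorem Pseudocoalgebra.toAlg_s : c.toAlg.s = c.s := rfl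
@[simp] theorem Pseudocoalgebra.toAlg_ν : c.toAlg.ν = P.e ⋆ᵣ c.s ∘₁ T.T ⋆ₗ c.ν := rfl
@[simp] theorem Pseudocoalgebra.toAlg_ψ : c.toAlg.ψ = c.ψ ∘₂ ((P.e ⋆ᵣ c.s) ◁ K.ix T.η c.ν) :=
  c.toCoalgData.alg_ψ_val
@[simp] theorem Pseudocoalgebra.toAlg_χ : c.toAlg.χ =
    ((P.e ⋆ᵣ c.s) ◁ TwoCat.inv (K.ix T.μ c.ν)) ∘₂
    ((comultCmp T P ⋆ᵣᵣ c.s) ▷ (T.T ⋆ₗ T.T ⋆ₗ c.ν)) ∘₂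
    ((P.e ⋆ᵣ c.s ∘₁ T.T ⋆ₗ P.e ⋆ᵣ (G ⋆ c.s)) ◁ (T.T ⋆ₗₗ T.T ⋆ₗₗ c.χ)) ∘₂
    ((P.e ⋆ᵣ c.s) ◁ (T.T ⋆ₗₗ K.ix P.e c.ν) ▷ (T.T ⋆ₗ T.T ⋆ₗ c.ν)) :=
  c.toCoalgData.alg_χ_val

end

/-- The morphism of pseudoalgebras given by a morphism of pseudocoalgebras. -/
noncomputable def PseudocoalgHom.toAlg (f : PseudocoalgHom (mateComonad T P) A) :
    PseudoalgHom T A where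
  src := f.src.toAlg
  tgt := f.tgt.toAlg
  h := f.h
  ϱ := f.toCoalgHomData.ϱ.val
  src_h := f.src_h
  tgt_h := f.tgt_h
  src_ϱ := congrArg Hom.val f.toCoalgHomData.dom_ϱ
  tgt_ϱ := congrArg Hom.val f.toCoalgHomData.cod_ϱ
  ϱ_iso := f.toCoalgHomData.iso_ϱ
  unit := by
    have h := (Frame.AlgData.homUnit_iff_val _ _ f.toCoalgHomData.cod_ϱ).1
      (f.toCoalgHomData.homUnit_iff.2 f.toCoalgHomData_counit)
    exact h
  mult := by
    have h := (Frame.AlgData.homMult_iff_val _ _ f.toCoalgHomData.dom_ϱ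
      f.toCoalgHomData.cod_ϱ).1 (f.toCoalgHomData.homMult_iff.2 f.toCoalgHomData_comult)
    exact h

section

variable (f : PseudocoalgHom (mateComonad T P) A)

@[simp] theorem PseudocoalgHom.toAlg_src : f.toAlg.src = f.src.toAlg := rfl
@[simp] theorem PseudocoalgHom.toAlg_tgt : f.toAlg.tgt = f.tgt.toAlg := rfl
@[simp] theorem PseudocoalgHom.toAlg_h : f.toAlg.h = f.h := rfl
@[simp] theorem PseudocoalgHom.toAlg_ϱ : f.toAlg.ϱ =
    (TwoCat.inv (K.ix P.e f.h) ▷ (T.T ⋆ₗ f.src.ν)) ∘₂ ((P.e ⋆ᵣ f.tgt.s) ◁ (T.T ⋆ₗₗ f.ϱ)) :=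
  f.toCoalgHomData.ϱ_val

end

end

namespace TwoCat.Cell

variable {X : TwoCat.{w}} {a b : X.Ob} {x : X.Cell a b}

theorem inv_vcomp_self (h : x.IsIso) : x.inv ⊙ x = Cell.id x.dom :=
  act_injective (by rw [act_vcomp (by simp [h]), act_inv_mul h])

theorem vcomp_inv_self (h : x.IsIso) : x ⊙ x.inv = Cell.id x.cod :=
  act_injective (by rw [act_vcomp (by simp [h]), act_mul_inv h])

end TwoCat.Cell

namespace Frame

variable {X : TwoCat.{w}} {W : Frame X} {r s t : X.Ob}

theorem isIso_of_transpose {x : X.Cell s (W.G.ob t)} (h : (W.σ t ◃ W.T.cell x).IsIso) :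
    x.IsIso := by
  obtain ⟨y, hd, hc, hy⟩ := W.full x.cod x.dom (W.σ t ◃ W.T.cell x).inv (by simp [h])
    (by simp [h])
  refine ⟨y.val, congrArg Hom.val hd, congrArg Hom.val hc, ?_, ?_⟩
  · rw [← Cell.vcomp_val hd.symm]
    refine congrArg Cell.val (a₂ := Cell.id x.dom) (W.faithful _ _ ?_ ?_ ?_)
    · simp [hd]
    · simp [hd, hc]
    · simp [hd, hy, -Cell.inv_wl, Cell.inv_vcomp_self h]
  · rw [← Cell.vcomp_val hc]
    refine congrArg Cell.val (a₂ := Cell.id x.cod) (W.faithful _ _ ?_ ?_ ?_)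
    · simp [hd, hc]
    · simp [hc]
    · simp [hc, hy, -Cell.inv_wl, Cell.vcomp_inv_self h]

namespace CoalgHomData

variable {c : W.CoalgData s} {e : W.CoalgData t} {h : X.Hom s t}

theorem ϱ'_eq_of_ϱ_eq {k k' : W.CoalgHomData c e h} (H : k.ϱ = k'.ϱ) : k.ϱ' = k'.ϱ' := by
  refine W.faithful _ _ (by simp) (by simp) ?_
  have H := congrArg Cell.act H
  simp (maxDischargeDepth := 12) [ϱ] at H
  exact Cell.cancel_left (p := (W.σn h).inv ▹ W.T.hom c.n) (by simp (maxDischargeDepth := 12))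
    (by simp (maxDischargeDepth := 12)) (by simp (maxDischargeDepth := 12)) H

theorem exists_ϱ_eq {ϱ : X.Cell (W.T.ob s) t} (hd : ϱ.dom = e.alg.ν ⊚ W.T.hom h)
    (hc : ϱ.cod = h ⊚ c.alg.ν) (hi : ϱ.IsIso) : ∃ k : W.CoalgHomData c e h, k.ϱ = ϱ := by
  simp at hd hc
  obtain ⟨x, xd, xc, hx⟩ := W.full (e.n ⊚ h) (W.G.hom h ⊚ c.n) (W.σn h ▹ W.T.hom c.n ⊙ ϱ)
    (by simp [hc, hd]) (by simp [hc])
  refine ⟨⟨x, xd, xc, W.isIso_of_transpose (by rw [hx]; simp [hc, hi])⟩, ?_⟩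
  refine Cell.act_injective ?_
  rw [CoalgHomData.ϱ, Cell.act_vcomp (by simp [xc]), hx]
  simp [hc]
  rw [← Cell.inv_wr (by simp)]
  have := Cell.act_inv_mul_assoc (p := W.σn h ▹ W.T.hom c.n) (x := ϱ) (by simp) (by simp [hc]) 1
  simpa using this

theorem two_iff {h' : X.Hom s t} (k : W.CoalgHomData c e h) (k' : W.CoalgHomData c e h')
    {ξ : X.Cell s t} (hd : ξ.dom = h) (hc : ξ.cod = h') :
    k'.ϱ ⊙ e.alg.ν ◃ W.T.cell ξ = ξ ▹ c.alg.ν ⊙ k.ϱ ↔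
      k'.ϱ' ⊙ e.n ◃ ξ = W.G.cell ξ ▹ c.n ⊙ k.ϱ' := by
  subst hd hc
  have n := congrArg Cell.act (Cell.square_inv (by simp) (by simp) (by simp) (by simp)
    (W.σn_two ξ))
  have n := congrArg (fun z => (z ▹ W.T.hom c.n).act) (Cell.square_inv (by simp) (by simp)
    (by simp) (by simp) (W.σn_two ξ))
  have l : (k'.ϱ ⊙ e.alg.ν ◃ W.T.cell ξ).act = ((W.σn ξ.cod).inv ▹ W.T.hom c.n).act *
      (W.σ t ◃ W.T.cell (k'.ϱ' ⊙ e.n ◃ ξ)).act := by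
    simp (maxDischargeDepth := 12) [ϱ, mul_assoc]
  have l' : (ξ ▹ c.alg.ν ⊙ k.ϱ).act = ((W.σn ξ.cod).inv ▹ W.T.hom c.n).act *
      (W.σ t ◃ W.T.cell (W.G.cell ξ ▹ c.n ⊙ k.ϱ')).act := by
    simp (maxDischargeDepth := 12) [ϱ, mul_assoc] at n ⊢
    rw [mul_reassoc n]
  constructor
  · intro H
    refine W.faithful _ _ (by simp) (by simp) ?_
    refine Cell.cancel_left (p := (W.σn ξ.cod).inv ▹ W.T.hom c.n) (by simp)
      (by simp) (by simp) ?_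
    rw [← l, ← l', H]
  · intro H
    exact Cell.act_injective (by rw [l, l', H])

end CoalgHomData

namespace CoalgData

theorem ext_of_alg_eq {c e : W.CoalgData t} (hn : c.n = e.n) (h : c.alg = e.alg) : c = e := by
  have hψ : c.ψ' = e.ψ' := by
    have h1 := congrArg (fun a : W.AlgData t => a.ψ.act) h
    simp [hn] at h1
    exact Cell.cancel_right (p := W.σ t ◃ W.ηn e.n) (by simp (maxDischargeDepth := 12)) (by simp (maxDischargeDepth := 12) [hn]) (by simp (maxDischargeDepth := 12)) h1
  have hχ : c.χ' = e.χ' := by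
    have h1 := congrArg (fun a : W.AlgData t => a.χ.act) h
    simp (maxDischargeDepth := 12) [hn] at h1
    have h2 := Cell.mul_cancel_left (by simp (maxDischargeDepth := 12))
      (by simp (maxDischargeDepth := 12) [hn]) (by simp (maxDischargeDepth := 12)) h1
    have h3 := Cell.cancel_both (by simp (maxDischargeDepth := 12))
      (by simp (maxDischargeDepth := 12)) (by simp (maxDischargeDepth := 12) [hn])
      (by simp (maxDischargeDepth := 12)) (by simp (maxDischargeDepth := 12) [hn])
      (by simp (maxDischargeDepth := 12)) h2
    exact W.faithful _ _ (by simp [hn]) (by simp [hn]) (W.faithful _ _ (by simp [hn])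
      (by simp [hn]) (by simpa using h3))
  obtain ⟨n, ψ₁, χ₁, _, _, _, _, _, _⟩ := c
  obtain ⟨n', ψ₂, χ₂, _, _, _, _, _, _⟩ := e
  obtain rfl : n = n' := hn
  obtain rfl : ψ₁ = ψ₂ := hψ
  obtain rfl : χ₁ = χ₂ := hχ
  rfl

theorem exists_alg_eq (n : X.Hom t (W.G.ob t)) (a : W.AlgData t) (h : a.ν = W.σ t ⊚ W.T.hom n) :
    ∃ c : W.CoalgData t, c.n = n ∧ c.alg = a := by
  obtain ⟨ν, ψ, χ, dψ, cψ, dχ, cχ, iψ, iχ⟩ := a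
  obtain rfl : ν = _ := h
  simp at dψ cψ dχ cχ
  obtain ⟨z, zd, zc, hz⟩ := W.full (W.σ (W.G.ob t) ⊚ W.T.hom (W.G.hom n ⊚ n))
    (W.σ (W.G.ob t) ⊚ W.T.hom (W.δ t ⊚ n)) ((W.d t ▹ W.T.hom (W.T.hom n)).inv ⊙
      W.σ t ◃ W.μn n ⊙ χ ⊙ (W.σ t ◃ W.T.cell (W.σn n) ▹ W.T.hom (W.T.hom n)).inv)
    (by simp (maxDischargeDepth := 12) [dχ, cχ]) (by simp (maxDischargeDepth := 12) [dχ, cχ])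
  obtain ⟨x, xd, xc, hx⟩ := W.full _ _ z zd zc
  have iz : (W.σ t ◃ W.T.cell z).IsIso := by
    rw [hz]; simp (maxDischargeDepth := 12) [dχ, cχ, iχ]
  have ix : x.IsIso := W.isIso_of_transpose (by rw [hx]; exact W.isIso_of_transpose iz)
  refine ⟨⟨n, ψ ⊙ (W.σ t ◃ W.ηn n).inv, x, by simp [dψ], by simp [dψ, cψ], xd, xc,
    by simp (maxDischargeDepth := 12) [dψ, iψ], ix⟩, rfl, ?_⟩
  have E : (ψ ⊙ (W.σ t ◃ W.ηn n).inv) ⊙ W.σ t ◃ W.ηn n = ψ := by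
    refine Cell.act_injective ?_
    rw [Cell.act_vcomp (by simp (maxDischargeDepth := 12) [dψ]), Cell.act_vcomp (by simp (maxDischargeDepth := 12) [dψ]), mul_assoc,
      Cell.act_inv_mul (by simp (maxDischargeDepth := 12)), Cell.act_mul_id _ _ (by simp (maxDischargeDepth := 12) [dψ])]
  have F : W.σ t ◃ (W.μn n).inv ⊙ W.d t ▹ W.T.hom (W.T.hom n) ⊙
      W.σ t ◃ W.T.hom (W.σ (W.G.ob t)) ◃ W.T.cell (W.T.cell x) ⊙
        W.σ t ◃ W.T.cell (W.σn n) ▹ W.T.hom (W.T.hom n) = χ := by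
    have e : W.σ t ◃ W.T.hom (W.σ (W.G.ob t)) ◃ W.T.cell (W.T.cell x) = W.σ t ◃ W.T.cell z := by
      rw [← hx]; simp
    rw [e, hz]
    have h1 := Cell.act_mul_inv_assoc (p := W.d t ▹ W.T.hom (W.T.hom n)) (x := W.σ t ◃ W.μn n)
      (by simp (maxDischargeDepth := 12)) (by simp (maxDischargeDepth := 12))
    have h2 := Cell.act_inv_mul_assoc (p := W.σ t ◃ W.μn n) (x := χ) (by simp (maxDischargeDepth := 12)) (by simp (maxDischargeDepth := 12) [cχ])
    refine Cell.act_injective ?_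
    have h3 := Cell.act_inv_mul (x := W.σ t ◃ W.T.cell (W.σn n) ▹ W.T.hom (W.T.hom n)) (by simp (maxDischargeDepth := 12))
    simp (maxDischargeDepth := 12) [dχ, cχ, mul_assoc] at h1 h2 h3 ⊢
    rw [h1, h2, h3, Cell.act_mul_id _ _ (by simp (maxDischargeDepth := 12) [dχ])]
  simp only [alg, E, F]

end CoalgData

end Frame

namespace Frame

variable {X : TwoCat.{w}} {W : Frame X} {r s t : X.Ob}

namespace AlgData

variable (a b : W.AlgData s)

/-- An isomorphism of pseudoalgebras whose underlying 1-cell is an identity. -/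
structure IsCmp (θ : X.Cell (W.T.ob s) s) : Prop where
  dom_θ : θ.dom = b.ν
  cod_θ : θ.cod = a.ν
  iso_θ : θ.IsIso
  unit : b.ψ = a.ψ ⊙ θ ▹ W.η s
  mult : θ ▹ W.μ s ⊙ b.χ = a.χ ⊙ θ ▹ W.T.hom a.ν ⊙ b.ν ◃ W.T.cell θ

variable {a b} {θ : X.Cell (W.T.ob s) s}

namespace IsCmp

theorem assoc (h : a.IsCmp b θ) (H : a.Assoc) : b.Assoc := by
  obtain ⟨dθ, cθ, iθ, -, hm⟩ := h
  have bd : b.χ.dom = b.ν ⊚ W.T.hom b.ν := b.dom_χ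
  have bc : b.χ.cod = b.ν ⊚ W.μ s := b.cod_χ
  have A0 := fun z => congrArg (fun y => y.act * z) H
  have i1 := Cell.interchange θ (W.alpha s)
  have k1 := congrArg (fun z => (z ▹ W.T.hom (W.μ s)).act) hm
  have k2 := congrArg (fun z => (z ▹ W.μ (W.T.ob s)).act) hm
  have k3 := congrArg (fun z => (z ▹ W.T.hom (W.T.hom a.ν)).act) hm
  have k4 := congrArg (fun z => (b.ν ◃ W.T.cell z).act) hm
  have i2 := Cell.interchange θ (W.T.cell a.χ)
  have i3 := Cell.interchange b.χ (W.T.cell (W.T.cell θ))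
  have i4 := Cell.interchange θ (W.μn a.ν).inv
  have n := congrArg (fun y => (b.ν ◃ y).act) (W.μn_inv_two θ)
  refine Cell.cancel_left (p := θ ▹ W.μ s ▹ W.μ (W.T.ob s)) (by simp (maxDischargeDepth := 12) [iθ])
    (by simp (maxDischargeDepth := 12) [dθ, cθ]) (by simp (maxDischargeDepth := 12) [dθ, cθ]) ?_
  simp (maxDischargeDepth := 12) [mul_assoc, dθ, cθ] at A0 i1 k1 k2 k3 k4 i2 i3 i4 n ⊢
  rw [mul_reassoc i1.symm, mul_reassoc k1, mul_reassoc k2]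
  simp only [mul_assoc]
  rw [k4, mul_reassoc i2.symm, A0, mul_reassoc n, i3, mul_reassoc i4.symm, mul_reassoc k3]
  simp only [mul_assoc]

theorem unitLaw (h : a.IsCmp b θ) (H : a.Unit) : b.Unit := by
  obtain ⟨dθ, cθ, iθ, hu, hm⟩ := h
  have U := fun z => congrArg (fun y => y.act * z) H
  have i1 := Cell.interchange θ (W.rho s)
  have i2 := Cell.interchange θ (W.T.cell a.ψ)
  have k1 := congrArg (fun z => (z ▹ W.T.hom (W.η s)).act) hm
  refine Cell.cancel_left (p := θ ▹ W.μ s ▹ W.T.hom (W.η s)) (by simp (maxDischargeDepth := 12) [iθ])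
    (by simp (maxDischargeDepth := 12) [dθ, cθ]) (by simp (maxDischargeDepth := 12) [dθ, cθ]) ?_
  simp (maxDischargeDepth := 12) [mul_assoc, dθ, cθ, hu] at U i1 i2 k1 ⊢
  rw [k1, U, mul_reassoc i2, mul_reassoc i1]

theorem exists_isCmp (a : W.AlgData s) (iθ : θ.IsIso) (cθ : θ.cod = a.ν) :
    ∃ b : W.AlgData s, a.IsCmp b θ := by
  refine ⟨⟨θ.dom, a.ψ ⊙ θ ▹ W.η s, (θ ▹ W.μ s).inv ⊙ a.χ ⊙ θ ▹ W.T.hom a.ν ⊙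
    θ.dom ◃ W.T.cell θ, ?_, ?_, ?_, ?_, ?_, ?_⟩, rfl, cθ, iθ, rfl, ?_⟩
  any_goals simp (maxDischargeDepth := 12) [cθ, iθ]
  refine Cell.act_injective ?_
  have h := Cell.act_mul_inv_assoc (p := θ ▹ W.μ s) (x := a.χ) (by simp [iθ]) (by simp [cθ])
  simp (maxDischargeDepth := 12) [cθ, iθ] at h ⊢
  rw [h]

end IsCmp
end AlgData
end Frame

section

variable {K : GrayCat.{u, w}} {B : K.Obj} {T : Pseudomonad K B} {G : (K.hom B B).Ob}
  {P : Pseudoadjunction K T.T G} {A : K.Obj}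

theorem PseudocoalgHom.two_comm_iff {f g : PseudocoalgHom (mateComonad T P) A}
    (e₁ : f.src = g.src) (e₂ : f.tgt = g.tgt) {ξ : (K.hom A B).Two}
    (hs : (K.hom A B).src₂ ξ = f.h) (ht : (K.hom A B).tgt₂ ξ = g.h) :
    g.toAlg.ϱ ∘₂ (g.tgt.toAlg.ν ◁ (T.T ⋆ₗₗ ξ)) = (ξ ▷ g.src.toAlg.ν) ∘₂ f.toAlg.ϱ ↔
      g.ϱ ∘₂ (g.tgt.ν ◁ ξ) = ((G ⋆ₗₗ ξ) ▷ g.src.ν) ∘₂ f.ϱ := by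
  have hg := g.src_h
  have hg' := g.tgt_h
  obtain ⟨c, e, h, ϱ, sh, th, sϱ, tϱ, iϱ, hu, hm⟩ := f
  obtain rfl : c = g.src := e₁
  obtain rfl : e = g.tgt := e₂
  have k := Frame.CoalgHomData.two_iff
    (PseudocoalgHom.toCoalgHomData ⟨g.src, g.tgt, h, ϱ, sh, th, sϱ, tϱ, iϱ, hu, hm⟩)
    g.toCoalgHomData (ξ := ⟨ξ, by simp [ht], by simp [ht]⟩) (Hom.ext hs) (Hom.ext ht)
  have k := (Cell.ext_iff.symm.trans k).trans Cell.ext_iff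
  rw [Cell.vcomp_val, Cell.vcomp_val, Cell.vcomp_val, Cell.vcomp_val] at k
  · exact k
  all_goals exact Hom.ext (by simp (maxDischargeDepth := 12) [hs, ht])

/-- The 2-cell of pseudoalgebras given by a 2-cell of pseudocoalgebras. -/
noncomputable def PseudocoalgTwo.toAlg (x : PseudocoalgTwo (mateComonad T P) A) :
    PseudoalgTwo T A where
  src := x.src.toAlg
  tgt := x.tgt.toAlg
  src_eq := by simp
  tgt_eq := by simp
  ξ := x.ξ
  src_ξ := by simp
  tgt_ξ := by simp
  comm := (PseudocoalgHom.two_comm_iff x.src_eq x.tgt_eq x.src_ξ x.tgt_ξ).2 x.comm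

@[simp] theorem PseudocoalgTwo.toAlg_src (x : PseudocoalgTwo (mateComonad T P) A) :
    x.toAlg.src = x.src.toAlg := rfl
@[simp] theorem PseudocoalgTwo.toAlg_tgt (x : PseudocoalgTwo (mateComonad T P) A) :
    x.toAlg.tgt = x.tgt.toAlg := rfl
@[simp] theorem PseudocoalgTwo.toAlg_ξ (x : PseudocoalgTwo (mateComonad T P) A) :
    x.toAlg.ξ = x.ξ := rfl

theorem PseudocoalgHom.toAlg_id (c : Pseudocoalgebra (mateComonad T P) A) :
    (PseudocoalgHom.id c).toAlg = PseudoalgHom.id c.toAlg := by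
  apply PseudoalgHom.ext <;> simp (maxDischargeDepth := 12)

theorem PseudocoalgHom.toAlg_comp (g f : PseudocoalgHom (mateComonad T P) A) (h : f.tgt = g.src) :
    (g.comp f).toAlg = g.toAlg.comp f.toAlg := by
  have e : f.toAlg.tgt = g.toAlg.src := by simp [h]
  apply PseudoalgHom.ext
  · simp [h, PseudoalgHom.src_comp e]
  · simp [h, PseudoalgHom.tgt_comp e]
  · simp [h, PseudoalgHom.comp_h e]
  · have I := (K.hom A B).interchange (TwoCat.inv (K.ix P.e g.h)) (T.T ⋆ₗₗ f.ϱ)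
      (by simp (maxDischargeDepth := 12) [h])
    rw [PseudoalgHom.comp_ϱ e]
    simp (maxDischargeDepth := 12) [h] at I ⊢
    have I' := TwoCat.reassoc I.symm (by simp (maxDischargeDepth := 12) [h])
      (by simp (maxDischargeDepth := 12) [h])
      ((P.e ⋆ᵣ g.tgt.s) ◁ ((T.T ⋆ₗₗ g.ϱ) ▷ (T.T ⋆ₗ f.h))) (by simp (maxDischargeDepth := 12) [h])
    rw [I']

/-- The 2-functor from pseudocoalgebras to pseudoalgebras. -/
noncomputable def toAlgFunctor (T : Pseudomonad K B) (P : Pseudoadjunction K T.T G) (A : K.Obj) :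
    TwoFunctor (coalgTwoCat (mateComonad T P) A) (algTwoCat T A) where
  ob c := c.toAlg
  one f := f.toAlg
  two x := x.toAlg
  src_one _ := rfl
  tgt_one _ := rfl
  src_two _ := rfl
  tgt_two _ := rfl
  map_id c := PseudocoalgHom.toAlg_id c
  map_comp g f h := PseudocoalgHom.toAlg_comp g f h
  map_id₂ f := rfl
  map_vcomp (y x : PseudocoalgTwo _ A) (h : x.tgt = y.src) := by
    change (y.vcomp x).toAlg = y.toAlg.vcomp x.toAlg
    have e : x.toAlg.tgt = y.toAlg.src := by simp [h]
    apply PseudoalgTwo.ext <;> simp (maxDischargeDepth := 9) [h, PseudocoalgHom.toAlg_comp,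
      PseudoalgTwo.src_vcomp e, PseudoalgTwo.tgt_vcomp e, PseudoalgTwo.vcomp_ξ e]
  map_wl (g : PseudocoalgHom _ A) (x : PseudocoalgTwo _ A) (h : x.tgt.tgt = g.src) := by
    change (PseudocoalgTwo.wl g x).toAlg = PseudoalgTwo.wl g.toAlg x.toAlg
    have e : x.toAlg.tgt.tgt = g.toAlg.src := by simp [h]
    apply PseudoalgTwo.ext <;> simp (maxDischargeDepth := 9) [h, PseudocoalgHom.toAlg_comp,
      PseudoalgTwo.src_wl e, PseudoalgTwo.tgt_wl e, PseudoalgTwo.wl_ξ e]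
  map_wr (x : PseudocoalgTwo _ A) (f : PseudocoalgHom _ A) (h : f.tgt = x.tgt.src) := by
    change (x.wr f).toAlg = x.toAlg.wr f.toAlg
    have e : f.toAlg.tgt = x.toAlg.tgt.src := by simp [h]
    apply PseudoalgTwo.ext <;> simp (maxDischargeDepth := 9) [h, PseudocoalgHom.toAlg_comp,
      PseudoalgTwo.src_wr e, PseudoalgTwo.tgt_wr e, PseudoalgTwo.wr_ξ e]

end

theorem Frame.AlgData.IsCmp.symm {X : TwoCat.{w}} {W : Frame X} {s : X.Ob} {a b : W.AlgData s}
    {θ : X.Cell (W.T.ob s) s} (h : a.IsCmp b θ) : b.IsCmp a θ.inv := by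
  obtain ⟨dθ, cθ, iθ, hu, hm⟩ := h
  refine ⟨by simp [iθ, cθ], by simp [iθ, dθ], by simp [iθ], ?_, ?_⟩
  · refine Cell.act_injective ?_
    have h1 := Cell.act_mul_inv (x := θ ▹ W.η s) (by simp [iθ])
    simp (maxDischargeDepth := 12) [dθ, cθ, iθ, hu, mul_assoc] at h1 ⊢
    rw [h1, Cell.act_mul_id _ _ (by simp)]
  · refine Cell.cancel_left (p := θ ▹ W.μ s) (by simp [iθ])
      (by simp (maxDischargeDepth := 12) [dθ, cθ, iθ])
      (by simp (maxDischargeDepth := 12) [dθ, cθ, iθ]) ?_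
    have hm' := congrArg Cell.act hm
    have h1 := Cell.act_mul_inv_assoc (p := θ ▹ W.μ s) (x := a.χ) (by simp [iθ]) (by simp [cθ]) 1
    have h3 := Cell.act_mul_inv (x := b.ν ◃ W.T.cell θ) (by simp [iθ])
    have h4 := Cell.act_mul_inv (x := θ ▹ W.T.hom a.ν) (by simp [iθ])
    have h5 := Cell.interchange θ.inv (W.T.cell θ.inv)
    simp (maxDischargeDepth := 12) [dθ, cθ, iθ, mul_assoc] at hm' h1 h3 h4 h5 ⊢
    rw [h1, mul_reassoc hm', mul_assoc, ← h5, mul_reassoc_left h3,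
      Cell.act_id_mul _ _ (by simp [iθ, dθ]), h4, Cell.act_mul_id _ _ (by simp)]

section

variable {K : GrayCat.{u, w}} {B : K.Obj} {T : Pseudomonad K B} {G : (K.hom B B).Ob}
  {P : Pseudoadjunction K T.T G} {A : K.Obj}

theorem Pseudocoalgebra.toAlg_injective {c e : Pseudocoalgebra (mateComonad T P) A}
    (hν : c.ν = e.ν) (h : c.toAlg = e.toAlg) : c = e := by
  have hs : c.s = e.s := congrArg Pseudoalgebra.s h
  have hψ := congrArg Pseudoalgebra.ψ h
  have hχ := congrArg Pseudoalgebra.χ h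
  obtain ⟨s, ν, ψ, χ, h1, h2, h3, h4, h5, h6, h7, h8, h9, h10⟩ := c
  obtain ⟨s', ν', ψ', χ', k1, k2, k3, k4, k5, k6, k7, k8, k9, k10⟩ := e
  obtain rfl : s = s' := hs
  obtain rfl : ν = ν' := hν
  have H : (⟨s, ν, ψ, χ, h1, h2, h3, h4, h5, h6, h7, h8, h9, h10⟩ :
      Pseudocoalgebra (mateComonad T P) A).toCoalgData =
      (⟨s, ν, ψ', χ', k1, k2, k3, k4, k5, k6, k7, k8, k9, k10⟩ :
      Pseudocoalgebra (mateComonad T P) A).toCoalgData := by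
    refine Frame.CoalgData.ext_of_alg_eq rfl ?_
    have hψ' := Cell.ext_iff.2 hψ
    have hχ' := Cell.ext_iff.2 hχ
    rw [Frame.AlgData.mk.injEq]
    exact ⟨rfl, hψ', hχ'⟩
  exact Pseudocoalgebra.ext rfl rfl (congrArg (fun d => d.ψ'.val) H)
    (congrArg (fun d => d.χ'.val) H)

theorem PseudocoalgHom.toAlg_injective {f g : PseudocoalgHom (mateComonad T P) A}
    (hs : f.src = g.src) (ht : f.tgt = g.tgt) (H : f.toAlg = g.toAlg) : f = g := by
  have hh := congrArg PseudoalgHom.h H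
  have hϱ := congrArg PseudoalgHom.ϱ H
  obtain ⟨c, e, h, ϱ, h1, h2, h3, h4, h5, h6, h7⟩ := f
  obtain ⟨c', e', h', ϱ', k1, k2, k3, k4, k5, k6, k7⟩ := g
  obtain rfl : c = c' := hs
  obtain rfl : e = e' := ht
  obtain rfl : h = h' := hh
  have H := Frame.CoalgHomData.ϱ'_eq_of_ϱ_eq
    (k := (⟨c, e, h, ϱ, h1, h2, h3, h4, h5, h6, h7⟩ :
      PseudocoalgHom (mateComonad T P) A).toCoalgHomData)
    (k' := (⟨c, e, h, ϱ', k1, k2, k3, k4, k5, k6, k7⟩ :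
      PseudocoalgHom (mateComonad T P) A).toCoalgHomData) (Cell.ext_iff.2 hϱ)
  exact PseudocoalgHom.ext rfl rfl rfl (congrArg Cell.val H)

theorem PseudocoalgTwo.toAlg_injective {x y : PseudocoalgTwo (mateComonad T P) A}
    (hs : x.src = y.src) (ht : x.tgt = y.tgt) (h : x.toAlg = y.toAlg) : x = y :=
  PseudocoalgTwo.ext hs ht (congrArg PseudoalgTwo.ξ h)

theorem PseudocoalgTwo.exists_toAlg_eq {f g : PseudocoalgHom (mateComonad T P) A}
    (e₁ : f.src = g.src) (e₂ : f.tgt = g.tgt) {x : PseudoalgTwo T A} (hs : x.src = f.toAlg)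
    (ht : x.tgt = g.toAlg) :
    ∃ y : PseudocoalgTwo (mateComonad T P) A, y.src = f ∧ y.tgt = g ∧ y.toAlg = x := by
  have h1 : (K.hom A B).src₂ x.ξ = f.h := by simp [hs]
  have h2 : (K.hom A B).tgt₂ x.ξ = g.h := by simp [ht]
  have h3 := x.comm
  rw [hs, ht] at h3
  exact ⟨⟨f, g, e₁, e₂, x.ξ, h1, h2, (PseudocoalgHom.two_comm_iff e₁ e₂ h1 h2).1 h3⟩, rfl, rfl,
    PseudoalgTwo.ext hs.symm ht.symm rfl⟩

theorem PseudocoalgHom.exists_toAlg_eq {c e : Pseudocoalgebra (mateComonad T P) A}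
    {f : PseudoalgHom T A} (hs : f.src = c.toAlg) (ht : f.tgt = e.toAlg) :
    ∃ g : PseudocoalgHom (mateComonad T P) A, g.src = c ∧ g.tgt = e ∧ g.toAlg = f := by
  obtain ⟨a, b, h, ϱ, h1, h2, h3, h4, h5, h6, h7⟩ := f
  obtain rfl : a = c.toAlg := hs
  obtain rfl : b = e.toAlg := ht
  have hs : (K.hom A B).src h = c.s := h1
  have ht : (K.hom A B).tgt h = e.s := h2
  let x : (K.hom A B).Cell ((mateFrame T P A).T.ob c.s) e.s := ⟨ϱ, by simp [h4, hs], by simp [h4, hs, ht]⟩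
  have hd : x.dom = e.toCoalgData.alg.ν ⊚ (mateFrame T P A).T.hom ⟨h, hs, ht⟩ := Hom.ext h3
  have hc : x.cod = ⟨h, hs, ht⟩ ⊚ c.toCoalgData.alg.ν := Hom.ext h4
  obtain ⟨k, hk⟩ := Frame.CoalgHomData.exists_ϱ_eq (ϱ := x) hd hc h5
  have hu : c.toCoalgData.alg.HomUnit _ e.toCoalgData.alg ⟨h, hs, ht⟩ k.ϱ := by
    rw [hk]
    exact (Frame.AlgData.homUnit_iff_val _ _ hc).2 h6
  have hm : c.toCoalgData.alg.HomMult _ e.toCoalgData.alg ⟨h, hs, ht⟩ k.ϱ := by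
    rw [hk]
    exact (Frame.AlgData.homMult_iff_val _ _ hd hc).2 h7
  have hu := (Frame.CoalgHomData.counit_iff_val _).1 (k.homUnit_iff.1 hu)
  have hm := (Frame.CoalgHomData.comult_iff_val _).1 (k.homMult_iff.1 hm)
  rw [mateFrame_εn_val] at hu
  refine ⟨⟨c, e, h, k.ϱ'.val, h1, h2, congrArg Hom.val k.dom_ϱ', congrArg Hom.val k.cod_ϱ',
    k.iso_ϱ', ?_, ?_⟩, rfl, rfl, ?_⟩
  · simpa [mateCounit_eq] using hu
  · simpa using hm
  · exact PseudoalgHom.ext rfl rfl rfl (congrArg Cell.val hk)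

end

section

variable {K : GrayCat.{u, w}} {B : K.Obj} {T : Pseudomonad K B} {G : (K.hom B B).Ob}
  {P : Pseudoadjunction K T.T G} {A A' : K.Obj}

theorem Pseudocoalgebra.toAlg_base (c : Pseudocoalgebra (mateComonad T P) A)
    (k : (K.hom A' A).Ob) : (c.base k).toAlg = c.toAlg.base k := by
  apply Pseudoalgebra.ext <;> simp (maxDischargeDepth := 12) [mateCounit_eq]

theorem PseudocoalgHom.toAlg_base (f : PseudocoalgHom (mateComonad T P) A)
    (k : (K.hom A' A).Ob) : (f.base k).toAlg = f.toAlg.base k := by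
  apply PseudoalgHom.ext <;> simp (maxDischargeDepth := 12) [Pseudocoalgebra.toAlg_base]

theorem PseudocoalgTwo.toAlg_base (x : PseudocoalgTwo (mateComonad T P) A)
    (k : (K.hom A' A).Ob) : (x.base k).toAlg = x.toAlg.base k := by
  apply PseudoalgTwo.ext <;> simp (maxDischargeDepth := 12) [PseudocoalgHom.toAlg_base]

theorem Pseudocoalgebra.toAlg_whisk (c : Pseudocoalgebra (mateComonad T P) A)
    (k : (K.hom A' A).One) : (c.whisk k).toAlg = c.toAlg.whisk k := by
  apply PseudoalgHom.ext <;> simp (maxDischargeDepth := 12) [Pseudocoalgebra.toAlg_base]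

theorem PseudocoalgHom.toAlg_whisk (f : PseudocoalgHom (mateComonad T P) A)
    (k : (K.hom A' A).One) : (f.whisk k).toAlg = f.toAlg.whisk k := by
  have e := fun (k : (K.hom A' A).Ob) =>
    show (f.base k).toAlg = f.toAlg.base k from PseudocoalgHom.toAlg_base f k
  apply PseudoalgTwo.ext <;> simp (maxDischargeDepth := 12) [Pseudocoalgebra.toAlg_whisk,
    PseudocoalgHom.toAlg_base, PseudocoalgHom.toAlg_comp]

theorem Pseudocoalgebra.toAlg_whisk₂ (c : Pseudocoalgebra (mateComonad T P) A)
    (x : (K.hom A' A).Two) : (c.whisk₂ x).toAlg = c.toAlg.whisk₂ x := by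
  apply PseudoalgTwo.ext <;> simp (maxDischargeDepth := 12) [Pseudocoalgebra.toAlg_whisk]

/-- The Gray-natural transformation from pseudocoalgebras to pseudoalgebras. -/
noncomputable def toAlgNat (T : Pseudomonad K B) (P : Pseudoadjunction K T.T G) :
    GrayNat (coalgGray (mateComonad T P)) (algGray T) where
  app A := toAlgFunctor T P A
  naturality A A' := by
    have h : ∀ k : (K.hom A' A).Ob, (toAlgFunctor T P A').comp (coalgBase _ k) =
        (algBase T k).comp (toAlgFunctor T P A) := fun k =>
      TwoFunctor.ext (funext fun c => Pseudocoalgebra.toAlg_base c k)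
        (funext fun f => PseudocoalgHom.toAlg_base f k)
        (funext fun x => PseudocoalgTwo.toAlg_base x k)
    have h' : ∀ k : (K.hom A' A).One, PsNat.post (toAlgFunctor T P A') (coalgPs _ k) =
        PsNat.pre (toAlgFunctor T P A) (algPs T k) := fun k =>
      PsNat.ext (h _) (h _) (funext fun c => Pseudocoalgebra.toAlg_whisk c k)
        (funext fun f => PseudocoalgHom.toAlg_whisk f k)
    exact TwoFunctor.ext (funext h) (funext h') (funext fun x =>
      Modif.ext (h' _) (h' _) (funext fun c => Pseudocoalgebra.toAlg_whisk₂ c x))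

theorem Pseudoalgebra.exists_isCmp (P : Pseudoadjunction K T.T G) (a : Pseudoalgebra T A) :
    ∃ c : (mateFrame T P A).CoalgData a.s,
      c.n = (K.post G).hom (a.toAlgData P).ν ⊚ P.ι a.s ∧
      (a.toAlgData P).IsCmp c.alg (P.cmp (s := a.s) (a.toAlgData P).ν) := by
  obtain ⟨b, hb⟩ := Frame.AlgData.IsCmp.exists_isCmp (a.toAlgData P)
    (θ := P.cmp (s := a.s) (a.toAlgData P).ν) (P.iso_cmp _) (P.cod_cmp _)
  obtain ⟨c, hn, rfl⟩ := Frame.CoalgData.exists_alg_eq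
    ((K.post G).hom (a.toAlgData P).ν ⊚ P.ι a.s) b (hb.dom_θ.symm.trans
      ((P.dom_cmp _).trans (congrArg _ ((K.post T.T).hom_comp _ _).symm)))
  exact ⟨c, hn, hb⟩

end

section

variable {K : GrayCat.{u, w}} {B : K.Obj} {T : Pseudomonad K B} {G : (K.hom B B).Ob}
  {P : Pseudoadjunction K T.T G} {A A' : K.Obj}

/-- The morphism of pseudoalgebras over an identity given by an invertible cell. -/
@[simps] def Frame.AlgData.IsCmp.toHom {s : (K.hom A B).Ob} {a b : (mateFrame T P A).AlgData s}
    {θ : (K.hom A B).Cell ((mateFrame T P A).T.ob s) s} (h : a.IsCmp b θ) (ha : a.Assoc ∧ a.Unit)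
    (hb : b.Assoc ∧ b.Unit) : PseudoalgHom T A where
  src := a.toPseudoalgebra ha
  tgt := b.toPseudoalgebra hb
  h := (K.hom A B).id s
  ϱ := θ.val
  src_h := by simp
  tgt_h := by simp
  src_ϱ := (congrArg Hom.val h.dom_θ).trans (by simp)
  tgt_ϱ := (congrArg Hom.val h.cod_θ).trans (by simp)
  ϱ_iso := h.iso_θ
  unit := by
    have h' := congrArg Cell.val h.unit
    have hψ : (K.hom A B).src₂ b.ψ.val = b.ν.val ∘₁ T.η ⋆ᵣ s := (b.toPseudoalgebra hb).src_ψ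
    rw [Cell.vcomp_val (by simp [h.cod_θ])] at h'
    simp (maxDischargeDepth := 12) at h' ⊢
    rw [TwoCat.vcomp_id' _ _ hψ, h']
  mult := by
    have h' := congrArg Cell.val h.mult
    rw [Cell.vcomp_val (by simp [h.dom_θ]), Cell.vcomp_val (by simp [h.dom_θ, h.cod_θ]),
      Cell.vcomp_val (by simp [h.dom_θ, h.cod_θ])] at h'
    have hχ : (K.hom A B).tgt₂ b.χ.val = b.ν.val ∘₁ T.μ ⋆ᵣ s := (b.toPseudoalgebra hb).tgt_χ
    simp (maxDischargeDepth := 12) at h' ⊢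
    rw [TwoCat.id_vcomp' _ _ hχ, h']

theorem PseudoalgHom.tgt_eq {f g : PseudoalgHom T A} (hs : f.src = g.src)
    (hf : f.h = (K.hom A B).id f.src.s) (hg : g.h = (K.hom A B).id g.src.s) (hϱ : f.ϱ = g.ϱ) :
    f.tgt = g.tgt := by
  have ef : f.tgt.s = f.src.s := by rw [← f.tgt_h, hf]; simp
  have eg : g.tgt.s = f.src.s := by rw [← g.tgt_h, hg, hs]; simp
  obtain ⟨a, b, _, ϱ, h1, h2, h3, h4, h5, h6, h7⟩ := f
  obtain ⟨_, b', _, _, k1, k2, k3, k4, k5, k6, k7⟩ := g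
  simp only at hs hϱ hf hg ef eg
  subst hs hϱ hf hg
  have tν := b.tgt_ν
  have tν' := b'.tgt_ν
  have sν := b.src_ν
  have sν' := b'.src_ν
  have sψ := b.src_ψ
  have sψ' := b'.src_ψ
  have sχ := b.src_χ
  have sχ' := b'.src_χ
  have tχ := b.tgt_χ
  have tχ' := b'.tgt_χ
  rw [ef] at tν sν sψ tχ
  rw [eg] at tν' sν' sψ' tχ'
  simp (maxDischargeDepth := 12) [sν, sν', ef, eg] at h3 k3
  have hν : b.ν = b'.ν := h3.symm.trans k3
  simp (maxDischargeDepth := 12) [sψ, sψ', sχ, sχ', sν, sν', tν, tν', ef, eg] at h6 h7 k6 k7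
  refine Pseudoalgebra.ext (ef.trans eg.symm) hν ?_ ?_
  · exact h6.symm.trans k6
  · rw [hν, k7] at h7
    have e : (K.hom A B).tgt (T.μ ⋆ᵣ a.s) = (K.hom A B).src ((K.hom A B).tgt₂ ϱ) := by
      simp (maxDischargeDepth := 12) [h4]
    have e1 : (K.hom A B).tgt₂ b.χ = (K.hom A B).src₂ (ϱ ▷ (T.μ ⋆ᵣ a.s)) := by
      rw [tχ, TwoCat.src_wr _ _ _ e, h3]
    have e2 : (K.hom A B).tgt₂ b'.χ = (K.hom A B).src₂ (ϱ ▷ (T.μ ⋆ᵣ a.s)) := by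
      rw [tχ', TwoCat.src_wr _ _ _ e, k3]
    refine TwoCat.act_cancel_left (TwoCat.isIso_wr h5 _ e) e1 e2 ?_
    rw [← TwoCat.act_vcomp _ _ e1, ← TwoCat.act_vcomp _ _ e2]
    exact congrArg _ h7.symm

/-- The typed form of the pseudocoalgebra given by a pseudoalgebra. -/
noncomputable def Pseudoalgebra.cofreeData (P : Pseudoadjunction K T.T G) (a : Pseudoalgebra T A) :
    (mateFrame T P A).CoalgData a.s :=
  (a.exists_isCmp P).choose

theorem Pseudoalgebra.cofreeData_isCmp (P : Pseudoadjunction K T.T G) (a : Pseudoalgebra T A) :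
    (a.toAlgData P).IsCmp (a.cofreeData P).alg (P.cmp (s := a.s) (a.toAlgData P).ν) :=
  (a.exists_isCmp P).choose_spec.2

theorem Pseudoalgebra.cofreeData_axioms (P : Pseudoadjunction K T.T G) (a : Pseudoalgebra T A) :
    (a.cofreeData P).alg.Assoc ∧ (a.cofreeData P).alg.Unit :=
  ⟨(a.cofreeData_isCmp P).assoc a.toAlgData_assoc, (a.cofreeData_isCmp P).unitLaw a.toAlgData_unit⟩

/-- The pseudocoalgebra given by a pseudoalgebra. -/
noncomputable def Pseudoalgebra.toCoalg (P : Pseudoadjunction K T.T G) (a : Pseudoalgebra T A) :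
    Pseudocoalgebra (mateComonad T P) A :=
  (a.cofreeData P).toPseudocoalgebra ((a.cofreeData P).axioms_iff.1 (a.cofreeData_axioms P))

@[simp] theorem Pseudoalgebra.toCoalg_s (a : Pseudoalgebra T A) : (a.toCoalg P).s = a.s := rfl
@[simp] theorem Pseudoalgebra.toCoalg_ν (a : Pseudoalgebra T A) :
    (a.toCoalg P).ν = G ⋆ₗ a.ν ∘₁ P.i ⋆ᵣ a.s :=
  congrArg Hom.val (a.exists_isCmp P).choose_spec.1

/-- The comparison of a pseudoalgebra with its double transpose. -/
noncomputable def Pseudoalgebra.cmpHom (P : Pseudoadjunction K T.T G) (a : Pseudoalgebra T A) :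
    PseudoalgHom T A :=
  (a.cofreeData_isCmp P).toHom ⟨a.toAlgData_assoc, a.toAlgData_unit⟩ (a.cofreeData_axioms P)

/-- The inverse of the comparison of a pseudoalgebra with its double transpose. -/
noncomputable def Pseudoalgebra.cmpInv (P : Pseudoadjunction K T.T G) (a : Pseudoalgebra T A) :
    PseudoalgHom T A :=
  (a.cofreeData_isCmp P).symm.toHom (a.cofreeData_axioms P) ⟨a.toAlgData_assoc, a.toAlgData_unit⟩

section

variable (a : Pseudoalgebra T A)

@[simp] theorem Pseudoalgebra.cmpHom_src : (a.cmpHom P).src = a := rfl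
@[simp] theorem Pseudoalgebra.cmpHom_tgt : (a.cmpHom P).tgt = (a.toCoalg P).toAlg := rfl
@[simp] theorem Pseudoalgebra.cmpHom_h : (a.cmpHom P).h = (K.hom A B).id a.s := rfl
theorem Pseudoalgebra.cmpHom_ϱ : (a.cmpHom P).ϱ =
    (a.ν ◁ (P.E ⋆ᵣᵣ a.s)) ∘₂ (TwoCat.inv (K.ix P.e a.ν) ▷ (T.T ⋆ₗ P.i ⋆ᵣ a.s)) :=
  (P.cmp_val (s := a.s) (a.toAlgData P).ν).trans (by simp [AdjData.cmp, Pseudoadjunction.data])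
@[simp] theorem Pseudoalgebra.cmpInv_src : (a.cmpInv P).src = (a.toCoalg P).toAlg := rfl
@[simp] theorem Pseudoalgebra.cmpInv_tgt : (a.cmpInv P).tgt = a := rfl
@[simp] theorem Pseudoalgebra.cmpInv_h : (a.cmpInv P).h = (K.hom A B).id a.s := rfl
@[simp] theorem Pseudoalgebra.cmpInv_ϱ : (a.cmpInv P).ϱ = TwoCat.inv (a.cmpHom P).ϱ := rfl

theorem Pseudoalgebra.cmpInv_cmpHom : (a.cmpInv P).comp (a.cmpHom P) = PseudoalgHom.id a := by
  have e : (a.cmpHom P).tgt = (a.cmpInv P).src := rfl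
  apply PseudoalgHom.ext
  · simp [PseudoalgHom.src_comp e]
  · simp [PseudoalgHom.tgt_comp e]
  · simp [PseudoalgHom.comp_h e]
  · rw [PseudoalgHom.comp_ϱ e]
    have h1 := (a.cmpHom P).src_ϱ
    have h2 := (a.cmpHom P).tgt_ϱ
    simp at h1 h2 ⊢
    simp (maxDischargeDepth := 12) [h1, h2]

theorem Pseudoalgebra.cmpHom_cmpInv : (a.cmpHom P).comp (a.cmpInv P) =
    PseudoalgHom.id (a.toCoalg P).toAlg := by
  have e : (a.cmpInv P).tgt = (a.cmpHom P).src := rfl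
  apply PseudoalgHom.ext
  · simp [PseudoalgHom.src_comp e]
  · simp [PseudoalgHom.tgt_comp e]
  · simp [PseudoalgHom.comp_h e]
  · rw [PseudoalgHom.comp_ϱ e]
    have h1 := (a.cmpHom P).src_ϱ
    have h2 := (a.cmpHom P).tgt_ϱ
    simp at h1 h2 ⊢
    simp (maxDischargeDepth := 12) [h1, h2]

end

theorem Pseudoalgebra.toCoalg_base (a : Pseudoalgebra T A) (k : (K.hom A' A).Ob) :
    (a.base k).toCoalg P = (a.toCoalg P).base k := by
  have h : ((a.base k).cmpHom P).tgt = ((a.cmpHom P).base k).tgt :=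
    PseudoalgHom.tgt_eq (by simp) (by simp) (by simp) (by
      have h1 := (a.cmpHom P).src_ϱ
      simp (maxDischargeDepth := 12) [Pseudoalgebra.cmpHom_ϱ])
  refine Pseudocoalgebra.toAlg_injective (by simp) (h.trans ?_)
  simp [Pseudocoalgebra.toAlg_base]

theorem Pseudoalgebra.cmpHom_base (a : Pseudoalgebra T A) (k : (K.hom A' A).Ob) :
    (a.base k).cmpHom P = (a.cmpHom P).base k := by
  have h1 := (a.cmpHom P).src_ϱ
  refine PseudoalgHom.ext (by simp) ?_ (by simp) ?_
  · simp [Pseudoalgebra.toCoalg_base, Pseudocoalgebra.toAlg_base]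
  · simp (maxDischargeDepth := 12) [Pseudoalgebra.cmpHom_ϱ]

theorem Pseudoalgebra.cmpInv_base (a : Pseudoalgebra T A) (k : (K.hom A' A).Ob) :
    (a.base k).cmpInv P = (a.cmpInv P).base k := by
  refine PseudoalgHom.ext ?_ (by simp) (by simp) ?_
  · simp [Pseudoalgebra.toCoalg_base, Pseudocoalgebra.toAlg_base]
  · have h : IsIso (a.cmpHom P).ϱ := (a.cmpHom P).ϱ_iso
    simp [Pseudoalgebra.cmpHom_base, h]

end

/-- A strict 2-natural transformation, as a pseudonatural transformation. -/
@[simps] def PsNat.ofStrict {X Y : TwoCat.{w}} (F G : TwoFunctor X Y) (app : X.Ob → Y.One)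
    (src_app : ∀ a, Y.src (app a) = F.ob a) (tgt_app : ∀ a, Y.tgt (app a) = G.ob a)
    (hone : ∀ f, app (X.tgt f) ∘₁ F.one f = G.one f ∘₁ app (X.src f))
    (htwo : ∀ x, app (X.tgt (X.tgt₂ x)) ◁ F.two x = G.two x ▷ app (X.src (X.tgt₂ x))) :
    PsNat X Y where
  src := F
  tgt := G
  app := app
  nat f := Y.id₂ (G.one f ∘₁ app (X.src f))
  src_app := src_app
  tgt_app := tgt_app
  src_nat := by simp
  tgt_nat f := by simp [hone]
  nat_iso := by simp
  nat_id := by simp [tgt_app]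
  nat_comp g f h := by
    have h1 := hone f
    have h2 := hone g
    rw [h] at h1
    have e1 : Y.tgt (F.one f) = Y.src (app (X.src g)) := by simp [h, src_app]
    have e2 : Y.tgt (app (X.src f)) = Y.src (G.one f) := by simp [tgt_app]
    have e3 : Y.tgt (app (X.src g)) = Y.src (G.one g) := by simp [tgt_app]
    have e4 : Y.tgt (G.one f) = Y.src (G.one g) := by simp [h]
    rw [Y.id₂_wr _ _ (by simpa [e3] using e1), Y.wl_id₂ _ _ (by simpa [e2] using e4),
      Y.comp_assoc _ _ _ e1 e3, h1, X.src_comp _ _ h, G.map_comp _ _ h, Y.comp_assoc _ _ _ e2 e4]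
    simp
  nat_two x := by simp (maxDischargeDepth := 9) [src_app, tgt_app, htwo]

theorem PsNat.comp_eq_id {X Y : TwoCat.{w}} {α β : PsNat X Y} {F : TwoFunctor X Y}
    (e : α.tgt = β.src) (hs : α.src = F) (ht : β.tgt = F)
    (hα : ∀ f, α.nat f = Y.id₂ (α.tgt.one f ∘₁ α.app (X.src f)))
    (hβ : ∀ f, β.nat f = Y.id₂ (β.tgt.one f ∘₁ β.app (X.src f)))
    (h : ∀ a, β.app a ∘₁ α.app a = Y.id (F.ob a)) : β.comp α = PsNat.id F := by
  subst ht
  refine PsNat.ext (by simp [e, hs]) (by simp [e]) (funext fun a => by simp [e, h])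
    (funext fun f => ?_)
  have h1 := β.tgt_nat f
  rw [hβ, Y.tgt_id₂, ← e] at h1
  rw [PsNat.comp_nat e, hα, hβ, Y.wl_id₂ _ _ (by simp [e]), Y.id₂_wr _ _ (by simp [e]),
    ← Y.comp_assoc _ _ _ (by simp) (by simp [e]), ← h1, Y.comp_assoc _ _ _ (by simp [e]) (by simp),
    h]
  simp

/-- Data exhibiting a 2-functor as a strict equivalence: it is bijective on 1-cells and 2-cells
between given ends, and every object is strictly isomorphic to one in its image. -/
structure TwoFunctor.StrictEquiv {X Y : TwoCat.{w}} (F : TwoFunctor Y X) where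
  ob : X.Ob → Y.Ob
  hom : X.Ob → X.One
  inv : X.Ob → X.One
  src_hom : ∀ a, X.src (hom a) = a
  tgt_hom : ∀ a, X.tgt (hom a) = F.ob (ob a)
  src_inv : ∀ a, X.src (inv a) = F.ob (ob a)
  tgt_inv : ∀ a, X.tgt (inv a) = a
  inv_hom : ∀ a, inv a ∘₁ hom a = X.id a
  hom_inv : ∀ a, hom a ∘₁ inv a = X.id (F.ob (ob a))
  one_ext : ∀ {f g}, Y.src f = Y.src g → Y.tgt f = Y.tgt g → F.one f = F.one g → f = g
  two_ext : ∀ {x y}, Y.src₂ x = Y.src₂ y → Y.tgt₂ x = Y.tgt₂ y → F.two x = F.two y → x = y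
  one_lift : ∀ {c e f}, X.src f = F.ob c → X.tgt f = F.ob e →
    ∃ g, Y.src g = c ∧ Y.tgt g = e ∧ F.one g = f
  two_lift : ∀ {f g x}, Y.src f = Y.src g → Y.tgt f = Y.tgt g → X.src₂ x = F.one f →
    X.tgt₂ x = F.one g → ∃ y, Y.src₂ y = f ∧ Y.tgt₂ y = g ∧ F.two y = x

namespace TwoFunctor.StrictEquiv

variable {X Y : TwoCat.{w}} {F : TwoFunctor Y X} (S : F.StrictEquiv)

attribute [simp] src_hom tgt_hom src_inv tgt_inv inv_hom hom_inv

@[simp] theorem inv_hom_comp (a : X.Ob) (f : X.One) (h : X.tgt f = a) :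
    S.inv a ∘₁ S.hom a ∘₁ f = f := by
  rw [← X.comp_assoc _ _ _ (by simp [h]) (by simp), S.inv_hom, id_comp' _ _ h]

@[simp] theorem inv_hom_wl (a : X.Ob) (x : X.Two) (h : X.tgt (X.tgt₂ x) = a) :
    S.inv a ◁ S.hom a ◁ x = x := by
  rw [← X.comp_wl _ _ _ (by simp [h]) (by simp), S.inv_hom, id_wl' _ _ h]

@[simp] theorem wr_inv_hom (a : X.Ob) (x : X.Two) (h : X.src (X.tgt₂ x) = a) :
    (x ▷ S.inv a) ▷ S.hom a = x := by
  rw [← X.wr_comp _ _ _ (by simp) (by simp [h]), S.inv_hom, wr_id' _ _ h]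

theorem exists_one (f : X.One) : ∃ g, Y.src g = S.ob (X.src f) ∧ Y.tgt g = S.ob (X.tgt f) ∧
    F.one g = S.hom (X.tgt f) ∘₁ f ∘₁ S.inv (X.src f) :=
  S.one_lift (by simp) (by simp)

/-- The action on 1-cells of the strict inverse. -/
noncomputable def one (f : X.One) : Y.One := (S.exists_one f).choose

@[simp] theorem src_one (f : X.One) : Y.src (S.one f) = S.ob (X.src f) :=
  (S.exists_one f).choose_spec.1
@[simp] theorem tgt_one (f : X.One) : Y.tgt (S.one f) = S.ob (X.tgt f) :=
  (S.exists_one f).choose_spec.2.1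
@[simp] theorem map_one (f : X.One) :
    F.one (S.one f) = S.hom (X.tgt f) ∘₁ f ∘₁ S.inv (X.src f) :=
  (S.exists_one f).choose_spec.2.2

theorem exists_two (x : X.Two) :
    ∃ y, Y.src₂ y = S.one (X.src₂ x) ∧ Y.tgt₂ y = S.one (X.tgt₂ x) ∧
      F.two y = S.hom (X.tgt (X.tgt₂ x)) ◁ x ▷ S.inv (X.src (X.tgt₂ x)) :=
  S.two_lift (by simp) (by simp) (by simp) (by simp)

/-- The action on 2-cells of the strict inverse. -/
noncomputable def two (x : X.Two) : Y.Two := (S.exists_two x).choose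

@[simp] theorem src_two (x : X.Two) : Y.src₂ (S.two x) = S.one (X.src₂ x) :=
  (S.exists_two x).choose_spec.1
@[simp] theorem tgt_two (x : X.Two) : Y.tgt₂ (S.two x) = S.one (X.tgt₂ x) :=
  (S.exists_two x).choose_spec.2.1
@[simp] theorem map_two (x : X.Two) :
    F.two (S.two x) = S.hom (X.tgt (X.tgt₂ x)) ◁ x ▷ S.inv (X.src (X.tgt₂ x)) :=
  (S.exists_two x).choose_spec.2.2

theorem one_id (a : X.Ob) : S.one (X.id a) = Y.id (S.ob a) :=
  S.one_ext (by simp) (by simp) (by simp)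

theorem one_comp (g f : X.One) (h : X.tgt f = X.src g) :
    S.one (g ∘₁ f) = S.one g ∘₁ S.one f :=
  S.one_ext (by simp [h]) (by simp [h]) (by simp (maxDischargeDepth := 9) [h])

/-- The strict inverse of a strict equivalence. -/
@[simps] noncomputable def functor : TwoFunctor X Y where
  ob := S.ob
  one := S.one
  two := S.two
  src_one := S.src_one
  tgt_one := S.tgt_one
  src_two := S.src_two
  tgt_two := S.tgt_two
  map_id := S.one_id
  map_comp := S.one_comp
  map_id₂ f := S.two_ext (by simp) (by simp) (by simp)
  map_vcomp y x h := S.two_ext (by simp [h]) (by simp [h]) (by simp (maxDischargeDepth := 9) [h])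
  map_wl g x h := S.two_ext (by simp [h, S.one_comp]) (by simp [h, S.one_comp])
    (by simp (maxDischargeDepth := 9) [h])
  map_wr x f h := S.two_ext (by simp [h, S.one_comp]) (by simp [h, S.one_comp])
    (by simp (maxDischargeDepth := 9) [h])

/-- The strict isomorphism from the identity to the composite of a strict inverse and a strict
equivalence. -/
@[simps!] noncomputable def unit : PsNat X X :=
  PsNat.ofStrict (TwoFunctor.id X) (F.comp S.functor) S.hom (by simp) (by simp) (by simp) (by simp)

/-- The inverse of the strict isomorphism `unit`. -/
@[simps!] noncomputable def unitInv : PsNat X X :=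
  PsNat.ofStrict (F.comp S.functor) (TwoFunctor.id X) S.inv (by simp) (by simp) (by simp) (by simp)

theorem exists_counitApp (c : Y.Ob) :
    ∃ g, Y.src g = S.ob (F.ob c) ∧ Y.tgt g = c ∧ F.one g = S.inv (F.ob c) :=
  S.one_lift (by simp) (by simp)

theorem exists_counitInvApp (c : Y.Ob) :
    ∃ g, Y.src g = c ∧ Y.tgt g = S.ob (F.ob c) ∧ F.one g = S.hom (F.ob c) :=
  S.one_lift (by simp) (by simp)

/-- The component of the counit of a strict equivalence. -/
noncomputable def counitApp (c : Y.Ob) : Y.One := (S.exists_counitApp c).choose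

/-- The component of the inverse of the counit of a strict equivalence. -/
noncomputable def counitInvApp (c : Y.Ob) : Y.One := (S.exists_counitInvApp c).choose

section

variable (c : Y.Ob)

@[simp] theorem src_counitApp : Y.src (S.counitApp c) = S.ob (F.ob c) :=
  (S.exists_counitApp c).choose_spec.1
@[simp] theorem tgt_counitApp : Y.tgt (S.counitApp c) = c :=
  (S.exists_counitApp c).choose_spec.2.1
@[simp] theorem map_counitApp : F.one (S.counitApp c) = S.inv (F.ob c) :=
  (S.exists_counitApp c).choose_spec.2.2
@[simp] theorem src_counitInvApp : Y.src (S.counitInvApp c) = c :=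
  (S.exists_counitInvApp c).choose_spec.1
@[simp] theorem tgt_counitInvApp : Y.tgt (S.counitInvApp c) = S.ob (F.ob c) :=
  (S.exists_counitInvApp c).choose_spec.2.1
@[simp] theorem map_counitInvApp : F.one (S.counitInvApp c) = S.hom (F.ob c) :=
  (S.exists_counitInvApp c).choose_spec.2.2

theorem counitApp_counitInvApp : S.counitApp c ∘₁ S.counitInvApp c = Y.id c :=
  S.one_ext (by simp) (by simp) (by simp)

theorem counitInvApp_counitApp :
    S.counitInvApp c ∘₁ S.counitApp c = Y.id (S.ob (F.ob c)) :=
  S.one_ext (by simp) (by simp) (by simp)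

end

theorem counitApp_one (f : Y.One) : S.counitApp (Y.tgt f) ∘₁ S.one (F.one f) =
    f ∘₁ S.counitApp (Y.src f) :=
  S.one_ext (by simp) (by simp) (by simp (maxDischargeDepth := 9))

theorem counitInvApp_one (f : Y.One) : S.one (F.one f) ∘₁ S.counitInvApp (Y.src f) =
    S.counitInvApp (Y.tgt f) ∘₁ f :=
  S.one_ext (by simp) (by simp) (by simp (maxDischargeDepth := 9))

/-- The strict isomorphism from the composite of a strict equivalence and a strict inverse to the
identity. -/
@[simps!] noncomputable def counit : PsNat Y Y :=
  PsNat.ofStrict (S.functor.comp F) (TwoFunctor.id Y) S.counitApp (by simp) (by simp)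
    (fun f => S.counitApp_one f) (fun x => S.two_ext (by simpa using S.counitApp_one (Y.src₂ x))
      (by simpa using S.counitApp_one (Y.tgt₂ x)) (by simp (maxDischargeDepth := 9)))

/-- The inverse of the strict isomorphism `counit`. -/
@[simps!] noncomputable def counitInv : PsNat Y Y :=
  PsNat.ofStrict (TwoFunctor.id Y) (S.functor.comp F) S.counitInvApp (by simp) (by simp)
    (fun f => (S.counitInvApp_one f).symm) (fun x => S.two_ext
      (by simpa using (S.counitInvApp_one (Y.src₂ x)).symm)
      (by simpa using (S.counitInvApp_one (Y.tgt₂ x)).symm) (by simp (maxDischargeDepth := 9)))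

theorem unitInv_unit : S.unitInv.comp S.unit = PsNat.id (TwoFunctor.id X) :=
  PsNat.comp_eq_id rfl rfl rfl (fun _ => rfl) (fun _ => rfl) S.inv_hom

theorem unit_unitInv : S.unit.comp S.unitInv = PsNat.id (F.comp S.functor) :=
  PsNat.comp_eq_id rfl rfl rfl (fun _ => rfl) (fun _ => rfl) S.hom_inv

theorem counitInv_counit : S.counitInv.comp S.counit = PsNat.id (S.functor.comp F) :=
  PsNat.comp_eq_id rfl rfl rfl (fun _ => rfl) (fun _ => rfl) S.counitInvApp_counitApp

theorem counit_counitInv : S.counit.comp S.counitInv = PsNat.id (TwoFunctor.id Y) :=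
  PsNat.comp_eq_id rfl rfl rfl (fun _ => rfl) (fun _ => rfl) S.counitApp_counitInvApp

end TwoFunctor.StrictEquiv

namespace TwoFunctor.StrictEquiv

variable {X Y X' Y' : TwoCat.{w}} {F : TwoFunctor Y X} {F' : TwoFunctor Y' X'}

/-- A commutative square of 2-functors whose sides are strict equivalences with compatible strict
inverses. -/
structure Square (S : F.StrictEquiv) (S' : F'.StrictEquiv) (H : TwoFunctor X X')
    (H' : TwoFunctor Y Y') : Prop where
  comm : F'.comp H' = H.comp F
  ob : ∀ a, S'.ob (H.ob a) = H'.ob (S.ob a)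
  hom : ∀ a, S'.hom (H.ob a) = H.one (S.hom a)
  inv : ∀ a, S'.inv (H.ob a) = H.one (S.inv a)

namespace Square

variable {S : F.StrictEquiv} {S' : F'.StrictEquiv} {H : TwoFunctor X X'} {H' : TwoFunctor Y Y'}

theorem comm_ob (Q : Square S S' H H') (c : Y.Ob) : F'.ob (H'.ob c) = H.ob (F.ob c) :=
  congrArg (fun D => TwoFunctor.ob D c) Q.comm

theorem comm_one (Q : Square S S' H H') (f : Y.One) : F'.one (H'.one f) = H.one (F.one f) :=
  congrArg (fun D => TwoFunctor.one D f) Q.comm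

theorem comm_two (Q : Square S S' H H') (x : Y.Two) : F'.two (H'.two x) = H.two (F.two x) :=
  congrArg (fun D => TwoFunctor.two D x) Q.comm

theorem one (Q : Square S S' H H') (f : X.One) : S'.one (H.one f) = H'.one (S.one f) :=
  S'.one_ext (by simp [Q.ob]) (by simp [Q.ob])
    (by simp (maxDischargeDepth := 9) [Q.comm_one, Q.hom, Q.inv])

theorem two (Q : Square S S' H H') (x : X.Two) : S'.two (H.two x) = H'.two (S.two x) :=
  S'.two_ext (by simp [Q.one]) (by simp [Q.one])
    (by simp (maxDischargeDepth := 9) [Q.comm_two, Q.hom, Q.inv])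

theorem functor (Q : Square S S' H H') : S'.functor.comp H = H'.comp S.functor :=
  TwoFunctor.ext (funext Q.ob) (funext Q.one) (funext Q.two)

end Square

variable {S : F.StrictEquiv} {S' : F'.StrictEquiv} {α : PsNat X X'} {α' : PsNat Y Y'}

theorem nat_inv (hα : ∀ a, α.nat (S.hom a) = X'.id₂ (α.tgt.one (S.hom a) ∘₁ α.app a)) (a : X.Ob) :
    α.nat (S.inv a) = X'.id₂ (α.tgt.one (S.inv a) ∘₁ α.app (F.ob (S.ob a))) := by
  have h := α.nat_comp (S.inv a) (S.hom a) (by simp)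
  rw [hα, S.inv_hom, α.nat_id, X'.wl_id₂ _ _ (by simp), vcomp_id' _ _ (by
    have h1 := α.src_nat (S.hom a)
    have h2 := α.tgt_nat (S.hom a)
    rw [hα] at h1 h2
    simp (maxDischargeDepth := 9) at h1 h2 ⊢
    rw [h2])] at h
  have h3 := congrArg (fun x => x ▷ α.src.one (S.inv a)) h
  rw [← X'.wr_comp _ _ _ (by simp) (by simp), ← α.src.map_comp _ _ (by simp), S.hom_inv,
    α.src.map_id, wr_id' _ _ (by simp), X'.id₂_wr _ _ (by simp)] at h3
  rw [← h3]
  have h4 := α.src_nat (S.inv a)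
  rw [← h3] at h4
  exact congrArg _ (by simpa using h4)

/-- A strict equivalence is compatible with a pseudonatural transformation. -/
theorem post_functor (Q : Square S S' α.src α'.src) (Q' : Square S S' α.tgt α'.tgt)
    (hF : PsNat.post F' α' = PsNat.pre F α)
    (hα : ∀ a, α.nat (S.hom a) = X'.id₂ (α.tgt.one (S.hom a) ∘₁ α.app a)) :
    PsNat.post S'.functor α = PsNat.pre S.functor α' := by
  have happ : ∀ c, F'.one (α'.app c) = α.app (F.ob c) := fun c =>
    congrArg (fun D => PsNat.app D c) hF
  have hnat : ∀ f, F'.two (α'.nat f) = α.nat (F.one f) := fun f =>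
    congrArg (fun D => PsNat.nat D f) hF
  have hinv := nat_inv hα
  have hi : ∀ a, α.tgt.one (S.inv a) ∘₁ α.app (F.ob (S.ob a)) =
      α.app a ∘₁ α.src.one (S.inv a) := fun a => by
    have h := α.tgt_nat (S.inv a)
    rw [hinv] at h
    simpa using h
  have key : ∀ a, S'.one (α.app a) = α'.app (S.ob a) := fun a =>
    S'.one_ext (by simp [Q.ob]) (by simp [Q'.ob]) (by
      rw [happ, map_one]
      simp only [PsNat.src_app, PsNat.tgt_app, Q.inv, Q'.hom]
      rw [← hi, ← X'.comp_assoc _ _ _ (by simp) (by simp), ← α.tgt.map_comp _ _ (by simp),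
        S.hom_inv]
      simp)
  refine PsNat.ext Q.functor Q'.functor (funext key) (funext fun f => ?_)
  refine S'.two_ext ?_ ?_ ?_
  · simp [S'.one_comp, key, Q'.one]
  · simp [S'.one_comp, key, Q.one]
  · simp (maxDischargeDepth := 9) [hnat, hα, hinv, hi, Q.inv, Q'.hom]

/-- A strict equivalence is compatible with a modification. -/
theorem modif_post_functor {m : Modif X X'} {m' : Modif Y Y'} (Q : Square S S' m.src.src m'.src.src)
    (Q' : Square S S' m.src.tgt m'.src.tgt)
    (hs : PsNat.post S'.functor m.src = PsNat.pre S.functor m'.src)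
    (ht : PsNat.post S'.functor m.tgt = PsNat.pre S.functor m'.tgt)
    (hF : Modif.post F' m' = Modif.pre F m)
    (h₁ : ∀ a, m.src.nat (S.hom a) = X'.id₂ (m.src.tgt.one (S.hom a) ∘₁ m.src.app a))
    (h₂ : ∀ a, m.tgt.nat (S.hom a) = X'.id₂ (m.tgt.tgt.one (S.hom a) ∘₁ m.tgt.app a)) :
    Modif.post S'.functor m = Modif.pre S.functor m' := by
  have happ : ∀ c, F'.two (m'.app c) = m.app (F.ob c) := fun c =>
    congrArg (fun D => Modif.app D c) hF
  refine Modif.ext hs ht (funext fun a => S'.two_ext ?_ ?_ ?_)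
  · simpa using congrArg (fun D => PsNat.app D a) hs
  · simpa using congrArg (fun D => PsNat.app D a) ht
  · have h := m.naturality (S.inv a)
    have e1 := Q.inv a
    have e2 := Q'.hom a
    have e3 := (m.src.tgt_nat (S.inv a)).symm
    rw [nat_inv h₁] at h e3
    rw [nat_inv h₂] at h
    rw [m.src_eq] at e1
    rw [m.tgt_eq] at e2
    simp (maxDischargeDepth := 9) at h e3
    rw [vcomp_id' _ _ (by simp (maxDischargeDepth := 9) [e3])] at h
    simp (maxDischargeDepth := 9) [happ, e1, e2]
    rw [← h, ← X'.comp_wl _ _ _ (by simp) (by simp), ← m.tgt.tgt.map_comp _ _ (by simp), S.hom_inv]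
    simp

end TwoFunctor.StrictEquiv

theorem Modif.ix_eq_inv {X Y X' Y' : TwoCat.{w}} {θ : PsNat X Y} {θ' : PsNat X' Y'}
    {α : PsNat X X'} {β : PsNat Y Y'} (hs : PsNat.post θ'.src α = PsNat.pre θ.src β)
    (ht : PsNat.post θ'.tgt α = PsNat.pre θ.tgt β) (hs' : PsNat.pre α.src θ' = PsNat.post β.src θ)
    (ht' : PsNat.pre α.tgt θ' = PsNat.post β.tgt θ)
    (h : ∀ a, θ'.nat (α.app a) = Y'.id₂ (θ'.tgt.one (α.app a) ∘₁ θ'.app (α.src.ob a)))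
    (h' : ∀ a, β.nat (θ.app a) = Y'.id₂ (β.tgt.one (θ.app a) ∘₁ β.app (θ.src.ob a))) :
    Modif.ix θ' α = TwoCat.inv (X := homTwoCat X Y') (Modif.ix β θ) := by
  have e₁ : (Modif.ix β θ).tgt = (Modif.ix θ' α).src := by simp [ht, hs']
  have e₂ : (Modif.ix θ' α).tgt = (Modif.ix β θ).src := by simp [hs, ht']
  have ha : ∀ a, X'.src (α.app a) = α.src.ob a := α.src_app
  have k : ∀ a, β.tgt.one (θ.app a) ∘₁ β.app (θ.src.ob a) =
      θ'.tgt.one (α.app a) ∘₁ θ'.app (α.src.ob a) := fun a => by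
    have h1 := (Modif.ix θ' α).src_app a
    have h2 := (Modif.ix β θ).tgt_app a
    rw [← e₁, ← h2] at h1
    simpa [h, h'] using h1.symm
  refine (TwoCat.IsInv.inv_eq (X := homTwoCat X Y') (x := Modif.ix β θ)
    (y := Modif.ix θ' α)
    ⟨e₁.symm, e₂, ?_, ?_⟩).symm
  · refine Modif.ext (Modif.src_vcomp e₁) ((Modif.tgt_vcomp e₁).trans e₂) (funext fun a => ?_)
    have h1 := (Modif.ix β θ).src_app a
    simp only [Modif.ix_app, h', Y'.src_id₂] at h1
    change (Modif.vcomp _ _).app a = Y'.id₂ ((Modif.ix β θ).src.app a)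
    rw [Modif.vcomp_app e₁, ← h1]
    simp [h, h', k]
  · refine Modif.ext ((Modif.src_vcomp e₂).trans e₁.symm) (Modif.tgt_vcomp e₂) (funext fun a => ?_)
    have h1 := (Modif.ix β θ).tgt_app a
    simp only [Modif.ix_app, h', Y'.tgt_id₂] at h1
    change (Modif.vcomp _ _).app a = Y'.id₂ ((Modif.ix β θ).tgt.app a)
    rw [Modif.vcomp_app e₂, ← h1]
    simp [h, h', k]

namespace TwoFunctor.StrictEquiv

variable {X Y X' Y' : TwoCat.{w}} {F : TwoFunctor Y X} {F' : TwoFunctor Y' X'}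
  {S : F.StrictEquiv} {S' : F'.StrictEquiv} {H : TwoFunctor X X'} {H' : TwoFunctor Y Y'}

namespace Square

theorem comp_functor (Q : Square S S' H H') :
    (F'.comp S'.functor).comp H = H.comp (F.comp S.functor) := by
  rw [TwoFunctor.comp_assoc, Q.functor, ← TwoFunctor.comp_assoc, Q.comm, TwoFunctor.comp_assoc]

theorem functor_comp (Q : Square S S' H H') :
    (S'.functor.comp F').comp H' = H'.comp (S.functor.comp F) := by
  rw [TwoFunctor.comp_assoc, Q.comm, ← TwoFunctor.comp_assoc, Q.functor, TwoFunctor.comp_assoc]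

theorem unit (Q : Square S S' H H') : PsNat.pre H S'.unit = PsNat.post H S.unit :=
  PsNat.ext rfl Q.comp_functor (funext Q.hom) (funext fun f => by
    simp (maxDischargeDepth := 9) [Q.hom, Q.inv])

theorem unitInv (Q : Square S S' H H') : PsNat.pre H S'.unitInv = PsNat.post H S.unitInv :=
  PsNat.ext Q.comp_functor rfl (funext Q.inv) (funext fun f => by
    simp (maxDischargeDepth := 9) [Q.hom, Q.inv])

theorem counitApp (Q : Square S S' H H') (c : Y.Ob) :
    S'.counitApp (H'.ob c) = H'.one (S.counitApp c) :=
  S'.one_ext (by simp [Q.comm_ob, Q.ob]) (by simp) (by simp [Q.comm_ob, Q.comm_one, Q.inv])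

theorem counitInvApp (Q : Square S S' H H') (c : Y.Ob) :
    S'.counitInvApp (H'.ob c) = H'.one (S.counitInvApp c) :=
  S'.one_ext (by simp) (by simp [Q.comm_ob, Q.ob]) (by simp [Q.comm_ob, Q.comm_one, Q.hom])

theorem counit (Q : Square S S' H H') : PsNat.pre H' S'.counit = PsNat.post H' S.counit :=
  PsNat.ext Q.functor_comp rfl (funext Q.counitApp) (funext fun f => by
    simp (maxDischargeDepth := 9) [Q.counitApp])

theorem counitInv (Q : Square S S' H H') :
    PsNat.pre H' S'.counitInv = PsNat.post H' S.counitInv :=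
  PsNat.ext rfl Q.functor_comp (funext Q.counitInvApp) (funext fun f => by
    simp (maxDischargeDepth := 9) [Q.counitInvApp, Q.comm_one, Q.one])

end Square

theorem nat_of_map (S' : F'.StrictEquiv) {α : PsNat X X'} {α' : PsNat Y Y'} {g : Y.One}
    (hF : PsNat.post F' α' = PsNat.pre F α)
    (h : α.nat (F.one g) = X'.id₂ (α.tgt.one (F.one g) ∘₁ α.app (F.ob (Y.src g)))) :
    α'.nat g = Y'.id₂ (α'.tgt.one g ∘₁ α'.app (Y.src g)) := by
  have hnat : F'.two (α'.nat g) = α.nat (F.one g) := congrArg (fun D => PsNat.nat D g) hF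
  rw [h] at hnat
  have h1 := α'.src_nat g
  have h2 := α'.tgt_nat g
  have h3 := congrArg X'.src₂ hnat
  have h4 := congrArg X'.tgt₂ hnat
  simp only [F'.src_two, F'.tgt_two, X'.src_id₂, X'.tgt_id₂, h1, h2] at h3 h4
  refine S'.two_ext (by simp) ?_ (by rw [F'.map_id₂, h3, hnat])
  rw [h2, Y'.tgt_id₂]
  exact S'.one_ext (by simp) (by simp) (h4.trans h3.symm)

end TwoFunctor.StrictEquiv

section

variable {K : GrayCat.{u, w}} {B : K.Obj} {T : Pseudomonad K B} {G : (K.hom B B).Ob}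
  {P : Pseudoadjunction K T.T G} {A A' : K.Obj}

/-- The 2-functor from pseudocoalgebras to pseudoalgebras is a strict equivalence. -/
noncomputable def toAlgEquiv (T : Pseudomonad K B) (P : Pseudoadjunction K T.T G)
    (A : K.Obj) : (toAlgFunctor T P A).StrictEquiv where
  ob := Pseudoalgebra.toCoalg P
  hom := Pseudoalgebra.cmpHom P
  inv := Pseudoalgebra.cmpInv P
  src_hom _ := rfl
  tgt_hom _ := rfl
  src_inv _ := rfl
  tgt_inv _ := rfl
  inv_hom a := a.cmpInv_cmpHom
  hom_inv a := a.cmpHom_cmpInv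
  one_ext hs ht h := PseudocoalgHom.toAlg_injective hs ht h
  two_ext hs ht h := PseudocoalgTwo.toAlg_injective hs ht h
  one_lift hs ht := PseudocoalgHom.exists_toAlg_eq hs ht
  two_lift hs ht h₁ h₂ := PseudocoalgTwo.exists_toAlg_eq hs ht h₁ h₂

theorem toAlgEquiv_square (k : (K.hom A' A).Ob) :
    (toAlgEquiv T P A).Square (toAlgEquiv T P A') (algBase T k) (coalgBase (mateComonad T P) k) where
  comm := congrArg (fun D => TwoFunctor.ob D k) ((toAlgNat T P).naturality A A')
  ob a := Pseudoalgebra.toCoalg_base a k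
  hom a := a.cmpHom_base k
  inv a := a.cmpInv_base k

theorem post_toAlgFunctor (k : (K.hom A' A).One) :
    PsNat.post (toAlgFunctor T P A') (coalgPs (mateComonad T P) k) =
      PsNat.pre (toAlgFunctor T P A) (algPs T k) :=
  congrArg (fun D => TwoFunctor.one D k) ((toAlgNat T P).naturality A A')

theorem modif_post_toAlgFunctor (x : (K.hom A' A).Two) :
    Modif.post (toAlgFunctor T P A') (coalgModif (mateComonad T P) x) =
      Modif.pre (toAlgFunctor T P A) (algModif T x) :=
  congrArg (fun D => TwoFunctor.two D x) ((toAlgNat T P).naturality A A')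

theorem PseudoalgTwo.eq_id {x : PseudoalgTwo T A} (h : x.ξ = (K.hom A B).id₂ x.src.h) :
    x = PseudoalgTwo.id x.src := by
  have h1 := x.tgt_ξ
  rw [h, TwoCat.tgt_id₂] at h1
  have h2 := x.comm
  have e1 := x.tgt.src_ϱ
  have e2 := x.src.tgt_ϱ
  rw [h, (K.post T.T).map_id₂, TwoCat.wl_id₂ _ _ _ (by simp), TwoCat.id₂_wr _ _ _ (by simp),
    TwoCat.vcomp_id' _ _ (by rw [e1, h1]), TwoCat.id_vcomp' _ _ (by rw [e2, x.src_eq])] at h2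
  exact PseudoalgTwo.ext rfl (PseudoalgHom.ext x.src_eq.symm x.tgt_eq.symm h1.symm h2) h

theorem Pseudoalgebra.cmpHom_whisk (a : Pseudoalgebra T A) (k : (K.hom A' A).One) :
    (a.cmpHom P).whisk k = PseudoalgTwo.id ((a.cmpHom P).whisk k).src :=
  PseudoalgTwo.eq_id (by simp)

/-- The Gray-natural transformation from pseudoalgebras to pseudocoalgebras. -/
noncomputable def toCoalgNat (T : Pseudomonad K B) (P : Pseudoadjunction K T.T G) :
    GrayNat (algGray T) (coalgGray (mateComonad T P)) where
  app A := (toAlgEquiv T P A).functor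
  naturality A A' := by
    have h : ∀ k : (K.hom A' A).Ob, (toAlgEquiv T P A').functor.comp (algBase T k) =
        (coalgBase _ k).comp (toAlgEquiv T P A).functor := fun k => (toAlgEquiv_square k).functor
    have h' : ∀ k : (K.hom A' A).One, PsNat.post (toAlgEquiv T P A').functor (algPs T k) =
        PsNat.pre (toAlgEquiv T P A).functor (coalgPs _ k) := fun k =>
      TwoFunctor.StrictEquiv.post_functor (toAlgEquiv_square _) (toAlgEquiv_square _)
        (post_toAlgFunctor k) (fun a => a.cmpHom_whisk k)
    have h₂ : ∀ x : (K.hom A' A).Two, Modif.post (toAlgEquiv T P A').functor (algModif T x) =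
        Modif.pre (toAlgEquiv T P A).functor (coalgModif _ x) := fun x =>
      TwoFunctor.StrictEquiv.modif_post_functor (toAlgEquiv_square _) (toAlgEquiv_square _) (h' _)
        (h' _) (modif_post_toAlgFunctor x) (fun a => a.cmpHom_whisk _) (fun a => a.cmpHom_whisk _)
    exact TwoFunctor.ext (funext h) (funext h') (funext h₂)

theorem Pseudoalgebra.cmpInv_whisk (a : Pseudoalgebra T A) (k : (K.hom A' A).One) :
    (a.cmpInv P).whisk k = PseudoalgTwo.id ((a.cmpInv P).whisk k).src :=
  PseudoalgTwo.eq_id (by simp)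

theorem PseudocoalgHom.whisk_eq_id {f : PseudocoalgHom (mateComonad T P) A} {g : PseudoalgHom T A}
    (hg : f.toAlg = g) {k : (K.hom A' A).One}
    (h : g.whisk k = PseudoalgTwo.id (g.whisk k).src) :
    f.whisk k = PseudocoalgTwo.id (f.whisk k).src :=
  TwoFunctor.StrictEquiv.nat_of_map (toAlgEquiv T P A') (post_toAlgFunctor k) (by subst hg; exact h)

/-- The Gray-modification from the identity to the composite of the comparisons, on
pseudoalgebras. -/
noncomputable def toCoalgUnit (T : Pseudomonad K B) (P : Pseudoadjunction K T.T G) :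
    GrayMod (GrayNat.id (algGray T)) ((toAlgNat T P).comp (toCoalgNat T P)) where
  app A := (toAlgEquiv T P A).unit
  src_app _ := rfl
  tgt_app _ := rfl
  nat_one {A A'} (k : (K.hom A' A).Ob) := (toAlgEquiv_square k).unit
  nat_two {A A'} (k : (K.hom A' A).One) := Modif.ix_eq_inv rfl
    (congrArg (fun D => TwoFunctor.one D k) (((toAlgNat T P).comp (toCoalgNat T P)).naturality A A'))
    (toAlgEquiv_square _).unit (toAlgEquiv_square _).unit (fun _ => rfl)
    (fun a => Pseudoalgebra.cmpHom_whisk a k)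

/-- The inverse of `toCoalgUnit`. -/
noncomputable def toCoalgUnitInv (T : Pseudomonad K B) (P : Pseudoadjunction K T.T G) :
    GrayMod ((toAlgNat T P).comp (toCoalgNat T P)) (GrayNat.id (algGray T)) where
  app A := (toAlgEquiv T P A).unitInv
  src_app _ := rfl
  tgt_app _ := rfl
  nat_one {A A'} (k : (K.hom A' A).Ob) := (toAlgEquiv_square k).unitInv
  nat_two {A A'} (k : (K.hom A' A).One) := Modif.ix_eq_inv
    (congrArg (fun D => TwoFunctor.one D k) (((toAlgNat T P).comp (toCoalgNat T P)).naturality A A'))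
    rfl (toAlgEquiv_square _).unitInv (toAlgEquiv_square _).unitInv (fun _ => rfl)
    (fun a => Pseudoalgebra.cmpInv_whisk a k)

/-- The Gray-modification from the composite of the comparisons to the identity, on
pseudocoalgebras. -/
noncomputable def toCoalgCounit (T : Pseudomonad K B) (P : Pseudoadjunction K T.T G) :
    GrayMod ((toCoalgNat T P).comp (toAlgNat T P)) (GrayNat.id (coalgGray (mateComonad T P))) where
  app A := (toAlgEquiv T P A).counit
  src_app _ := rfl
  tgt_app _ := rfl
  nat_one {A A'} (k : (K.hom A' A).Ob) := (toAlgEquiv_square k).counit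
  nat_two {A A'} (k : (K.hom A' A).One) := Modif.ix_eq_inv
    (congrArg (fun D => TwoFunctor.one D k) (((toCoalgNat T P).comp (toAlgNat T P)).naturality A A'))
    rfl (toAlgEquiv_square _).counit (toAlgEquiv_square _).counit (fun _ => rfl)
    (fun c => (PseudocoalgHom.whisk_eq_id ((toAlgEquiv T P A).map_counitApp c)
      (Pseudoalgebra.cmpInv_whisk _ k)).trans
        (congrArg PseudocoalgTwo.id (congrArg (fun s => (PseudocoalgHom.base _ _).comp
          (Pseudocoalgebra.whisk s k)) ((toAlgEquiv T P A).src_counitApp c))))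

/-- The inverse of `toCoalgCounit`. -/
noncomputable def toCoalgCounitInv (T : Pseudomonad K B) (P : Pseudoadjunction K T.T G) :
    GrayMod (GrayNat.id (coalgGray (mateComonad T P))) ((toCoalgNat T P).comp (toAlgNat T P)) where
  app A := (toAlgEquiv T P A).counitInv
  src_app _ := rfl
  tgt_app _ := rfl
  nat_one {A A'} (k : (K.hom A' A).Ob) := (toAlgEquiv_square k).counitInv
  nat_two {A A'} (k : (K.hom A' A).One) := Modif.ix_eq_inv rfl
    (congrArg (fun D => TwoFunctor.one D k) (((toCoalgNat T P).comp (toAlgNat T P)).naturality A A'))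
    (toAlgEquiv_square _).counitInv (toAlgEquiv_square _).counitInv (fun _ => rfl)
    (fun c => (PseudocoalgHom.whisk_eq_id ((toAlgEquiv T P A).map_counitInvApp c)
      (Pseudoalgebra.cmpHom_whisk _ k)).trans
        (congrArg PseudocoalgTwo.id (congrArg (fun s => (PseudocoalgHom.base _ _).comp
          (Pseudocoalgebra.whisk s k)) ((toAlgEquiv T P A).src_counitInvApp c))))

theorem toCoalgUnit_isInvertible : (toCoalgUnit T P).IsInvertible :=
  ⟨toCoalgUnitInv T P, fun A => ⟨(toAlgEquiv T P A).unitInv_unit, (toAlgEquiv T P A).unit_unitInv⟩⟩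

theorem toCoalgCounit_isInvertible : (toCoalgCounit T P).IsInvertible :=
  ⟨toCoalgCounitInv T P, fun A =>
    ⟨(toAlgEquiv T P A).counitInv_counit, (toAlgEquiv T P A).counit_counitInv⟩⟩

theorem forget_comp_toAlgNat : (forget T).comp (toAlgNat T P) = forgetCo (mateComonad T P) := rfl

theorem PseudoalgHom.conj_h (f : PseudoalgHom T A) :
    ((f.tgt.cmpHom P).comp (f.comp (f.src.cmpInv P))).h = f.h := by
  have e : (f.src.cmpInv P).tgt = f.src := rfl
  have e' : (f.comp (f.src.cmpInv P)).tgt = (f.tgt.cmpHom P).src := PseudoalgHom.tgt_comp e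
  rw [PseudoalgHom.comp_h e', PseudoalgHom.comp_h e]
  simp

theorem toAlgEquiv_one_h (f : PseudoalgHom T A) : PseudocoalgHom.h ((toAlgEquiv T P A).one f) = f.h :=
  (congrArg PseudoalgHom.h ((toAlgEquiv T P A).map_one f)).trans f.conj_h

theorem PseudoalgTwo.conj_ξ (x : PseudoalgTwo T A) :
    (PseudoalgTwo.wl (x.tgt.tgt.cmpHom P) (x.wr (x.tgt.src.cmpInv P))).ξ = x.ξ := by
  have e : (x.tgt.src.cmpInv P).tgt = x.tgt.src := rfl
  have e' : (x.wr (x.tgt.src.cmpInv P)).tgt.tgt = (x.tgt.tgt.cmpHom P).src := by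
    rw [PseudoalgTwo.tgt_wr e]
    exact PseudoalgHom.tgt_comp e
  rw [PseudoalgTwo.wl_ξ e', PseudoalgTwo.wr_ξ e]
  simp

theorem toAlgEquiv_two_ξ (x : PseudoalgTwo T A) : PseudocoalgTwo.ξ ((toAlgEquiv T P A).two x) = x.ξ :=
  (congrArg PseudoalgTwo.ξ ((toAlgEquiv T P A).map_two x)).trans x.conj_ξ

theorem coalgForget_comp_functor (A : K.Obj) : (coalgForget (mateComonad T P) A).comp
    (toAlgEquiv T P A).functor = algForget T A :=
  TwoFunctor.ext rfl (funext toAlgEquiv_one_h) (funext toAlgEquiv_two_ξ)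

theorem forgetCo_comp_toCoalgNat : (forgetCo (mateComonad T P)).comp (toCoalgNat T P) = forget T :=
  GrayNat.ext (funext fun A : K.Obj => coalgForget_comp_functor A)

theorem forget_toCoalgUnit (A : K.Obj) : (forget T).app A ⋆ₗ (toCoalgUnit T P).app A =
    (Gray.hom _ _).id ((forget T).app A) := by
  refine PsNat.ext rfl (coalgForget_comp_functor A) rfl (funext fun f : PseudoalgHom T A => ?_)
  change (K.hom A B).id₂ ((PseudocoalgHom.toAlg ((toAlgEquiv T P A).one f)).comp
    (f.src.cmpHom P)).h = (K.hom A B).id₂ f.h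
  have e : (f.src.cmpHom P).tgt = (PseudocoalgHom.toAlg ((toAlgEquiv T P A).one f)).src :=
    congrArg Pseudocoalgebra.toAlg ((toAlgEquiv T P A).src_one f).symm
  have h : (PseudocoalgHom.toAlg ((toAlgEquiv T P A).one f)).h = f.h := toAlgEquiv_one_h f
  rw [PseudoalgHom.comp_h e, h]
  simp

theorem counitApp_h (c : Pseudocoalgebra (mateComonad T P) A) :
    PseudocoalgHom.h ((toAlgEquiv T P A).counitApp c) = (K.hom A B).id c.s :=
  congrArg PseudoalgHom.h ((toAlgEquiv T P A).map_counitApp c)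

theorem forgetCo_toCoalgCounit (A : K.Obj) :
    (forgetCo (mateComonad T P)).app A ⋆ₗ (toCoalgCounit T P).app A =
      (Gray.hom _ _).id ((forgetCo (mateComonad T P)).app A) := by
  refine PsNat.ext (congrArg (fun D => D.comp (toAlgFunctor T P A)) (coalgForget_comp_functor A))
    rfl (funext counitApp_h) (funext fun f : PseudocoalgHom (mateComonad T P) A => ?_)
  change (K.hom A B).id₂ (f.comp ((toAlgEquiv T P A).counitApp f.src)).h = (K.hom A B).id₂ f.h
  rw [PseudocoalgHom.comp_h ((toAlgEquiv T P A).tgt_counitApp f.src), counitApp_h]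
  simp

end

theorem mainTheorem6 {K : GrayCat.{u, w}} {B : K.Obj} (T : Pseudomonad K B)
    (G : (K.hom B B).Ob) (adj : Pseudoadjunction K T.T G) :
    ∃ 𝔾 : Pseudocomonad K B, 𝔾.toPseudocomonadData = mateComonadData T adj ∧
      ∃ (M : GrayNat (algGray T) (coalgGray 𝔾)) (M' : GrayNat (coalgGray 𝔾) (algGray T))
        (Γ : GrayMod (GrayNat.id (algGray T)) (M'.comp M))
        (Γ' : GrayMod (M.comp M') (GrayNat.id (coalgGray 𝔾))),
        Γ.IsInvertible ∧ Γ'.IsInvertible ∧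
        (forgetCo 𝔾).comp M = forget T ∧ (forget T).comp M' = forgetCo 𝔾 ∧
        (∀ A : K.Obj, (forget T).app A ⋆ₗ Γ.app A = (Gray.hom _ _).id ((forget T).app A)) ∧
        (∀ A : K.Obj, (forgetCo 𝔾).app A ⋆ₗ Γ'.app A = (Gray.hom _ _).id ((forgetCo 𝔾).app A)) :=
  ⟨mateComonad T adj, rfl, toCoalgNat T adj, toAlgNat T adj, toCoalgUnit T adj,
    toCoalgCounit T adj, toCoalgUnit_isInvertible, toCoalgCounit_isInvertible,
    forgetCo_comp_toCoalgNat, forget_comp_toAlgNat, forget_toCoalgUnit, forgetCo_toCoalgCounit⟩
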